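/- **Setting.** Let $\Omega\subset\mathbb R^3$ be bounded (open, closed, or neither) with the uniform cone property: there are an angle $\theta\in(0,\pi/2)$ and a radius $r>0$ such that for each $x\in\partial\Omega$ there is a unit vector $\xi_x$ with $\{z : |z-y|<r,\ (z-y)\cdot\xi_x>\cos\theta\,|z-y|\}\subset\Omega$ for all $y\in\Omega\cap B(x,r)$. Let $a,A,\mu_0>0$ and let $h_Z:\mathbb R^3\to\mathbb R^3$ be continuous. $H^1(\Omega;\mathbb R^3)$ is defined by weak derivatives in the interior of $\Omega$. For $n\ge1$ let $\mathcal L_n=\frac an\mathbb Z^3$, $\mathcal L_{n,\Omega}=\mathcal L_n\cap\Omega$, $W_n=(\mathbb R^3)^{\mathcal L_{n,\Omega}}$, $W=\prod_{n\ge1}W_n$, and for $x\in\mathcal L_{n,\Omega}$ let $N_{n,\Omega,x}$ be the set of those of the six nearest neighbours of $x$ in $\mathcal L_n$ that lie in $\Omega$. *Interpolation.* Split every lattice cell into five tetrahedra: a central one, whose vertices are the four vertices $\frac an k$ of the cell with $k_1+k_2+k_3$ odd, and four corner ones, each spanned by another vertex of the cell and its three neighbours in the cell. Let $\Omega_n$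 be the union of the closed cells contained in $\Omega$. For $\mu\in W_n$, $P_n(\mu)$ is the function which equals $\mu$ at the nodes of $\Omega_n$, is affine on each tetrahedron of $\Omega_n$, and is $0$ off $\Omega_n$; $\nabla P_n(\mu)$ denotes its gradient taken element by element ($0$ off $\Omega_n$). *Topology.* A sequence $(\mu_n)\in W$ converges to $m\in H^1(\Omega;\mathbb R^3)$, written $\mu_n\to m$, if $P_n(\mu_n)\rightharpoonup m$ and $\nabla P_n(\mu_n)\rightharpoonup\nabla m$ weakly in $L^2(\Omega)$. It is bounded if $\sup_{n\ge1}(a/n)^3\sum_{x\in\mathcal L_{n,\Omega}}|\mu_{n,x}|^2<\infty$. *Class $W^{\mathfrak h}$.* $(\mu_n)\in W$ belongs to $W^{\mathfrak h}$ if there are $c>0$, $C$, a sequence $c_n\to0$ and sets $l_n\subset\mathcal L_{n,\Omega}$ with $\#l_n\le Cn$ such that, for all $n\ge1$ and $y\in N_{n,\Omega,x}$, $|\mu_{n,x}-\mu_{n,y}|^2\le c/n^2$ if $x\in\mathcal L_{n,\Omega}\setminus l_n$, and $|\mu_{n,x}-\mu_{n,y}|^2\le c_n$ if $x\in l_n$.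 *Energies.* For $u\in L^2(\mathbb R^3;\mathbb R^3)$ let $h_d(u)\in L^2(\mathbb R^3;\mathbb R^3)$ be the solution of $\operatorname{curl}h=0$, $\operatorname{div}h=-\operatorname{div}u$ in the sense of distributions on $\mathbb R^3$, and $\mathcal E_d(u)=\frac{\mu_0}2\|h_d(u)\|_{L^2(\mathbb R^3;\mathbb R^3)}$. A tilde denotes extension from $\Omega$ by zero. Set $$\mathcal E_n(\mu)=\frac an\sum_{x\in\mathcal L_{n,\Omega}}\sum_{y\in N_{n,\Omega,x}}A|\mu_y-\mu_x|^2+\mathcal E_d\big(\widetilde{P_n(\mu)}\big)-\Big(\frac an\Big)^3\sum_{x\in\mathcal L_{n,\Omega}}h_Z(x)\cdot\mu_x ,\qquad \mu\in W_n,$$ $$\mathcal E_\infty(m)=2A\int_\Omega|\nabla m|^2\,dx+\mathcal E_d(\widetilde m)-\int_\Omega h_Z\cdot m\,dx ,\qquad m\in H^1(\Omega;\mathbb R^3).$$ **Theorem.** For each $u\in L^2(\mathbb R^3;\mathbb R^3)$ the field $h_d(u)$ exists and is unique, and $\mathcal E_n$ $\Gamma$-converges to $\mathcal E_\infty$, compatibly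 with the unit norm constraint: 1. If $(\mu_n)\in W$ is bounded (in $W^{\mathfrak h}$ or not) and $\mu_n\to m$, then $\liminf_{n\to\infty}\mathcal E_n(\mu_n)\ge\mathcal E_\infty(m)$. 2. For each $m\in H^1(\Omega;\mathbb R^3)$ there is a bounded $(\mu_n)\in W$ with $\mu_n\to m$ and $\limsup_{n\to\infty}\mathcal E_n(\mu_n)\le\mathcal E_\infty(m)$. 3. If $(\mu_n)\in W$ satisfies $|\mu_{n,x}|=1$ for all $n\ge1$ and $x\in\mathcal L_{n,\Omega}$, and $\mu_n\to m$, then $\liminf_{n\to\infty}\mathcal E_n(\mu_n)\ge\mathcal E_\infty(m)$ and $|m|=1$ a.e. in $\Omega$. Conversely, if $m\in H^1(\Omega;\mathbb R^3)$ and $|m|=1$ a.e. in $\Omega$, then the sequence in 2 can be chosen with $|\mu_{n,x}|=1$ for all $n\ge1$ and $x\in\mathcal L_{n,\Omega}$. 4. If moreover $\nabla m\in L^\infty(\Omega)$, then the sequences in 2 and in 3 can be chosen in $W^{\mathfrak h}$. -/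

import Mathlib

open MeasureTheory Filter Topology
open scoped ContDiff

noncomputable section

/-- Euclidean space `ℝ³`, used both for positions and for magnetic moments. -/
abbrev E3 : Type := EuclideanSpace ℝ (Fin 3)

/-- Indices of the nodes of the cubic lattice. -/
abbrev Idx : Type := Fin 3 → ℤ

/-- The `i`-th vector of the canonical basis of `ℝ³`. -/
def basisVec (i : Fin 3) : E3 := EuclideanSpace.single i 1

/-! ### The domain -/

/-- The uniform cone property: one opening angle and one radius serve for the whole boundary, and
near each boundary point one direction `ξ` serves for all points of `Ω`. For a bounded open set,
this says that the boundary is Lipschitz. -/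
def UniformConeProperty (Ω : Set E3) : Prop :=
  ∃ θ r : ℝ, 0 < θ ∧ θ < Real.pi / 2 ∧ 0 < r ∧
    ∀ x ∈ frontier Ω, ∃ ξ : E3, ‖ξ‖ = 1 ∧
      ∀ y ∈ Ω ∩ Metric.ball x r, ∀ z ∈ Metric.ball y r,
        Real.cos θ * ‖z - y‖ < inner ℝ (z - y) ξ → z ∈ Ω

/-! ### The Sobolev space `H¹(Ω; ℝ³)` -/

/-- `g` is the weak `i`-th partial derivative of `u` in (the interior of) `Ω`. -/
def IsWeakPartial (Ω : Set E3) (i : Fin 3) (u g : E3 → E3) : Prop :=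
  ∀ φ : E3 → ℝ, ContDiff ℝ ∞ φ → HasCompactSupport φ → tsupport φ ⊆ interior Ω →
    ∫ x in Ω, fderiv ℝ φ x (basisVec i) • u x = - ∫ x in Ω, φ x • g x

/-- `u ∈ H¹(Ω; ℝ³)`. -/
def MemH1 (Ω : Set E3) (u : E3 → E3) : Prop :=
  MemLp u 2 (volume.restrict Ω) ∧
    ∀ i, ∃ g : E3 → E3, MemLp g 2 (volume.restrict Ω) ∧ IsWeakPartial Ω i u g

open Classical in
/-- The weak `i`-th partial derivative in `L²(Ω; ℝ³)` (`0` if there is none). -/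
def weakPartial (Ω : Set E3) (i : Fin 3) (u : E3 → E3) : E3 → E3 :=
  if h : ∃ g : E3 → E3, MemLp g 2 (volume.restrict Ω) ∧ IsWeakPartial Ω i u g then h.choose else 0

/-! ### The shrunk lattice

A spin distribution at level `n` is a function `Idx → E3`; only its values at the nodes that belong
to `Ω` enter the definitions below, and only the levels `n ≥ 1` matter. -/

/-- The node of `(a / n) ℤ³` with index `k`. -/
def node (a : ℝ) (n : ℕ) (k : Idx) : E3 := (a / n) • WithLp.toLp 2 (fun i => (k i : ℝ))

/-- The (indices of the) lattice nodes in `Ω`. -/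
def nodes (a : ℝ) (Ω : Set E3) (n : ℕ) : Set Idx := {k | node a n k ∈ Ω}

/-- The nearest neighbours in `Ω` (at most six) of the node with index `k`. -/
def neighbours (a : ℝ) (Ω : Set E3) (n : ℕ) (k : Idx) : Set Idx :=
  {l | l ∈ nodes a Ω n ∧ ∃ i : Fin 3, l = k + Pi.single i 1 ∨ l = k - Pi.single i 1}

/-- All moments have norm one. -/
def UnitSpins (a : ℝ) (Ω : Set E3) (μ : ℕ → Idx → E3) : Prop :=
  ∀ n, 1 ≤ n → ∀ k ∈ nodes a Ω n, ‖μ n k‖ = 1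

/-- The discrete `L²` norms of the spin distributions are bounded. -/
def BoundedSpins (a : ℝ) (Ω : Set E3) (μ : ℕ → Idx → E3) : Prop :=
  ∃ B : ℝ, ∀ n : ℕ, 1 ≤ n → (a / n) ^ 3 * ∑ᶠ k ∈ nodes a Ω n, ‖μ n k‖ ^ 2 ≤ B ^ 2

/-- The class `W^𝔥`: neighbouring moments differ by `O(1/n)`, except at `O(n)` defect nodes, where
they differ by `o(1)`, uniformly. -/
def LocallyAligned (a : ℝ) (Ω : Set E3) (μ : ℕ → Idx → E3) : Prop :=
  ∃ c : ℝ, 0 < c ∧ ∃ C : ℝ, ∃ d : ℕ → ℝ, Tendsto d atTop (𝓝 0) ∧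
    ∀ n : ℕ, 1 ≤ n → ∃ D : Finset Idx, (D : Set Idx) ⊆ nodes a Ω n ∧ (D.card : ℝ) ≤ C * n ∧
      (∀ k ∈ nodes a Ω n, k ∉ D → ∀ l ∈ neighbours a Ω n k,
        ‖μ n k - μ n l‖ ^ 2 ≤ c / (n : ℝ) ^ 2) ∧
      (∀ k ∈ D, ∀ l ∈ neighbours a Ω n k, ‖μ n k - μ n l‖ ^ 2 ≤ d n)

/-! ### The interpolation `P_n`

Each lattice cell is split into five tetrahedra: the central one, whose vertices are the four odd
vertices of the cell (sum of the indices odd), and four corner ones, each spanned by an even vertex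
of the cell and its three neighbours in the cell. This is the only way to split all cells into
five tetrahedra such that the diagonals of adjacent cells match, up to exchanging even and odd. -/

/-- The function that is affine on each tetrahedron (for the lattice `ℤ³`), equal to `1` at the node
`k` and to `0` at all other nodes. -/
def hat (k : Idx) (z : E3) : ℝ :=
  if Even (∑ i, k i) then
    max 0 (1 - ∑ i, |z i - k i|)
  else
    max 0 (1 - max (max (max |z 0 - k 0| |z 1 - k 1|) |z 2 - k 2|) ((∑ i, |z i - k i|) / 2))

/-- The interpolation on the tetrahedral mesh of `ℤ³`. -/
def interp (μ : Idx → E3) (z : E3) : E3 := ∑ᶠ k, hat k z • μ k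

/-! The next facts check that `interp μ` takes the values of `μ` at the vertices of each tetrahedron
of the mesh and is affine in between. -/

lemma interp_eq_of_hat (μ : Idx → E3) (z : E3) (w : Fin 4 → ℝ) (v : Fin 4 → Idx)
    (h : ∀ k, hat k z = ∑ j, if k = v j then w j else 0) :
    interp μ z = ∑ j, w j • μ (v j) := by
  classical
  unfold interp
  rw [finsum_eq_sum_of_support_subset (s := Finset.univ.image v)]
  · simp_rw [h, Finset.sum_smul]
    rw [Finset.sum_comm]
    refine Finset.sum_congr rfl fun j _ => ?_
    simp [ite_smul, Finset.sum_ite_eq']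
  · intro k hk
    by_contra hk'
    apply hk
    have : ∀ j, k ≠ v j := by
      intro j hj
      apply hk'
      simp [hj]
    simp [h, this]

/-- Distance of two coordinates, in a frame in which the first one is `v + s t`. -/
lemma abs_coord (v k s : ℤ) (t : ℝ) (hs : s = 1 ∨ s = -1) :
    |((v : ℝ) + s * t) - k| = |t - ((s * (k - v) : ℤ) : ℝ)| := by
  rcases hs with rfl | rfl
  · congr 1; push_cast; ring
  · rw [← abs_neg]; congr 1; push_cast; ring

lemma coord_cases (d : ℤ) (t : ℝ) (h0 : 0 ≤ t) (h1 : t ≤ 1) :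
    (d = 0 ∧ |t - (d : ℝ)| = t) ∨ (d = 1 ∧ |t - (d : ℝ)| = 1 - t) ∨
      (d ≠ 0 ∧ d ≠ 1 ∧ 1 ≤ |t - (d : ℝ)|) := by
  rcases lt_or_ge d 0 with h | h
  · have : (d : ℝ) ≤ -1 := by exact_mod_cast (by omega : d ≤ -1)
    exact Or.inr (Or.inr ⟨by omega, by omega, by rw [abs_of_nonneg] <;> linarith⟩)
  rcases lt_or_ge 1 d with h' | h'
  · have : (2 : ℝ) ≤ d := by exact_mod_cast (by omega : 2 ≤ d)
    exact Or.inr (Or.inr ⟨by omega, by omega, by rw [abs_of_nonpos] <;> linarith⟩)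
  obtain rfl | rfl : d = 0 ∨ d = 1 := by omega
  · left; simp [abs_of_nonneg h0]
  · right; left; refine ⟨rfl, ?_⟩; rw [abs_of_nonpos] <;> push_cast <;> linarith

lemma hat_far (p : Prop) [Decidable p] (a0 a1 a2 : ℝ) (p0 : 0 ≤ a0) (p1 : 0 ≤ a1) (p2 : 0 ≤ a2)
    (h : 1 ≤ a0 ∨ 1 ≤ a1 ∨ 1 ≤ a2) : (if p then max 0 (1 - (a0 + a1 + a2))
      else max 0 (1 - max (max (max a0 a1) a2) ((a0 + a1 + a2) / 2))) = 0 := by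
  split_ifs
  · apply max_eq_left
    rcases h with h | h | h <;> linarith
  · apply max_eq_left
    rw [sub_nonpos, le_max_iff, le_max_iff, le_max_iff]
    tauto

lemma idx_ext (k l : Idx) : k = l ↔ k 0 = l 0 ∧ k 1 = l 1 ∧ k 2 = l 2 := by
  simp [funext_iff, Fin.forall_fin_succ]

lemma hat_values (a0 a1 a2 : ℝ) (k : Idx) (z : E3) (h0 : |z 0 - k 0| = a0) (h1 : |z 1 - k 1| = a1)
    (h2 : |z 2 - k 2| = a2) : hat k z = if Even (k 0 + k 1 + k 2) then max 0 (1 - (a0 + a1 + a2))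
      else max 0 (1 - max (max (max a0 a1) a2) ((a0 + a1 + a2) / 2)) := by
  simp only [hat, Fin.sum_univ_three, h0, h1, h2]

lemma corner_key (d0 d1 d2 : ℤ) (t0 t1 t2 a0 a1 a2 : ℝ) (p0 : 0 ≤ t0) (p1 : 0 ≤ t1) (p2 : 0 ≤ t2)
    (p : t0 + t1 + t2 ≤ 1) (h0 : |t0 - (d0 : ℝ)| = a0) (h1 : |t1 - (d1 : ℝ)| = a1)
    (h2 : |t2 - (d2 : ℝ)| = a2) :
    (if Even (d0 + d1 + d2) then max 0 (1 - (a0 + a1 + a2))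
      else max 0 (1 - max (max (max a0 a1) a2) ((a0 + a1 + a2) / 2))) =
    (if d0 = 0 ∧ d1 = 0 ∧ d2 = 0 then 1 - (t0 + t1 + t2) else 0) +
    (if d0 = 1 ∧ d1 = 0 ∧ d2 = 0 then t0 else 0) +
    (if d0 = 0 ∧ d1 = 1 ∧ d2 = 0 then t1 else 0) +
    (if d0 = 0 ∧ d1 = 0 ∧ d2 = 1 then t2 else 0) := by
  have q0 := coord_cases d0 t0 p0 (by linarith)
  have q1 := coord_cases d1 t1 p1 (by linarith)
  have q2 := coord_cases d2 t2 p2 (by linarith)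
  have n0 : 0 ≤ a0 := h0 ▸ abs_nonneg _
  have n1 : 0 ≤ a1 := h1 ▸ abs_nonneg _
  have n2 : 0 ≤ a2 := h2 ▸ abs_nonneg _
  rw [h0] at q0; rw [h1] at q1; rw [h2] at q2
  clear h0 h1 h2
  by_cases hf : 1 ≤ a0 ∧ d0 ≠ 0 ∧ d0 ≠ 1 ∨ 1 ≤ a1 ∧ d1 ≠ 0 ∧ d1 ≠ 1 ∨ 1 ≤ a2 ∧ d2 ≠ 0 ∧ d2 ≠ 1
  · rw [hat_far _ a0 a1 a2 n0 n1 n2 (hf.imp And.left (Or.imp And.left And.left))]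
    simp only [Ne] at hf
    rcases hf with ⟨_, h, h'⟩ | ⟨_, h, h'⟩ | ⟨_, h, h'⟩ <;> simp [h, h']
  rcases q0 with ⟨r0, e0⟩ | ⟨r0, e0⟩ | ⟨r0, e0⟩
  on_goal 3 => exact absurd ⟨e0.2, r0, e0.1⟩ (fun h => hf (Or.inl h))
  all_goals
    rcases q1 with ⟨r1, e1⟩ | ⟨r1, e1⟩ | ⟨r1, e1⟩
    on_goal 3 => exact absurd ⟨e1.2, r1, e1.1⟩ (fun h => hf (Or.inr (Or.inl h)))
    all_goals
      rcases q2 with ⟨r2, e2⟩ | ⟨r2, e2⟩ | ⟨r2, e2⟩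
      on_goal 3 => exact absurd ⟨e2.2, r2, e2.1⟩ (fun h => hf (Or.inr (Or.inr h)))
      all_goals
        clear hf
        subst_vars
        norm_num [Int.even_iff]
        try first | linarith | grind

lemma center_key (d0 d1 d2 : ℤ) (w w0 w1 w2 a0 a1 a2 : ℝ) (p : 0 ≤ w) (p0 : 0 ≤ w0) (p1 : 0 ≤ w1)
    (p2 : 0 ≤ w2) (hw : w + w0 + w1 + w2 = 1) (h0 : |(w1 + w2) - (d0 : ℝ)| = a0)
    (h1 : |(w0 + w2) - (d1 : ℝ)| = a1) (h2 : |(w0 + w1) - (d2 : ℝ)| = a2) :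
    (if ¬ Even (d0 + d1 + d2) then max 0 (1 - (a0 + a1 + a2))
      else max 0 (1 - max (max (max a0 a1) a2) ((a0 + a1 + a2) / 2))) =
    (if d0 = 0 ∧ d1 = 0 ∧ d2 = 0 then w else 0) +
    (if d0 = 0 ∧ d1 = 1 ∧ d2 = 1 then w0 else 0) +
    (if d0 = 1 ∧ d1 = 0 ∧ d2 = 1 then w1 else 0) +
    (if d0 = 1 ∧ d1 = 1 ∧ d2 = 0 then w2 else 0) := by
  have q0 := coord_cases d0 _ (by linarith : 0 ≤ w1 + w2) (by linarith)
  have q1 := coord_cases d1 _ (by linarith : 0 ≤ w0 + w2) (by linarith)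
  have q2 := coord_cases d2 _ (by linarith : 0 ≤ w0 + w1) (by linarith)
  have n0 : 0 ≤ a0 := h0 ▸ abs_nonneg _
  have n1 : 0 ≤ a1 := h1 ▸ abs_nonneg _
  have n2 : 0 ≤ a2 := h2 ▸ abs_nonneg _
  rw [h0] at q0; rw [h1] at q1; rw [h2] at q2
  clear h0 h1 h2
  by_cases hf : 1 ≤ a0 ∧ d0 ≠ 0 ∧ d0 ≠ 1 ∨ 1 ≤ a1 ∧ d1 ≠ 0 ∧ d1 ≠ 1 ∨ 1 ≤ a2 ∧ d2 ≠ 0 ∧ d2 ≠ 1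
  · rw [hat_far _ a0 a1 a2 n0 n1 n2 (hf.imp And.left (Or.imp And.left And.left))]
    simp only [Ne] at hf
    rcases hf with ⟨_, h, h'⟩ | ⟨_, h, h'⟩ | ⟨_, h, h'⟩ <;> simp [h, h']
  rcases q0 with ⟨r0, e0⟩ | ⟨r0, e0⟩ | ⟨r0, e0⟩
  on_goal 3 => exact absurd ⟨e0.2, r0, e0.1⟩ (fun h => hf (Or.inl h))
  all_goals
    rcases q1 with ⟨r1, e1⟩ | ⟨r1, e1⟩ | ⟨r1, e1⟩
    on_goal 3 => exact absurd ⟨e1.2, r1, e1.1⟩ (fun h => hf (Or.inr (Or.inl h)))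
    all_goals
      rcases q2 with ⟨r2, e2⟩ | ⟨r2, e2⟩ | ⟨r2, e2⟩
      on_goal 3 => exact absurd ⟨e2.2, r2, e2.1⟩ (fun h => hf (Or.inr (Or.inr h)))
      all_goals
        clear hf
        subst_vars
        norm_num [Int.even_iff]
        try first | linarith | grind

/-- `interp μ` on the corner tetrahedron with vertices `v`, `v + s₀ e₀`, `v + s₁ e₁`, `v + s₂ e₂`,
where `v` is even and the signs `s` are arbitrary. -/
lemma interp_corner (μ : Idx → E3) (v s : Idx) (hv : Even (∑ i, v i))
    (hs : ∀ i, s i = 1 ∨ s i = -1) (t : Fin 3 → ℝ) (ht : ∀ i, 0 ≤ t i) (ht1 : ∑ i, t i ≤ 1) :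
    interp μ (WithLp.toLp 2 fun i => (v i : ℝ) + s i * t i) =
      (1 - ∑ i, t i) • μ v + ∑ i, t i • μ (v + Pi.single i (s i)) := by
  rw [interp_eq_of_hat μ _ ![1 - ∑ i, t i, t 0, t 1, t 2]
    ![v, v + Pi.single 0 (s 0), v + Pi.single 1 (s 1), v + Pi.single 2 (s 2)]]
  · simp [Fin.sum_univ_succ]
  intro k
  have e (i : Fin 3) := abs_coord (v i) (k i) (s i) (t i) (hs i)
  rw [hat_values _ _ _ k _ (e 0) (e 1) (e 2)]
  have key := corner_key (s 0 * (k 0 - v 0)) (s 1 * (k 1 - v 1)) (s 2 * (k 2 - v 2)) (t 0) (t 1)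
    (t 2) _ _ _ (ht 0) (ht 1) (ht 2) (by simpa [Fin.sum_univ_three] using ht1) rfl rfl rfl
  have hpar : Even (k 0 + k 1 + k 2) ↔
      Even (s 0 * (k 0 - v 0) + s 1 * (k 1 - v 1) + s 2 * (k 2 - v 2)) := by
    rw [Fin.sum_univ_three] at hv
    simp only [Int.even_iff] at *
    rcases hs 0 with h | h <;> rcases hs 1 with h' | h' <;> rcases hs 2 with h'' | h'' <;>
      rw [h, h', h''] <;> omega
  rw [if_congr hpar rfl rfl, key]
  simp only [Fin.sum_univ_four, Fin.sum_univ_three, idx_ext]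
  have m0 (i : Fin 3) : s i * (k i - v i) = 0 ↔ k i = v i := by
    rcases hs i with h | h <;> rw [h] <;> omega
  have m1 (i : Fin 3) : s i * (k i - v i) = 1 ↔ k i = v i + s i := by
    rcases hs i with h | h <;> rw [h] <;> omega
  simp [m0, m1]

/-- `interp μ` on the central tetrahedron with vertices `v`, `v + s₁ e₁ + s₂ e₂`,
`v + s₀ e₀ + s₂ e₂`, `v + s₀ e₀ + s₁ e₁`, where `v` is odd and the signs `s` are arbitrary, at the
point with barycentric coordinates `w`, `t 0`, `t 1`, `t 2`. -/
lemma interp_center (μ : Idx → E3) (v s : Idx) (hv : ¬ Even (∑ i, v i))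
    (hs : ∀ i, s i = 1 ∨ s i = -1) (w : ℝ) (t : Fin 3 → ℝ) (hw : 0 ≤ w) (ht : ∀ i, 0 ≤ t i)
    (hwt : w + ∑ i, t i = 1) :
    interp μ (WithLp.toLp 2 fun i => (v i : ℝ) + s i * ∑ j, if j = i then 0 else t j) =
      w • μ v + ∑ i, t i • μ (v + s - Pi.single i (s i)) := by
  rw [interp_eq_of_hat μ _ ![w, t 0, t 1, t 2]
    ![v, v + s - Pi.single 0 (s 0), v + s - Pi.single 1 (s 1), v + s - Pi.single 2 (s 2)]]
  · simp [Fin.sum_univ_succ]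
  intro k
  have e (i : Fin 3) := abs_coord (v i) (k i) (s i) (∑ j, if j = i then 0 else t j) (hs i)
  rw [hat_values _ _ _ k _ (e 0) (e 1) (e 2)]
  have key := center_key (s 0 * (k 0 - v 0)) (s 1 * (k 1 - v 1)) (s 2 * (k 2 - v 2)) w (t 0) (t 1)
    (t 2) _ _ _ hw (ht 0) (ht 1) (ht 2) (by rw [← hwt, Fin.sum_univ_three]; ring) rfl rfl rfl
  have hpar : Even (k 0 + k 1 + k 2) ↔
      ¬ Even (s 0 * (k 0 - v 0) + s 1 * (k 1 - v 1) + s 2 * (k 2 - v 2)) := by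
    rw [Fin.sum_univ_three] at hv
    simp only [Int.even_iff] at *
    rcases hs 0 with h | h <;> rcases hs 1 with h' | h' <;> rcases hs 2 with h'' | h'' <;>
      rw [h, h', h''] <;> omega
  have f0 : (∑ j : Fin 3, if j = 0 then 0 else t j) = t 1 + t 2 := by simp [Fin.sum_univ_three]
  have f1 : (∑ j : Fin 3, if j = 1 then 0 else t j) = t 0 + t 2 := by simp [Fin.sum_univ_three]
  have f2 : (∑ j : Fin 3, if j = 2 then 0 else t j) = t 0 + t 1 := by simp [Fin.sum_univ_three]
  rw [f0, f1, f2, if_congr hpar rfl rfl, key]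
  simp only [Fin.sum_univ_four, idx_ext]
  have m0 (i : Fin 3) : s i * (k i - v i) = 0 ↔ k i = v i := by
    rcases hs i with h | h <;> rw [h] <;> omega
  have m1 (i : Fin 3) : s i * (k i - v i) = 1 ↔ k i = v i + s i := by
    rcases hs i with h | h <;> rw [h] <;> omega
  simp [m0, m1]

/-- The closed lattice cell with lowest corner `k`. -/
def cell (a : ℝ) (n : ℕ) (k : Idx) : Set E3 :=
  {y | ∀ i, a / n * k i ≤ y i ∧ y i ≤ a / n * (k i + 1)}

/-- `Ω_n`, the union of the lattice cells contained in `Ω`. -/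
def meshDomain (a : ℝ) (Ω : Set E3) (n : ℕ) : Set E3 :=
  {y | ∃ k : Idx, y ∈ cell a n k ∧ cell a n k ⊆ Ω}

/-- `P_n(μ)`: equal to `μ` at the nodes of `Ω_n`, affine on each tetrahedron of `Ω_n`, and zero off
`Ω_n`. -/
def P (a : ℝ) (Ω : Set E3) (n : ℕ) (μ : Idx → E3) : E3 → E3 :=
  (meshDomain a Ω n).indicator (fun y => interp μ (((n : ℝ) / a) • y))

/-- Convergence of a sequence of spin distributions to `m ∈ H¹(Ω; ℝ³)`: weak convergence of
`P_n(μ_n)` in `H¹`, that is, weak convergence in `L²` of the functions and of their gradients. The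
gradient of `P_n(μ_n)` is taken element by element (zero off `Ω_n`); almost everywhere it is the
pointwise derivative. -/
def ConvergesTo (a : ℝ) (Ω : Set E3) (μ : ℕ → Idx → E3) (m : E3 → E3) : Prop :=
  MemH1 Ω m ∧
    ∀ v : E3 → E3, MemLp v 2 (volume.restrict Ω) →
      Tendsto (fun n => ∫ x in Ω, inner ℝ (P a Ω n (μ n) x) (v x)) atTop
        (𝓝 (∫ x in Ω, inner ℝ (m x) (v x))) ∧
      ∀ i, Tendsto
        (fun n => ∫ x in Ω, inner ℝ (fderiv ℝ (P a Ω n (μ n)) x (basisVec i)) (v x)) atTop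
        (𝓝 (∫ x in Ω, inner ℝ (weakPartial Ω i m x) (v x)))

/-! ### The demagnetizing field -/

/-- `h ∈ L²(ℝ³; ℝ³)` solves `curl h = 0`, `div h = - div u` in the sense of distributions. -/
def IsDemagField (u h : E3 → E3) : Prop :=
  MemLp h 2 volume ∧
    ∀ φ : E3 → ℝ, ContDiff ℝ ∞ φ → HasCompactSupport φ →
      (∀ i j : Fin 3, ∫ x, h x i * fderiv ℝ φ x (basisVec j) =
        ∫ x, h x j * fderiv ℝ φ x (basisVec i)) ∧
      ∫ x, ∑ i, h x i * fderiv ℝ φ x (basisVec i) =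
        - ∫ x, ∑ i, u x i * fderiv ℝ φ x (basisVec i)

open Classical in
/-- The demagnetizing field `h_d(u)` of `u ∈ L²(ℝ³; ℝ³)`. -/
def demagField (u : E3 → E3) : E3 → E3 :=
  if h : ∃ f, IsDemagField u f then h.choose else 0

/-- The demagnetizing energy `(μ₀ / 2) ‖h_d(u)‖_{L²(ℝ³)}`. -/
def demagEnergy (μ₀ : ℝ) (u : E3 → E3) : ℝ :=
  μ₀ / 2 * (eLpNorm (demagField u) 2 volume).toReal

/-! ### The energies -/

/-- The discrete exchange energy. -/
def exchangeN (a A : ℝ) (Ω : Set E3) (n : ℕ) (μ : Idx → E3) : ℝ :=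
  a / n * ∑ᶠ k ∈ nodes a Ω n, ∑ᶠ l ∈ neighbours a Ω n k, A * ‖μ l - μ k‖ ^ 2

/-- The discrete Zeeman energy. -/
def zeemanN (a : ℝ) (hZ : E3 → E3) (Ω : Set E3) (n : ℕ) (μ : Idx → E3) : ℝ :=
  -((a / n) ^ 3 * ∑ᶠ k ∈ nodes a Ω n, inner ℝ (hZ (node a n k)) (μ k))

/-- The total discrete energy. -/
def energyN (a A μ₀ : ℝ) (hZ : E3 → E3) (Ω : Set E3) (n : ℕ) (μ : Idx → E3) : ℝ :=
  exchangeN a A Ω n μ + demagEnergy μ₀ (Ω.indicator (P a Ω n μ)) + zeemanN a hZ Ω n μ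

/-- The continuum micromagnetic energy. -/
def energyInf (A μ₀ : ℝ) (hZ : E3 → E3) (Ω : Set E3) (m : E3 → E3) : ℝ :=
  2 * A * (∫ x in Ω, ∑ i, ‖weakPartial Ω i m x‖ ^ 2) + demagEnergy μ₀ (Ω.indicator m)
    + -∫ x in Ω, inner ℝ (hZ x) (m x)

/-- The lower bound of `Γ`-convergence along the sequence `μ`, with limit `m`. -/
def LiminfIneq (a A μ₀ : ℝ) (hZ : E3 → E3) (Ω : Set E3) (μ : ℕ → Idx → E3) (m : E3 → E3) : Prop :=
  ((energyInf A μ₀ hZ Ω m : ℝ) : EReal) ≤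
    liminf (fun n => ((energyN a A μ₀ hZ Ω n (μ n) : ℝ) : EReal)) atTop

/-- The upper bound of `Γ`-convergence along the sequence `μ`, with limit `m`. -/
def LimsupIneq (a A μ₀ : ℝ) (hZ : E3 → E3) (Ω : Set E3) (μ : ℕ → Idx → E3) (m : E3 → E3) : Prop :=
  limsup (fun n => ((energyN a A μ₀ hZ Ω n (μ n) : ℝ) : EReal)) atTop ≤
    ((energyInf A μ₀ hZ Ω m : ℝ) : EReal)

end

/-! Write h = a/n. The lower bound rests on convexity, the norm constraint on a Poincaré inequality
on small cubes, the upper bound on averaging over shifts of the lattice.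

Demagnetizing field. Minus the orthogonal projection of u onto the L² closure of the gradients
solves the equations (`isDemagField_gradProj`). The components of a difference of two solutions are
weakly harmonic and square integrable, hence zero (`isDemagField_unique`). Thus the energy is a
continuous seminorm on L², it has subgradients, and it is weakly lower semicontinuous.

Lower bound. The difference D along an edge in direction e_i satisfies |D|² ≥ 2h⟨φ, D⟩ − h²|φ|² for
any φ, here a test field in the interior. Summation by parts moves the difference to φ
(`sum_edges_ge`). The sums tend to 2∫⟨∂_i m, φ⟩ − ∫|φ|² = ∫|∂_i m|² − ∫|∂_i m − φ|², and φ is taken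
close to ∂_i m. The limit of these sums, and of the Zeeman energy, is given by `tendsto_sum_inner`.
Weak convergence bounds the gradients of P_n(μ_n), and these control all edges of the cells inside
Ω, because one endpoint of each edge is even and the gradient near it is a difference quotient along
the edge. The other nodes lie in a thin layer around the frontier. The frontier is a null set by the
cone property, and the discrete L² bound makes their contribution vanish.

Norm constraint. On a fixed cube Q of side ε, Poincaré's inequality gives ∫_Q|P_n|² ≤ ε⁻³|∫_Q P_n|²
+ 16ε²∫_Q|∇P_n|². As n → ∞, the left-hand side tends to |Q|, since |P_n| is almost 1, and the
averages converge by weak convergence (`sum_cubes_le`). Summing over the cubes and letting ε → 0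
gives |Ω| ≤ ∫|m|². Since |m| ≤ 1 passes to weak limits, |m| = 1 (`ae_norm_eq_one`).

Recovery sequence. The spins are point values of m on the lattice shifted by some σ ∈ (0,h)³. Near
the frontier the nodes are also displaced into Ω by a vector τ of length O(h) along a cone
direction. Averaged over σ, the discrete energy of the edges far from the frontier is at most ∫|∇m|²
with the sharp constant. The remaining edges cost a multiple of the Dirichlet integral over a
boundary layer, which tends to 0 (`lintegral_edge_le`, `lintegral_edgeSq_le`). The L² distance to m
is averaged at the same time, so that one σ is good for both (`exists_shift`). Since only values of
m are used, no extension or smoothing is needed. The condition |m| = 1 and difference bounds from a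
bounded gradient hold for almost every σ, which yields all variants at once (`exists_recovery`). -/

open scoped ENNReal

noncomputable section

/-! ### Square integrable fields -/

section L2

variable {α : Type*} [MeasurableSpace α] {ν : Measure α}

lemma memLp_inner_integrable {f g : α → E3} (hf : MemLp f 2 ν) (hg : MemLp g 2 ν) :
    Integrable (fun x => inner ℝ (f x) (g x)) ν := by
  refine (L2.integrable_inner (𝕜 := ℝ) (hf.toLp f) (hg.toLp g)).congr ?_
  filter_upwards [hf.coeFn_toLp, hg.coeFn_toLp] with x h1 h2
  rw [h1, h2]

lemma inner_toLp {f g : α → E3} (hf : MemLp f 2 ν) (hg : MemLp g 2 ν) :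
    inner ℝ (hf.toLp f) (hg.toLp g) = ∫ x, inner ℝ (f x) (g x) ∂ν := by
  rw [L2.inner_def]
  refine integral_congr_ae ?_
  filter_upwards [hf.coeFn_toLp, hg.coeFn_toLp] with x h1 h2
  rw [h1, h2]

lemma memLp_sq_integrable {f : α → E3} (hf : MemLp f 2 ν) : Integrable (fun x => ‖f x‖ ^ 2) ν := by
  simpa [real_inner_self_eq_norm_sq] using memLp_inner_integrable hf hf

lemma norm_toLp_sq {f : α → E3} (hf : MemLp f 2 ν) :
    ‖hf.toLp f‖ ^ 2 = ∫ x, ‖f x‖ ^ 2 ∂ν := by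
  rw [← real_inner_self_eq_norm_sq, inner_toLp hf hf]
  simp_rw [real_inner_self_eq_norm_sq]

lemma integral_inner_le_sqrt {f g : α → E3} (hf : MemLp f 2 ν) (hg : MemLp g 2 ν) :
    |∫ x, inner ℝ (f x) (g x) ∂ν| ≤ √(∫ x, ‖f x‖ ^ 2 ∂ν) * √(∫ x, ‖g x‖ ^ 2 ∂ν) := by
  rw [← norm_toLp_sq hf, ← norm_toLp_sq hg, Real.sqrt_sq (norm_nonneg _),
    Real.sqrt_sq (norm_nonneg _), ← inner_toLp hf hg]
  exact abs_real_inner_le_norm _ _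

lemma lintegral_enorm_sq {f : α → E3} (hf : MemLp f 2 ν) :
    ∫⁻ x, ‖f x‖ₑ ^ 2 ∂ν = ENNReal.ofReal (∫ x, ‖f x‖ ^ 2 ∂ν) := by
  rw [ofReal_integral_eq_lintegral_ofReal (memLp_sq_integrable hf)
    (Eventually.of_forall fun x => by positivity)]
  refine lintegral_congr fun x => ?_
  rw [ENNReal.ofReal_pow (norm_nonneg _), ofReal_norm]

end L2

/-- A smooth vector field with compact support in `U`. -/
structure IsTestField (U : Set E3) (Φ : E3 → E3) : Prop where
  contDiff : ContDiff ℝ ∞ Φ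
  hasCompactSupport : HasCompactSupport Φ
  tsupport_subset : tsupport Φ ⊆ U

namespace IsTestField

variable {U : Set E3} {Φ Ψ : E3 → E3}

lemma memLp (h : IsTestField U Φ) (ν : Measure E3) [IsFiniteMeasureOnCompacts ν] : MemLp Φ 2 ν :=
  h.contDiff.continuous.memLp_of_hasCompactSupport h.hasCompactSupport

lemma eq_zero (h : IsTestField U Φ) {x : E3} (hx : x ∉ U) : Φ x = 0 :=
  image_eq_zero_of_notMem_tsupport fun hx' => hx (h.tsupport_subset hx')

lemma add (h : IsTestField U Φ) (h' : IsTestField U Ψ) : IsTestField U (Φ + Ψ) :=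
  ⟨h.1.add h'.1, h.2.add h'.2, (tsupport_add Φ Ψ).trans (Set.union_subset h.3 h'.3)⟩

lemma smul (h : IsTestField U Φ) (c : ℝ) : IsTestField U (c • Φ) :=
  ⟨contDiff_const.smul h.1, h.2.smul_left (f := fun _ => c),
    (tsupport_smul_subset_right (fun _ => c) Φ).trans h.3⟩

lemma fderiv_apply (h : IsTestField U Φ) (v : E3) : IsTestField U (fun x => fderiv ℝ Φ x v) :=
  ⟨(h.1.fderiv_right (m := ∞) (by simp)).clm_apply contDiff_const,
    h.2.fderiv_apply ℝ v,
    (tsupport_fderiv_apply_subset ℝ v).trans h.3⟩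

lemma comp_sub (h : IsTestField U Φ) (w : E3) {V : Set E3} (hV : ∀ y ∈ U, y + w ∈ V) :
    IsTestField V (fun x => Φ (x - w)) := by
  refine ⟨h.1.comp (contDiff_id.sub contDiff_const), 
    h.2.comp_homeomorph (Homeomorph.subRight w), ?_⟩
  have : tsupport (fun x => Φ (x - w)) = (Homeomorph.subRight w) ⁻¹' tsupport Φ :=
    tsupport_comp_eq_preimage Φ (Homeomorph.subRight w)
  rw [this]
  intro x hx
  simpa using hV _ (h.3 hx)

/-- A component of a test field. -/
lemma comp_contDiff (h : IsTestField U Φ) (j : Fin 3) : ContDiff ℝ ∞ (fun x => Φ x j) :=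
  (EuclideanSpace.proj (𝕜 := ℝ) j).contDiff.comp h.1

lemma comp_hasCompactSupport (h : IsTestField U Φ) (j : Fin 3) :
    HasCompactSupport (fun x => Φ x j) :=
  h.2.comp_left (g := fun y : E3 => y j) rfl

lemma comp_tsupport (h : IsTestField U Φ) (j : Fin 3) : tsupport (fun x => Φ x j) ⊆ U :=
  (closure_mono (Function.support_comp_subset (g := fun y : E3 => y j) rfl Φ)).trans h.3

lemma fderiv_comp (h : IsTestField U Φ) (j : Fin 3) (x v : E3) :
    fderiv ℝ (fun x => Φ x j) x v = fderiv ℝ Φ x v j := by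
  have := ((EuclideanSpace.proj (𝕜 := ℝ) j).hasFDerivAt (x := Φ x)).comp x
    ((h.1.differentiable (by simp)) x).hasFDerivAt
  have h2 := this.fderiv
  change fderiv ℝ (fun x => Φ x j) x = _ at h2
  rw [h2]; rfl

end IsTestField

lemma isTestField_smul {U : Set E3} {φ : E3 → ℝ} (h : ContDiff ℝ ∞ φ) (h' : HasCompactSupport φ)
    (hU : tsupport φ ⊆ U) (c : E3) : IsTestField U (fun x => φ x • c) :=
  ⟨h.smul contDiff_const, h'.smul_right, (tsupport_smul_subset_left φ _).trans hU⟩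

/-- The test fields, as a subspace of `L²`. -/
def testFields (U : Set E3) : Submodule ℝ (Lp E3 2 (volume.restrict U)) where
  carrier := {f | ∃ Φ, ∃ h : IsTestField U Φ, f = (h.memLp _).toLp Φ}
  add_mem' := by
    rintro _ _ ⟨Φ, h, rfl⟩ ⟨Ψ, h', rfl⟩
    exact ⟨Φ + Ψ, h.add h', rfl⟩
  zero_mem' := ⟨0, ⟨contDiff_const, HasCompactSupport.zero, by simp⟩, rfl⟩
  smul_mem' := by
    rintro c _ ⟨Φ, h, rfl⟩
    exact ⟨c • Φ, h.smul c, rfl⟩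

/-- A field orthogonal to all φ e_j has vanishing components by the fundamental lemma of the
calculus of variations, so the orthogonal complement is trivial. -/
lemma dense_testFields {U : Set E3} (hU : IsOpen U) : (testFields U).topologicalClosure = ⊤ := by
  rw [Submodule.topologicalClosure_eq_top_iff, Submodule.eq_bot_iff]
  intro f hf
  rw [Submodule.mem_orthogonal] at hf
  have hm : MemLp f 2 (volume.restrict U) := Lp.memLp f
  have hloc : LocallyIntegrableOn f U volume :=
    locallyIntegrableOn_of_locallyIntegrable_restrict (hm.locallyIntegrable (by norm_num))
  have key (j : Fin 3) : ∀ᵐ x ∂volume, x ∈ U → f x j = 0 := by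
    have hj : LocallyIntegrableOn (fun x => f x j) U volume := by
      intro x hx
      obtain ⟨t, ht, hi⟩ := hloc x hx
      exact ⟨t, ht, (EuclideanSpace.proj (𝕜 := ℝ) j).integrable_comp hi⟩
    refine hU.ae_eq_zero_of_integral_contDiff_smul_eq_zero hj fun φ h1 h2 h3 => ?_
    have ht := isTestField_smul h1 h2 h3 (basisVec j)
    have := hf _ ⟨_, ht, rfl⟩
    rw [← Lp.toLp_coeFn f hm, inner_toLp] at this
    rw [← this, eq_comm, setIntegral_eq_integral_of_forall_compl_eq_zero]
    · refine integral_congr_ae (Eventually.of_forall fun x => ?_)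
      simp [basisVec, inner_smul_left, EuclideanSpace.inner_single_left]
    · intro x hx
      rw [ht.eq_zero hx, inner_zero_left]
  refine (Lp.eq_zero_iff_ae_eq_zero).2 ?_
  rw [Filter.EventuallyEq, ae_restrict_iff' hU.measurableSet]
  filter_upwards [key 0, key 1, key 2] with x h0 h1 h2 hx
  ext j
  fin_cases j <;> simp [h0 hx, h1 hx, h2 hx]

lemma exists_testField {U : Set E3} (hU : IsOpen U) {f : E3 → E3}
    (hf : MemLp f 2 (volume.restrict U)) {ε : ℝ} (hε : 0 < ε) :
    ∃ Φ, IsTestField U Φ ∧ ∫ x in U, ‖f x - Φ x‖ ^ 2 < ε := by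
  have hmem : hf.toLp f ∈ closure (testFields U : Set (Lp E3 2 (volume.restrict U))) := by
    rw [← Submodule.topologicalClosure_coe, dense_testFields hU]; trivial
  obtain ⟨_, ⟨Φ, h, rfl⟩, hd⟩ := Metric.mem_closure_iff.1 hmem (√ε) (by positivity)
  refine ⟨Φ, h, ?_⟩
  rw [dist_eq_norm, ← MemLp.toLp_sub] at hd
  have := norm_toLp_sq (hf.sub (h.memLp (volume.restrict U)))
  simp only [Pi.sub_apply] at this
  rw [← this, ← Real.sq_sqrt hε.le]
  gcongr

/-- The weak partial derivative, tested with vector fields. -/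
lemma IsWeakPartial.inner_eq {U : Set E3} (hU : IsOpen U) {i : Fin 3} {u g : E3 → E3}
    (hu : MemLp u 2 (volume.restrict U)) (hg : MemLp g 2 (volume.restrict U))
    (h : IsWeakPartial U i u g) {Φ : E3 → E3} (hΦ : IsTestField U Φ) :
    ∫ x in U, inner ℝ (u x) (fderiv ℝ Φ x (basisVec i)) = - ∫ x in U, inner ℝ (g x) (Φ x) := by
  -- `IsWeakPartial` only knows scalar test functions; the pairing with a field is the trace of its
  -- pairings with the components.
  have aux {w Ψ : E3 → E3} (hw : MemLp w 2 (volume.restrict U)) (hΨ : IsTestField U Ψ) :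
      ∫ x in U, inner ℝ (w x) (Ψ x) = ∑ j, (∫ x in U, Ψ x j • w x) j := by
    have hint (j : Fin 3) : Integrable (fun x => Ψ x j • w x) (volume.restrict U) := by
      refine memLp_one_iff_integrable.1 (MemLp.smul (p := 2) (q := 2) (φ := fun x => Ψ x j) hw ?_)
      exact (hΨ.comp_contDiff j).continuous.memLp_of_hasCompactSupport (hΨ.comp_hasCompactSupport j)
    have hc (j : Fin 3) : (∫ x in U, Ψ x j • w x) j = ∫ x in U, Ψ x j * w x j := by
      have := (EuclideanSpace.proj (𝕜 := ℝ) j).integral_comp_comm (hint j)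
      simpa using this.symm
    simp_rw [hc]
    rw [← integral_finsetSum]
    · refine integral_congr_ae (Eventually.of_forall fun x => ?_)
      simp [PiLp.inner_apply]
    · intro j _
      simpa using (EuclideanSpace.proj (𝕜 := ℝ) j).integrable_comp (hint j)
  rw [aux hu (hΦ.fderiv_apply _), aux hg hΦ, ← Finset.sum_neg_distrib]
  refine Finset.sum_congr rfl fun j _ => ?_
  have := h (fun x => Φ x j) (hΦ.comp_contDiff j) (hΦ.comp_hasCompactSupport j)
    (by rw [hU.interior_eq]; exact hΦ.comp_tsupport j)
  simp only [hΦ.fderiv_comp] at this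
  rw [this]; simp

/-! ### Translations of Sobolev functions -/

lemma memLp_translate {U S : Set E3} (hU : MeasurableSet U) {f : E3 → E3}
    (hf : MemLp f 2 (volume.restrict U)) {w : E3} (hS : ∀ y ∈ S, y + w ∈ U) :
    MemLp (fun y => f (y + w)) 2 (volume.restrict S) := by
  have hp : MeasurePreserving (fun y : E3 => y + w)
      (volume.restrict ((fun y => y + w) ⁻¹' U)) (volume.restrict U) :=
    (measurePreserving_add_right volume w).restrict_preimage hU
  exact (hf.comp_measurePreserving hp).mono_measure (Measure.restrict_mono hS le_rfl)

lemma setIntegral_inner_translate {U S : Set E3} {f Φ : E3 → E3} (hΦ : IsTestField S Φ) {w : E3}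
    (hS : ∀ y ∈ S, y + w ∈ U) :
    ∫ z in U, inner ℝ (f z) (Φ (z - w)) = ∫ y in S, inner ℝ (f (y + w)) (Φ y) := by
  rw [setIntegral_eq_integral_of_forall_compl_eq_zero,
    setIntegral_eq_integral_of_forall_compl_eq_zero,
    ← integral_add_right_eq_self (fun z => inner ℝ (f z) (Φ (z - w))) w]
  · simp
  · intro x hx
    rw [hΦ.eq_zero hx, inner_zero_right]
  · intro x hx
    rw [hΦ.eq_zero (x := x - w) fun h => hx (by simpa using hS _ h), inner_zero_right]

lemma sum_basisVec (v : E3) : ∑ i, v i • basisVec i = v := by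
  ext j
  fin_cases j <;> simp [basisVec, Fin.sum_univ_three]

/-- Differentiating `∫ ⟪u, Φ (· - t v)⟫` in `t`. -/
lemma hasDerivAt_integral_inner_translate {U : Set E3} (hfin : volume U ≠ ⊤) {u Φ : E3 → E3}
    (hu : MemLp u 2 (volume.restrict U)) {S : Set E3} (hΦ : IsTestField S Φ) (v : E3) (t : ℝ) :
    HasDerivAt (fun t : ℝ => ∫ z in U, inner ℝ (u z) (Φ (z - t • v)))
      (∫ z in U, inner ℝ (u z) (-fderiv ℝ Φ (z - t • v) v)) t := by
  have : IsFiniteMeasure (volume.restrict U) := ⟨by simpa using hfin.lt_top⟩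
  obtain ⟨M, hM⟩ : ∃ M, ∀ x, ‖fderiv ℝ Φ x v‖ ≤ M := by
    have := (hΦ.fderiv_apply v).hasCompactSupport.exists_bound_of_continuous
      (hΦ.fderiv_apply v).contDiff.continuous
    exact this
  obtain ⟨K, hK⟩ := hΦ.hasCompactSupport.exists_bound_of_continuous hΦ.contDiff.continuous
  have hc (t : ℝ) : Continuous fun z : E3 => Φ (z - t • v) :=
    hΦ.contDiff.continuous.comp (by fun_prop)
  have hui : Integrable u (volume.restrict U) := hu.integrable (by norm_num)
  refine (hasDerivAt_integral_of_dominated_loc_of_deriv_le (s := Set.univ) (F := fun t z => inner ℝ (u z) (Φ (z - t • v)))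
    (F' := fun t z => inner ℝ (u z) (-fderiv ℝ Φ (z - t • v) v)) (x₀ := t)
    (bound := fun z => ‖u z‖ * M) univ_mem ?_ ?_ ?_ ?_ ?_ ?_).2
  · exact Eventually.of_forall fun t => hu.1.inner (hc t).aestronglyMeasurable
  · refine (hui.norm.mul_const K).mono' (hu.1.inner (hc t).aestronglyMeasurable) ?_
    refine Eventually.of_forall fun z => (norm_inner_le_norm _ _).trans ?_
    gcongr; exact hK _
  · refine hu.1.inner (Continuous.aestronglyMeasurable ?_)
    exact ((hΦ.fderiv_apply v).contDiff.continuous.comp (by fun_prop : Continuous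
      fun z : E3 => z - t • v)).neg
  · refine Eventually.of_forall fun z s _ => (norm_inner_le_norm _ _).trans ?_
    rw [norm_neg]
    gcongr; exact hM _
  · exact hui.norm.mul_const M
  · refine Eventually.of_forall fun z s _ => ?_
    have h1 : HasDerivAt (fun s : ℝ => z - s • v) (-v) s := by
      simpa using ((hasDerivAt_id s).smul_const v).const_sub z
    have h2 := ((hΦ.contDiff.differentiable (by simp)) (z - s • v)).hasFDerivAt.comp_hasDerivAt s h1
    have h3 := (hasDerivAt_const s (u z)).inner ℝ h2
    simpa using h3

/-- F(t) = ∫⟨u, Φ(· − tv)⟩ has derivative −∫⟨u, ∂_vΦ(· − tv)⟩ = ∫⟨∂_v u, Φ(· − tv)⟩, which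
Cauchy–Schwarz bounds. The derivative falls on Φ, so u needs no regularity on lines. Only the
segments that start in S have to stay in U. -/
lemma abs_integral_translate_le {U S : Set E3} (hU : IsOpen U) (hfin : volume U ≠ ⊤)
    {u : E3 → E3} {g : Fin 3 → E3 → E3} (hu : MemLp u 2 (volume.restrict U))
    (hg : ∀ i, MemLp (g i) 2 (volume.restrict U)) (hw : ∀ i, IsWeakPartial U i u (g i))
    {v : E3} (hSv : ∀ t ∈ Set.Icc (0 : ℝ) 1, ∀ y ∈ S, y + t • v ∈ U)
    {C : ℝ} (hC : ∀ t ∈ Set.Icc (0 : ℝ) 1, ∫ y in S, ‖∑ i, v i • g i (y + t • v)‖ ^ 2 ≤ C)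
    {Φ : E3 → E3} (hΦ : IsTestField S Φ) :
    |∫ y in S, inner ℝ (u (y + v) - u y) (Φ y)| ≤ √C * √(∫ y in S, ‖Φ y‖ ^ 2) := by
  set F : ℝ → ℝ := fun t => ∫ z in U, inner ℝ (u z) (Φ (z - t • v)) with hF
  have hG : MemLp (fun z => ∑ i, v i • g i z) 2 (volume.restrict U) :=
    memLp_finsetSum _ fun i _ => (hg i).const_smul (v i)
  have hderiv (t : ℝ) (ht : t ∈ Set.Icc (0 : ℝ) 1) :
      |∫ z in U, inner ℝ (u z) (-fderiv ℝ Φ (z - t • v) v)| ≤ √C * √(∫ y in S, ‖Φ y‖ ^ 2) := by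
    have hΨ : IsTestField U (fun z => Φ (z - t • v)) := hΦ.comp_sub _ (hSv t ht)
    have h1 : ∫ z in U, inner ℝ (u z) (-fderiv ℝ Φ (z - t • v) v) =
        ∫ z in U, inner ℝ (∑ i, v i • g i z) (Φ (z - t • v)) := by
      have e1 (z : E3) : inner ℝ (u z) (-fderiv ℝ Φ (z - t • v) v) =
          -∑ i, v i * inner ℝ (u z) (fderiv ℝ (fun z => Φ (z - t • v)) z (basisVec i)) := by
        conv_lhs => rw [← sum_basisVec v, map_sum]
        rw [inner_neg_right, inner_sum]
        simp [inner_smul_right, fderiv_comp_sub]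
        simp [sum_basisVec]
      have e2 (z : E3) : inner ℝ (∑ i, v i • g i z) (Φ (z - t • v)) =
          ∑ i, v i * inner ℝ (g i z) (Φ (z - t • v)) := by
        simp [sum_inner, inner_smul_left]
      simp_rw [e1, e2]
      rw [integral_neg, integral_finsetSum, integral_finsetSum, ← Finset.sum_neg_distrib]
      · refine Finset.sum_congr rfl fun i _ => ?_
        rw [integral_const_mul, integral_const_mul,
          (hw i).inner_eq hU hu (hg i) hΨ]
        ring
      · exact fun i _ => (memLp_inner_integrable (hg i) (hΨ.memLp _)).const_mul _
      · exact fun i _ => (memLp_inner_integrable hu ((hΨ.fderiv_apply _).memLp _)).const_mul _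
    rw [h1, setIntegral_inner_translate hΦ (hSv t ht)]
    refine (integral_inner_le_sqrt (memLp_translate hU.measurableSet hG (hSv t ht))
      (hΦ.memLp _)).trans ?_
    gcongr
    exact hC t ht
  have hmv := norm_image_sub_le_of_norm_deriv_le_segment_01' (f := F)
    (f' := fun t => ∫ z in U, inner ℝ (u z) (-fderiv ℝ Φ (z - t • v) v))
    (fun t _ => (hasDerivAt_integral_inner_translate hfin hu hΦ v t).hasDerivWithinAt)
    (fun t ht => hderiv t ⟨ht.1, ht.2.le⟩)
  have h0S : ∀ y ∈ S, y + (0 : ℝ) • v ∈ U := hSv 0 (by simp)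
  have h1S : ∀ y ∈ S, y + (1 : ℝ) • v ∈ U := hSv 1 (by simp)
  have e : ∫ y in S, inner ℝ (u (y + v) - u y) (Φ y) = F 1 - F 0 := by
    simp only [hF]
    rw [setIntegral_inner_translate hΦ h0S, setIntegral_inner_translate hΦ h1S, ← integral_sub]
    · simp [inner_sub_left]
    · exact memLp_inner_integrable (memLp_translate hU.measurableSet hu h1S) (hΦ.memLp _)
    · exact memLp_inner_integrable (memLp_translate hU.measurableSet hu h0S) (hΦ.memLp _)
  rw [e]
  exact hmv

/-- A bound of a functional on test fields bounds the `L²` norm. -/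
lemma integral_sq_le_of_testFields {S : Set E3} (hS : IsOpen S) {f : E3 → E3}
    (hf : MemLp f 2 (volume.restrict S)) {K : ℝ} (hK : 0 ≤ K)
    (h : ∀ Φ, IsTestField S Φ →
      |∫ y in S, inner ℝ (f y) (Φ y)| ≤ K * √(∫ y in S, ‖Φ y‖ ^ 2)) :
    ∫ y in S, ‖f y‖ ^ 2 ≤ K ^ 2 := by
  have hall : ∀ x : Lp E3 2 (volume.restrict S), inner ℝ (hf.toLp f) x ≤ K * ‖x‖ := by
    intro x
    have hx : x ∈ closure (testFields S : Set (Lp E3 2 (volume.restrict S))) := by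
      rw [← Submodule.topologicalClosure_coe, dense_testFields hS]; trivial
    refine closure_minimal (t := {x | inner ℝ (hf.toLp f) x ≤ K * ‖x‖}) ?_
      (isClosed_le (by fun_prop) (by fun_prop)) hx
    rintro _ ⟨Φ, hΦ, rfl⟩
    have := h Φ hΦ
    rw [← norm_toLp_sq (hΦ.memLp _), Real.sqrt_sq (norm_nonneg _), ← inner_toLp hf] at this
    exact (le_abs_self _).trans this
  have := hall (hf.toLp f)
  rw [real_inner_self_eq_norm_sq] at this
  rw [← norm_toLp_sq hf]
  have h0 := norm_nonneg (hf.toLp f)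
  have : ‖hf.toLp f‖ ≤ K := by
    by_contra! hlt
    nlinarith
  gcongr

/-- The `L²` norm of `u (· + v) - u` is bounded by the largest `L²` norm of the directional
derivative along the translation. -/
lemma lintegral_translate_sub_le {U S : Set E3} (hU : IsOpen U) (hfin : volume U ≠ ⊤)
    {u : E3 → E3} {g : Fin 3 → E3 → E3} (hu : MemLp u 2 (volume.restrict U))
    (hg : ∀ i, MemLp (g i) 2 (volume.restrict U)) (hw : ∀ i, IsWeakPartial U i u (g i))
    (hS : IsOpen S) {v : E3} (hSv : ∀ t ∈ Set.Icc (0 : ℝ) 1, ∀ y ∈ S, y + t • v ∈ U)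
    {C : ℝ≥0∞}
    (hC : ∀ t ∈ Set.Icc (0 : ℝ) 1, ∫⁻ y in S, ‖∑ i, v i • g i (y + t • v)‖ₑ ^ 2 ≤ C) :
    ∫⁻ y in S, ‖u (y + v) - u y‖ₑ ^ 2 ≤ C := by
  rcases eq_or_ne C ⊤ with rfl | hCt
  · exact le_top
  lift C to NNReal using hCt
  have hG : MemLp (fun z => ∑ i, v i • g i z) 2 (volume.restrict U) :=
    memLp_finsetSum _ fun i _ => (hg i).const_smul (v i)
  have hC' : ∀ t ∈ Set.Icc (0 : ℝ) 1, ∫ y in S, ‖∑ i, v i • g i (y + t • v)‖ ^ 2 ≤ C := by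
    intro t ht
    have := hC t ht
    rw [lintegral_enorm_sq (memLp_translate hU.measurableSet hG (hSv t ht)),
      ENNReal.ofReal_le_iff_le_toReal (by simp)] at this
    simpa using this
  have hd : MemLp (fun y => u (y + v) - u y) 2 (volume.restrict S) := by
    have h0 := memLp_translate hU.measurableSet hu (hSv 0 (by simp))
    have h1 := memLp_translate hU.measurableSet hu (hSv 1 (by simp))
    simp only [one_smul, zero_smul, add_zero] at h0 h1
    exact h1.sub h0
  have := integral_sq_le_of_testFields hS hd (Real.sqrt_nonneg C) fun Φ hΦ =>
    abs_integral_translate_le hU hfin hu hg hw hSv hC' hΦ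
  rw [Real.sq_sqrt C.coe_nonneg] at this
  rw [lintegral_enorm_sq hd, ENNReal.ofReal_le_iff_le_toReal (by simp)]
  simpa using this

lemma enorm_sum_smul_sq_le (v : E3) (g : Fin 3 → E3) :
    ‖∑ i, v i • g i‖ₑ ^ 2 ≤ ‖v‖ₑ ^ 2 * ∑ i, ‖g i‖ₑ ^ 2 := by
  have h : ‖∑ i, v i • g i‖ ^ 2 ≤ ‖v‖ ^ 2 * ∑ i, ‖g i‖ ^ 2 := by
    have h1 : ‖∑ i, v i • g i‖ ≤ ∑ i, |v i| * ‖g i‖ :=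
      (norm_sum_le _ _).trans_eq (by simp [norm_smul])
    calc ‖∑ i, v i • g i‖ ^ 2 ≤ (∑ i, |v i| * ‖g i‖) ^ 2 := by gcongr
      _ ≤ (∑ i, |v i| ^ 2) * ∑ i, ‖g i‖ ^ 2 := Finset.sum_mul_sq_le_sq_mul_sq _ _ _
      _ = _ := by rw [EuclideanSpace.norm_sq_eq]; simp
  have e (x : E3) : ‖x‖ₑ ^ 2 = ENNReal.ofReal (‖x‖ ^ 2) := by
    rw [ENNReal.ofReal_pow (norm_nonneg _), ofReal_norm]
  simp_rw [e]
  rw [← ENNReal.ofReal_sum_of_nonneg (fun _ _ => by positivity), ← ENNReal.ofReal_mul (by positivity)]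
  exact ENNReal.ofReal_le_ofReal h

lemma setLIntegral_translate_le {S T : Set E3} {w : E3} (h : ∀ y ∈ S, y + w ∈ T)
    (f : E3 → ℝ≥0∞) (hT : MeasurableSet T) :
    ∫⁻ y in S, f (y + w) ≤ ∫⁻ y in T, f y := by
  calc ∫⁻ y in S, f (y + w) ≤ ∫⁻ y in (fun y => y + w) ⁻¹' T, f (y + w) :=
        lintegral_mono_set h
    _ = ∫⁻ y in T, f y := by
        rw [← lintegral_indicator (hT.preimage (by fun_prop)), ← lintegral_indicator hT,
          ← lintegral_add_right_eq_self (T.indicator f) w]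
        rfl

/-- The `L²` norm of `u (· + v) - u` is bounded by the gradient in a set that contains the
translation. -/
lemma lintegral_translate_sub_le_grad {U S T : Set E3} (hU : IsOpen U) (hfin : volume U ≠ ⊤)
    {u : E3 → E3} {g : Fin 3 → E3 → E3} (hu : MemLp u 2 (volume.restrict U))
    (hg : ∀ i, MemLp (g i) 2 (volume.restrict U)) (hw : ∀ i, IsWeakPartial U i u (g i))
    (hS : IsOpen S) {v : E3} (hT : MeasurableSet T) (hTU : T ⊆ U)
    (hSv : ∀ t ∈ Set.Icc (0 : ℝ) 1, ∀ y ∈ S, y + t • v ∈ T) :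
    ∫⁻ y in S, ‖u (y + v) - u y‖ₑ ^ 2 ≤ ‖v‖ₑ ^ 2 * ∫⁻ y in T, ∑ i, ‖g i y‖ₑ ^ 2 := by
  refine lintegral_translate_sub_le hU hfin hu hg hw hS (fun t ht y hy => hTU (hSv t ht y hy)) ?_
  intro t ht
  refine (setLIntegral_translate_le (hSv t ht) (fun y => ‖∑ i, v i • g i y‖ₑ ^ 2) hT).trans ?_
  rw [← lintegral_const_mul' _ _ (by simp)]
  exact lintegral_mono fun y => enorm_sum_smul_sq_le _ _

lemma IsWeakPartial.mono {U S : Set E3} (hSU : S ⊆ U) {i : Fin 3} {u g : E3 → E3}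
    (h : IsWeakPartial U i u g) : IsWeakPartial S i u g := by
  intro φ h1 h2 h3
  have := h φ h1 h2 (h3.trans (interior_mono hSU))
  have hφ (x : E3) (hx : x ∉ S) : φ x = 0 :=
    image_eq_zero_of_notMem_tsupport fun hx' => hx (interior_subset (h3 hx'))
  have hφ' (x : E3) (hx : x ∉ S) : fderiv ℝ φ x (basisVec i) = 0 := by
    rw [image_eq_zero_of_notMem_tsupport (f := fderiv ℝ φ)
      fun hx' => hx (interior_subset (h3 (tsupport_fderiv_subset ℝ hx')))]
    rfl
  rw [setIntegral_eq_integral_of_forall_compl_eq_zero fun x hx => by rw [hφ' x hx, zero_smul],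
    setIntegral_eq_integral_of_forall_compl_eq_zero fun x hx => by rw [hφ x hx, zero_smul]]
  rwa [setIntegral_eq_integral_of_forall_compl_eq_zero
      fun x hx => by rw [hφ' x fun hx' => hx (hSU hx'), zero_smul],
    setIntegral_eq_integral_of_forall_compl_eq_zero
      fun x hx => by rw [hφ x fun hx' => hx (hSU hx'), zero_smul]] at this

lemma IsWeakPartial.congr {U : Set E3} {i : Fin 3} {u u' g : E3 → E3}
    (h : IsWeakPartial U i u g) (hu : u =ᵐ[volume.restrict U] u') : IsWeakPartial U i u' g := by
  intro φ h1 h2 h3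
  rw [← h φ h1 h2 h3]
  refine integral_congr_ae ?_
  filter_upwards [hu] with x hx
  rw [hx]

/-- A Poincaré inequality on convex sets. -/
lemma lintegral_lintegral_sub_le {S : Set E3} (hfin : volume S ≠ ⊤)
    {u : E3 → E3} {g : Fin 3 → E3 → E3} (hu : MemLp u 2 (volume.restrict S))
    (hg : ∀ i, MemLp (g i) 2 (volume.restrict S)) (hw : ∀ i, IsWeakPartial S i u (g i))
    (hS : IsOpen S) (hconv : Convex ℝ S) {W : Set E3} (hW : MeasurableSet W)
    (hSW : ∀ x ∈ S, ∀ y ∈ S, x - y ∈ W) {d : ℝ} (hd : ∀ w ∈ W, ‖w‖ ≤ d) :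
    ∫⁻ y in S, ∫⁻ x in S, ‖u x - u y‖ₑ ^ 2 ≤
      volume W * (ENNReal.ofReal (d ^ 2) * ∫⁻ y in S, ∑ i, ‖g i y‖ₑ ^ 2) := by
  -- Exchanging the order of integration requires joint measurability, hence a measurable
  -- representative.
  obtain ⟨u', hu'm, hu'⟩ := hu.1
  have hcg : ∫⁻ y in S, ∫⁻ x in S, ‖u x - u y‖ₑ ^ 2 =
      ∫⁻ y in S, ∫⁻ x in S, ‖u' x - u' y‖ₑ ^ 2 := by
    refine lintegral_congr_ae ?_
    filter_upwards [hu'] with y hy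
    refine lintegral_congr_ae ?_
    filter_upwards [hu'] with x hx
    rw [hx, hy]
  have hSm := hS.measurableSet
  set I := ∫⁻ y in S, ∑ i, ‖g i y‖ₑ ^ 2
  -- With x = y + w, the double integral becomes an integral over w ∈ W of the squared norm of u(· +
  -- w) − u on S ∩ (S − w). Convexity keeps the segments from y to y + w in S.
  let F : E3 → E3 → ℝ≥0∞ := fun y w =>
    ({p : E3 × E3 | p.1 ∈ S ∧ p.1 + p.2 ∈ S}).indicator (fun p => ‖u' (p.1 + p.2) - u' p.1‖ₑ ^ 2)
      (y, w)
  have hF : Measurable (Function.uncurry F) := by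
    refine Measurable.indicator ?_ ?_
    · have := hu'm.measurable
      fun_prop
    · exact (hSm.preimage measurable_fst).inter (hSm.preimage (measurable_fst.add measurable_snd))
  have h1 (y : E3) (hy : y ∈ S) : ∫⁻ x in S, ‖u' x - u' y‖ₑ ^ 2 = ∫⁻ w, F y w := by
    rw [← lintegral_indicator hSm, ← lintegral_add_left_eq_self _ y]
    refine lintegral_congr fun w => ?_
    by_cases hyw : y + w ∈ S <;> simp [F, Set.indicator, hy, hyw]
  rw [hcg, setLIntegral_congr_fun hSm h1]
  calc ∫⁻ y in S, ∫⁻ w, F y w ≤ ∫⁻ y, ∫⁻ w, F y w := setLIntegral_le_lintegral _ _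
    _ = ∫⁻ w, ∫⁻ y, F y w := lintegral_lintegral_swap hF.aemeasurable
    _ ≤ ∫⁻ w, W.indicator (fun _ => ENNReal.ofReal (d ^ 2) * I) w := by
        refine lintegral_mono fun w => ?_
        by_cases hwW : w ∈ W
        · rw [Set.indicator_of_mem hwW]
          set Sw := S ∩ (fun y => y + w) ⁻¹' S
          have hSw : IsOpen Sw := hS.inter (hS.preimage (by fun_prop))
          have e : ∫⁻ y, F y w = ∫⁻ y in Sw, ‖u' (y + w) - u' y‖ₑ ^ 2 := by
            rw [← lintegral_indicator hSw.measurableSet]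
            refine lintegral_congr fun y => ?_
            by_cases hyw : y ∈ Sw
            · rw [Set.indicator_of_mem hyw]
              exact Set.indicator_of_mem (show (y, w) ∈ {p : E3 × E3 | p.1 ∈ S ∧ p.1 + p.2 ∈ S}
                from hyw) _
            · rw [Set.indicator_of_notMem hyw]
              exact Set.indicator_of_notMem (show (y, w) ∉ {p : E3 × E3 | p.1 ∈ S ∧ p.1 + p.2 ∈ S}
                from hyw) _
          rw [e]
          refine (lintegral_translate_sub_le_grad hS hfin (hu.ae_eq hu') hg
            (fun i => (hw i).congr hu') hSw hSm le_rfl ?_).trans ?_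
          · intro t ht y hy
            have := hconv hy.1 hy.2 (sub_nonneg.2 ht.2) ht.1 (by ring)
            convert this using 1
            module
          · gcongr
            rw [← ofReal_norm, ← ENNReal.ofReal_pow (norm_nonneg _)]
            exact ENNReal.ofReal_le_ofReal (by have := hd w hwW; gcongr)
        · rw [Set.indicator_of_notMem hwW, nonpos_iff_eq_zero]
          have : ∀ y, F y w = 0 := by
            intro y
            refine Set.indicator_of_notMem (fun hy => hwW ?_) _
            simpa using hSW _ hy.2 _ hy.1
          simp [this]
    _ = _ := by
        rw [lintegral_indicator hW, lintegral_const, Measure.restrict_apply_univ, mul_comm]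

/-! ### Weakly harmonic square integrable functions vanish -/

/-- The `j`-th partial derivative. -/
def partialD (j : Fin 3) (φ : E3 → ℝ) : E3 → ℝ := fun x => fderiv ℝ φ x (basisVec j)

lemma contDiff_partialD {φ : E3 → ℝ} (h : ContDiff ℝ ∞ φ) (j : Fin 3) :
    ContDiff ℝ ∞ (partialD j φ) :=
  (h.fderiv_right (m := ∞) (by simp)).clm_apply contDiff_const

lemma hasCompactSupport_partialD {φ : E3 → ℝ} (h : HasCompactSupport φ) (j : Fin 3) :
    HasCompactSupport (partialD j φ) := h.fderiv_apply ℝ _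

lemma partialD_comm {φ : E3 → ℝ} (h : ContDiff ℝ ∞ φ) (i j : Fin 3) :
    partialD i (partialD j φ) = partialD j (partialD i φ) := by
  ext x
  have hs := (h.contDiffAt (x := x)).isSymmSndFDerivAt (by
    simp only [minSmoothness_of_isRCLikeNormedField]
    exact WithTop.coe_le_coe.2 le_top)
  have hd : DifferentiableAt ℝ (fderiv ℝ φ) x :=
    ((h.fderiv_right (m := ∞) (by simp)).differentiable (by simp)) x
  have e (i j : Fin 3) : partialD i (partialD j φ) x =
      fderiv ℝ (fderiv ℝ φ) x (basisVec i) (basisVec j) := by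
    unfold partialD
    rw [fderiv_clm_apply hd (differentiableAt_const _)]
    simp
  rw [e, e, hs.eq]

/-- Integration by parts with a compactly supported factor. -/
lemma integral_mul_partialD {f g : E3 → ℝ} (hf : ContDiff ℝ ∞ f) (hg : ContDiff ℝ ∞ g)
    (hfc : HasCompactSupport f) (j : Fin 3) :
    ∫ x, f x * partialD j g x = -∫ x, partialD j f x * g x := by
  refine integral_mul_fderiv_eq_neg_fderiv_mul_of_integrable ?_ ?_ ?_ ?_ ?_
  · exact ((contDiff_partialD hf j).continuous.mul hg.continuous).integrable_of_hasCompactSupport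
      (hasCompactSupport_partialD hfc j).mul_right
  · exact (hf.continuous.mul (contDiff_partialD hg j).continuous).integrable_of_hasCompactSupport
      hfc.mul_right
  · exact (hf.continuous.mul hg.continuous).integrable_of_hasCompactSupport hfc.mul_right
  · exact fun x _ => hf.differentiable (by simp) x
  · exact fun x _ => hg.differentiable (by simp) x

lemma partialD_mul {f g : E3 → ℝ} (hf : ContDiff ℝ ∞ f) (hg : ContDiff ℝ ∞ g) (j : Fin 3)
    (x : E3) : partialD j (fun x => f x * g x) x = partialD j f x * g x + f x * partialD j g x := by
  unfold partialD
  rw [fderiv_fun_mul (hf.differentiable (by simp) x) (hg.differentiable (by simp) x)]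
  simp only [add_apply, smul_apply, smul_eq_mul]
  ring

/-- The Caccioppoli inequality for harmonic functions. -/
lemma caccioppoli {w η : E3 → ℝ} (hw : ContDiff ℝ ∞ w) (hη : ContDiff ℝ ∞ η)
    (hηc : HasCompactSupport η) (hharm : ∀ x, ∑ j, partialD j (partialD j w) x = 0) :
    ∑ j, ∫ x, (η x * partialD j w x) ^ 2 ≤ 4 * ∑ j, ∫ x, (w x * partialD j η x) ^ 2 := by
  have c1 (j : Fin 3) : Continuous (partialD j w) := (contDiff_partialD hw j).continuous
  have c2 (j : Fin 3) : Continuous (partialD j η) := (contDiff_partialD hη j).continuous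
  have c0 := hw.continuous
  have c3 := hη.continuous
  have hint {F : E3 → ℝ} (hF : Continuous F) (h : ∀ x, η x = 0 → F x = 0 ) : Integrable F := by
    refine hF.integrable_of_hasCompactSupport (hηc.mono fun x hx => ?_)
    exact fun h' => hx (h x h')
  have hint' {F : E3 → ℝ} (hF : Continuous F) (j : Fin 3) (h : ∀ x, partialD j η x = 0 → F x = 0) :
      Integrable F := by
    refine hF.integrable_of_hasCompactSupport ((hasCompactSupport_partialD hηc j).mono
      fun x hx => ?_)
    exact fun h' => hx (h x h')
  have i1 (j : Fin 3) : Integrable fun x => (η x * partialD j w x) ^ 2 :=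
    hint (by fun_prop) fun x hx => by simp [hx]
  have i2 (j : Fin 3) : Integrable fun x => (w x * partialD j η x) ^ 2 :=
    hint' (by fun_prop) j fun x hx => by simp [hx]
  have i3 (j : Fin 3) : Integrable fun x => 2 * (η x * partialD j w x) * (w x * partialD j η x) :=
    hint (by fun_prop) fun x hx => by simp [hx]
  -- Testing Δw = 0 with η²w gives ∫ η²|∇w|² + 2ηw ∇η·∇w = 0 after summation over j.
  have key (j : Fin 3) : ∫ x, (η x * η x * w x) * partialD j (partialD j w) x =
      -∫ x, ((η x * partialD j w x) ^ 2 + 2 * (η x * partialD j w x) * (w x * partialD j η x)) := by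
    rw [integral_mul_partialD ((hη.mul hη).mul hw) (contDiff_partialD hw j)
      (hηc.mul_right.mul_right)]
    congr 1
    refine integral_congr_ae (Eventually.of_forall fun x => ?_)
    simp only
    rw [partialD_mul (hη.mul hη) hw, partialD_mul hη hη]
    ring
  have hsum : ∑ j, ∫ x, (η x * η x * w x) * partialD j (partialD j w) x = 0 := by
    rw [← integral_finsetSum]
    · simp_rw [← Finset.mul_sum, hharm]; simp
    · intro j _
      exact hint (((c3.mul c3).mul c0).mul
        (contDiff_partialD (contDiff_partialD hw j) j).continuous) fun x hx => by simp [hx]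
  simp_rw [key] at hsum
  rw [Finset.sum_neg_distrib, neg_eq_zero] at hsum
  -- This is p² ≤ 2(p² + 2pq) + 4q², that is (p + 2q)² ≥ 0, with p = η ∂_j w and q = w ∂_j η. Summed
  -- over j, the middle term vanishes.
  have hle (j : Fin 3) : ∫ x, (η x * partialD j w x) ^ 2 ≤
      2 * (∫ x, ((η x * partialD j w x) ^ 2 + 2 * (η x * partialD j w x) * (w x * partialD j η x)))
        + 4 * ∫ x, (w x * partialD j η x) ^ 2 := by
    rw [← integral_const_mul, ← integral_const_mul, ← integral_add]
    · refine integral_mono (i1 j) ((((i1 j).add (i3 j)).const_mul 2).add ((i2 j).const_mul 4))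
        fun x => ?_
      simp only
      nlinarith [sq_nonneg (η x * partialD j w x + 2 * (w x * partialD j η x))]
    · exact ((i1 j).add (i3 j)).const_mul 2
    · exact (i2 j).const_mul 4
  calc _ ≤ ∑ j, (2 * (∫ x, ((η x * partialD j w x) ^ 2 +
          2 * (η x * partialD j w x) * (w x * partialD j η x)))
        + 4 * ∫ x, (w x * partialD j η x) ^ 2) := Finset.sum_le_sum fun j _ => hle j
    _ = _ := by rw [Finset.sum_add_distrib, ← Finset.mul_sum, ← Finset.mul_sum, hsum]; ring

/-- Liouville's theorem for square integrable harmonic functions. -/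
lemma eq_zero_of_harmonic {w : E3 → ℝ} (hw : ContDiff ℝ ∞ w) (hL : MemLp w 2)
    (hharm : ∀ x, ∑ j, partialD j (partialD j w) x = 0) : w = 0 := by
  have hwi : Integrable fun x => w x ^ 2 := hL.integrable_sq
  let b : ContDiffBump (0 : E3) := ⟨1, 2, by norm_num, by norm_num⟩
  have hb : ContDiff ℝ ∞ (b : E3 → ℝ) := b.contDiff
  obtain ⟨M, hM⟩ : ∃ M, ∀ x, ‖fderiv ℝ b x‖ ≤ M :=
    (b.hasCompactSupport.fderiv ℝ).exists_bound_of_continuous (hb.continuous_fderiv (by simp))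
  have hM0 : 0 ≤ M := (norm_nonneg _).trans (hM 0)
  -- The cut-off at scale R has gradient at most M/R, so the gradient of w on growing balls is
  -- O(1/R) in L²; 12 = 4 · 3 collects the three directions.
  have hbound (R : ℝ) (hR : 0 < R) (j : Fin 3) :
      ∫ x, (b (R⁻¹ • x) * partialD j w x) ^ 2 ≤ 12 * (R⁻¹ * M) ^ 2 * ∫ x, w x ^ 2 := by
    set η : E3 → ℝ := fun x => b (R⁻¹ • x)
    have hη : ContDiff ℝ ∞ η := hb.comp (contDiff_const_smul _)
    have hηc : HasCompactSupport η := b.hasCompactSupport.comp_smul (inv_ne_zero hR.ne')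
    have hd (i : Fin 3) (x : E3) : |partialD i η x| ≤ R⁻¹ * M := by
      have : fderiv ℝ η x = R⁻¹ • fderiv ℝ b (R⁻¹ • x) := fderiv_comp_smul _
      rw [partialD, this, smul_apply, smul_eq_mul, abs_mul,
        abs_of_pos (inv_pos.2 hR)]
      gcongr
      refine ((fderiv ℝ b (R⁻¹ • x)).le_opNorm _).trans ?_
      simpa [basisVec] using hM _
    have h1 := caccioppoli hw hη hηc hharm
    have h2 : ∫ x, (η x * partialD j w x) ^ 2 ≤ ∑ j, ∫ x, (η x * partialD j w x) ^ 2 :=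
      Finset.single_le_sum (f := fun j => ∫ x, (η x * partialD j w x) ^ 2)
        (fun i _ => integral_nonneg fun x => sq_nonneg _) (Finset.mem_univ j)
    have h3 (i : Fin 3) : ∫ x, (w x * partialD i η x) ^ 2 ≤ (R⁻¹ * M) ^ 2 * ∫ x, w x ^ 2 := by
      rw [← integral_const_mul]
      refine integral_mono_of_nonneg (Eventually.of_forall fun x => sq_nonneg _)
        (hwi.const_mul _) (Eventually.of_forall fun x => ?_)
      simp only
      rw [mul_pow, mul_comm]
      refine mul_le_mul_of_nonneg_right ?_ (sq_nonneg _)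
      rw [← sq_abs (partialD i η x)]
      exact pow_le_pow_left₀ (abs_nonneg _) (hd i x) 2
    calc _ ≤ _ := h2.trans h1
      _ ≤ 4 * ∑ _j : Fin 3, (R⁻¹ * M) ^ 2 * ∫ x, w x ^ 2 := by gcongr with i; exact h3 i
      _ = _ := by simp; ring
  have hzero (j : Fin 3) (x₀ : E3) : partialD j w x₀ = 0 := by
    by_contra hne
    have hcont : Continuous (partialD j w) := (contDiff_partialD hw j).continuous
    have hpos : 0 < partialD j w x₀ ^ 2 := by positivity
    obtain ⟨δ, hδ, hball⟩ := Metric.mem_nhds_iff.1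
      ((hcont.pow 2).continuousAt.preimage_mem_nhds (Ioi_mem_nhds (half_lt_self hpos)))
    set c := partialD j w x₀ ^ 2 / 2
    have hvol : 0 < volume.real (Metric.ball x₀ δ) :=
      ENNReal.toReal_pos (Metric.measure_ball_pos _ _ hδ).ne' measure_ball_lt_top.ne
    have hlow : ∀ᶠ R : ℝ in atTop, c * volume.real (Metric.ball x₀ δ) ≤
        12 * (R⁻¹ * M) ^ 2 * ∫ x, w x ^ 2 := by
      filter_upwards [eventually_gt_atTop 0, eventually_ge_atTop (‖x₀‖ + δ)] with R hR hR'
      refine le_trans ?_ (hbound R hR j)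
      have hη : ∀ x ∈ Metric.ball x₀ δ, b (R⁻¹ • x) = 1 := by
        intro x hx
        refine b.one_of_mem_closedBall ?_
        rw [mem_closedBall_zero_iff, norm_smul, norm_inv, Real.norm_of_nonneg hR.le,
          inv_mul_le_iff₀ hR]
        have : ‖x‖ ≤ ‖x₀‖ + ‖x - x₀‖ := norm_le_insert' x x₀
        rw [Metric.mem_ball, dist_eq_norm] at hx
        change ‖x‖ ≤ R * 1
        linarith
      have hi : Integrable fun x => (b (R⁻¹ • x) * partialD j w x) ^ 2 := by
        refine Continuous.integrable_of_hasCompactSupport ?_ ?_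
        · have := hb.continuous
          fun_prop
        · refine (b.hasCompactSupport.comp_smul (inv_ne_zero hR.ne')).mono fun x hx => ?_
          exact fun h' => hx (by simp [h'])
      calc c * volume.real (Metric.ball x₀ δ) = ∫ x in Metric.ball x₀ δ, c := by
            simp [mul_comm]
        _ ≤ ∫ x in Metric.ball x₀ δ, (b (R⁻¹ • x) * partialD j w x) ^ 2 := by
            refine setIntegral_mono_on (integrableOn_const measure_ball_lt_top.ne) hi.integrableOn
              measurableSet_ball fun x hx => ?_
            rw [hη x hx, one_mul]
            exact (hball hx).le
        _ ≤ _ := setIntegral_le_integral hi (Eventually.of_forall fun x => sq_nonneg _)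
    have hlim : Tendsto (fun R : ℝ => 12 * (R⁻¹ * M) ^ 2 * ∫ x, w x ^ 2) atTop
        (𝓝 (12 * (0 * M) ^ 2 * ∫ x, w x ^ 2)) :=
      ((tendsto_const_nhds.mul ((tendsto_inv_atTop_zero.mul tendsto_const_nhds).pow 2)).mul
        tendsto_const_nhds)
    have := le_of_tendsto_of_tendsto tendsto_const_nhds hlim hlow
    have hc : 0 < c * volume.real (Metric.ball x₀ δ) := mul_pos (by positivity) hvol
    simp at this
    linarith
  have hfd : ∀ x, fderiv ℝ w x = 0 := by
    intro x
    ext v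
    rw [← sum_basisVec v, map_sum]
    simp only [map_smul]
    exact Finset.sum_eq_zero fun j _ => by rw [show fderiv ℝ w x (basisVec j) = 0 from hzero j x]; simp
  have hconst : w = fun _ => w 0 := by
    ext x
    exact is_const_of_fderiv_eq_zero (hw.differentiable (by simp)) hfd x 0
  rw [hconst] at hL
  rcases (memLp_const_iff (by norm_num) (by norm_num)).1 hL with h | h
  · rw [hconst, h]; rfl
  · simp at h

/-- Young's inequality for L² ∗ L¹: Cauchy–Schwarz for |q||ρ|^{1/2} · |ρ|^{1/2} gives |q ∗ ρ|² ≤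
(|q|² ∗ |ρ|)‖ρ‖₁, and Tonelli's theorem integrates the right-hand side. -/
lemma memLp_convolution {q ρ : E3 → ℝ} (hq : MemLp q 2) (hρ : Continuous ρ)
    (hρc : HasCompactSupport ρ) (hcont : Continuous fun x => ∫ y, q y * ρ (x - y)) :
    MemLp (fun x => ∫ y, q y * ρ (x - y)) 2 := by
  refine ⟨hcont.aestronglyMeasurable, ?_⟩
  rw [eLpNorm_lt_top_iff_lintegral_rpow_enorm_lt_top (by simp) (by simp)]
  simp only [ENNReal.toReal_ofNat, ENNReal.rpow_ofNat]
  have hρi : ∫⁻ y, ‖ρ y‖ₑ < ⊤ := (hρ.integrable_of_hasCompactSupport hρc).2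
  have hqi : ∫⁻ y, ‖q y‖ₑ ^ 2 < ⊤ := by
    have := (eLpNorm_lt_top_iff_lintegral_rpow_enorm_lt_top (by simp) (by simp)).1 hq.2
    simpa using this
  have hpt (x : E3) : ‖∫ y, q y * ρ (x - y)‖ₑ ^ 2 ≤
      (∫⁻ y, ‖q y‖ₑ ^ 2 * ‖ρ (x - y)‖ₑ) * ∫⁻ y, ‖ρ y‖ₑ := by
    have e1 : ∫⁻ y, ‖ρ (x - y)‖ₑ = ∫⁻ y, ‖ρ y‖ₑ := lintegral_sub_left_eq_self (fun y => ‖ρ y‖ₑ) x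
    have h1 : ‖∫ y, q y * ρ (x - y)‖ₑ ≤ ∫⁻ y, (‖q y‖ₑ * ‖ρ (x - y)‖ₑ ^ (1/2 : ℝ)) *
        ‖ρ (x - y)‖ₑ ^ (1/2 : ℝ) := by
      refine (enorm_integral_le_lintegral_enorm _).trans (lintegral_mono fun y => ?_)
      rw [enorm_mul, mul_assoc, ← ENNReal.rpow_add_of_nonneg _ _ (by norm_num) (by norm_num)]
      norm_num
    have hm : Measurable fun y => ‖ρ (x - y)‖ₑ :=
      (hρ.comp (continuous_const.sub continuous_id)).measurable.enorm
    have h2 := ENNReal.lintegral_mul_le_Lp_mul_Lq volume Real.HolderConjugate.two_two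
      (f := fun y => ‖q y‖ₑ * ‖ρ (x - y)‖ₑ ^ (1/2 : ℝ)) (g := fun y => ‖ρ (x - y)‖ₑ ^ (1/2 : ℝ))
      (hq.1.enorm.mul (hm.pow_const _).aemeasurable) (hm.pow_const _).aemeasurable
    have h3 := h1.trans h2
    have h4 (t : ℝ≥0∞) : (t ^ (1/2 : ℝ)) ^ (2 : ℝ) = t := by
      rw [← ENNReal.rpow_mul]; norm_num
    have h5 (t : ℝ≥0∞) : (t ^ (1/2 : ℝ)) ^ 2 = t := by
      rw [← ENNReal.rpow_natCast, ← ENNReal.rpow_mul]; norm_num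
    calc _ ≤ _ := pow_le_pow_left' h3 2
      _ = _ := by
        rw [mul_pow, h5, h5]
        simp_rw [ENNReal.mul_rpow_of_nonneg _ _ (show (0:ℝ) ≤ 2 by norm_num), h4, e1]
        simp
  calc ∫⁻ x, ‖∫ y, q y * ρ (x - y)‖ₑ ^ 2
      ≤ ∫⁻ x, (∫⁻ y, ‖q y‖ₑ ^ 2 * ‖ρ (x - y)‖ₑ) * ∫⁻ y, ‖ρ y‖ₑ := lintegral_mono hpt
    _ = (∫⁻ x, ∫⁻ y, ‖q y‖ₑ ^ 2 * ‖ρ (x - y)‖ₑ) * ∫⁻ y, ‖ρ y‖ₑ :=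
        lintegral_mul_const' _ _ hρi.ne
    _ = (∫⁻ y, ∫⁻ x, ‖q y‖ₑ ^ 2 * ‖ρ (x - y)‖ₑ) * ∫⁻ y, ‖ρ y‖ₑ := by
        rw [lintegral_lintegral_swap]
        exact AEMeasurable.mul (f := fun p : E3 × E3 => ‖q p.2‖ₑ ^ 2)
          (g := fun p : E3 × E3 => ‖ρ (p.1 - p.2)‖ₑ) (hq.1.enorm.pow_const 2).comp_snd
          (hρ.comp (continuous_fst.sub continuous_snd)).measurable.enorm.aemeasurable
    _ = (∫⁻ y, ‖q y‖ₑ ^ 2 * ∫⁻ y, ‖ρ y‖ₑ) * ∫⁻ y, ‖ρ y‖ₑ := by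
        congr 1
        refine lintegral_congr fun y => ?_
        rw [lintegral_const_mul' _ _ (by simp), lintegral_sub_right_eq_self (fun y => ‖ρ y‖ₑ)]
    _ < ⊤ := by
        rw [lintegral_mul_const' _ _ hρi.ne]
        exact ENNReal.mul_lt_top (ENNReal.mul_lt_top hqi hρi) hρi

lemma partialD_comp_sub_left (φ : E3 → ℝ) (j : Fin 3) (x y : E3) :
    partialD j (fun y => φ (x - y)) y = -partialD j φ (x - y) := by
  unfold partialD
  rw [show (fun y => φ (x - y)) = fun y => (fun z => φ (-z)) (y - x) by ext; simp,
    fderiv_comp_sub (f := fun z => φ (-z)), show (fun z => φ (-z)) = fun z => φ ((-1 : ℝ) • z) by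
      ext; simp, fderiv_comp_smul]
  simp

/-- A weakly harmonic square integrable function vanishes almost everywhere. -/
lemma ae_eq_zero_of_weakly_harmonic {q : E3 → ℝ} (hq : MemLp q 2)
    (h : ∀ φ : E3 → ℝ, ContDiff ℝ ∞ φ → HasCompactSupport φ →
      ∫ x, q x * ∑ j, partialD j (partialD j φ) x = 0) : ∀ᵐ x, q x = 0 := by
  have hloc : LocallyIntegrable q := hq.locallyIntegrable (by norm_num)
  have hconv (ρ : E3 → ℝ) (hρ : ContDiff ℝ ∞ ρ) (hρc : HasCompactSupport ρ) :
      ContDiff ℝ ∞ (fun x => ∫ y, q y * ρ (x - y)) ∧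
      ∀ j, partialD j (fun x => ∫ y, q y * ρ (x - y)) = fun x => ∫ y, q y * partialD j ρ (x - y) := by
    refine ⟨hρc.contDiff_convolution_right (n := ⊤) (ContinuousLinearMap.mul ℝ ℝ) hloc hρ, fun j => ?_⟩
    ext x
    have := hρc.hasFDerivAt_convolution_right (ContinuousLinearMap.mul ℝ ℝ) hloc
      (hρ.of_le (by simp)) x
    have h2 := this.fderiv
    change fderiv ℝ (fun x => ∫ y, q y * ρ (x - y)) x = _ at h2
    rw [partialD, h2, convolution_precompR_apply _ hloc (hρc.fderiv ℝ)
      (hρ.continuous_fderiv (by simp))]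
    rfl
  refine ae_eq_zero_of_integral_contDiff_smul_eq_zero hloc fun φ h1 h2 => ?_
  -- With the reflected test function, ∫ qφ is the value at 0 of q ∗ ρ, a smooth, square integrable,
  -- harmonic function.
  set ρ : E3 → ℝ := fun x => φ (-x)
  have hρ : ContDiff ℝ ∞ ρ := h1.comp contDiff_neg
  have hρc : HasCompactSupport ρ := h2.comp_homeomorph (Homeomorph.neg E3)
  have hw := hconv ρ hρ hρc
  have hzero := eq_zero_of_harmonic hw.1 (memLp_convolution hq hρ.continuous hρc hw.1.continuous) ?_
  · have := congrFun hzero 0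
    simpa [ρ, mul_comm] using this
  · intro x
    have e (j : Fin 3) : partialD j (partialD j (fun x => ∫ y, q y * ρ (x - y))) =
        fun x => ∫ y, q y * partialD j (partialD j ρ) (x - y) := by
      rw [hw.2 j]
      exact (hconv _ (contDiff_partialD hρ j) (hasCompactSupport_partialD hρc j)).2 j
    simp_rw [e]
    have hc (y : E3) (j : Fin 3) : partialD j (partialD j ρ) (x - y) =
        partialD j (partialD j (fun y => ρ (x - y))) y := by
      rw [show partialD j (fun y => ρ (x - y)) = fun y => -partialD j ρ (x - y) from
        funext fun y => partialD_comp_sub_left _ _ _ _]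
      have : partialD j (fun y => -partialD j ρ (x - y)) y =
          - partialD j (fun y => partialD j ρ (x - y)) y := by
        unfold partialD
        rw [fderiv_fun_neg]; rfl
      rw [this, partialD_comp_sub_left, neg_neg]
    have hd : ContDiff ℝ ∞ fun y => ρ (x - y) := hρ.comp (contDiff_const.sub contDiff_id)
    have hdc : HasCompactSupport fun y => ρ (x - y) :=
      hρc.comp_homeomorph (Homeomorph.subLeft x)
    rw [← h _ hd hdc, ← integral_finsetSum]
    · simp_rw [Finset.mul_sum, hc]
    · intro j _
      simp_rw [hc]
      exact hq.integrable_mul (q := 2) ((contDiff_partialD (contDiff_partialD hd j) j).continuous.memLp_of_hasCompactSupport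
        (hasCompactSupport_partialD (hasCompactSupport_partialD hdc j) j))

/-! ### The demagnetizing field -/

/-- The gradient as a vector field. -/
def testGrad (φ : E3 → ℝ) : E3 → E3 := fun x => WithLp.toLp 2 fun i => partialD i φ x

lemma isTestField_testGrad {φ : E3 → ℝ} (h : ContDiff ℝ ∞ φ) (hc : HasCompactSupport φ) :
    IsTestField Set.univ (testGrad φ) := by
  refine ⟨?_, ?_, Set.subset_univ _⟩
  · rw [contDiff_piLp]
    exact fun i => contDiff_partialD h i
  · refine (hc.fderiv ℝ).mono fun x hx hx' => hx ?_
    ext i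
    simp [testGrad, partialD, hx']

/-- The gradients of test functions, as a subspace of `L²`. -/
def gradFields : Submodule ℝ (Lp E3 2 (volume : Measure E3)) where
  carrier := {f | ∃ φ, ∃ h : ContDiff ℝ ∞ φ, ∃ hc : HasCompactSupport φ,
    f = ((isTestField_testGrad h hc).memLp volume).toLp (testGrad φ)}
  add_mem' := by
    rintro _ _ ⟨φ, h, hc, rfl⟩ ⟨ψ, h', hc', rfl⟩
    refine ⟨φ + ψ, h.add h', hc.add hc', ?_⟩
    rw [← MemLp.toLp_add]
    refine MemLp.toLp_congr _ _ (Eventually.of_forall fun x => ?_)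
    ext i
    simp [testGrad, partialD, fderiv_add (h.differentiable (by simp) x)
      (h'.differentiable (by simp) x)]
  zero_mem' := by
    refine ⟨0, contDiff_const, HasCompactSupport.zero, ?_⟩
    rw [← MemLp.toLp_zero (MemLp.zero : MemLp (0 : E3 → E3) 2 volume)]
    refine MemLp.toLp_congr _ _ (Eventually.of_forall fun x => ?_)
    ext i
    simp [testGrad, partialD]
  smul_mem' := by
    rintro c _ ⟨φ, h, hc, rfl⟩
    refine ⟨c • φ, contDiff_const.smul h, hc.smul_left (f := fun _ => c), ?_⟩
    rw [← MemLp.toLp_const_smul]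
    refine MemLp.toLp_congr _ _ (Eventually.of_forall fun x => ?_)
    ext i
    simp [testGrad, partialD, fderiv_const_smul (h.differentiable (by simp) x)]

/-- The projection of `L²` to the closure of the gradients. -/
def gradProj : Lp E3 2 (volume : Measure E3) →L[ℝ] Lp E3 2 (volume : Measure E3) :=
  gradFields.topologicalClosure.starProjection

lemma gradProj_inner (u v : Lp E3 2 (volume : Measure E3)) :
    inner ℝ (gradProj u) (gradProj v) = inner ℝ u (gradProj v) := by
  have := gradFields.topologicalClosure.starProjection_inner_eq_zero u (gradProj v)
    (Submodule.starProjection_apply_mem _ _)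
  rw [inner_sub_left, sub_eq_zero] at this
  exact this.symm

lemma sum_inner_testGrad (v : E3) (φ : E3 → ℝ) (x : E3) :
    ∑ i, v i * fderiv ℝ φ x (basisVec i) = inner ℝ v (testGrad φ x) := by
  simp [PiLp.inner_apply, testGrad, partialD, mul_comm]

/-- The curl equation says that h is orthogonal to ∂_jφ e_i − ∂_iφ e_j. This holds for gradients by
the symmetry of second derivatives and passes to their closure. The divergence equation says that u
minus its projection is orthogonal to all gradients. -/
lemma isDemagField_gradProj {u : E3 → E3} (hu : MemLp u 2 volume) :
    IsDemagField u (-(gradProj (hu.toLp u)) : Lp E3 2 (volume : Measure E3)) := by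
  set h : Lp E3 2 (volume : Measure E3) := -(gradProj (hu.toLp u)) with hh
  have hL : MemLp h 2 volume := Lp.memLp h
  refine ⟨hL, fun φ h1 h2 => ⟨fun i j => ?_, ?_⟩⟩
  · have ht (i j : Fin 3) := isTestField_smul (U := Set.univ) (contDiff_partialD h1 j)
      (hasCompactSupport_partialD h2 j) (Set.subset_univ _) (basisVec i)
    have hk (i j : Fin 3) : MemLp (fun x => partialD j φ x • basisVec i) 2 volume :=
      (ht i j).memLp volume
    have hmem : h ∈ gradFields.topologicalClosure :=
      neg_mem (Submodule.starProjection_apply_mem _ _)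
    have hz : inner ℝ h ((hk i j).toLp _ - (hk j i).toLp _) = 0 := by
      rw [← SetLike.mem_coe, Submodule.topologicalClosure_coe] at hmem
      refine closure_minimal (t := {h | inner ℝ h ((hk i j).toLp _ - (hk j i).toLp _) = 0}) ?_
        (isClosed_eq (by fun_prop) (by fun_prop)) hmem
      rintro _ ⟨ψ, h1', h2', rfl⟩
      simp only [Set.mem_ofPred_eq]
      rw [inner_sub_right, inner_toLp, inner_toLp]
      have e (i j : Fin 3) : ∫ x, inner ℝ (testGrad ψ x) (partialD j φ x • basisVec i) =
          -∫ x, partialD j (partialD i ψ) x * φ x := by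
        rw [← integral_mul_partialD (contDiff_partialD h1' i) h1 (hasCompactSupport_partialD h2' i)]
        simp [testGrad, inner_smul_right, basisVec, EuclideanSpace.inner_single_right, mul_comm]
      rw [e, e, partialD_comm h1', sub_self]
    rw [inner_sub_right, sub_eq_zero, ← Lp.toLp_coeFn h hL, inner_toLp, inner_toLp] at hz
    simpa [inner_smul_right, basisVec, EuclideanSpace.inner_single_right, mul_comm, partialD]
      using hz
  · have hg := (isTestField_testGrad h1 h2).memLp volume
    simp_rw [sum_inner_testGrad]
    rw [← inner_toLp hL hg, ← inner_toLp hu hg, Lp.toLp_coeFn, hh, inner_neg_left, neg_inj]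
    have := gradFields.topologicalClosure.starProjection_inner_eq_zero (hu.toLp u) (hg.toLp _)
      (Submodule.le_topologicalClosure _ ⟨φ, h1, h2, rfl⟩)
    rw [inner_sub_left, sub_eq_zero] at this
    exact this.symm

/-- For the difference d of two solutions, the curl equation with test function ∂_jφ and then the
divergence equation with ∂_iφ give ∫ d_i Δφ = Σ_j ∫ d_j ∂_j∂_iφ = 0. So each component is weakly
harmonic, and Liouville's theorem in L² applies. -/
lemma isDemagField_unique {u h₁ h₂ : E3 → E3} (H₁ : IsDemagField u h₁) (H₂ : IsDemagField u h₂) :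
    h₁ =ᵐ[volume] h₂ := by
  have hd (i : Fin 3) : MemLp (fun x => h₁ x i - h₂ x i) 2 volume :=
    (H₁.1.eval_piLp i).sub (H₂.1.eval_piLp i)
  have hin {ψ : E3 → ℝ} (h1 : ContDiff ℝ ∞ ψ) (h2 : HasCompactSupport ψ) {f : E3 → ℝ}
      (hf : MemLp f 2 volume) : Integrable fun x => f x * ψ x :=
    hf.integrable_mul (q := 2) (h1.continuous.memLp_of_hasCompactSupport h2)
  have hcurl (φ : E3 → ℝ) (h1 : ContDiff ℝ ∞ φ) (h2 : HasCompactSupport φ) (i j : Fin 3) :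
      ∫ x, (h₁ x i - h₂ x i) * partialD j φ x = ∫ x, (h₁ x j - h₂ x j) * partialD i φ x := by
    simp_rw [sub_mul]
    have c (j : Fin 3) := contDiff_partialD h1 j
    have d (j : Fin 3) := hasCompactSupport_partialD h2 j
    rw [integral_sub (hin (c j) (d j) (H₁.1.eval_piLp i)) (hin (c j) (d j) (H₂.1.eval_piLp i)),
      integral_sub (hin (c i) (d i) (H₁.1.eval_piLp j)) (hin (c i) (d i) (H₂.1.eval_piLp j))]
    have e1 := (H₁.2 φ h1 h2).1 i j
    have e2 := (H₂.2 φ h1 h2).1 i j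
    unfold partialD
    rw [e1, e2]
  have hdiv (φ : E3 → ℝ) (h1 : ContDiff ℝ ∞ φ) (h2 : HasCompactSupport φ) :
      ∑ i, ∫ x, (h₁ x i - h₂ x i) * partialD i φ x = 0 := by
    have c (j : Fin 3) := contDiff_partialD h1 j
    have d (j : Fin 3) := hasCompactSupport_partialD h2 j
    have e1 := (H₁.2 φ h1 h2).2
    have e2 := (H₂.2 φ h1 h2).2
    change ∫ x, ∑ i, h₁ x i * partialD i φ x = _ at e1
    change ∫ x, ∑ i, h₂ x i * partialD i φ x = _ at e2
    rw [integral_finsetSum _ fun i _ => hin (c i) (d i) (H₁.1.eval_piLp i)] at e1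
    rw [integral_finsetSum _ fun i _ => hin (c i) (d i) (H₂.1.eval_piLp i)] at e2
    simp_rw [sub_mul]
    have e3 (i : Fin 3) := integral_sub (hin (c i) (d i) (H₁.1.eval_piLp i))
      (hin (c i) (d i) (H₂.1.eval_piLp i))
    simp_rw [e3]
    rw [Finset.sum_sub_distrib, sub_eq_zero]
    exact e1.trans e2.symm
  have key (i : Fin 3) : ∀ᵐ x, h₁ x i - h₂ x i = 0 := by
    refine ae_eq_zero_of_weakly_harmonic (hd i) fun φ h1 h2 => ?_
    have c (j : Fin 3) := contDiff_partialD h1 j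
    have d (j : Fin 3) := hasCompactSupport_partialD h2 j
    simp_rw [Finset.mul_sum]
    rw [integral_finsetSum _ fun j _ => hin (contDiff_partialD (c j) j)
      (hasCompactSupport_partialD (d j) j) (hd i), ← hdiv (partialD i φ) (c i) (d i)]
    refine Finset.sum_congr rfl fun j _ => ?_
    rw [hcurl _ (c j) (d j), partialD_comm h1 i j]
  filter_upwards [key 0, key 1, key 2] with x k0 k1 k2
  ext i
  fin_cases i
  · exact sub_eq_zero.1 k0
  · exact sub_eq_zero.1 k1
  · exact sub_eq_zero.1 k2

/-- By uniqueness, the field chosen in `demagField` is minus the projection; this exhibits the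
energy as a continuous seminorm on L². -/
lemma demagEnergy_eq (μ₀ : ℝ) {u : E3 → E3} (hu : MemLp u 2 volume) :
    demagEnergy μ₀ u = μ₀ / 2 * ‖gradProj (hu.toLp u)‖ := by
  have hex : ∃ f, IsDemagField u f := ⟨_, isDemagField_gradProj hu⟩
  have hf : IsDemagField u (demagField u) := by
    rw [demagField, dif_pos hex]; exact hex.choose_spec
  rw [demagEnergy, eLpNorm_congr_ae (isDemagField_unique hf (isDemagField_gradProj hu)),
    ← Lp.norm_def, norm_neg]

lemma demagEnergy_congr (μ₀ : ℝ) {u v : E3 → E3} (h : u =ᵐ[volume] v) :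
    demagEnergy μ₀ u = demagEnergy μ₀ v := by
  have : IsDemagField u = IsDemagField v := by
    ext f
    have e (φ : E3 → ℝ) : ∫ x, ∑ i, u x i * fderiv ℝ φ x (basisVec i) =
        ∫ x, ∑ i, v x i * fderiv ℝ φ x (basisVec i) := by
      refine integral_congr_ae ?_
      filter_upwards [h] with x hx
      rw [hx]
    simp only [IsDemagField, e]
  have : demagField u = demagField v := by unfold demagField; rw [this]
  rw [demagEnergy, demagEnergy, this]

/-- A subgradient of the demagnetizing energy. -/
lemma exists_subgradient_demagEnergy {μ₀ : ℝ} (hμ₀ : 0 < μ₀) {u : E3 → E3}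
    (hu : MemLp u 2 volume) : ∃ v, MemLp v 2 volume ∧
      ∫ x, inner ℝ (u x) (v x) = demagEnergy μ₀ u ∧
      ∀ w, MemLp w 2 volume → ∫ x, inner ℝ (w x) (v x) ≤ demagEnergy μ₀ w := by
  set p := gradProj (hu.toLp u)
  -- The gradient of the seminorm where p ≠ 0. If p = 0, the convention 0⁻¹ = 0 gives v = 0, which
  -- is a subgradient too.
  set v : Lp E3 2 (volume : Measure E3) := (μ₀ / 2 * ‖p‖⁻¹) • p with hv
  have e (w : E3 → E3) (hw : MemLp w 2 volume) : ∫ x, inner ℝ (w x) (v x) =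
      μ₀ / 2 * (‖p‖⁻¹ * inner ℝ (gradProj (hw.toLp w)) p) := by
    rw [← inner_toLp hw (Lp.memLp v), Lp.toLp_coeFn, hv, inner_smul_right, gradProj_inner]
    simp [p, mul_assoc]
  refine ⟨v, Lp.memLp v, ?_, fun w hw => ?_⟩
  · rw [e u hu, demagEnergy_eq μ₀ hu, real_inner_self_eq_norm_sq]
    rcases eq_or_ne ‖p‖ 0 with h | h
    · rw [h]; simp
    · change μ₀ / 2 * (‖p‖⁻¹ * ‖p‖ ^ 2) = μ₀ / 2 * ‖p‖
      field_simp
  · rw [e w hw, demagEnergy_eq μ₀ hw]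
    gcongr
    rcases eq_or_ne ‖p‖ 0 with h | h
    · rw [h]; simp
    · rw [inv_mul_le_iff₀ (lt_of_le_of_ne (norm_nonneg _) h.symm), mul_comm]
      exact real_inner_le_norm _ _

/-- The reverse triangle inequality for the seminorm, together with the fact that projections are
contractions. -/
lemma abs_demagEnergy_sub_le {μ₀ : ℝ} (hμ₀ : 0 < μ₀) {u w : E3 → E3} (hu : MemLp u 2 volume)
    (hw : MemLp w 2 volume) :
    |demagEnergy μ₀ u - demagEnergy μ₀ w| ≤ μ₀ / 2 * √(∫ x, ‖u x - w x‖ ^ 2) := by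
  rw [demagEnergy_eq μ₀ hu, demagEnergy_eq μ₀ hw, ← mul_sub, abs_mul, abs_of_pos (half_pos hμ₀)]
  gcongr
  refine (abs_norm_sub_norm_le _ _).trans ?_
  rw [← map_sub, ← MemLp.toLp_sub]
  refine (Submodule.norm_starProjection_apply_le _ _).trans ?_
  have := norm_toLp_sq (hu.sub hw)
  simp only [Pi.sub_apply] at this
  rw [← this, Real.sqrt_sq (norm_nonneg _)]

/-! ### Domains with the uniform cone property -/

/-- The cone at y contains a ball around y + tξ whose radius is proportional to t. With c = cos θ,
the factor (1 − c)/2 works because 1 + c ≥ c(3 − c), that is (1 − c)² ≥ 0. The radius r is halved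
because points of this ball are at distance up to 2t from y. -/
lemma UniformConeProperty.exists_ball_subset {Ω : Set E3} (h : UniformConeProperty Ω) :
    ∃ κ r : ℝ, 0 < κ ∧ κ ≤ 1 ∧ 0 < r ∧ ∀ x ∈ frontier Ω, ∃ ξ : E3, ‖ξ‖ = 1 ∧
      ∀ y ∈ Ω ∩ Metric.ball x r, ∀ t, 0 < t → t < r → Metric.ball (y + t • ξ) (κ * t) ⊆ Ω := by
  obtain ⟨θ, r, h0, h1, hr, H⟩ := h
  have hc : 0 < Real.cos θ := Real.cos_pos_of_mem_Ioo ⟨by linarith, h1⟩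
  have hc1 : Real.cos θ < 1 := by
    rw [← Real.cos_zero]
    exact Real.cos_lt_cos_of_nonneg_of_le_pi_div_two le_rfl h1.le h0
  refine ⟨(1 - Real.cos θ) / 2, r / 2, by linarith, by linarith, by linarith, fun x hx => ?_⟩
  obtain ⟨ξ, hξ, Hξ⟩ := H x hx
  refine ⟨ξ, hξ, fun y hy t ht htr z hz => ?_⟩
  have hz' : ‖z - (y + t • ξ)‖ < (1 - Real.cos θ) / 2 * t := by
    simpa [dist_eq_norm] using hz
  set w := z - (y + t • ξ) with hw
  have e : z - y = t • ξ + w := by rw [hw]; abel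
  have hn : ‖z - y‖ ≤ t + ‖w‖ := by
    rw [e]
    refine (norm_add_le _ _).trans ?_
    rw [norm_smul, hξ, Real.norm_of_nonneg ht.le, mul_one]
  have hin : t - ‖w‖ ≤ inner ℝ (z - y) ξ := by
    rw [e, inner_add_left, inner_smul_left, real_inner_self_eq_norm_sq, hξ]
    have := abs_real_inner_le_norm w ξ
    rw [hξ, mul_one] at this
    have := neg_le_of_abs_le this
    simp
    linarith
  have hw0 := norm_nonneg w
  refine Hξ y ⟨hy.1, Metric.ball_subset_ball (by linarith) hy.2⟩ z ?_ ?_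
  · rw [Metric.mem_ball, dist_eq_norm]
    nlinarith
  · nlinarith

-- Near a boundary point x, any push along ξ by less than r moves frontier points into the interior.
-- Hence the translates of the frontier part near x by distinct small multiples of ξ are pairwise
-- disjoint. Infinitely many disjoint translates in a bounded region force measure zero.
open scoped Pointwise in
lemma volume_frontier_eq_zero {Ω : Set E3} (h : UniformConeProperty Ω) :
    volume (frontier Ω) = 0 := by
  obtain ⟨κ, r, hκ, hκ1, hr, H⟩ := h.exists_ball_subset
  refine measure_null_of_locally_null _ fun x hx => ?_
  obtain ⟨ξ, hξ, Hξ⟩ := H x hx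
  set s := frontier Ω ∩ Metric.ball x (r / 2) with hs
  refine ⟨s, inter_mem_nhdsWithin _ (Metric.ball_mem_nhds _ (by positivity)), ?_⟩
  have hpos (n : ℕ) : (0 : ℝ) < ((n : ℝ) + 1)⁻¹ := by positivity
  have hle (n : ℕ) : ((n : ℝ) + 1)⁻¹ ≤ 1 := inv_le_one_of_one_le₀ (by linarith [n.cast_nonneg (α := ℝ)])
  have key : ∀ y ∈ s, ∀ t, 0 < t → t < r → y + t • ξ ∉ frontier Ω := by
    intro y hy t ht htr hf
    -- A frontier point need not belong to Ω, so the cone is placed at a nearby point of Ω; the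
    -- distance κt/2 keeps y + tξ inside the ball of radius κt.
    obtain ⟨y', hy', hd⟩ := Metric.mem_closure_iff.1 (frontier_subset_closure hy.1)
      (min (κ * t / 2) (r / 2)) (by positivity)
    have hd1 := hd.trans_le (min_le_left _ _)
    have hd2 := hd.trans_le (min_le_right _ _)
    have hb := Hξ y' ⟨hy', by
      have := dist_triangle y' y x
      rw [dist_comm y' y] at this
      have := Metric.mem_ball.1 hy.2
      rw [Metric.mem_ball]; linarith⟩ t ht htr
    have : y + t • ξ ∈ interior Ω := by
      refine interior_maximal hb Metric.isOpen_ball ?_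
      rw [Metric.mem_ball, dist_add_right]
      nlinarith
    rw [frontier] at hf
    exact hf.2 this
  refine Measure.addHaar_eq_zero_of_disjoint_translates volume
    (fun n : ℕ => (r / 2 * ((n : ℝ) + 1)⁻¹) • ξ)
    ?_ ?_ (isClosed_frontier.measurableSet.inter measurableSet_ball)
  · refine (Metric.isBounded_closedBall (x := (0 : E3)) (r := r)).subset ?_
    rintro _ ⟨n, rfl⟩
    rw [mem_closedBall_zero_iff, norm_smul, hξ, mul_one, Real.norm_of_nonneg (by positivity)]
    have := hle n
    nlinarith
  · have aux : ∀ m n : ℕ, m < n → Disjoint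
        (({(r / 2 * ((m : ℝ) + 1)⁻¹) • ξ} : Set E3) + s)
        (({(r / 2 * ((n : ℝ) + 1)⁻¹) • ξ} : Set E3) + s) := by
      intro m n hmn
      rw [Set.disjoint_left]
      rintro z hz hz'
      rw [Set.singleton_add, Set.mem_image] at hz hz'
      obtain ⟨y, hy, rfl⟩ := hz
      obtain ⟨y', hy', e⟩ := hz'
      have hlt : ((n : ℝ) + 1)⁻¹ < ((m : ℝ) + 1)⁻¹ := by
        gcongr
      refine key y hy (r / 2 * (((m : ℝ) + 1)⁻¹ - ((n : ℝ) + 1)⁻¹))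
        (mul_pos (by positivity) (sub_pos.2 hlt)) ?_ ?_
      · have := hle m
        have := hpos n
        nlinarith
      · have : y + (r / 2 * (((m : ℝ) + 1)⁻¹ - ((n : ℝ) + 1)⁻¹)) • ξ = y' := by
          rw [mul_sub, sub_smul]
          rw [← add_left_cancel_iff (a := (r / 2 * ((n : ℝ) + 1)⁻¹) • ξ), e]
          abel
        rw [this]; exact hy'.1
    intro m n hmn
    rcases lt_or_gt_of_ne hmn with h | h
    · exact aux m n h
    · exact (aux n m h).symm

lemma ae_eq_interior {Ω : Set E3} (h : UniformConeProperty Ω) :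
    (Ω : Set E3) =ᵐ[volume] (interior Ω : Set E3) :=
  (interior_ae_eq_of_null_frontier (volume_frontier_eq_zero h)).symm

lemma restrict_interior {Ω : Set E3} (h : UniformConeProperty Ω) :
    volume.restrict Ω = volume.restrict (interior Ω) :=
  Measure.restrict_congr_set (ae_eq_interior h)

/-- Otherwise the interior and the exterior of Ω would separate the connected set K. -/
lemma exists_frontier_of_not_subset {Ω K : Set E3} (hK : IsPreconnected K) {y : E3} (hy : y ∈ Ω)
    (hyK : y ∈ K) (h : ¬ K ⊆ Ω) : ∃ x ∈ frontier Ω, x ∈ K := by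
  by_contra! hne
  have := hK.subset_left_of_subset_union (u := interior Ω) (v := (closure Ω)ᶜ) isOpen_interior
    isClosed_closure.isOpen_compl ?_ ?_ ?_
  · exact h (this.trans interior_subset)
  · exact Set.disjoint_left.2 fun x hx hx' => hx' (subset_closure (interior_subset hx))
  · intro x hx
    by_cases hc : x ∈ closure Ω
    · left
      by_contra hi
      exact hne x ⟨hc, hi⟩ hx
    · exact Or.inr hc
  · refine ⟨y, hyK, ?_⟩
    by_contra hi
    exact hne y ⟨subset_closure hy, hi⟩ hyK

/-- Displacements that push the points of `Ω` away from the boundary. -/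
lemma UniformConeProperty.exists_displacement {Ω : Set E3} (h : UniformConeProperty Ω) :
    ∃ C h₀ : ℝ, 1 ≤ C ∧ 0 < h₀ ∧ ∀ h, 0 < h → h < h₀ → ∃ τ : E3 → E3,
      (∀ y, ‖τ y‖ ≤ C * h) ∧ (∀ y ∈ Ω, Metric.closedBall y (4 * h) ⊆ Ω → τ y = 0) ∧
      ∀ y ∈ Ω, ∀ y' ∈ Ω, dist y y' ≤ h → ∀ t ∈ Set.Icc (0 : ℝ) 1,
        Metric.ball (y + τ y + t • τ y') (4 * h) ⊆ interior Ω := by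
  classical
  obtain ⟨κ, r, hκ, hκ1, hr, H⟩ := h.exists_ball_subset
  choose! ξ hξ Hξ using H
  have hC4 : 4 ≤ 4 / κ := by rw [le_div_iff₀ hκ]; linarith
  -- C = 4/κ makes a push of length Ch leave a ball of radius κCh = 4h in Ω. The bound on h ensures
  -- 6Ch + 4h ≤ 10Ch < r, so that the cone direction chosen for y serves all points within 6Ch of y.
  refine ⟨4 / κ, r / (10 * (4 / κ)), by linarith, by positivity, fun h hh hlt => ?_⟩
  set C := 4 / κ with hC
  have hκC : κ * (C * h) = 4 * h := by rw [hC]; field_simp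
  have hhr : 10 * C * h < r := by
    rw [lt_div_iff₀ (by positivity)] at hlt; linarith
  have hCh : 4 * h ≤ C * h := by gcongr
  have hf : ∀ y, y ∈ Ω → ¬ Metric.closedBall y (4 * h) ⊆ Ω → ∃ x ∈ frontier Ω, dist x y ≤ 4 * h :=
    fun y hy hn => exists_frontier_of_not_subset (convex_closedBall y _).isPreconnected hy
      (Metric.mem_closedBall_self (by positivity)) hn
  choose! x hx hxd using hf
  set τ : E3 → E3 := fun y => if y ∈ Ω ∧ ¬ Metric.closedBall y (4 * h) ⊆ Ω then
    (C * h) • ξ (x y) else 0 with hτ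
  have hτn : ∀ y, ‖τ y‖ ≤ C * h := by
    intro y
    simp only [hτ]
    split_ifs with hy
    · rw [norm_smul, hξ _ (hx y hy.1 hy.2), mul_one, Real.norm_of_nonneg (by positivity)]
    · rw [norm_zero]; positivity
  -- The direction chosen for y keeps every nearby point of Ω in Ω, not just y. This is what permits
  -- two successive pushes in unrelated directions.
  have hshift : ∀ y ∈ Ω, ∀ z ∈ Ω, dist z y < 6 * (C * h) → ∀ t ∈ Set.Icc (0 : ℝ) 1,
      z + t • τ y ∈ Ω := by
    intro y hy z hz hd t ht
    rcases ht.1.eq_or_lt with rfl | ht0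
    · simpa using hz
    simp only [hτ]
    split_ifs with hy'
    · have h1 := Hξ _ (hx y hy hy'.2) z ⟨hz, ?_⟩ (t * (C * h)) (by positivity) ?_
      · rw [smul_smul]
        exact h1 (Metric.mem_ball_self (by positivity))
      · rw [Metric.mem_ball]
        have := dist_triangle z y (x y)
        have := hxd y hy hy'.2
        rw [dist_comm] at this
        linarith
      · have := mul_le_of_le_one_left (by positivity : 0 ≤ C * h) ht.2
        linarith
    · simpa using hz
  have hball : ∀ y ∈ Ω, Metric.ball (y + τ y) (4 * h) ⊆ Ω := by
    intro y hy
    simp only [hτ]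
    split_ifs with hy'
    · have h1 := Hξ _ (hx y hy hy'.2) y ⟨hy, ?_⟩ (C * h) (by positivity) (by linarith)
      · rwa [hκC] at h1
      · have := hxd y hy hy'.2
        rw [Metric.mem_ball, dist_comm]
        linarith
    · rw [add_zero]
      exact Metric.ball_subset_closedBall.trans (not_not.1 fun hn => hy' ⟨hy, hn⟩)
  refine ⟨τ, hτn, fun y hy hb => by simp [hτ, hb], fun y hy y' hy' hd t ht => ?_⟩
  refine interior_maximal (fun z hz => ?_) Metric.isOpen_ball
  -- The whole ball around y + τ y is in Ω; it is then translated by t τ y', which keeps its points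
  -- in Ω.
  have hz' : z - t • τ y' ∈ Metric.ball (y + τ y) (4 * h) := by
    rw [Metric.mem_ball, dist_eq_norm] at hz ⊢
    convert hz using 2
    abel
  have := hshift y' hy' _ (hball y hy hz') ?_ t ht
  · simpa using this
  · have h1 := dist_triangle (z - t • τ y') (y + τ y) y'
    have h2 := dist_triangle (y + τ y) y y'
    have h3 : dist (y + τ y) y = ‖τ y‖ := by simp [dist_eq_norm]
    have h4 := hτn y
    rw [Metric.mem_ball] at hz'
    have : 0 < C * h := by positivity
    linarith

/-- Boundary layers of vanishing thickness have vanishing measure. -/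
lemma tendsto_measure_layer {Ω : Set E3} (hΩ : Bornology.IsBounded Ω) (h : UniformConeProperty Ω)
    (ν : Measure E3) [IsFiniteMeasureOnCompacts ν] (hν : ν ≪ volume) {δ : ℕ → ℝ}
    (hδ : Tendsto δ atTop (𝓝 0)) :
    Tendsto (fun n => ν (Metric.cthickening (δ n) (frontier Ω))) atTop (𝓝 0) := by
  have hc : IsCompact (frontier Ω) := Metric.isCompact_of_isClosed_isBounded isClosed_frontier
    (hΩ.closure.subset frontier_subset_closure)
  have := tendsto_measure_cthickening_of_isCompact (μ := ν) hc
  rw [hν (volume_frontier_eq_zero h)] at this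
  exact this.comp hδ

lemma mem_cthickening_of_dist {Ω : Set E3} {x y : E3} {δ : ℝ} (hx : x ∈ frontier Ω)
    (h : dist y x ≤ δ) : y ∈ Metric.cthickening δ (frontier Ω) :=
  Metric.mem_cthickening_of_dist_le y x δ _ hx h

/-! ### The interpolation on the unit lattice -/

/-- The offsets of the corners of a cell. -/
def corners : Finset Idx := Fintype.piFinset fun _ => {0, 1}

lemma mem_corners {j : Idx} : j ∈ corners ↔ ∀ i, j i = 0 ∨ j i = 1 := by
  simp [corners, Fintype.mem_piFinset]

lemma card_corners : corners.card = 8 := by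
  simp [corners, Fintype.card_piFinset]

lemma hat_nonneg (k : Idx) (z : E3) : 0 ≤ hat k z := by
  unfold hat; split_ifs <;> exact le_max_left _ _

lemma hat_eq_zero {k : Idx} {z : E3} {i : Fin 3} (h : 1 ≤ |z i - k i|) : hat k z = 0 := by
  rw [hat_values _ _ _ k z rfl rfl rfl]
  refine hat_far _ _ _ _ (abs_nonneg _) (abs_nonneg _) (abs_nonneg _) ?_
  fin_cases i
  · exact Or.inl h
  · exact Or.inr (Or.inl h)
  · exact Or.inr (Or.inr h)

lemma abs_apply_le_norm (x : E3) (i : Fin 3) : |x i| ≤ ‖x‖ := PiLp.norm_apply_le x i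

/-- Each coordinate distance changes by at most ‖z − z'‖, and at most three of them are added. -/
lemma abs_hat_sub_le (k : Idx) (z z' : E3) : |hat k z - hat k z'| ≤ 3 * ‖z - z'‖ := by
  have h (i : Fin 3) : |(|z i - k i| - |z' i - k i|)| ≤ ‖z - z'‖ := by
    refine (abs_abs_sub_abs_le _ _).trans ?_
    have := abs_apply_le_norm (z - z') i
    simpa using this
  have h0 := h 0
  have h1 := h 1
  have h2 := h 2
  have hn := norm_nonneg (z - z')
  unfold hat
  simp only [Fin.sum_univ_three]
  generalize |z 0 - k 0| = a0 at *
  generalize |z 1 - k 1| = a1 at *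
  generalize |z 2 - k 2| = a2 at *
  generalize |z' 0 - k 0| = b0 at *
  generalize |z' 1 - k 1| = b1 at *
  generalize |z' 2 - k 2| = b2 at *
  generalize ‖z - z'‖ = d at *
  have hmax (x y : ℝ) : |max 0 x - max 0 y| ≤ |x - y| := by
    rw [max_comm 0 x, max_comm 0 y]; exact abs_max_sub_max_le_abs _ _ _
  split_ifs
  · refine (hmax _ _).trans ?_
    rw [abs_le] at *
    constructor <;> linarith
  · refine (hmax _ _).trans ?_
    have e1 := abs_max_sub_max_le_max (max (max a0 a1) a2) ((a0 + a1 + a2) / 2)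
      (max (max b0 b1) b2) ((b0 + b1 + b2) / 2)
    have e2 := abs_max_sub_max_le_max (max a0 a1) a2 (max b0 b1) b2
    have e3 := abs_max_sub_max_le_max a0 a1 b0 b1
    have e4 : |(a0 + a1 + a2) / 2 - (b0 + b1 + b2) / 2| ≤ 3 * d := by
      rw [abs_le] at *
      constructor <;> linarith
    have e5 : |max a0 a1 - max b0 b1| ≤ d := e3.trans (max_le h0 h1)
    have e6 : |max (max a0 a1) a2 - max (max b0 b1) b2| ≤ d := e2.trans (max_le e5 h2)
    rw [show ∀ x y : ℝ, (1 - x) - (1 - y) = y - x from fun x y => by ring, abs_sub_comm]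
    exact e1.trans (max_le (by linarith) e4)

/-- The closed unit cell with lowest corner `k`. -/
def unitCell (k : Idx) : Set E3 := {z | ∀ i, (k i : ℝ) ≤ z i ∧ z i ≤ k i + 1}

lemma hat_eq_zero_of_unitCell {k l : Idx} {z : E3} (hz : z ∈ unitCell k)
    (hl : l - k ∉ corners) : hat l z = 0 := by
  rw [mem_corners] at hl
  push Not at hl
  obtain ⟨i, h0, h1⟩ := hl
  refine hat_eq_zero (i := i) ?_
  simp only [Pi.sub_apply] at h0 h1
  obtain ⟨hz0, hz1⟩ := hz i
  rcases (by omega : l i ≤ k i - 1 ∨ k i + 2 ≤ l i) with h | h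
  · have : (l i : ℝ) ≤ k i - 1 := by exact_mod_cast h
    rw [le_abs]; left; linarith
  · have : (k i : ℝ) + 2 ≤ l i := by exact_mod_cast h
    rw [le_abs]; right; linarith

lemma interp_eq_sum (μ : Idx → E3) {k : Idx} {z : E3} (hz : z ∈ unitCell k) :
    interp μ z = ∑ j ∈ corners, hat (k + j) z • μ (k + j) := by
  unfold interp
  rw [finsum_eq_sum_of_support_subset (s := corners.map (addLeftEmbedding k)), Finset.sum_map]
  · rfl
  · intro l hl
    rw [Finset.coe_map, Set.mem_image]
    by_contra hn
    push Not at hn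
    refine hl ?_
    have : l - k ∉ corners := fun h => hn _ h (by simp)
    simp only [hat_eq_zero_of_unitCell hz this, zero_smul]

/-- Seen from an even vertex v with axis signs s, a point of the cell lies in the corner tetrahedron
of one of the four even vertices 000, 110, 101, 011, or else in the central one. In each case the
barycentric coordinates sum to one. -/
lemma interp_const_of_tet (c : E3) (v s : Idx) (hv : Even (∑ i, v i))
    (hs : ∀ i, s i = 1 ∨ s i = -1) (f : Fin 3 → ℝ) (h0 : ∀ i, 0 ≤ f i) (h1 : ∀ i, f i ≤ 1) :
    interp (fun _ => c) (WithLp.toLp 2 fun i => (v i : ℝ) + s i * f i) = c := by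
  have corner (v s : Idx) (hv : Even (∑ i, v i)) (hs : ∀ i, s i = 1 ∨ s i = -1) (t : Fin 3 → ℝ)
      (ht : ∀ i, 0 ≤ t i) (ht1 : ∑ i, t i ≤ 1) (p : Fin 3 → ℝ)
      (hp : ∀ i, p i = (v i : ℝ) + s i * t i) : interp (fun _ => c) (WithLp.toLp 2 p) = c := by
    obtain rfl : p = fun i => (v i : ℝ) + s i * t i := funext hp
    rw [interp_corner _ v s hv hs t ht ht1, ← Finset.sum_smul, ← add_smul]
    simp
  have hneg {x : ℤ} (h : x = 1 ∨ x = -1) : -x = 1 ∨ -x = -1 := by omega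
  rw [Fin.sum_univ_three] at hv
  by_cases hA : f 0 + f 1 + f 2 ≤ 1
  · exact corner v s (by rwa [Fin.sum_univ_three]) hs f h0 (by rwa [Fin.sum_univ_three]) _
      fun _ => rfl
  by_cases hB : (1 - f 0) + (1 - f 1) + f 2 ≤ 1
  · refine corner ![v 0 + s 0, v 1 + s 1, v 2] ![-s 0, -s 1, s 2] ?_ ?_
      ![1 - f 0, 1 - f 1, f 2] ?_ ?_ _ ?_
    · rw [Fin.sum_univ_three]
      rcases hs 0 with h | h <;> rcases hs 1 with h' | h' <;> simp only [h, h', Int.even_iff] at * <;>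
        simp <;> omega
    · intro i; fin_cases i <;> simp <;> [have := hs 0; have := hs 1; exact hs 2] <;> omega
    · intro i; fin_cases i <;> simp [h0, h1]
    · rw [Fin.sum_univ_three]; simpa using hB
    · intro i; fin_cases i <;> simp <;> ring
  by_cases hC : (1 - f 0) + f 1 + (1 - f 2) ≤ 1
  · refine corner ![v 0 + s 0, v 1, v 2 + s 2] ![-s 0, s 1, -s 2] ?_ ?_
      ![1 - f 0, f 1, 1 - f 2] ?_ ?_ _ ?_
    · rw [Fin.sum_univ_three]
      rcases hs 0 with h | h <;> rcases hs 2 with h' | h' <;> simp only [h, h', Int.even_iff] at * <;>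
        simp <;> omega
    · intro i; fin_cases i <;> simp <;> [have := hs 0; exact hs 1; have := hs 2] <;> omega
    · intro i; fin_cases i <;> simp [h0, h1]
    · rw [Fin.sum_univ_three]; simpa using hC
    · intro i; fin_cases i <;> simp <;> ring
  by_cases hD : f 0 + (1 - f 1) + (1 - f 2) ≤ 1
  · refine corner ![v 0, v 1 + s 1, v 2 + s 2] ![s 0, -s 1, -s 2] ?_ ?_
      ![f 0, 1 - f 1, 1 - f 2] ?_ ?_ _ ?_
    · rw [Fin.sum_univ_three]
      rcases hs 1 with h | h <;> rcases hs 2 with h' | h' <;> simp only [h, h', Int.even_iff] at * <;>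
        simp <;> omega
    · intro i; fin_cases i <;> simp <;> [exact hs 0; have := hs 1; have := hs 2] <;> omega
    · intro i; fin_cases i <;> simp [h0, h1]
    · rw [Fin.sum_univ_three]; simpa using hD
    · intro i; fin_cases i <;> simp <;> ring
  push Not at hA hB hC hD
  -- Outside the four corner tetrahedra: barycentric coordinates in the central one, seen from its
  -- vertex v + s₀e₀. The four negated inequalities are the nonnegativity of these coordinates.
  set t : Fin 3 → ℝ := ![(f 0 + f 1 + f 2 - 1) / 2, (1 - f 0 + f 2 - f 1) / 2,
    (1 - f 0 + f 1 - f 2) / 2] with ht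
  set w : ℝ := (1 + f 0 - f 1 - f 2) / 2 with hw
  have hwt : w + ∑ i, t i = 1 := by rw [Fin.sum_univ_three]; simp [ht, hw]; ring
  have := interp_center (fun _ => c) ![v 0 + s 0, v 1, v 2] ![-s 0, s 1, s 2] ?_ ?_ w t ?_ ?_ hwt
  · rw [← Finset.sum_smul, ← add_smul, hwt, one_smul] at this
    refine Eq.trans (congrArg _ (congrArg _ (funext fun i => ?_))) this
    fin_cases i <;> simp [Fin.sum_univ_three, ht] <;> first | ring1 | (left; ring1)
  · rw [Fin.sum_univ_three]
    rcases hs 0 with h | h <;> simp only [h, Int.even_iff] at * <;> simp <;> omega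
  · intro i; fin_cases i <;> simp <;> [have := hs 0; exact hs 1; exact hs 2] <;> omega
  · rw [hw]; linarith
  · intro i; fin_cases i <;> simp [ht] <;> linarith

/-- Every cell has an even vertex in reach: the floor of z or, if that is odd, its neighbour in
direction 0 with that axis reversed. -/
lemma interp_const (c : E3) (z : E3) : interp (fun _ => c) z = c := by
  have hf0 (i : Fin 3) := Int.fract_nonneg (z i)
  have hf1 (i : Fin 3) := (Int.fract_lt_one (z i)).le
  by_cases he : Even (∑ i, ⌊z i⌋)
  · have h := interp_const_of_tet c (fun i => ⌊z i⌋) (fun _ => 1) he (fun _ => Or.inl rfl)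
      (fun i => Int.fract (z i)) hf0 hf1
    refine Eq.trans (congrArg _ (PiLp.ext fun i => ?_)) h
    simp [Int.floor_add_fract]
  · have h := interp_const_of_tet c (fun i => ⌊z i⌋ + if i = 0 then 1 else 0)
      (fun i => if i = 0 then -1 else 1) ?_ (fun i => ?_)
      (fun i => if i = 0 then 1 - Int.fract (z i) else Int.fract (z i)) (fun i => ?_) (fun i => ?_)
    · refine Eq.trans (congrArg _ (PiLp.ext fun i => ?_)) h
      by_cases hi : i = 0 <;> simp [hi, Int.floor_add_fract]
    · rw [Int.not_even_iff_odd] at he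
      rw [Finset.sum_add_distrib]
      simpa using he.add_one
    · by_cases hi : i = 0 <;> simp [hi]
    · by_cases hi : i = 0 <;> simp [hi, hf1]
    · by_cases hi : i = 0 <;> simp [hi, hf1]

/-- Partition of unity, read off from the interpolation of a constant. -/
lemma sum_hat {k : Idx} {z : E3} (hz : z ∈ unitCell k) : ∑ j ∈ corners, hat (k + j) z = 1 := by
  have h := interp_const (basisVec 0) z
  rw [interp_eq_sum _ hz, ← Finset.sum_smul] at h
  have := congrArg (fun v : E3 => v 0) h
  simpa [basisVec] using this

/-- Sum of the absolute differences from the lowest corner. -/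
def cellOsc (μ : Idx → E3) (k : Idx) : ℝ := ∑ j ∈ corners, ‖μ (k + j) - μ k‖

lemma cellOsc_nonneg (μ : Idx → E3) (k : Idx) : 0 ≤ cellOsc μ k :=
  Finset.sum_nonneg fun _ _ => norm_nonneg _

lemma norm_interp_sub_le (μ : Idx → E3) {k : Idx} {z : E3} (hz : z ∈ unitCell k) :
    ‖interp μ z - μ k‖ ≤ cellOsc μ k := by
  have h1 : interp μ z - μ k = ∑ j ∈ corners, hat (k + j) z • (μ (k + j) - μ k) := by
    simp_rw [smul_sub, Finset.sum_sub_distrib, ← Finset.sum_smul, sum_hat hz, one_smul]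
    rw [interp_eq_sum μ hz]
  rw [h1]
  refine (norm_sum_le _ _).trans (Finset.sum_le_sum fun j hj => ?_)
  rw [norm_smul, Real.norm_of_nonneg (hat_nonneg _ _)]
  refine mul_le_of_le_one_left (norm_nonneg _) ?_
  rw [← sum_hat hz]
  exact Finset.single_le_sum (f := fun j => hat (k + j) z) (fun _ _ => hat_nonneg _ _) hj

lemma norm_interp_sub_interp_le (μ : Idx → E3) {k : Idx} {z z' : E3} (hz : z ∈ unitCell k)
    (hz' : z' ∈ unitCell k) : ‖interp μ z - interp μ z'‖ ≤ 3 * cellOsc μ k * ‖z - z'‖ := by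
  have h1 : interp μ z - interp μ z' =
      ∑ j ∈ corners, (hat (k + j) z - hat (k + j) z') • (μ (k + j) - μ k) := by
    simp_rw [sub_smul, smul_sub, Finset.sum_sub_distrib, ← Finset.sum_smul, sum_hat hz, sum_hat hz']
    rw [interp_eq_sum μ hz, interp_eq_sum μ hz']
    abel
  rw [h1, cellOsc, mul_assoc, mul_comm (∑ j ∈ corners, _), ← mul_assoc, Finset.mul_sum]
  refine (norm_sum_le _ _).trans (Finset.sum_le_sum fun j _ => ?_)
  rw [norm_smul]
  gcongr
  exact abs_hat_sub_le _ _ _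

lemma norm_interp_le (μ : Idx → E3) {k : Idx} {z : E3} (hz : z ∈ unitCell k) {M : ℝ}
    (hM : ∀ j ∈ corners, ‖μ (k + j)‖ ≤ M) : ‖interp μ z‖ ≤ M := by
  rw [interp_eq_sum μ hz]
  calc _ ≤ ∑ j ∈ corners, hat (k + j) z * M := by
        refine (norm_sum_le _ _).trans (Finset.sum_le_sum fun j hj => ?_)
        rw [norm_smul, Real.norm_of_nonneg (hat_nonneg _ _)]
        exact mul_le_mul_of_nonneg_left (hM j hj) (hat_nonneg _ _)
    _ = M := by rw [← Finset.sum_mul, sum_hat hz, one_mul]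

lemma interp_congr {μ μ' : Idx → E3} {k : Idx} {z : E3} (hz : z ∈ unitCell k)
    (h : ∀ j ∈ corners, μ (k + j) = μ' (k + j)) : interp μ z = interp μ' z := by
  rw [interp_eq_sum μ hz, interp_eq_sum μ' hz]
  exact Finset.sum_congr rfl fun j hj => by rw [h j hj]

/-- The interpolation of finitely many values is Lipschitz continuous. -/
lemma exists_lipschitzWith_interp {μ : Idx → E3} {s : Finset Idx} (h : ∀ k ∉ s, μ k = 0) :
    ∃ C, LipschitzWith C (interp μ) := by
  have e : interp μ = fun z => ∑ k ∈ s, hat k z • μ k := by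
    ext1 z
    unfold interp
    rw [finsum_eq_sum_of_support_subset]
    intro k hk
    by_contra hn
    exact hk (by simp [h k hn])
  rw [e]
  refine ⟨_, LipschitzWith.of_dist_le_mul (K := (3 * ∑ k ∈ s, ‖μ k‖).toNNReal) fun z z' => ?_⟩
  rw [Real.coe_toNNReal _ (by positivity), dist_eq_norm, dist_eq_norm, ← Finset.sum_sub_distrib,
    Finset.mul_sum, Finset.sum_mul]
  refine (norm_sum_le _ _).trans (Finset.sum_le_sum fun k _ => ?_)
  rw [← sub_smul, norm_smul]
  have := abs_hat_sub_le k z z'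
  rw [Real.norm_eq_abs]
  calc _ ≤ 3 * ‖z - z'‖ * ‖μ k‖ := by gcongr
    _ = _ := by ring

/-- The derivative of the interpolation near an even node. -/
lemma hasFDerivAt_interp_corner (μ : Idx → E3) (v s : Idx) (hv : Even (∑ i, v i))
    (hs : ∀ i, s i = 1 ∨ s i = -1) (z : E3) (hz0 : ∀ i, 0 < s i * (z i - v i))
    (hz1 : ∀ i, s i * (z i - v i) < 1 / 3) (i : Fin 3) :
    fderiv ℝ (interp μ) z (basisVec i) = (s i : ℝ) • (μ (v + Pi.single i (s i)) - μ v) := by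
  set L : E3 →L[ℝ] E3 := ∑ i, (s i : ℝ) • (EuclideanSpace.proj (𝕜 := ℝ) i).smulRight
    (μ (v + Pi.single i (s i)) - μ v) with hL
  have hss (i : Fin 3) : (s i : ℝ) * s i = 1 := by
    rcases hs i with h | h <;> simp [h]
  have hloc : interp μ =ᶠ[𝓝 z] fun y => L (y - WithLp.toLp 2 fun i => (v i : ℝ)) + μ v := by
    have hopen : ∀ᶠ y : E3 in 𝓝 z, ∀ i, 0 < s i * (y i - v i) ∧ s i * (y i - v i) < 1 / 3 := by
      rw [eventually_all]
      intro i
      have hc : Continuous fun y : E3 => (s i : ℝ) * (y i - v i) := by fun_prop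
      exact ((hc.tendsto z).eventually_const_lt (hz0 i)).and
        ((hc.tendsto z).eventually_lt_const (hz1 i))
    filter_upwards [hopen] with y hy
    -- Three coordinates below 1/3 have sum below 1: this small cube lies inside the corner
    -- tetrahedron.
    have := interp_corner μ v s hv hs (fun i => s i * (y i - v i)) (fun i => (hy i).1.le) (by
      rw [Fin.sum_univ_three]; linarith [(hy 0).2, (hy 1).2, (hy 2).2])
    have e : (WithLp.toLp 2 fun i => (v i : ℝ) + s i * (s i * (y i - v i))) = y := by
      ext i
      simp only
      rw [← mul_assoc, hss]; ring
    rw [e] at this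
    have eL : L (y - WithLp.toLp 2 fun i => (v i : ℝ)) =
        ∑ i, (s i * (y i - v i)) • (μ (v + Pi.single i (s i)) - μ v) := by
      simp [hL, smul_smul]
    rw [this, eL]
    simp_rw [smul_sub, Finset.sum_sub_distrib, ← Finset.sum_smul, sub_smul, one_smul]
    abel
  have hd : HasFDerivAt (interp μ) L z := by
    refine HasFDerivAt.congr_of_eventuallyEq ?_ hloc
    have := (L.hasFDerivAt (x := z - WithLp.toLp 2 fun i => (v i : ℝ))).comp z
      ((hasFDerivAt_id z).sub_const (WithLp.toLp 2 fun i => (v i : ℝ)))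
    exact this.add_const _
  rw [hd.fderiv, hL]
  simp [basisVec]

/-! ### Open cells of the lattice `h ℤ³` -/

/-- An open cube of side `ℓ` with lowest corner `c`. -/
def openBox (c : Fin 3 → ℝ) (ℓ : ℝ) : Set E3 := {y | ∀ i, c i < y i ∧ y i < c i + ℓ}

lemma openBox_eq_preimage (c : Fin 3 → ℝ) (ℓ : ℝ) :
    openBox c ℓ = (WithLp.ofLp : E3 → Fin 3 → ℝ) ⁻¹' Set.univ.pi fun i => Set.Ioo (c i) (c i + ℓ) := by
  ext y
  simp [openBox, Set.mem_pi]

lemma isOpen_openBox (c : Fin 3 → ℝ) (ℓ : ℝ) : IsOpen (openBox c ℓ) := by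
  rw [openBox_eq_preimage]
  exact (isOpen_set_pi Set.finite_univ fun _ _ => isOpen_Ioo).preimage (PiLp.continuous_ofLp 2 _)

lemma volume_openBox (c : Fin 3 → ℝ) {ℓ : ℝ} (hℓ : 0 ≤ ℓ) :
    volume (openBox c ℓ) = ENNReal.ofReal (ℓ ^ 3) := by
  rw [openBox_eq_preimage, (PiLp.volume_preserving_ofLp (Fin 3)).measure_preimage
    (MeasurableSet.univ_pi fun _ => measurableSet_Ioo).nullMeasurableSet, volume_pi_pi]
  simp [ENNReal.ofReal_pow hℓ]

/-- The point of `h ℤ³` with index `k`. -/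
def latt (h : ℝ) (k : Idx) : E3 := h • WithLp.toLp 2 fun i => (k i : ℝ)

@[simp] lemma latt_apply (h : ℝ) (k : Idx) (i : Fin 3) : latt h k i = h * k i := by simp [latt]

lemma latt_add (h : ℝ) (k l : Idx) : latt h (k + l) = latt h k + latt h l := by
  ext i; simp [mul_add]

lemma latt_single (h : ℝ) (i : Fin 3) : latt h (Pi.single i 1) = h • basisVec i := by
  ext j
  by_cases hj : j = i
  · subst hj; simp [basisVec]
  · simp [basisVec, hj]

/-- The open cell of `h ℤ³` with lowest corner `k`. -/
def cellO (h : ℝ) (k : Idx) : Set E3 := openBox (fun i => h * k i) h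

lemma isOpen_cellO (h : ℝ) (k : Idx) : IsOpen (cellO h k) := isOpen_openBox _ _

lemma measurableSet_cellO (h : ℝ) (k : Idx) : MeasurableSet (cellO h k) :=
  (isOpen_cellO h k).measurableSet

lemma volume_cellO {h : ℝ} (hh : 0 ≤ h) (k : Idx) : volume (cellO h k) = ENNReal.ofReal (h ^ 3) :=
  volume_openBox _ hh

lemma convex_cellO (h : ℝ) (k : Idx) : Convex ℝ (cellO h k) := by
  unfold cellO
  rw [openBox_eq_preimage]
  exact (convex_pi fun _ _ => convex_Ioo _ _).linear_preimage
    (WithLp.linearEquiv 2 ℝ (Fin 3 → ℝ)).toLinearMap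

lemma disjoint_cellO {h : ℝ} (hh : 0 < h) {k l : Idx} (hkl : k ≠ l) :
    Disjoint (cellO h k) (cellO h l) := by
  obtain ⟨i, hi⟩ := Function.ne_iff.1 hkl
  refine Set.disjoint_left.2 fun y hy hy' => hi ?_
  have h1 := hy i
  have h2 := hy' i
  have e1 : h * (k i : ℝ) < h * ((l i : ℝ) + 1) := by linarith
  have e2 : h * (l i : ℝ) < h * ((k i : ℝ) + 1) := by linarith
  have e1' := lt_of_mul_lt_mul_left e1 hh.le
  have e2' := lt_of_mul_lt_mul_left e2 hh.le
  norm_cast at e1' e2'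
  omega

lemma volume_coord_eq (i : Fin 3) (c : ℝ) : volume {y : E3 | y i = c} = 0 := by
  have : {y : E3 | y i = c} = (WithLp.ofLp : E3 → Fin 3 → ℝ) ⁻¹' {f | f i = c} := rfl
  rw [this, (PiLp.volume_preserving_ofLp (Fin 3)).measure_preimage]
  · exact Measure.pi_hyperplane (fun _ : Fin 3 => (volume : Measure ℝ)) i c
  · exact (measurableSet_eq_fun (measurable_pi_apply i) measurable_const).nullMeasurableSet

lemma ae_mem_cellO {h : ℝ} (hh : 0 < h) : ∀ᵐ y : E3, ∃ k, y ∈ cellO h k := by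
  have : ∀ᵐ y : E3, ∀ i : Fin 3, ∀ m : ℤ, y i ≠ h * m := by
    rw [ae_all_iff]; intro i
    rw [ae_all_iff]; intro m
    rw [ae_iff]
    simpa using volume_coord_eq i (h * m)
  filter_upwards [this] with y hy
  refine ⟨fun i => ⌊y i / h⌋, fun i => ⟨lt_of_le_of_ne ?_ (hy i _).symm, ?_⟩⟩
  · change h * (⌊y i / h⌋ : ℝ) ≤ y i
    rw [mul_comm, ← le_div_iff₀ hh]; exact Int.floor_le _
  · have := Int.lt_floor_add_one (y i / h)
    rw [div_lt_iff₀ hh] at this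
    change y i < h * (⌊y i / h⌋ : ℝ) + h
    linarith

lemma mem_cellO_iff_sub {h : ℝ} {k : Idx} {y : E3} :
    y ∈ cellO h k ↔ y - latt h k ∈ cellO h 0 := by
  simp only [cellO, openBox, Set.mem_ofPred_eq, PiLp.sub_apply, latt_apply, Pi.zero_apply,
    Int.cast_zero, mul_zero]
  refine forall_congr' fun i => ?_
  constructor <;> rintro ⟨h1, h2⟩ <;> constructor <;> linarith

lemma norm_lt_of_mem_cellO_zero {h : ℝ} (hh : 0 < h) {σ : E3} (hσ : σ ∈ cellO h 0) : ‖σ‖ < 2 * h := by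
  have h0 : ∀ i, 0 < σ i ∧ σ i < h := by simpa [cellO, openBox] using hσ
  have : ‖σ‖ ^ 2 < (2 * h) ^ 2 := by
    rw [EuclideanSpace.norm_sq_eq, Fin.sum_univ_three]
    simp only [Real.norm_eq_abs, sq_abs]
    have := h0 0
    have := h0 1
    have := h0 2
    nlinarith
  exact lt_of_pow_lt_pow_left₀ 2 (by positivity) this

lemma dist_latt_lt {h : ℝ} (hh : 0 < h) {k : Idx} {y : E3} (hy : y ∈ cellO h k) :
    dist y (latt h k) < 2 * h := by
  rw [dist_eq_norm]
  exact norm_lt_of_mem_cellO_zero hh (mem_cellO_iff_sub.1 hy)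

/-- The integral over a translated cell. -/
lemma lintegral_cellO_translate (h : ℝ) (c : E3) (f : E3 → ℝ≥0∞) :
    ∫⁻ σ in cellO h 0, f (c + σ) = ∫⁻ y in (fun y => y - c) ⁻¹' cellO h 0, f y := by
  have hm := measurableSet_cellO h 0
  rw [← lintegral_indicator hm, ← lintegral_indicator (hm.preimage (by fun_prop)),
    ← lintegral_add_left_eq_self (((fun y => y - c) ⁻¹' cellO h 0).indicator f) c]
  refine lintegral_congr fun σ => ?_
  by_cases hσ : σ ∈ cellO h 0
  · rw [Set.indicator_of_mem hσ, Set.indicator_of_mem (by simpa using hσ)]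
  · rw [Set.indicator_of_notMem hσ, Set.indicator_of_notMem (by simpa using hσ)]

lemma lintegral_cellO_eq (h : ℝ) (k : Idx) (f : E3 → ℝ≥0∞) :
    ∫⁻ y in cellO h k, f y = ∫⁻ σ in cellO h 0, f (latt h k + σ) := by
  rw [lintegral_cellO_translate]
  congr 2
  ext y
  exact mem_cellO_iff_sub

/-- Sums of integrals over cells. -/
lemma sum_lintegral_cellO_le {h : ℝ} (hh : 0 < h) {s : Finset Idx} {T : Set E3}
    (hT : ∀ k ∈ s, cellO h k ⊆ T) (f : E3 → ℝ≥0∞) :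
    ∑ k ∈ s, ∫⁻ y in cellO h k, f y ≤ ∫⁻ y in T, f y := by
  rw [← lintegral_biUnion_finset (fun k _ l _ hkl => disjoint_cellO hh hkl)
    fun k _ => measurableSet_cellO h k]
  exact lintegral_mono_set (Set.iUnion₂_subset hT)

/-- Each coordinate of an index is confined to an interval of 2M + 2 integers. This bounds the
overlap of balls around nodes. -/
lemma card_ball_le {h : ℝ} (hh : 0 < h) (s : Finset Idx) (M : ℕ) (y : E3) :
    (s.filter fun k => dist y (latt h k) < M * h).card ≤ (2 * M + 2) ^ 3 := by
  have hsub : (s.filter fun k => dist y (latt h k) < M * h) ⊆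
      Fintype.piFinset fun i => Finset.Icc (⌊y i / h⌋ - M) (⌊y i / h⌋ + M + 1) := by
    intro k hk
    rw [Finset.mem_filter] at hk
    rw [Fintype.mem_piFinset]
    intro i
    have h1 : |y i - h * k i| < M * h := by
      have := abs_apply_le_norm (y - latt h k) i
      simp only [PiLp.sub_apply, latt_apply] at this
      exact this.trans_lt (by rw [← dist_eq_norm]; exact hk.2)
    rw [abs_lt] at h1
    have h2 : y i / h - k i < M := by
      rw [← mul_lt_mul_iff_left₀ hh, sub_mul, div_mul_cancel₀ _ hh.ne']; linarith
    have h3 : -M < y i / h - k i := by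
      rw [← mul_lt_mul_iff_left₀ hh, sub_mul, div_mul_cancel₀ _ hh.ne']; linarith
    have h4 := Int.floor_le (y i / h)
    have h5 := Int.lt_floor_add_one (y i / h)
    have h6 : ((⌊y i / h⌋ : ℤ) : ℝ) - M < k i := by linarith
    have h7 : (k i : ℝ) < ⌊y i / h⌋ + 1 + M := by linarith
    rw [Finset.mem_Icc]
    constructor
    · have : ⌊y i / h⌋ - (M : ℤ) < k i := by exact_mod_cast h6
      omega
    · have : k i < ⌊y i / h⌋ + 1 + (M : ℤ) := by exact_mod_cast h7
      omega
  refine (Finset.card_le_card hsub).trans ?_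
  rw [Fintype.card_piFinset]
  refine (Finset.prod_le_prod' (g := fun _ => 2 * M + 2) fun i _ => ?_).trans (by simp)
  rw [Int.card_Icc]
  omega

/-- Sums of integrals over balls around the nodes. -/
lemma sum_lintegral_ball_le {h : ℝ} (hh : 0 < h) {s : Finset Idx} {S : Idx → Set E3} {T : Set E3}
    (hS : ∀ k ∈ s, MeasurableSet (S k)) (hT : ∀ k ∈ s, S k ⊆ T) (M : ℕ)
    (hb : ∀ k ∈ s, S k ⊆ Metric.ball (latt h k) (M * h)) (f : E3 → ℝ≥0∞) (hf : AEMeasurable f (volume.restrict T)) :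
    ∑ k ∈ s, ∫⁻ y in S k, f y ≤ ((2 * M + 2) ^ 3 : ℕ) * ∫⁻ y in T, f y := by
  calc ∑ k ∈ s, ∫⁻ y in S k, f y
      = ∑ k ∈ s, ∫⁻ y in T, (S k).indicator f y := by
        refine Finset.sum_congr rfl fun k hk => ?_
        rw [lintegral_indicator (hS k hk), Measure.restrict_restrict (hS k hk),
          Set.inter_eq_left.2 (hT k hk)]
    _ = ∫⁻ y in T, ∑ k ∈ s, (S k).indicator f y :=
        (lintegral_finsetSum' _ fun k hk => hf.indicator (hS k hk)).symm
    _ ≤ ∫⁻ y in T, ((2 * M + 2) ^ 3 : ℕ) * f y := by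
        refine lintegral_mono fun y => ?_
        calc ∑ k ∈ s, (S k).indicator f y
            ≤ ∑ k ∈ s, if dist y (latt h k) < M * h then f y else 0 := by
              refine Finset.sum_le_sum fun k hk => ?_
              by_cases hy : y ∈ S k
              · have hd : dist y (latt h k) < M * h := hb k hk hy
                rw [Set.indicator_of_mem hy, if_pos hd]
              · rw [Set.indicator_of_notMem hy]; exact zero_le
          _ = (s.filter fun k => dist y (latt h k) < M * h).card * f y := by
              rw [← Finset.sum_filter, Finset.sum_const, nsmul_eq_mul]
          _ ≤ _ := by gcongr; exact card_ball_le hh s M y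
    _ = _ := lintegral_const_mul' _ _ (ENNReal.natCast_ne_top _)

/-! ### Lattice nodes in a bounded set -/

lemma node_eq_latt (a : ℝ) (n : ℕ) (k : Idx) : node a n k = latt (a / n) k := rfl

lemma finite_nodes {a : ℝ} (ha : 0 < a) {Ω : Set E3} (hΩ : Bornology.IsBounded Ω) {n : ℕ}
    (hn : 1 ≤ n) : (nodes a Ω n).Finite := by
  obtain ⟨M, hM⟩ := hΩ.exists_norm_le
  have hh : 0 < a / n := div_pos ha (by exact_mod_cast hn)
  refine (Set.finite_Icc (fun _ => -⌈M / (a / n)⌉ : Idx) (fun _ => ⌈M / (a / n)⌉)).subset ?_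
  intro k hk
  have key (i : Fin 3) : |(k i : ℝ)| ≤ ⌈M / (a / n)⌉ := by
    have h1 := (abs_apply_le_norm (node a n k) i).trans (hM _ hk)
    rw [node_eq_latt, latt_apply, abs_mul, abs_of_pos hh] at h1
    refine le_trans ?_ (Int.le_ceil _)
    rw [le_div_iff₀ hh]; linarith
  constructor <;> intro i
  · have := (abs_le.1 (key i)).1
    exact_mod_cast this
  · have := (abs_le.1 (key i)).2
    exact_mod_cast this

/-! ### Properties of the interpolation `P` -/

/-- The cells contained in `Ω`. -/
def goodCells (a : ℝ) (Ω : Set E3) (n : ℕ) : Set Idx := {k | cell a n k ⊆ Ω}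

section

variable {a : ℝ} {n : ℕ} {Ω : Set E3}

lemma node_add_mem_cell (ha : 0 < a) (hn : 1 ≤ n) {k j : Idx} (hj : j ∈ corners) :
    node a n (k + j) ∈ cell a n k := by
  have hh : 0 < a / n := div_pos ha (by exact_mod_cast hn)
  intro i
  rw [node_eq_latt, latt_apply]
  rcases mem_corners.1 hj i with h | h <;> simp only [Pi.add_apply, h] <;> push_cast <;>
    constructor <;> nlinarith

lemma mem_nodes_of_good (ha : 0 < a) (hn : 1 ≤ n) {k j : Idx} (hk : k ∈ goodCells a Ω n)
    (hj : j ∈ corners) : k + j ∈ nodes a Ω n := hk (node_add_mem_cell ha hn hj)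

lemma goodCells_subset_nodes (ha : 0 < a) (hn : 1 ≤ n) : goodCells a Ω n ⊆ nodes a Ω n := by
  intro k hk
  simpa using mem_nodes_of_good ha hn hk (j := 0) (mem_corners.2 (by simp))

lemma finite_goodCells (ha : 0 < a) (hΩ : Bornology.IsBounded Ω) (hn : 1 ≤ n) :
    (goodCells a Ω n).Finite := (finite_nodes ha hΩ hn).subset (goodCells_subset_nodes ha hn)

lemma cellO_subset_cell (k : Idx) : cellO (a / n) k ⊆ cell a n k := by
  intro y hy i
  have h1 := hy i
  exact ⟨h1.1.le, by linarith [h1.2]⟩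

lemma isClosed_cell (a : ℝ) (n : ℕ) (k : Idx) : IsClosed (cell a n k) := by
  have : cell a n k = ⋂ i, {y : E3 | y i ∈ Set.Icc (a / n * k i) (a / n * (k i + 1))} := by
    ext; simp [cell]
  rw [this]
  exact isClosed_iInter fun i => isClosed_Icc.preimage (by fun_prop : Continuous fun y : E3 => y i)

lemma meshDomain_eq (a : ℝ) (Ω : Set E3) (n : ℕ) :
    meshDomain a Ω n = ⋃ k ∈ goodCells a Ω n, cell a n k := by
  ext y; simp [meshDomain, goodCells, and_comm]

lemma isClosed_meshDomain (ha : 0 < a) (hΩ : Bornology.IsBounded Ω) (hn : 1 ≤ n) :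
    IsClosed (meshDomain a Ω n) := by
  rw [meshDomain_eq]
  exact (finite_goodCells ha hΩ hn).isClosed_biUnion fun k _ => isClosed_cell a n k

lemma meshDomain_subset : meshDomain a Ω n ⊆ Ω := by
  rintro y ⟨k, hk, hs⟩
  exact hs hk

lemma cell_subset_meshDomain {k : Idx} (hk : k ∈ goodCells a Ω n) :
    cell a n k ⊆ meshDomain a Ω n := fun _ hy => ⟨k, hy, hk⟩

lemma mem_unitCell (ha : 0 < a) (hn : 1 ≤ n) {k : Idx} {y : E3} :
    ((n : ℝ) / a) • y ∈ unitCell k ↔ y ∈ cell a n k := by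
  have hn' : (0 : ℝ) < n := by exact_mod_cast hn
  refine forall_congr' fun i => ?_
  rw [PiLp.smul_apply, smul_eq_mul, div_mul_eq_mul_div, div_mul_eq_mul_div, div_mul_eq_mul_div,
    le_div_iff₀ ha, div_le_iff₀ hn', div_le_iff₀ ha, le_div_iff₀ hn']
  constructor <;> rintro ⟨h1, h2⟩ <;> constructor <;> linarith

lemma P_apply {k : Idx} (hk : k ∈ goodCells a Ω n) {y : E3} (hy : y ∈ cell a n k) (μ : Idx → E3) :
    P a Ω n μ y = interp μ (((n : ℝ) / a) • y) :=
  Set.indicator_of_mem (cell_subset_meshDomain hk hy) _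

/-- In each cell, `k` good or not, a point of an open cell is in `Ω_n` iff the cell is good. -/
lemma mem_meshDomain_iff (ha : 0 < a) (hn : 1 ≤ n) {k : Idx} {y : E3} (hy : y ∈ cellO (a / n) k) :
    y ∈ meshDomain a Ω n ↔ k ∈ goodCells a Ω n := by
  have hh : 0 < a / n := div_pos ha (by exact_mod_cast hn)
  refine ⟨?_, fun hk => cell_subset_meshDomain hk (cellO_subset_cell k hy)⟩
  rintro ⟨l, hl, hs⟩
  suffices h : k = l by rw [h]; exact hs
  ext i
  have h1 := hy i
  have h2 := hl i
  have e1 : a / n * (k i : ℝ) < a / n * ((l i : ℝ) + 1) := by linarith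
  have e2 : a / n * (l i : ℝ) < a / n * ((k i : ℝ) + 1) := by linarith
  have e1' := lt_of_mul_lt_mul_left e1 hh.le
  have e2' := lt_of_mul_lt_mul_left e2 hh.le
  norm_cast at e1' e2'
  omega

lemma P_eq_zero_of_not_good (ha : 0 < a) (hn : 1 ≤ n) {k : Idx} (hk : k ∉ goodCells a Ω n)
    {y : E3} (hy : y ∈ cellO (a / n) k) (μ : Idx → E3) : P a Ω n μ y = 0 :=
  Set.indicator_of_notMem (fun h => hk ((mem_meshDomain_iff ha hn hy).1 h)) _

lemma norm_P_sub_le (ha : 0 < a) (hn : 1 ≤ n) {k : Idx} (hk : k ∈ goodCells a Ω n)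
    {y : E3} (hy : y ∈ cell a n k) (μ : Idx → E3) : ‖P a Ω n μ y - μ k‖ ≤ cellOsc μ k := by
  rw [P_apply hk hy]
  exact norm_interp_sub_le μ ((mem_unitCell ha hn).2 hy)

/-- A local Lipschitz bound bounds the value of `fderiv` at every point, so the faces between
tetrahedra, where P may fail to be differentiable, need no separate treatment. -/
lemma norm_fderiv_P_le (ha : 0 < a) (hn : 1 ≤ n) {k : Idx} (hk : k ∈ goodCells a Ω n)
    {y : E3} (hy : y ∈ cellO (a / n) k) (μ : Idx → E3) (i : Fin 3) :
    ‖fderiv ℝ (P a Ω n μ) y (basisVec i)‖ ≤ 3 * cellOsc μ k / (a / n) := by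
  have hn' : (0 : ℝ) < n := by exact_mod_cast hn
  have h0 : 0 ≤ 3 * cellOsc μ k / (a / n) := by
    have := cellOsc_nonneg μ k
    positivity
  have h1 : ‖fderiv ℝ (P a Ω n μ) y‖ ≤ 3 * cellOsc μ k / (a / n) := by
    refine norm_fderiv_le_of_lip' ℝ h0 ?_
    filter_upwards [(isOpen_cellO _ _).mem_nhds hy] with x hx
    have hx' := cellO_subset_cell k hx
    have hy' := cellO_subset_cell k hy
    rw [P_apply hk hx', P_apply hk hy']
    refine (norm_interp_sub_interp_le μ ((mem_unitCell ha hn).2 hx')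
      ((mem_unitCell ha hn).2 hy')).trans_eq ?_
    rw [← smul_sub, norm_smul, Real.norm_of_nonneg (by positivity)]
    field_simp
  refine ((fderiv ℝ (P a Ω n μ) y).le_opNorm _).trans ?_
  simpa [basisVec] using h1

lemma fderiv_P_eq_zero (ha : 0 < a) (hΩ : Bornology.IsBounded Ω) (hn : 1 ≤ n) {y : E3}
    (hy : y ∉ meshDomain a Ω n) (μ : Idx → E3) : fderiv ℝ (P a Ω n μ) y = 0 := by
  have : P a Ω n μ =ᶠ[𝓝 y] fun _ => 0 := by
    filter_upwards [(isClosed_meshDomain ha hΩ hn).isOpen_compl.mem_nhds hy] with x hx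
    exact Set.indicator_of_notMem hx _
  rw [this.fderiv_eq, fderiv_fun_const]; rfl

/-- Sum of the squared differences along the edges of a cell. -/
def edgeSum (μ : Idx → E3) (k : Idx) : ℝ :=
  ∑ j ∈ corners, ∑ i, if j i = 0 then ‖μ (k + j + Pi.single i 1) - μ (k + j)‖ ^ 2 else 0

lemma edgeSum_nonneg (μ : Idx → E3) (k : Idx) : 0 ≤ edgeSum μ k := by
  unfold edgeSum; positivity

lemma edge_le_edgeSum (μ : Idx → E3) (k : Idx) {j : Idx} (hj : j ∈ corners) {i : Fin 3}
    (hi : j i = 0) : ‖μ (k + j + Pi.single i 1) - μ (k + j)‖ ^ 2 ≤ edgeSum μ k := by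
  set f : Idx → Fin 3 → ℝ := fun j i =>
    if j i = 0 then ‖μ (k + j + Pi.single i 1) - μ (k + j)‖ ^ 2 else 0 with hf
  have h0 (j : Idx) (i : Fin 3) : 0 ≤ f j i := by simp only [hf]; positivity
  have h1 : f j i ≤ ∑ i, f j i := Finset.single_le_sum (fun i _ => h0 j i) (Finset.mem_univ i)
  have h2 : ∑ i, f j i ≤ edgeSum μ k :=
    Finset.single_le_sum (f := fun j => ∑ i, f j i)
      (fun j _ => Finset.sum_nonneg fun i _ => h0 j i) hj
  have h3 : f j i = ‖μ (k + j + Pi.single i 1) - μ (k + j)‖ ^ 2 := if_pos hi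
  rw [← h3]
  exact h1.trans h2

/-- Walk from the corner to the lowest one along at most three edges, resetting one coordinate at a
time. -/
lemma norm_corner_sub_le (μ : Idx → E3) (k : Idx) {j : Idx} (hj : j ∈ corners) :
    ‖μ (k + j) - μ k‖ ≤ 3 * √(edgeSum μ k) := by
  have step {j : Idx} (hj : j ∈ corners) (i : Fin 3) : Function.update j i 0 ∈ corners ∧
      ‖μ (k + j) - μ (k + Function.update j i 0)‖ ≤ √(edgeSum μ k) := by
    have hmem : Function.update j i 0 ∈ corners := by
      rw [mem_corners] at hj ⊢
      intro m
      by_cases hm : m = i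
      · subst hm; simp
      · simp [hm, hj m]
    refine ⟨hmem, ?_⟩
    rcases mem_corners.1 hj i with h | h
    · have : Function.update j i 0 = j := by rw [← h]; simp
      rw [this]; simp
    · have e : k + j = k + Function.update j i 0 + Pi.single i 1 := by
        ext m
        by_cases hm : m = i
        · subst hm; simp [h]
        · simp [hm]
      rw [e]
      exact Real.le_sqrt_of_sq_le (edge_le_edgeSum μ k hmem (by simp))
  obtain ⟨h1, e1⟩ := step hj 0
  obtain ⟨h2, e2⟩ := step h1 1
  obtain ⟨h3, e3⟩ := step h2 2
  have e : Function.update (Function.update (Function.update j 0 0) 1 0) 2 0 = 0 := by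
    ext m; fin_cases m <;> simp [Function.update]
  rw [e, add_zero] at e3
  set x1 := μ (k + Function.update j 0 0)
  set x2 := μ (k + Function.update (Function.update j 0 0) 1 0)
  have := norm_sub_le_norm_sub_add_norm_sub (μ (k + j)) x1 (μ k)
  have := norm_sub_le_norm_sub_add_norm_sub x1 x2 (μ k)
  linarith

lemma cellOsc_le (μ : Idx → E3) (k : Idx) : cellOsc μ k ≤ 24 * √(edgeSum μ k) := by
  calc cellOsc μ k ≤ ∑ j ∈ corners, 3 * √(edgeSum μ k) :=
        Finset.sum_le_sum fun j hj => norm_corner_sub_le μ k hj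
    _ = _ := by rw [Finset.sum_const, card_corners, nsmul_eq_mul]; ring

lemma cellOsc_sq_le (μ : Idx → E3) (k : Idx) : cellOsc μ k ^ 2 ≤ 576 * edgeSum μ k := by
  have := pow_le_pow_left₀ (cellOsc_nonneg μ k) (cellOsc_le μ k) 2
  rw [mul_pow, Real.sq_sqrt (edgeSum_nonneg _ _)] at this
  linarith

/-- The gradient of the interpolation controls the differences at an even corner. -/
lemma corner_le_lintegral (ha : 0 < a) (hn : 1 ≤ n) {k : Idx} (hk : k ∈ goodCells a Ω n)
    (μ : Idx → E3) {j : Idx} (hj : j ∈ corners) (he : Even (∑ i, (k + j) i)) (i : Fin 3) :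
    ENNReal.ofReal (a / n * ‖μ (k + j + Pi.single i (1 - 2 * j i)) - μ (k + j)‖ ^ 2) ≤
      27 * ∫⁻ y in cellO (a / n) k, ‖fderiv ℝ (P a Ω n μ) y (basisVec i)‖ₑ ^ 2 := by
  have hn' : (0 : ℝ) < n := by exact_mod_cast hn
  have hh : 0 < a / n := div_pos ha hn'
  set h := a / n with hdef
  have hjm := mem_corners.1 hj
  set s : Idx := fun m => 1 - 2 * j m with hs
  have hs1 (m : Fin 3) : s m = 1 ∨ s m = -1 := by
    rcases hjm m with e | e <;> simp [hs, e]
  set D := μ (k + j + Pi.single i (1 - 2 * j i)) - μ (k + j) with hD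
  -- The cube of side h/3 at the corner k + j. It lies in the corner tetrahedron, where the
  -- derivative in direction e_i is ±D/h; its volume h³/27 accounts for the factor 27.
  set B := openBox (fun m => h * k m + 2 / 3 * h * j m) (h / 3) with hB
  have hBsub : B ⊆ cellO h k := by
    intro y hy m
    have h1 := hy m
    rcases hjm m with e | e <;> simp only [e] at h1 <;> push_cast at h1 <;>
      constructor <;> linarith
  have hder : ∀ y ∈ B, ‖fderiv ℝ (P a Ω n μ) y (basisVec i)‖ₑ ^ 2 =
      ENNReal.ofReal ((h⁻¹ * ‖D‖) ^ 2) := by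
    intro y hy
    have hloc : P a Ω n μ =ᶠ[𝓝 y] fun x => interp μ (((n : ℝ) / a) • x) := by
      filter_upwards [(isOpen_cellO h k).mem_nhds (hBsub hy)] with x hx
      exact P_apply hk (cellO_subset_cell k hx) μ
    have hna : (n : ℝ) / a = h⁻¹ := by rw [hdef, inv_div]
    have hz (m : Fin 3) : 0 < (s m : ℝ) * ((((n : ℝ) / a) • y) m - ((k + j) m : ℤ)) ∧
        (s m : ℝ) * ((((n : ℝ) / a) • y) m - ((k + j) m : ℤ)) < 1 / 3 := by
      have h1 := hy m
      have e0 : (((n : ℝ) / a) • y) m = y m / h := by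
        rw [hna, PiLp.smul_apply, smul_eq_mul, inv_mul_eq_div]
      rw [e0]
      have h2 : y m = y m / h * h := (div_mul_cancel₀ _ hh.ne').symm
      set q := y m / h
      rw [h2] at h1
      rcases hjm m with e | e <;> simp only [hs, e, Pi.add_apply] at h1 ⊢ <;> push_cast at h1 ⊢ <;>
        constructor <;> nlinarith
    have h3 := hasFDerivAt_interp_corner μ (k + j) s he hs1 _ (fun m => (hz m).1)
      (fun m => (hz m).2) i
    have h4 : ‖fderiv ℝ (P a Ω n μ) y (basisVec i)‖ = h⁻¹ * ‖D‖ := by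
      rw [hloc.fderiv_eq, fderiv_comp_smul, smul_apply, h3, norm_smul, norm_smul,
        hna, Real.norm_of_nonneg (inv_pos.2 hh).le]
      have : ‖((s i : ℤ) : ℝ)‖ = 1 := by rcases hs1 i with e | e <;> simp [e]
      rw [this, one_mul]
    rw [← ofReal_norm, ← ENNReal.ofReal_pow (norm_nonneg _), h4]
  calc ENNReal.ofReal (h * ‖D‖ ^ 2)
      = 27 * (ENNReal.ofReal ((h⁻¹ * ‖D‖) ^ 2) * volume B) := by
        rw [hB, volume_openBox _ (by positivity), ← ENNReal.ofReal_mul (by positivity),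
          show (27 : ℝ≥0∞) = ENNReal.ofReal 27 by simp, ← ENNReal.ofReal_mul (by positivity)]
        congr 1
        field_simp
        norm_num
    _ = 27 * ∫⁻ y in B, ‖fderiv ℝ (P a Ω n μ) y (basisVec i)‖ₑ ^ 2 := by
        rw [setLIntegral_congr_fun (isOpen_openBox _ _).measurableSet hder, setLIntegral_const]
    _ ≤ _ := by gcongr

/-- One of the two endpoints of an edge is even, and the gradient near that endpoint sees the edge.
-/
lemma edge_le_lintegral (ha : 0 < a) (hn : 1 ≤ n) {k : Idx} (hk : k ∈ goodCells a Ω n)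
    (μ : Idx → E3) {j : Idx} (hj : j ∈ corners) {i : Fin 3} (hi : j i = 0) :
    ENNReal.ofReal (a / n * ‖μ (k + j + Pi.single i 1) - μ (k + j)‖ ^ 2) ≤
      27 * ∫⁻ y in cellO (a / n) k, ‖fderiv ℝ (P a Ω n μ) y (basisVec i)‖ₑ ^ 2 := by
  by_cases he : Even (∑ i, (k + j) i)
  · have := corner_le_lintegral ha hn hk μ hj he i
    simpa [hi] using this
  · have hj' : j + Pi.single i 1 ∈ corners := by
      rw [mem_corners] at hj ⊢
      intro m
      by_cases hm : m = i
      · subst hm; simp [hi]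
      · simp [hm, hj m]
    have he' : Even (∑ m, (k + (j + Pi.single i 1) : Idx) m) := by
      have : ∑ m, (k + (j + Pi.single i 1) : Idx) m = ∑ m, (k + j) m + 1 := by
        simp [Finset.sum_add_distrib, add_assoc]
      rw [this]
      exact (Int.not_even_iff_odd.1 he).add_one
    have := corner_le_lintegral ha hn hk μ hj' he' i
    have e : k + (j + Pi.single i 1) + Pi.single i (1 - 2 * (j + Pi.single i 1 : Idx) i) = k + j := by
      ext m
      by_cases hm : m = i
      · subst hm; simp [hi]
      · simp [hm]
    rw [e, norm_sub_rev, ← add_assoc] at this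
    exact this

/-- The gradient on the cell is used once for each of the eight corners: 216 = 8 · 27. -/
lemma edgeSum_le_lintegral (ha : 0 < a) (hn : 1 ≤ n) {k : Idx} (hk : k ∈ goodCells a Ω n)
    (μ : Idx → E3) : ENNReal.ofReal (a / n * edgeSum μ k) ≤
      216 * ∑ i, ∫⁻ y in cellO (a / n) k, ‖fderiv ℝ (P a Ω n μ) y (basisVec i)‖ₑ ^ 2 := by
  have hh : 0 < a / n := div_pos ha (by exact_mod_cast hn)
  unfold edgeSum
  simp_rw [Finset.mul_sum]
  rw [ENNReal.ofReal_sum_of_nonneg (fun j _ => by positivity)]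
  have hj (j : Idx) (hj : j ∈ corners) : ENNReal.ofReal (∑ i, a / n *
      if j i = 0 then ‖μ (k + j + Pi.single i 1) - μ (k + j)‖ ^ 2 else 0) ≤
      27 * ∑ i, ∫⁻ y in cellO (a / n) k, ‖fderiv ℝ (P a Ω n μ) y (basisVec i)‖ₑ ^ 2 := by
    rw [ENNReal.ofReal_sum_of_nonneg (fun i _ => by positivity), Finset.mul_sum]
    refine Finset.sum_le_sum fun i _ => ?_
    split_ifs with hi
    · exact edge_le_lintegral ha hn hk μ hj hi
    · simp
  refine (Finset.sum_le_sum hj).trans_eq ?_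
  rw [Finset.sum_const, card_corners, nsmul_eq_mul, ← Finset.mul_sum, ← mul_assoc]
  norm_num

end

/-! ### Sobolev regularity of the interpolation -/

section

variable {a : ℝ} {n : ℕ} {Ω : Set E3}

/-- The values of μ off Ω are arbitrary and may be unbounded. They do not enter cells contained in
Ω, so they are replaced by zero, which leaves a finite sum of Lipschitz hat functions. -/
lemma exists_lipschitz_P (ha : 0 < a) (hΩ : Bornology.IsBounded Ω) (hn : 1 ≤ n) (μ : Idx → E3) :
    ∃ (F : E3 → E3) (C : NNReal), LipschitzWith C F ∧
      P a Ω n μ = (meshDomain a Ω n).indicator F := by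
  classical
  have hf := finite_nodes ha hΩ hn
  obtain ⟨C, hC⟩ := exists_lipschitzWith_interp (μ := fun k => if k ∈ nodes a Ω n then μ k else 0)
    (s := hf.toFinset) (fun k hk => if_neg (by simpa using hk))
  refine ⟨fun y => interp (fun k => if k ∈ nodes a Ω n then μ k else 0) (((n : ℝ) / a) • y), _,
    hC.comp (lipschitzWith_smul ((n : ℝ) / a)), ?_⟩
  refine Set.indicator_congr fun y hy => ?_
  obtain ⟨k, hk, hs⟩ := hy
  exact interp_congr ((mem_unitCell ha hn).2 hk) fun j hj =>
    (if_pos (mem_nodes_of_good ha hn hs hj)).symm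

lemma isBounded_meshDomain (hΩ : Bornology.IsBounded Ω) :
    Bornology.IsBounded (meshDomain a Ω n) := hΩ.subset meshDomain_subset

lemma isCompact_meshDomain (ha : 0 < a) (hΩ : Bornology.IsBounded Ω) (hn : 1 ≤ n) :
    IsCompact (meshDomain a Ω n) :=
  Metric.isCompact_of_isClosed_isBounded (isClosed_meshDomain ha hΩ hn) (isBounded_meshDomain hΩ)

lemma memLp_of_bounded_support {K : Set E3} (hK : IsCompact K) {f : E3 → E3}
    (hf : AEStronglyMeasurable f volume) (h0 : ∀ x ∉ K, f x = 0) {M : ℝ}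
    (hM : ∀ᵐ x, ‖f x‖ ≤ M) : MemLp f 2 volume := by
  have h1 : f = K.indicator f := by
    ext1 x
    by_cases hx : x ∈ K
    · rw [Set.indicator_of_mem hx]
    · rw [Set.indicator_of_notMem hx, h0 x hx]
  rw [h1, memLp_indicator_iff_restrict hK.measurableSet]
  have : IsFiniteMeasure (volume.restrict K) := ⟨by simpa using hK.measure_lt_top⟩
  exact MemLp.of_bound hf.restrict M (ae_restrict_of_ae hM)

lemma memLp_P (ha : 0 < a) (hΩ : Bornology.IsBounded Ω) (hn : 1 ≤ n) (μ : Idx → E3) :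
    MemLp (P a Ω n μ) 2 volume := by
  obtain ⟨F, C, hF, hP⟩ := exists_lipschitz_P ha hΩ hn μ
  have hK := isCompact_meshDomain ha hΩ hn
  obtain ⟨M, hM⟩ := hK.exists_bound_of_continuousOn hF.continuous.continuousOn
  refine memLp_of_bounded_support hK (M := max M 0) ?_ (fun x hx => Set.indicator_of_notMem hx _)
    (ae_of_all _ fun x => ?_)
  · rw [hP]
    exact hF.continuous.aestronglyMeasurable.indicator hK.measurableSet
  · rw [hP]
    by_cases hx : x ∈ meshDomain a Ω n
    · rw [Set.indicator_of_mem hx]; exact (hM x hx).trans (le_max_left _ _)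
    · rw [Set.indicator_of_notMem hx]; simp

lemma memLp_fderiv_P (ha : 0 < a) (hΩ : Bornology.IsBounded Ω) (hn : 1 ≤ n) (μ : Idx → E3)
    (i : Fin 3) : MemLp (fun y => fderiv ℝ (P a Ω n μ) y (basisVec i)) 2 volume := by
  have hh : 0 < a / n := div_pos ha (by exact_mod_cast hn)
  have hfin := finite_goodCells (Ω := Ω) ha hΩ hn
  have hc (k : Idx) : 0 ≤ 3 * cellOsc μ k / (a / n) := by
    have := cellOsc_nonneg μ k
    positivity
  refine memLp_of_bounded_support (isCompact_meshDomain ha hΩ hn)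
    (M := ∑ k ∈ hfin.toFinset, 3 * cellOsc μ k / (a / n))
    (measurable_fderiv_apply_const ℝ _ _).aestronglyMeasurable
    (fun x hx => by rw [fderiv_P_eq_zero ha hΩ hn hx]; rfl) ?_
  filter_upwards [ae_mem_cellO hh] with y ⟨k, hk⟩
  by_cases hg : k ∈ goodCells a Ω n
  · exact (norm_fderiv_P_le ha hn hg hk μ i).trans (Finset.single_le_sum
      (f := fun k => 3 * cellOsc μ k / (a / n)) (fun k _ => hc k) (hfin.mem_toFinset.2 hg))
  · rw [fderiv_P_eq_zero ha hΩ hn (fun h => hg ((mem_meshDomain_iff ha hn hk).1 h))]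
    simpa using Finset.sum_nonneg fun k _ => hc k

/-- Componentwise integration by parts for Lipschitz functions, which are differentiable almost
everywhere by Rademacher's theorem. -/
lemma integral_smul_lipschitz {F : E3 → E3} {C : NNReal} (hF : LipschitzWith C F) {φ : E3 → ℝ}
    (hφ : ContDiff ℝ ∞ φ) (hc : HasCompactSupport φ) (v : E3) :
    ∫ x, fderiv ℝ φ x v • F x = - ∫ x, φ x • fderiv ℝ F x v := by
  have hφd : Differentiable ℝ φ := hφ.differentiable (by simp)
  obtain ⟨D, hD⟩ := ContDiff.lipschitzWith_of_hasCompactSupport hc hφ (by simp)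
  have hI1 : Integrable (fun x => fderiv ℝ φ x v • F x) :=
    (((hφ.continuous_fderiv (by simp)).clm_apply continuous_const).smul hF.continuous).integrable_of_hasCompactSupport
      ((hc.fderiv_apply (𝕜 := ℝ) v).smul_right)
  have hI2 : Integrable (fun x => φ x • fderiv ℝ F x v) := by
    refine (((hφ.continuous.integrable_of_hasCompactSupport hc).norm.mul_const (C * ‖v‖))).mono'
      (hφ.continuous.aestronglyMeasurable.smul
        (measurable_fderiv_apply_const ℝ _ _).aestronglyMeasurable) (ae_of_all _ fun x => ?_)
    rw [norm_smul]
    gcongr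
    exact (ContinuousLinearMap.le_opNorm _ _).trans
      (by gcongr; exact norm_fderiv_le_of_lipschitz ℝ hF)
  ext j
  have hp (f : E3 → E3) (hf : Integrable f) : (∫ x, f x) j = ∫ x, f x j ∂volume :=
    ((EuclideanSpace.proj j : E3 →L[ℝ] ℝ).integral_comp_comm (μ := volume) hf).symm
  have hFj : LipschitzWith C (fun x => F x j) := by
    refine LipschitzWith.of_dist_le_mul fun x y => le_trans ?_ (hF.dist_le_mul x y)
    rw [Real.dist_eq, dist_eq_norm]
    exact abs_apply_le_norm (F x - F y) j
  have key := hFj.integral_lineDeriv_mul_eq (μ := volume) hD hc v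
  rw [PiLp.neg_apply, hp _ hI1, hp _ hI2, ← integral_neg]
  have e1 : ∫ x, lineDeriv ℝ φ x (-v) * F x j = - ∫ x, (fderiv ℝ φ x v • F x) j := by
    rw [← integral_neg]
    refine integral_congr_ae (ae_of_all _ fun x => ?_)
    simp [(hφd x).lineDeriv_eq_fderiv]
  have e2 : ∫ x, lineDeriv ℝ (fun x => F x j) x v * φ x = ∫ x, (φ x • fderiv ℝ F x v) j := by
    refine integral_congr_ae ?_
    filter_upwards [hF.ae_differentiableAt (μ := volume)] with x hx
    have h1 : HasFDerivAt (fun x => F x j)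
      ((EuclideanSpace.proj j : E3 →L[ℝ] ℝ).comp (fderiv ℝ F x)) x :=
      (EuclideanSpace.proj j : E3 →L[ℝ] ℝ).hasFDerivAt.comp x hx.hasFDerivAt
    rw [h1.differentiableAt.lineDeriv_eq_fderiv, h1.fderiv]
    simp [mul_comm]
  rw [e1, e2] at key
  rw [integral_neg, key, neg_neg]

/-- P coincides with a Lipschitz function on Ω_n but may jump to zero across the boundary of Ω_n, so
the weak derivative is claimed only in the interior of Ω_n. -/
lemma isWeakPartial_P (ha : 0 < a) (hΩ : Bornology.IsBounded Ω) (hn : 1 ≤ n) (μ : Idx → E3)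
    (i : Fin 3) : IsWeakPartial (interior (meshDomain a Ω n)) i (P a Ω n μ)
      (fun y => fderiv ℝ (P a Ω n μ) y (basisVec i)) := by
  obtain ⟨F, C, hF, hP⟩ := exists_lipschitz_P ha hΩ hn μ
  intro φ hφ hc hs
  rw [interior_interior] at hs
  set M := interior (meshDomain a Ω n) with hM
  have hPF {x : E3} (hx : x ∈ M) : P a Ω n μ =ᶠ[𝓝 x] F := by
    filter_upwards [isOpen_interior.mem_nhds hx] with y hy
    rw [hP, Set.indicator_of_mem (interior_subset hy)]
  have h0 {x : E3} (hx : x ∉ M) : φ x = 0 :=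
    image_eq_zero_of_notMem_tsupport fun h => hx (hs h)
  have h1 {x : E3} (hx : x ∉ M) : fderiv ℝ φ x (basisVec i) = 0 :=
    image_eq_zero_of_notMem_tsupport (f := fun x => fderiv ℝ φ x (basisVec i))
      fun h => hx (hs (tsupport_fderiv_apply_subset ℝ _ h))
  calc ∫ x in M, fderiv ℝ φ x (basisVec i) • P a Ω n μ x
      = ∫ x in M, fderiv ℝ φ x (basisVec i) • F x :=
        setIntegral_congr_fun isOpen_interior.measurableSet fun x hx => by
          simp only [(hPF hx).eq_of_nhds]
    _ = ∫ x, fderiv ℝ φ x (basisVec i) • F x :=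
        setIntegral_eq_integral_of_forall_compl_eq_zero fun x hx => by rw [h1 hx, zero_smul]
    _ = - ∫ x, φ x • fderiv ℝ F x (basisVec i) := integral_smul_lipschitz hF hφ hc _
    _ = - ∫ x in M, φ x • fderiv ℝ F x (basisVec i) := by
        rw [setIntegral_eq_integral_of_forall_compl_eq_zero fun x hx => by rw [h0 hx, zero_smul]]
    _ = _ := by
        congr 1
        exact setIntegral_congr_fun isOpen_interior.measurableSet fun x hx => by
          simp only [(hPF hx).fderiv_eq]

end

/-! ### Riemann sums against converging spin distributions -/

lemma norm_le_two_mul_of_abs_le {x : E3} {h : ℝ} (hh : 0 ≤ h) (hx : ∀ i, |x i| ≤ h) :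
    ‖x‖ ≤ 2 * h := by
  rw [EuclideanSpace.norm_eq]
  refine Real.sqrt_le_iff.2 ⟨by positivity, ?_⟩
  have (i : Fin 3) : ‖x i‖ ^ 2 ≤ h ^ 2 := by
    rw [Real.norm_eq_abs]; exact pow_le_pow_left₀ (abs_nonneg _) (hx i) 2
  rw [Fin.sum_univ_three]
  nlinarith [this 0, this 1, this 2]

lemma card_mul_le_volume {h : ℝ} (hh : 0 < h) {s : Finset Idx} {T : Set E3}
    (hT : ∀ k ∈ s, cellO h k ⊆ T) (hfin : volume T ≠ ⊤) : h ^ 3 * s.card ≤ (volume T).toReal := by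
  have h1 := sum_lintegral_cellO_le hh hT (fun _ => 1)
  simp only [setLIntegral_const, one_mul, volume_cellO hh.le, Finset.sum_const, nsmul_eq_mul] at h1
  have h2 := ENNReal.toReal_mono hfin h1
  rw [ENNReal.toReal_mul, ENNReal.toReal_ofReal (by positivity), ENNReal.toReal_natCast] at h2
  linarith

lemma integral_eq_sum_cellO {h : ℝ} (hh : 0 < h) {f : E3 → ℝ} (hf : Integrable f) (s : Finset Idx)
    (h0 : ∀ k ∉ s, ∀ y ∈ cellO h k, f y = 0) : ∫ y, f y = ∑ k ∈ s, ∫ y in cellO h k, f y := by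
  rw [← integral_biUnion_finset s (fun k _ => measurableSet_cellO h k)
    (fun k _ l _ hkl => disjoint_cellO hh hkl) (fun k _ => hf.integrableOn)]
  refine (setIntegral_eq_integral_of_ae_compl_eq_zero ?_).symm
  filter_upwards [ae_mem_cellO hh] with y ⟨k, hk⟩ hy
  exact h0 k (fun hks => hy (Set.mem_biUnion hks hk)) y hk

section

variable {a : ℝ} {n : ℕ} {Ω : Set E3}

lemma dist_le_of_mem_cell (ha : 0 < a) {k : Idx} {x y : E3} (hx : x ∈ cell a n k)
    (hy : y ∈ cell a n k) : dist x y ≤ 2 * (a / n) := by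
  rw [dist_eq_norm]
  refine norm_le_two_mul_of_abs_le (by positivity) fun i => ?_
  rw [PiLp.sub_apply, abs_le]
  have h1 := hx i
  have h2 := hy i
  constructor <;> nlinarith

lemma isPreconnected_cell (a : ℝ) (n : ℕ) (k : Idx) : IsPreconnected (cell a n k) := by
  refine Convex.isPreconnected fun x hx y hy s t hs ht hst i => ?_
  have h1 := hx i
  have h2 := hy i
  simp only [PiLp.add_apply, PiLp.smul_apply, smul_eq_mul]
  obtain rfl : s = 1 - t := by linarith
  constructor <;> nlinarith

lemma node_mem_cell (ha : 0 < a) (hn : 1 ≤ n) (k : Idx) : node a n k ∈ cell a n k := by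
  simpa using node_add_mem_cell ha hn (k := k) (j := 0) (mem_corners.2 (by simp))

/-- The cell of a node in `Ω` that is not contained in `Ω` is close to the boundary. -/
lemma cell_subset_layer (ha : 0 < a) (hn : 1 ≤ n) {k : Idx} (hk : k ∈ nodes a Ω n)
    (hg : k ∉ goodCells a Ω n) : cell a n k ⊆ Metric.cthickening (2 * (a / n)) (frontier Ω) := by
  obtain ⟨x, hx, hxc⟩ := exists_frontier_of_not_subset (isPreconnected_cell a n k) hk
    (node_mem_cell ha hn k) hg
  exact fun y hy => mem_cthickening_of_dist hx (dist_le_of_mem_cell ha hy hxc)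

lemma tendsto_mesh (a c : ℝ) : Tendsto (fun n : ℕ => c * (a / n)) atTop (𝓝 0) := by
  simpa using (tendsto_const_div_atTop_nhds_zero_nat a).const_mul c

/-- The open cells of these nodes are disjoint and lie in a layer of width 2h around the frontier,
whose volume tends to 0. -/
lemma tendsto_card_bad (ha : 0 < a) (hΩ : Bornology.IsBounded Ω) (hcone : UniformConeProperty Ω) :
    ∀ ε > 0, ∀ᶠ n : ℕ in atTop, ∀ s : Finset Idx,
      (∀ k ∈ s, k ∈ nodes a Ω n ∧ k ∉ goodCells a Ω n) → (a / n) ^ 3 * s.card ≤ ε := by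
  intro ε hε
  have h1 := tendsto_measure_layer hΩ hcone volume Measure.AbsolutelyContinuous.rfl
    (tendsto_mesh a 2)
  filter_upwards [h1.eventually_lt_const (ENNReal.ofReal_pos.2 hε), eventually_ge_atTop 1]
    with n hv hn s hs
  have hh : 0 < a / n := div_pos ha (by exact_mod_cast hn)
  refine (card_mul_le_volume hh (fun k hk => (cellO_subset_cell k).trans
    (cell_subset_layer ha hn (hs k hk).1 (hs k hk).2)) (ne_top_of_lt hv)).trans ?_
  rw [← ENNReal.toReal_ofReal hε.le]
  exact ENNReal.toReal_mono ENNReal.ofReal_ne_top hv.le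

lemma exists_card_nodes_le (ha : 0 < a) (hΩ : Bornology.IsBounded Ω) :
    ∃ V : ℝ, 0 ≤ V ∧ ∀ n : ℕ, 1 ≤ n → ∀ s : Finset Idx, (∀ k ∈ s, k ∈ nodes a Ω n) →
      (a / n) ^ 3 * s.card ≤ V := by
  obtain ⟨R, hR⟩ := hΩ.subset_closedBall 0
  refine ⟨(volume (Metric.closedBall (0 : E3) (R + 2 * a))).toReal, ENNReal.toReal_nonneg,
    fun n hn s hs => ?_⟩
  have hn' : (1 : ℝ) ≤ n := by exact_mod_cast hn
  have hh : 0 < a / n := div_pos ha (by linarith)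
  refine card_mul_le_volume hh (fun k hk y hy => ?_) measure_closedBall_lt_top.ne
  have h1 := dist_latt_lt hh hy
  have h2 : dist (latt (a / n) k) 0 ≤ R := hR (hs k hk)
  have h3 : a / n ≤ a := div_le_self ha.le hn'
  rw [Metric.mem_closedBall]
  linarith [dist_triangle y (latt (a / n) k) 0]

/-- The sum over a cell of the discrete Dirichlet energy. -/
def meshEnergy (a : ℝ) (Ω : Set E3) (n : ℕ) (μ : Idx → E3) : ℝ :=
  a / n * ∑ᶠ k ∈ goodCells a Ω n, edgeSum μ k

/-- Three errors are estimated: replacing Ψ by ψ at the nodes, dropping the few nodes whose cell is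
not inside Ω, and comparing on each good cell the nodal value with the integral. The last one uses
the oscillation of ψ and that of P, the latter through the mesh energy. -/
lemma abs_sum_sub_integral_le (ha : 0 < a) (hΩ : Bornology.IsBounded Ω) (hn : 1 ≤ n)
    {μ Ψ : Idx → E3} {ψ : E3 → E3} (hψ : Continuous ψ) {M V ε B C : ℝ} (hε : 0 < ε) (hM0 : 0 ≤ M)
    (hM : ∀ x ∈ Ω, ‖ψ x‖ ≤ M) (hosc : ∀ x ∈ Ω, ∀ y ∈ Ω, dist x y ≤ 2 * (a / n) → ‖ψ x - ψ y‖ ≤ ε)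
    (hΨ : ∀ k ∈ nodes a Ω n, ‖Ψ k - ψ (node a n k)‖ ≤ ε)
    (hV : ∀ s : Finset Idx, (∀ k ∈ s, k ∈ nodes a Ω n) → (a / n) ^ 3 * s.card ≤ V)
    (hbad : ∀ s : Finset Idx, (∀ k ∈ s, k ∈ nodes a Ω n ∧ k ∉ goodCells a Ω n) →
      (a / n) ^ 3 * s.card ≤ ε ^ 2)
    (hB : (a / n) ^ 3 * ∑ᶠ k ∈ nodes a Ω n, ‖μ k‖ ^ 2 ≤ B) (hC : meshEnergy a Ω n μ ≤ C)
    (hh : a / n ≤ ε) :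
    |(a / n) ^ 3 * ∑ᶠ k ∈ nodes a Ω n, inner ℝ (Ψ k) (μ k) -
      ∫ x in Ω, inner ℝ (P a Ω n μ x) (ψ x)| ≤
      ε * (2 * (V + B) + M * (1 + B) + 12 * M * (V + C)) := by
  classical
  have hh0 : 0 < a / n := div_pos ha (by exact_mod_cast hn)
  set h := a / n with hhdef
  set N := (finite_nodes ha hΩ hn).toFinset with hN
  set G := (finite_goodCells ha hΩ hn).toFinset with hG
  have hGN : G ⊆ N := by
    intro k hk
    simp only [hG, hN, Set.Finite.mem_toFinset] at hk ⊢
    exact goodCells_subset_nodes ha hn hk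
  have hNm {k : Idx} (hk : k ∈ N) : k ∈ nodes a Ω n := by simpa [hN] using hk
  have hGm {k : Idx} (hk : k ∈ G) : k ∈ goodCells a Ω n := by simpa [hG] using hk
  rw [finsum_mem_eq_finite_toFinset_sum _ (finite_nodes ha hΩ hn)] at hB ⊢
  rw [meshEnergy, finsum_mem_eq_finite_toFinset_sum _ (finite_goodCells ha hΩ hn)] at hC
  rw [← hN] at hB ⊢
  rw [← hG, ← hhdef] at hC
  have hPL := memLp_P ha hΩ hn μ
  have hI : ∫ x in Ω, inner ℝ (P a Ω n μ x) (ψ x) =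
      ∑ k ∈ G, ∫ y in cellO h k, inner ℝ (P a Ω n μ y) (ψ y) := by
    rw [setIntegral_eq_integral_of_forall_compl_eq_zero]
    · refine integral_eq_sum_cellO hh0 ?_ G fun k hk y hy => ?_
      · have hK := isCompact_meshDomain ha hΩ hn
        have : (fun y => inner ℝ (P a Ω n μ y) (ψ y)) = fun y =>
            inner ℝ (P a Ω n μ y) ((meshDomain a Ω n).indicator ψ y) := by
          ext y
          by_cases hy : y ∈ meshDomain a Ω n
          · rw [Set.indicator_of_mem hy]
          · rw [Set.indicator_of_notMem hy, P, Set.indicator_of_notMem hy]; simp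
        rw [this]
        refine memLp_inner_integrable hPL ((memLp_indicator_iff_restrict hK.measurableSet).2 ?_)
        have : IsFiniteMeasure (volume.restrict (meshDomain a Ω n)) :=
          ⟨by simpa using hK.measure_lt_top⟩
        exact MemLp.of_bound hψ.aestronglyMeasurable M
          ((ae_restrict_iff' hK.measurableSet).2 (ae_of_all _ fun x hx => hM x (meshDomain_subset hx)))
      · rw [P_eq_zero_of_not_good ha hn (fun h' => hk ((Set.Finite.mem_toFinset _).2 h')) hy,
          inner_zero_left]
    · intro x hx
      rw [P, Set.indicator_of_notMem (fun h' => hx (meshDomain_subset h')), inner_zero_left]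
  -- the contribution of a cell
  have hcell {k : Idx} (hk : k ∈ G) : |h ^ 3 * inner ℝ (ψ (node a n k)) (μ k) -
      ∫ y in cellO h k, inner ℝ (P a Ω n μ y) (ψ y)| ≤
      (ε * (1 + ‖μ k‖ ^ 2) + M * (12 * (h + edgeSum μ k / h))) * h ^ 3 := by
    have hk' := hGm hk
    have hvol : (volume (cellO h k)).toReal = h ^ 3 := by
      rw [volume_cellO hh0.le, ENNReal.toReal_ofReal (by positivity)]
    have hvf : volume (cellO h k) < ⊤ := by rw [volume_cellO hh0.le]; exact ENNReal.ofReal_lt_top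
    have hint : IntegrableOn (fun y => inner ℝ (P a Ω n μ y) (ψ y)) (cellO h k) := by
      have : IsFiniteMeasure (volume.restrict (cellO h k)) := ⟨by simpa using hvf⟩
      refine memLp_inner_integrable (hPL.restrict _) (MemLp.of_bound hψ.aestronglyMeasurable M
        ((ae_restrict_iff' (measurableSet_cellO h k)).2 (ae_of_all _ fun x hx => hM x
          (hk' (cellO_subset_cell k hx)))))
    have e1 : h ^ 3 * inner ℝ (ψ (node a n k)) (μ k) =
        ∫ y in cellO h k, inner ℝ (ψ (node a n k)) (μ k) := by
      rw [setIntegral_const, smul_eq_mul, measureReal_def, hvol]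
    have hconst : IntegrableOn (fun _ => (inner ℝ (ψ (node a n k)) (μ k) : ℝ)) (cellO h k) :=
      integrableOn_const hvf.ne
    rw [e1, ← integral_sub (G := ℝ) hconst hint, ← hvol, ← measureReal_def,
      ← Real.norm_eq_abs]
    refine norm_setIntegral_le_of_norm_le_const hvf fun y hy => ?_
    have hyc := cellO_subset_cell k hy
    have b1 : ‖ψ (node a n k) - ψ y‖ ≤ ε := hosc _ (goodCells_subset_nodes ha hn hk') _ (hk' hyc)
      (dist_le_of_mem_cell ha (node_mem_cell ha hn k) hyc)
    have b2 := norm_P_sub_le ha hn hk' hyc μ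
    have b3 := hM y (hk' hyc)
    -- Young's inequality 2q ≤ h + q²/h. The weight h is chosen such that, after multiplication by
    -- h³ and summation, a factor h remains in front of volume plus mesh energy.
    have b4 : cellOsc μ k ≤ 12 * (h + edgeSum μ k / h) := by
      refine (cellOsc_le μ k).trans ?_
      have h1 := Real.sq_sqrt (edgeSum_nonneg μ k)
      set q := √(edgeSum μ k)
      rw [← h1]
      have : 0 ≤ (h - q) ^ 2 / h := by positivity
      have e : (h - q) ^ 2 / h = h + q ^ 2 / h - 2 * q := by field_simp; ring
      linarith
    have e2 : inner ℝ (ψ (node a n k)) (μ k) - inner ℝ (P a Ω n μ y) (ψ y) =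
        inner ℝ (ψ (node a n k) - ψ y) (μ k) - inner ℝ (P a Ω n μ y - μ k) (ψ y) := by
      rw [inner_sub_left, inner_sub_left, real_inner_comm (ψ y) (μ k)]; ring
    rw [e2]
    refine (norm_sub_le _ _).trans (add_le_add ((norm_inner_le_norm _ _).trans ?_)
      ((norm_inner_le_norm _ _).trans ?_))
    · have : ‖μ k‖ ≤ 1 + ‖μ k‖ ^ 2 := by nlinarith [sq_nonneg (‖μ k‖ - 1), norm_nonneg (μ k)]
      exact mul_le_mul b1 this (norm_nonneg _) hε.le
    · rw [mul_comm]
      exact mul_le_mul b3 (b2.trans b4) (norm_nonneg _) hM0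
  have split : h ^ 3 * ∑ k ∈ N, inner ℝ (Ψ k) (μ k) =
      h ^ 3 * ∑ k ∈ N, inner ℝ (Ψ k - ψ (node a n k)) (μ k) +
      h ^ 3 * ∑ k ∈ N \ G, inner ℝ (ψ (node a n k)) (μ k) +
      ∑ k ∈ G, h ^ 3 * inner ℝ (ψ (node a n k)) (μ k) := by
    rw [← Finset.mul_sum, add_assoc, ← mul_add, ← mul_add, Finset.sum_sdiff hGN,
      ← Finset.sum_add_distrib]
    simp [inner_sub_left]
  have t1 : |h ^ 3 * ∑ k ∈ N, inner ℝ (Ψ k - ψ (node a n k)) (μ k)| ≤ ε * (V + B) := by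
    rw [abs_mul, abs_of_nonneg (by positivity : (0 : ℝ) ≤ h ^ 3)]
    calc h ^ 3 * |∑ k ∈ N, inner ℝ (Ψ k - ψ (node a n k)) (μ k)|
        ≤ h ^ 3 * ∑ k ∈ N, ε * (1 + ‖μ k‖ ^ 2) := by
          gcongr
          refine (Finset.abs_sum_le_sum_abs _ _).trans (Finset.sum_le_sum fun k hk => ?_)
          refine (abs_real_inner_le_norm _ _).trans ?_
          have : ‖μ k‖ ≤ 1 + ‖μ k‖ ^ 2 := by nlinarith [sq_nonneg (‖μ k‖ - 1), norm_nonneg (μ k)]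
          exact mul_le_mul (hΨ k (hNm hk)) this (norm_nonneg _) hε.le
      _ = ε * (h ^ 3 * N.card + h ^ 3 * ∑ k ∈ N, ‖μ k‖ ^ 2) := by
          rw [← Finset.mul_sum, Finset.sum_add_distrib, Finset.sum_const, nsmul_eq_mul]; ring
      _ ≤ ε * (V + B) := by
          gcongr
          exact hV N fun k hk => hNm hk
  have t2 : |h ^ 3 * ∑ k ∈ N \ G, inner ℝ (ψ (node a n k)) (μ k)| ≤ ε * (M * (1 + B)) := by
    rw [abs_mul, abs_of_nonneg (by positivity : (0 : ℝ) ≤ h ^ 3)]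
    calc h ^ 3 * |∑ k ∈ N \ G, inner ℝ (ψ (node a n k)) (μ k)|
        ≤ h ^ 3 * ∑ k ∈ N \ G, M * (ε⁻¹ + ε * ‖μ k‖ ^ 2) := by
          gcongr
          refine (Finset.abs_sum_le_sum_abs _ _).trans (Finset.sum_le_sum fun k hk => ?_)
          refine (abs_real_inner_le_norm _ _).trans ?_
          -- Young's inequality with weight ε: the bad nodes have total volume at most ε², so both
          -- summands contribute O(ε).
          have : ‖μ k‖ ≤ ε⁻¹ + ε * ‖μ k‖ ^ 2 := by
            have h1 : 0 ≤ (1 - ε * ‖μ k‖) ^ 2 / ε := by positivity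
            have e : (1 - ε * ‖μ k‖) ^ 2 / ε = ε⁻¹ + ε * ‖μ k‖ ^ 2 - 2 * ‖μ k‖ := by
              field_simp; ring
            linarith [norm_nonneg (μ k)]
          exact mul_le_mul (hM _ (hNm (Finset.mem_sdiff.1 hk).1)) this (norm_nonneg _) hM0
      _ = M * (ε⁻¹ * (h ^ 3 * (N \ G).card) + ε * (h ^ 3 * ∑ k ∈ N \ G, ‖μ k‖ ^ 2)) := by
          rw [← Finset.mul_sum, Finset.sum_add_distrib, Finset.sum_const, nsmul_eq_mul,
            ← Finset.mul_sum]
          ring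
      _ ≤ M * (ε⁻¹ * ε ^ 2 + ε * B) := by
          gcongr
          · refine hbad _ fun k hk => ⟨hNm (Finset.mem_sdiff.1 hk).1, fun h' =>
              (Finset.mem_sdiff.1 hk).2 ((Set.Finite.mem_toFinset _).2 h')⟩
          · refine le_trans ?_ hB
            gcongr
            exact Finset.sdiff_subset
      _ = ε * (M * (1 + B)) := by field_simp
  have t3 : |∑ k ∈ G, h ^ 3 * inner ℝ (ψ (node a n k)) (μ k) -
      ∑ k ∈ G, ∫ y in cellO h k, inner ℝ (P a Ω n μ y) (ψ y)| ≤
      ε * (V + B) + ε * (12 * M * (V + C)) := by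
    rw [← Finset.sum_sub_distrib]
    refine (Finset.abs_sum_le_sum_abs _ _).trans ((Finset.sum_le_sum fun k hk => hcell hk).trans ?_)
    have e : ∑ k ∈ G, (ε * (1 + ‖μ k‖ ^ 2) + M * (12 * (h + edgeSum μ k / h))) * h ^ 3 =
        ε * (h ^ 3 * G.card + h ^ 3 * ∑ k ∈ G, ‖μ k‖ ^ 2) +
        h * (12 * M * (h ^ 3 * G.card + h * ∑ k ∈ G, edgeSum μ k)) := by
      simp only [add_mul, mul_add, Finset.sum_add_distrib, Finset.sum_const, nsmul_eq_mul,
        Finset.mul_sum, mul_one]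
      have : ∀ k, M * (12 * (edgeSum μ k / h)) * h ^ 3 = h * (12 * M * (h * edgeSum μ k)) := by
        intro k; field_simp
      simp only [this]
      have : ∀ k, ε * ‖μ k‖ ^ 2 * h ^ 3 = ε * (h ^ 3 * ‖μ k‖ ^ 2) := by intro k; ring
      simp only [this]
      ring
    rw [e]
    have g1 : h ^ 3 * G.card ≤ V := hV G fun k hk => hNm (hGN hk)
    have g2 : h ^ 3 * ∑ k ∈ G, ‖μ k‖ ^ 2 ≤ B := by
      refine le_trans ?_ hB
      gcongr
    have g3 : 0 ≤ h ^ 3 * G.card + h * ∑ k ∈ G, edgeSum μ k :=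
      add_nonneg (by positivity) (mul_nonneg hh0.le
        (Finset.sum_nonneg fun k _ => edgeSum_nonneg μ k))
    gcongr
  rw [split, hI]
  have := abs_add_three (h ^ 3 * ∑ k ∈ N, inner ℝ (Ψ k - ψ (node a n k)) (μ k))
    (h ^ 3 * ∑ k ∈ N \ G, inner ℝ (ψ (node a n k)) (μ k))
    (∑ k ∈ G, h ^ 3 * inner ℝ (ψ (node a n k)) (μ k) -
      ∑ k ∈ G, ∫ y in cellO h k, inner ℝ (P a Ω n μ y) (ψ y))
  rw [add_sub_assoc]
  linarith

/-- Riemann sums of converging spin distributions against continuous functions converge. -/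
lemma tendsto_sum_inner (ha : 0 < a) (hΩ : Bornology.IsBounded Ω) (hcone : UniformConeProperty Ω)
    {μ : ℕ → Idx → E3} {m : E3 → E3} (hB : BoundedSpins a Ω μ)
    (hP : ∀ v : E3 → E3, MemLp v 2 (volume.restrict Ω) →
      Tendsto (fun n => ∫ x in Ω, inner ℝ (P a Ω n (μ n) x) (v x)) atTop
        (𝓝 (∫ x in Ω, inner ℝ (m x) (v x))))
    {C : ℝ} (hC : ∀ᶠ n in atTop, meshEnergy a Ω n (μ n) ≤ C) {ψ : E3 → E3} (hψ : Continuous ψ)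
    {Ψ : ℕ → Idx → E3}
    (hΨ : ∀ ε > 0, ∀ᶠ n in atTop, ∀ k ∈ nodes a Ω n, ‖Ψ n k - ψ (node a n k)‖ ≤ ε) :
    Tendsto (fun n : ℕ => (a / n) ^ 3 * ∑ᶠ k ∈ nodes a Ω n, inner ℝ (Ψ n k) (μ n k)) atTop
      (𝓝 (∫ x in Ω, inner ℝ (ψ x) (m x))) := by
  obtain ⟨B, hB⟩ := hB
  obtain ⟨V, hV0, hV⟩ := exists_card_nodes_le ha hΩ
  obtain ⟨R, hR⟩ := hΩ.subset_closedBall 0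
  have hK : IsCompact (Metric.closedBall (0 : E3) R) := isCompact_closedBall _ _
  obtain ⟨M', hM'⟩ := hK.exists_bound_of_continuousOn hψ.continuousOn
  set M := max M' 0
  have hM (x : E3) (hx : x ∈ Ω) : ‖ψ x‖ ≤ M := (hM' x (hR hx)).trans (le_max_left _ _)
  have huc := hK.uniformContinuousOn_of_continuous hψ.continuousOn
  have hψm : MemLp ψ 2 (volume.restrict Ω) := by
    have hfin : IsFiniteMeasure (volume.restrict Ω) := ⟨by simpa using hΩ.measure_lt_top⟩
    have h1 := hfin
    rw [restrict_interior hcone] at h1 ⊢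
    exact MemLp.of_bound hψ.aestronglyMeasurable M ((ae_restrict_iff'
      isOpen_interior.measurableSet).2 (ae_of_all _ fun x hx => hM x (interior_subset hx)))
  have hlim := hP ψ hψm
  simp_rw [real_inner_comm (ψ _) (m _)] at hlim
  set K := 2 * (V + B ^ 2) + M * (1 + B ^ 2) + 12 * M * (V + max C 0) with hKdef
  have hM0 : 0 ≤ M := le_max_right _ _
  have hK0 : 0 ≤ K := by positivity
  have hdiff : Tendsto (fun n : ℕ => (a / n) ^ 3 * ∑ᶠ k ∈ nodes a Ω n, inner ℝ (Ψ n k) (μ n k) -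
      ∫ x in Ω, inner ℝ (P a Ω n (μ n) x) (ψ x)) atTop (𝓝 0) := by
    rw [Metric.tendsto_nhds]
    intro δ hδ
    set ε := δ / (K + 1) with hεdef
    have hε : 0 < ε := by positivity
    obtain ⟨η, hη, hη'⟩ := Metric.uniformContinuousOn_iff_le.1 huc ε hε
    have hsmall := (tendsto_mesh a 1).eventually_le_const hε
    have hsmall' := (tendsto_mesh a 2).eventually_le_const hη
    filter_upwards [hC, hΨ ε hε, tendsto_card_bad ha hΩ hcone (ε ^ 2) (by positivity), hsmall,
      hsmall', eventually_ge_atTop 1] with n h1 h2 h3 h4 h5 hn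
    rw [Real.dist_eq, sub_zero]
    refine (abs_sum_sub_integral_le ha hΩ hn hψ hε hM0 hM (fun x hx y hy hxy => ?_) h2 (hV n hn) h3
      (hB n hn) (h1.trans (le_max_left C 0)) (by linarith)).trans_lt ?_
    · rw [← dist_eq_norm]
      exact hη' x (hR hx) y (hR hy) (hxy.trans h5)
    · rw [← hKdef, hεdef, div_mul_eq_mul_div, div_lt_iff₀ (by positivity)]
      nlinarith
  have := hdiff.add hlim
  simp only [sub_add_cancel, zero_add] at this
  exact this

end

/-! ### Uniform bounds and the exchange energy as a sum over edges -/

lemma weakPartial_spec {Ω : Set E3} {m : E3 → E3} (hm : MemH1 Ω m) (i : Fin 3) :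
    MemLp (weakPartial Ω i m) 2 (volume.restrict Ω) ∧ IsWeakPartial Ω i m (weakPartial Ω i m) := by
  unfold weakPartial
  rw [dif_pos (hm.2 i)]
  exact (hm.2 i).choose_spec

/-- A weakly convergent sequence in `L²` is bounded. -/
lemma exists_integral_sq_le {α : Type*} [MeasurableSpace α] {ν : Measure α} {f : ℕ → α → E3}
    (hf : ∀ n, MemLp (f n) 2 ν)
    (h : ∀ v, MemLp v 2 ν → ∃ L, Tendsto (fun n => ∫ x, inner ℝ (f n x) (v x) ∂ν) atTop (𝓝 L)) :
    ∃ C, ∀ n, ∫ x, ‖f n x‖ ^ 2 ∂ν ≤ C := by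
  obtain ⟨C, hC⟩ := banach_steinhaus (g := fun n => innerSL ℝ ((hf n).toLp (f n))) fun v => by
    obtain ⟨L, hL⟩ := h v (Lp.memLp v)
    obtain ⟨C, hC⟩ := (Metric.isBounded_range_of_tendsto _ hL).exists_norm_le
    refine ⟨C, fun n => ?_⟩
    have e : v = (Lp.memLp v).toLp v := (Lp.toLp_coeFn v _).symm
    rw [innerSL_apply_apply, e, inner_toLp]
    exact hC _ ⟨n, rfl⟩
  refine ⟨C ^ 2, fun n => ?_⟩
  rw [← norm_toLp_sq (hf n)]
  have := hC n
  rw [innerSL_apply_norm] at this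
  exact pow_le_pow_left₀ (norm_nonneg _) this 2

section

variable {a : ℝ} {n : ℕ} {Ω : Set E3}

lemma meshEnergy_le (ha : 0 < a) (hΩ : Bornology.IsBounded Ω) (hn : 1 ≤ n) (μ : Idx → E3) :
    meshEnergy a Ω n μ ≤
      216 * ∑ i, ∫ y in Ω, ‖fderiv ℝ (P a Ω n μ) y (basisVec i)‖ ^ 2 := by
  have hh : 0 < a / n := div_pos ha (by exact_mod_cast hn)
  have hfin := finite_goodCells (Ω := Ω) ha hΩ hn
  have h0 (i : Fin 3) : 0 ≤ ∫ y in Ω, ‖fderiv ℝ (P a Ω n μ) y (basisVec i)‖ ^ 2 :=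
    integral_nonneg fun _ => by positivity
  rw [meshEnergy, finsum_mem_eq_finite_toFinset_sum _ hfin]
  refine (ENNReal.ofReal_le_ofReal_iff (mul_nonneg (by norm_num)
    (Finset.sum_nonneg fun i _ => h0 i))).1 ?_
  rw [Finset.mul_sum, ENNReal.ofReal_sum_of_nonneg
    (fun k _ => mul_nonneg hh.le (edgeSum_nonneg μ k)), ENNReal.ofReal_mul (by norm_num),
    ENNReal.ofReal_sum_of_nonneg (fun i _ => h0 i)]
  refine (Finset.sum_le_sum fun k hk =>
    edgeSum_le_lintegral ha hn (hfin.mem_toFinset.1 hk) μ).trans ?_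
  rw [← Finset.mul_sum, Finset.sum_comm]
  norm_num
  refine mul_le_mul_right (Finset.sum_le_sum fun i _ => ?_) _
  rw [← lintegral_enorm_sq ((memLp_fderiv_P ha hΩ hn μ i).restrict Ω)]
  exact sum_lintegral_cellO_le hh
    (fun k hk => (cellO_subset_cell k).trans (hfin.mem_toFinset.1 hk)) _

/-- The uniform boundedness principle for the weakly convergent gradients. The index is shifted by
one because level 0 has the degenerate mesh size a/0 = 0. -/
lemma ConvergesTo.exists_meshEnergy_le (ha : 0 < a) (hΩ : Bornology.IsBounded Ω)
    {μ : ℕ → Idx → E3} {m : E3 → E3} (h : ConvergesTo a Ω μ m) :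
    ∃ C, ∀ n, 1 ≤ n → ∑ i, ∫ y in Ω, ‖fderiv ℝ (P a Ω n (μ n)) y (basisVec i)‖ ^ 2 ≤ C := by
  have key (i : Fin 3) : ∃ C, ∀ n : ℕ,
      ∫ y in Ω, ‖fderiv ℝ (P a Ω (n + 1) (μ (n + 1))) y (basisVec i)‖ ^ 2 ≤ C :=
    exists_integral_sq_le (fun n => (memLp_fderiv_P ha hΩ (by omega) _ i).restrict Ω)
      fun v hv => ⟨_, ((tendsto_add_atTop_iff_nat 1).2 ((h.2 v hv).2 i))⟩
  choose C hC using key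
  refine ⟨∑ i, C i, fun n hn => Finset.sum_le_sum fun i _ => ?_⟩
  obtain ⟨n, rfl⟩ : ∃ k, n = k + 1 := ⟨n - 1, by omega⟩
  exact hC i n

lemma mem_layer_of_mem_cell (ha : 0 < a) {k : Idx} {y : E3} (hy : y ∈ Ω) (hyk : y ∈ cell a n k)
    (hg : k ∉ goodCells a Ω n) : y ∈ Metric.cthickening (2 * (a / n)) (frontier Ω) := by
  obtain ⟨x, hx, hxc⟩ := exists_frontier_of_not_subset (isPreconnected_cell a n k) hy hyk hg
  exact mem_cthickening_of_dist hx (dist_le_of_mem_cell ha hyk hxc)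

/-- The layer estimate is applied to the finite measure with density f on the interior, which is
absolutely continuous. -/
lemma tendsto_lintegral_layer (hΩ : Bornology.IsBounded Ω) (hcone : UniformConeProperty Ω)
    {f : E3 → ℝ≥0∞} (hfin : ∫⁻ y in interior Ω, f y ≠ ⊤) {δ : ℕ → ℝ}
    (hδ : Tendsto δ atTop (𝓝 0)) :
    Tendsto (fun n => ∫⁻ y in interior Ω ∩ Metric.cthickening (δ n) (frontier Ω), f y) atTop
      (𝓝 0) := by
  have h1 : IsFiniteMeasure ((volume.restrict (interior Ω)).withDensity f) :=
    isFiniteMeasure_withDensity hfin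
  have h2 := tendsto_measure_layer hΩ hcone ((volume.restrict (interior Ω)).withDensity f)
    ((withDensity_absolutelyContinuous _ _).trans Measure.restrict_le_self.absolutelyContinuous) hδ
  refine h2.congr fun n => ?_
  rw [withDensity_apply _ Metric.isClosed_cthickening.measurableSet,
    Measure.restrict_restrict Metric.isClosed_cthickening.measurableSet, Set.inter_comm]

open Classical in
/-- The exchange energy as a sum over the edges of the lattice. -/
lemma exchangeN_eq (ha : 0 < a) (hΩ : Bornology.IsBounded Ω) (hn : 1 ≤ n) (A : ℝ) (μ : Idx → E3) :
    exchangeN a A Ω n μ = 2 * A * (a / n * ∑ k ∈ (finite_nodes ha hΩ hn).toFinset,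
      ∑ i, if k + Pi.single i 1 ∈ nodes a Ω n then ‖μ (k + Pi.single i 1) - μ k‖ ^ 2 else 0) := by
  have hfin := finite_nodes (Ω := Ω) ha hΩ hn
  have hs (i j : Fin 3) (s t : ℤ) (hs : s ≠ 0) (h : (Pi.single i s : Idx) = Pi.single j t) :
      i = j ∧ s = t := by
    have h1 := congrFun h i
    by_cases hij : i = j
    · subst hij; simpa using h1
    · simp [hij, hs] at h1
  have hneg (i : Fin 3) : -(Pi.single i 1 : Idx) = Pi.single i (-1) := by
    ext m; by_cases hm : m = i
    · subst hm; simp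
    · simp [hm]
  have hnb (k : Idx) (f : Idx → ℝ) : ∑ᶠ l ∈ neighbours a Ω n k, f l =
      (∑ i, if k + Pi.single i 1 ∈ nodes a Ω n then f (k + Pi.single i 1) else 0) +
      ∑ i, if k - Pi.single i 1 ∈ nodes a Ω n then f (k - Pi.single i 1) else 0 := by
    have e : neighbours a Ω n k = ↑(((Finset.univ.image fun i : Fin 3 => k + Pi.single i 1) ∪
        (Finset.univ.image fun i : Fin 3 => k - Pi.single i 1)).filter (· ∈ nodes a Ω n)) := by
      ext l
      simp only [neighbours, Set.mem_ofPred_eq, Finset.coe_filter, Finset.mem_union,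
        Finset.mem_image, Finset.mem_univ, true_and]
      constructor
      · rintro ⟨h1, i, h2 | h2⟩
        · exact ⟨Or.inl ⟨i, h2.symm⟩, h1⟩
        · exact ⟨Or.inr ⟨i, h2.symm⟩, h1⟩
      · rintro ⟨⟨i, h2⟩ | ⟨i, h2⟩, h1⟩
        · exact ⟨h1, i, Or.inl h2.symm⟩
        · exact ⟨h1, i, Or.inr h2.symm⟩
    rw [e, finsum_mem_coe_finset, Finset.sum_filter, Finset.sum_union, Finset.sum_image,
      Finset.sum_image]
    · intro i _ j _ h
      simp only [sub_eq_add_neg, hneg, add_right_inj] at h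
      exact (hs i j _ _ (by norm_num) h).1
    · intro i _ j _ h
      simp only [add_right_inj] at h
      exact (hs i j _ _ (by norm_num) h).1
    · rw [Finset.disjoint_left]
      intro l h1 h2
      obtain ⟨i, -, rfl⟩ := Finset.mem_image.1 h1
      obtain ⟨j, -, h⟩ := Finset.mem_image.1 h2
      simp only [sub_eq_add_neg, hneg, add_right_inj] at h
      exact absurd (hs j i _ _ (by norm_num) h).2 (by norm_num)
  set N := hfin.toFinset with hN
  have hNm {k : Idx} : k ∈ N ↔ k ∈ nodes a Ω n := hfin.mem_toFinset
  -- Every edge is counted from both endpoints; the shift by e_i identifies the two counts and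
  -- produces the factor 2.
  have hswap : ∑ k ∈ N, ∑ i, (if k - Pi.single i 1 ∈ nodes a Ω n then
      A * ‖μ (k - Pi.single i 1) - μ k‖ ^ 2 else 0) =
      ∑ k ∈ N, ∑ i, if k + Pi.single i 1 ∈ nodes a Ω n then
      A * ‖μ (k + Pi.single i 1) - μ k‖ ^ 2 else 0 := by
    rw [Finset.sum_comm, Finset.sum_comm (s := N)]
    refine Finset.sum_congr rfl fun i _ => ?_
    rw [← Finset.sum_filter, ← Finset.sum_filter]
    refine Finset.sum_nbij' (fun k => k - Pi.single i 1) (fun k => k + Pi.single i 1) ?_ ?_ ?_ ?_ ?_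
    · intro k hk
      rw [Finset.mem_filter, hNm] at hk ⊢
      rw [sub_add_cancel]
      exact ⟨hk.2, hk.1⟩
    · intro k hk
      rw [Finset.mem_filter, hNm] at hk ⊢
      rw [add_sub_cancel_right]
      exact ⟨hk.2, hk.1⟩
    · intro k _; exact sub_add_cancel _ _
    · intro k _; exact add_sub_cancel_right _ _
    · intro k _; rw [sub_add_cancel, norm_sub_rev]
  unfold exchangeN
  rw [finsum_mem_eq_finite_toFinset_sum _ hfin]
  simp_rw [hnb]
  rw [Finset.sum_add_distrib, ← hN, hswap, ← two_mul]
  have : ∀ k i, (if k + Pi.single i 1 ∈ nodes a Ω n then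
      A * ‖μ (k + Pi.single i 1) - μ k‖ ^ 2 else 0) =
      A * if k + Pi.single i 1 ∈ nodes a Ω n then ‖μ (k + Pi.single i 1) - μ k‖ ^ 2 else 0 := by
    intro k i; split_ifs <;> simp
  simp_rw [this, ← Finset.mul_sum]
  ring

lemma UnitSpins.boundedSpins (ha : 0 < a) (hΩ : Bornology.IsBounded Ω) {μ : ℕ → Idx → E3}
    (h : UnitSpins a Ω μ) : BoundedSpins a Ω μ := by
  obtain ⟨V, hV0, hV⟩ := exists_card_nodes_le ha hΩ
  refine ⟨√V, fun n hn => ?_⟩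
  have hfin := finite_nodes (Ω := Ω) ha hΩ hn
  rw [Real.sq_sqrt hV0, finsum_mem_eq_finite_toFinset_sum _ hfin]
  rw [Finset.sum_congr rfl fun k hk => by rw [h n hn k (hfin.mem_toFinset.1 hk), one_pow]]
  simpa using hV n hn hfin.toFinset fun k hk => hfin.mem_toFinset.1 hk

end

/-! ### The lower bound -/

lemma tendsto_inner_of_strong {α : Type*} [MeasurableSpace α] {ν : Measure α} {f : ℕ → α → E3}
    {m v : α → E3} (hf : ∀ n, 1 ≤ n → MemLp (f n) 2 ν) (hm : MemLp m 2 ν) (hv : MemLp v 2 ν)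
    (h : Tendsto (fun n => ∫⁻ x, ‖f n x - m x‖ₑ ^ 2 ∂ν) atTop (𝓝 0)) :
    Tendsto (fun n => ∫ x, inner ℝ (f n x) (v x) ∂ν) atTop (𝓝 (∫ x, inner ℝ (m x) (v x) ∂ν)) := by
  rw [tendsto_iff_norm_sub_tendsto_zero]
  have h1 : Tendsto (fun n => √(∫⁻ x, ‖f n x - m x‖ₑ ^ 2 ∂ν).toReal * √(∫ x, ‖v x‖ ^ 2 ∂ν)) atTop
      (𝓝 0) := by
    have := (ENNReal.tendsto_toReal ENNReal.zero_ne_top).comp h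
    simpa using ((Real.continuous_sqrt.tendsto _).comp this).mul_const (√(∫ x, ‖v x‖ ^ 2 ∂ν))
  refine squeeze_zero' (Eventually.of_forall fun n => norm_nonneg _) ?_ h1
  filter_upwards [eventually_ge_atTop 1] with n hn
  have hd := (hf n hn).sub hm
  rw [← integral_sub (memLp_inner_integrable (hf n hn) hv) (memLp_inner_integrable hm hv)]
  simp_rw [← inner_sub_left]
  refine (integral_inner_le_sqrt hd hv).trans_eq ?_
  have e := lintegral_enorm_sq hd
  simp only [Pi.sub_apply] at e ⊢
  rw [e, ENNReal.toReal_ofReal (integral_nonneg fun _ => by positivity)]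

lemma enorm_sub_sq_le (x y z : E3) : ‖x - z‖ₑ ^ 2 ≤ 2 * ‖x - y‖ₑ ^ 2 + 2 * ‖y - z‖ₑ ^ 2 := by
  simp_rw [← ofReal_norm, ← ENNReal.ofReal_pow (norm_nonneg _)]
  have h2 (t : ℝ) : 2 * ENNReal.ofReal t = ENNReal.ofReal (2 * t) := by
    rw [ENNReal.ofReal_mul (by norm_num)]; simp
  rw [h2, h2, ← ENNReal.ofReal_add (by positivity) (by positivity)]
  refine ENNReal.ofReal_le_ofReal ?_
  have h1 := norm_sub_le_norm_sub_add_norm_sub x y z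
  have h2 := pow_le_pow_left₀ (norm_nonneg _) h1 2
  nlinarith [sq_nonneg (‖x - y‖ - ‖y - z‖)]

/-! ### Strong convergence of interpolations and Riemann sums -/

section

variable {a : ℝ} {Ω : Set E3}

/-- The interpolations converge strongly if the associated step functions do. -/
lemma tendsto_P_strong (ha : 0 < a) (hΩ : Bornology.IsBounded Ω) (hcone : UniformConeProperty Ω)
    {μ : ℕ → Idx → E3} {m : E3 → E3} (hm : MemLp m 2 (volume.restrict Ω)) {C : ℝ}
    (hC : ∀ᶠ n in atTop, meshEnergy a Ω n (μ n) ≤ C) {J : ℕ → ℝ≥0∞} (hJ : Tendsto J atTop (𝓝 0))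
    (hμ : ∀ᶠ n : ℕ in atTop, ∀ s : Finset Idx, (∀ k ∈ s, k ∈ goodCells a Ω n) →
      ∑ k ∈ s, ∫⁻ y in cellO (a / n) k, ‖μ n k - m y‖ₑ ^ 2 ≤ J n) :
    Tendsto (fun n => ∫⁻ y in Ω, ‖P a Ω n (μ n) y - m y‖ₑ ^ 2) atTop (𝓝 0) := by
  have hm' := hm
  rw [restrict_interior hcone] at hm'
  have hlayer := tendsto_lintegral_layer hΩ hcone (f := fun y => ‖m y‖ₑ ^ 2)
    (by rw [lintegral_enorm_sq hm']; exact ENNReal.ofReal_ne_top) (tendsto_mesh a 2)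
  have hmesh : Tendsto (fun n : ℕ => 1152 * ENNReal.ofReal ((a / n) * (a / n) * C)) atTop
      (𝓝 0) := by
    have h1 := tendsto_mesh a 1
    simp only [one_mul] at h1
    have h2 := ENNReal.tendsto_ofReal ((h1.mul h1).mul_const C)
    have := ENNReal.Tendsto.const_mul h2 (Or.inr (by norm_num : (1152 : ℝ≥0∞) ≠ ⊤))
    simpa using this
  have hsum := (hmesh.add (ENNReal.Tendsto.const_mul hJ
    (Or.inr (by norm_num : (2 : ℝ≥0∞) ≠ ⊤)))).add hlayer
  simp only [mul_zero, add_zero] at hsum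
  refine tendsto_of_tendsto_of_tendsto_of_le_of_le' tendsto_const_nhds hsum
    (Eventually.of_forall fun _ => zero_le) ?_
  filter_upwards [hC, hμ, eventually_ge_atTop 1] with n h1 h2 hn
  have hh : 0 < a / n := div_pos ha (by exact_mod_cast hn)
  set G := (finite_goodCells (Ω := Ω) ha hΩ hn).toFinset with hG
  have hGm {k : Idx} (hk : k ∈ G) : k ∈ goodCells a Ω n := by simpa [hG] using hk
  -- The part of Ω that good cells leave uncovered. There P vanishes, and the error is the integral
  -- of |m|² over a thin layer.
  set L := (interior Ω ∩ Metric.cthickening (2 * (a / n)) (frontier Ω)) \ meshDomain a Ω n with hL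
  set f := fun y => ‖P a Ω n (μ n) y - m y‖ₑ ^ 2 with hf
  have hcell {k : Idx} (hk : k ∈ G) : ∫⁻ y in cellO (a / n) k, f y ≤
      1152 * ENNReal.ofReal ((a / n) * (a / n) * (a / n * edgeSum (μ n) k)) +
      2 * ∫⁻ y in cellO (a / n) k, ‖μ n k - m y‖ₑ ^ 2 := by
    calc ∫⁻ y in cellO (a / n) k, f y
        ≤ ∫⁻ y in cellO (a / n) k, (2 * ENNReal.ofReal (576 * edgeSum (μ n) k) +
            2 * ‖μ n k - m y‖ₑ ^ 2) := by
          refine setLIntegral_mono' (measurableSet_cellO _ _) fun y hy => ?_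
          refine (enorm_sub_sq_le _ (μ n k) _).trans ?_
          gcongr
          rw [← ofReal_norm, ← ENNReal.ofReal_pow (norm_nonneg _)]
          refine ENNReal.ofReal_le_ofReal ((pow_le_pow_left₀ (norm_nonneg _)
            (norm_P_sub_le ha hn (hGm hk) (cellO_subset_cell k hy) _) 2).trans (cellOsc_sq_le _ _))
      _ = _ := by
          rw [lintegral_add_left measurable_const, setLIntegral_const, volume_cellO hh.le,
            lintegral_const_mul' _ _ (by norm_num), mul_assoc,
            ← ENNReal.ofReal_mul (mul_nonneg (by norm_num) (edgeSum_nonneg _ _)),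
            show (1152 : ℝ≥0∞) = 2 * ENNReal.ofReal 576 by norm_num, mul_assoc 2,
            ← ENNReal.ofReal_mul (by norm_num)]
          congr 3
          ring
  calc ∫⁻ y in Ω, f y = ∫⁻ y in interior Ω, f y := by rw [restrict_interior hcone]
    _ ≤ ∫⁻ y in (⋃ k ∈ G, cellO (a / n) k) ∪ L, f y := by
        refine lintegral_mono' (Measure.restrict_mono_ae ?_) le_rfl
        filter_upwards [ae_mem_cellO hh] with y ⟨k, hk⟩ hy
        by_cases hg : k ∈ goodCells a Ω n
        · exact Or.inl (Set.mem_biUnion ((Set.Finite.mem_toFinset _).2 hg) hk)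
        · exact Or.inr ⟨⟨hy, mem_layer_of_mem_cell ha (interior_subset hy)
            (cellO_subset_cell k hk) hg⟩, fun h' => hg ((mem_meshDomain_iff ha hn hk).1 h')⟩
    _ ≤ (∫⁻ y in ⋃ k ∈ G, cellO (a / n) k, f y) + ∫⁻ y in L, f y := lintegral_union_le _ _ _
    _ ≤ _ := by
        refine add_le_add ?_ ?_
        · rw [lintegral_biUnion_finset (fun k _ l _ hkl => disjoint_cellO hh hkl)
            (fun k _ => measurableSet_cellO _ k)]
          refine (Finset.sum_le_sum fun k hk => hcell hk).trans ?_
          rw [Finset.sum_add_distrib, ← Finset.mul_sum, ← Finset.mul_sum]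
          gcongr
          · rw [← ENNReal.ofReal_sum_of_nonneg fun k _ => mul_nonneg (by positivity)
              (mul_nonneg hh.le (edgeSum_nonneg _ _)), ← Finset.mul_sum, ← Finset.mul_sum]
            gcongr
            rwa [meshEnergy, finsum_mem_eq_finite_toFinset_sum _ (finite_goodCells ha hΩ hn)] at h1
          · exact h2 G fun k hk => hGm hk
        · refine le_trans (b := ∫⁻ y in L, ‖m y‖ₑ ^ 2) ?_ (lintegral_mono_set Set.sdiff_subset)
          refine setLIntegral_mono' ((isOpen_interior.measurableSet.inter
            Metric.isClosed_cthickening.measurableSet).diff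
            (isClosed_meshDomain ha hΩ hn).measurableSet) fun y hy => ?_
          rw [hf]
          beta_reduce
          rw [P, Set.indicator_of_notMem hy.2, zero_sub, enorm_neg]

lemma meshEnergy_const (n : ℕ) (c : E3) : meshEnergy a Ω n (fun _ => c) = 0 := by
  simp [meshEnergy, edgeSum]

/-- Riemann sums of continuous functions. -/
lemma tendsto_riemann_sum (ha : 0 < a) (hΩ : Bornology.IsBounded Ω) (hcone : UniformConeProperty Ω)
    {f : E3 → ℝ} (hf : Continuous f) :
    Tendsto (fun n : ℕ => (a / n) ^ 3 * ∑ᶠ k ∈ nodes a Ω n, f (node a n k)) atTop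
      (𝓝 (∫ x in Ω, f x)) := by
  have he : ‖basisVec 0‖ = 1 := by simp [basisVec]
  have hfinm : IsFiniteMeasure (volume.restrict Ω) := ⟨by simpa using hΩ.measure_lt_top⟩
  -- A scalar Riemann sum is the pairing of f e₀ with the constant spin e₀, whose mesh energy is
  -- zero.
  have hB : BoundedSpins a Ω (fun _ _ => basisVec 0) :=
    UnitSpins.boundedSpins ha hΩ fun n hn k hk => he
  have hm : MemLp (fun _ => basisVec 0) 2 (volume.restrict Ω) := memLp_const _
  have hs := tendsto_P_strong ha hΩ hcone (μ := fun _ _ => basisVec 0) hm (C := 0)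
    (Eventually.of_forall fun n => (meshEnergy_const n _).le) (J := fun _ => 0)
    tendsto_const_nhds (Eventually.of_forall fun n s hs => by simp)
  have key := tendsto_sum_inner ha hΩ hcone hB (m := fun _ => basisVec 0)
    (fun v hv => tendsto_inner_of_strong (fun n hn => (memLp_P ha hΩ hn _).restrict Ω) hm hv hs)
    (C := 0) (Eventually.of_forall fun n => (meshEnergy_const n _).le)
    (ψ := fun x => f x • basisVec 0) (hf.smul continuous_const)
    (Ψ := fun n k => f (node a n k) • basisVec 0)
    (fun ε hε => Eventually.of_forall fun n k hk => by simpa using hε.le)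
  simpa [inner_smul_left, he] using key

end

/-! ### The exchange energy tested with smooth fields -/

/-- The derivative of a test field is uniformly continuous, so the mean value inequality applies
uniformly in x. The backward quotient is the one that summation by parts produces. -/
lemma IsTestField.exists_diffQuot {U : Set E3} {φ : E3 → E3} (hφ : IsTestField U φ) (e : E3)
    (he : ‖e‖ = 1) : ∀ ε > 0, ∃ δ > 0, ∀ h : ℝ, 0 < h → h < δ → ∀ x,
      ‖h⁻¹ • (φ (x - h • e) - φ x) - -fderiv ℝ φ x e‖ ≤ ε := by
  intro ε hε
  have huc : UniformContinuous (fderiv ℝ φ) :=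
    Continuous.uniformContinuous_of_tendsto_cocompact (x := 0)
      (hφ.contDiff.continuous_fderiv (by simp))
      ((hφ.hasCompactSupport.fderiv ℝ).is_zero_at_infty)
  obtain ⟨δ, hδ, hδ'⟩ := Metric.uniformContinuous_iff.1 huc ε hε
  refine ⟨δ, hδ, fun h hh hhδ x => ?_⟩
  have key := (convex_closedBall x h).norm_image_sub_le_of_norm_fderiv_le' (𝕜 := ℝ) (f := φ)
    (φ := fderiv ℝ φ x) (C := ε) (x := x) (y := x - h • e)
    (fun y _ => (hφ.contDiff.differentiable (by simp)) y)
    (fun y hy => by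
      rw [← dist_eq_norm]; exact (hδ' ((Metric.mem_closedBall.1 hy).trans_lt hhδ)).le)
    (Metric.mem_closedBall_self hh.le)
    (by simp [norm_smul, he, abs_of_pos hh])
  rw [sub_sub_cancel_left, norm_neg, norm_smul, he, Real.norm_of_nonneg hh.le, mul_one, map_neg,
    map_smul, sub_neg_eq_add] at key
  have e1 : h⁻¹ • (φ (x - h • e) - φ x) - -fderiv ℝ φ x e =
      h⁻¹ • (φ (x - h • e) - φ x + h • fderiv ℝ φ x e) := by
    rw [smul_add, inv_smul_smul₀ hh.ne', sub_neg_eq_add]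
  rw [e1, norm_smul, norm_inv, Real.norm_of_nonneg hh.le, inv_mul_le_iff₀ hh, mul_comm]
  exact key

section

variable {a : ℝ} {Ω : Set E3}

lemma node_add_single (a : ℝ) (n : ℕ) (k : Idx) (i : Fin 3) :
    node a n (k + Pi.single i 1) = node a n k + (a / n) • basisVec i := by
  rw [node_eq_latt, latt_add, latt_single, node_eq_latt]

lemma norm_basisVec (i : Fin 3) : ‖basisVec i‖ = 1 := by simp [basisVec]

open Classical in
/-- The exchange energy is bounded below by its linearization at a test field. -/
lemma sum_edges_ge (ha : 0 < a) {n : ℕ} (hn : 1 ≤ n) (N : Finset Idx)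
    (hN : ∀ k, k ∈ N ↔ k ∈ nodes a Ω n) (μ : Idx → E3) {φ : E3 → E3} (i : Fin 3)
    (hφ : ∀ x, φ x ≠ 0 → Metric.closedBall x (a / n) ⊆ Ω) :
    2 * ((a / n) ^ 3 * ∑ k ∈ N,
        inner ℝ ((a / n)⁻¹ • (φ (node a n k - (a / n) • basisVec i) - φ (node a n k))) (μ k)) -
      (a / n) ^ 3 * ∑ k ∈ N, ‖φ (node a n k)‖ ^ 2 ≤
    a / n * ∑ k ∈ N, if k + Pi.single i 1 ∈ nodes a Ω n then
      ‖μ (k + Pi.single i 1) - μ k‖ ^ 2 else 0 := by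
  have hh : 0 < a / n := div_pos ha (by exact_mod_cast hn)
  set h := a / n with hdef
  have hsupp {k : Idx} (hk : φ (node a n k) ≠ 0) : k + Pi.single i 1 ∈ nodes a Ω n := by
    refine hφ _ hk ?_
    rw [node_add_single, ← hdef]
    simp [norm_smul, norm_basisVec, abs_of_pos hh]
  have hsupp' {k : Idx} (hk : φ (node a n k - h • basisVec i) ≠ 0) :
      k - Pi.single i 1 ∈ nodes a Ω n := by
    refine hφ _ hk ?_
    have := node_add_single a n (k - Pi.single i 1) i
    rw [sub_add_cancel, ← hdef] at this
    rw [this, add_sub_cancel_right]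
    exact Metric.mem_closedBall_self hh.le
  -- Summation by parts without boundary terms: where φ does not vanish, the neighbours are still
  -- nodes of Ω.
  have hshift : ∑ k ∈ N, inner ℝ (φ (node a n k)) (μ (k + Pi.single i 1)) =
      ∑ k ∈ N, inner ℝ (φ (node a n k - h • basisVec i)) (μ k) := by
    refine Finset.sum_bij_ne_zero (fun k _ _ => k + Pi.single i 1) ?_ ?_ ?_ ?_
    · intro k _ hk
      exact (hN _).2 (hsupp fun h0 => hk (by rw [h0, inner_zero_left]))
    · intro k _ _ l _ _ hkl
      exact add_right_cancel hkl
    · intro k hk hk0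
      have e : node a n (k - Pi.single i 1) = node a n k - h • basisVec i := by
        have := node_add_single a n (k - Pi.single i 1) i
        rw [sub_add_cancel, ← hdef] at this
        rw [this, add_sub_cancel_right]
      refine ⟨k - Pi.single i 1, (hN _).2 (hsupp' fun h0 => hk0 (by rw [h0, inner_zero_left])), ?_,
        sub_add_cancel _ _⟩
      rwa [e, sub_add_cancel]
    · intro k _ _
      rw [node_add_single, ← hdef, add_sub_cancel_right]
  -- Expansion of ‖D − hφ‖² ≥ 0 for the edge difference D; edges where φ vanishes are simply
  -- estimated below by 0.
  have hterm (k : Idx) : 2 * h * inner ℝ (φ (node a n k)) (μ (k + Pi.single i 1) - μ k) -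
      h ^ 2 * ‖φ (node a n k)‖ ^ 2 ≤ if k + Pi.single i 1 ∈ nodes a Ω n then
      ‖μ (k + Pi.single i 1) - μ k‖ ^ 2 else 0 := by
    by_cases hk : φ (node a n k) = 0
    · rw [hk]; simp only [inner_zero_left, norm_zero]
      split_ifs <;> nlinarith [sq_nonneg ‖μ (k + Pi.single i 1) - μ k‖]
    · rw [if_pos (hsupp hk)]
      have := norm_sub_sq_real (μ (k + Pi.single i 1) - μ k) (h • φ (node a n k))
      rw [inner_smul_right, norm_smul, Real.norm_of_nonneg hh.le, mul_pow,
        real_inner_comm] at this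
      nlinarith [sq_nonneg ‖μ (k + Pi.single i 1) - μ k - h • φ (node a n k)‖]
  have := mul_le_mul_of_nonneg_left (Finset.sum_le_sum fun k (_ : k ∈ N) => hterm k) hh.le
  refine le_trans (le_of_eq ?_) this
  simp_rw [inner_sub_right, inner_smul_left, inner_sub_left, mul_sub, Finset.sum_sub_distrib,
    ← Finset.mul_sum, hshift]
  simp only [conj_trivial]
  field_simp

end

lemma integral_norm_sub_sq {α : Type*} [MeasurableSpace α] {ν : Measure α} {f g : α → E3}
    (hf : MemLp f 2 ν) (hg : MemLp g 2 ν) : ∫ x, ‖f x - g x‖ ^ 2 ∂ν =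
      (∫ x, ‖f x‖ ^ 2 ∂ν) - 2 * (∫ x, inner ℝ (f x) (g x) ∂ν) + ∫ x, ‖g x‖ ^ 2 ∂ν := by
  have h1 := (memLp_inner_integrable hf hg).const_mul 2
  have h2 : Integrable (fun x => ‖f x‖ ^ 2 - 2 * inner ℝ (f x) (g x)) ν :=
    (memLp_sq_integrable hf).sub h1
  rw [← integral_const_mul, ← integral_sub (memLp_sq_integrable hf) h1, ← integral_add h2
    (memLp_sq_integrable hg)]
  exact integral_congr_ae (ae_of_all _ fun x => norm_sub_sq_real _ _)

section

variable {a : ℝ} {Ω : Set E3}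

lemma indicator_P (n : ℕ) (μ : Idx → E3) : Ω.indicator (P a Ω n μ) = P a Ω n μ := by
  refine Set.indicator_eq_self.2 fun y hy => ?_
  by_contra h
  exact hy (Set.indicator_of_notMem (fun h' => h (meshDomain_subset h')) _)

lemma indicator_interior_ae_eq (hcone : UniformConeProperty Ω) (m : E3 → E3) :
    Ω.indicator m =ᵐ[volume] (interior Ω).indicator m :=
  indicator_ae_eq_of_ae_eq_set (ae_eq_interior hcone)

lemma memLp_indicator (hcone : UniformConeProperty Ω) {m : E3 → E3}
    (hm : MemLp m 2 (volume.restrict Ω)) : MemLp ((interior Ω).indicator m) 2 volume := by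
  rw [memLp_indicator_iff_restrict isOpen_interior.measurableSet, ← restrict_interior hcone]
  exact hm

lemma integral_inner_indicator (hcone : UniformConeProperty Ω) (m v : E3 → E3) :
    ∫ x, inner ℝ ((interior Ω).indicator m x) (v x) = ∫ x in Ω, inner ℝ (m x) (v x) := by
  rw [restrict_interior hcone, ← integral_indicator isOpen_interior.measurableSet]
  congr 1
  ext x
  by_cases hx : x ∈ interior Ω
  · simp [Set.indicator_of_mem hx]
  · simp [Set.indicator_of_notMem hx]

lemma integral_inner_P (n : ℕ) (μ : Idx → E3) (v : E3 → E3) :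
    ∫ x, inner ℝ (P a Ω n μ x) (v x) = ∫ x in Ω, inner ℝ (P a Ω n μ x) (v x) := by
  rw [setIntegral_eq_integral_of_forall_compl_eq_zero]
  intro x hx
  rw [P, Set.indicator_of_notMem (fun h' => hx (meshDomain_subset h')), inner_zero_left]

/-- Difference quotients of test fields along the lattice. -/
lemma tendsto_sum_diffQuot (ha : 0 < a) (hΩ : Bornology.IsBounded Ω) (hcone : UniformConeProperty Ω)
    {μ : ℕ → Idx → E3} {m : E3 → E3} (hB : BoundedSpins a Ω μ) (hc : ConvergesTo a Ω μ m)
    {φ : E3 → E3} (i : Fin 3) (hφ : IsTestField (interior Ω) φ) :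
    Tendsto (fun n : ℕ => (a / n) ^ 3 * ∑ᶠ k ∈ nodes a Ω n,
        inner ℝ ((a / n)⁻¹ • (φ (node a n k - (a / n) • basisVec i) - φ (node a n k))) (μ n k)) atTop
      (𝓝 (∫ x in Ω, inner ℝ (weakPartial Ω i m x) (φ x))) := by
  obtain ⟨C, hC⟩ := hc.exists_meshEnergy_le ha hΩ
  have h1 := tendsto_sum_inner ha hΩ hcone hB (fun v hv => (hc.2 v hv).1) (C := 216 * C)
    (by
      filter_upwards [eventually_ge_atTop 1] with n hn
      exact (meshEnergy_le ha hΩ hn _).trans (by gcongr; exact hC n hn))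
    (ψ := fun x => -fderiv ℝ φ x (basisVec i))
    (((hφ.contDiff.continuous_fderiv (by simp)).clm_apply continuous_const).neg)
    (Ψ := fun n k => (a / n)⁻¹ • (φ (node a n k - (a / n) • basisVec i) - φ (node a n k)))
    (fun ε hε => by
      obtain ⟨δ, hδ, hδ'⟩ := hφ.exists_diffQuot (basisVec i) (norm_basisVec i) ε hε
      have hsmall := (tendsto_mesh a 1).eventually_lt_const hδ
      filter_upwards [hsmall, eventually_ge_atTop 1] with n h1 hn k _
      exact hδ' _ (div_pos ha (by exact_mod_cast hn)) (by simpa using h1) _)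
  convert h1 using 2
  have hw := weakPartial_spec hc.1 i
  have h2 := (hw.2.mono interior_subset).inner_eq isOpen_interior
    (by rw [← restrict_interior hcone]; exact hc.1.1)
    (by rw [← restrict_interior hcone]; exact hw.1) hφ
  rw [restrict_interior hcone]
  rw [← neg_eq_iff_eq_neg] at h2
  rw [← h2, ← integral_neg]
  congr 1
  ext x
  rw [inner_neg_left, real_inner_comm]

lemma IsTestField.eventually_closedBall_subset {φ : E3 → E3} (a : ℝ)
    (hφ : IsTestField (interior Ω) φ) :
    ∀ᶠ n : ℕ in atTop, ∀ x, φ x ≠ 0 → Metric.closedBall x (a / n) ⊆ Ω := by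
  obtain ⟨δ, hδ, hδ'⟩ := hφ.hasCompactSupport.isCompact.exists_cthickening_subset_open
    isOpen_interior hφ.tsupport_subset
  filter_upwards [(tendsto_mesh a 1).eventually_le_const hδ] with n hn x hx
  refine (Metric.closedBall_subset_cthickening (subset_tsupport φ hx) _).trans ?_
  refine (Metric.cthickening_mono (by simpa using hn) _).trans (hδ'.trans interior_subset)

/-- The lower bound, up to an arbitrarily small error. -/
lemma eventually_le_energyN (ha : 0 < a) (hΩ : Bornology.IsBounded Ω)
    (hcone : UniformConeProperty Ω) {A μ₀ : ℝ} (hA : 0 < A) (hμ₀ : 0 < μ₀) {hZ : E3 → E3}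
    (hhZ : Continuous hZ) {μ : ℕ → Idx → E3} {m : E3 → E3} (hB : BoundedSpins a Ω μ)
    (hc : ConvergesTo a Ω μ m) {ε : ℝ} (hε : 0 < ε) :
    ∀ᶠ n in atTop, energyInf A μ₀ hZ Ω m - ε ≤ energyN a A μ₀ hZ Ω n (μ n) := by
  classical
  have hw (i : Fin 3) := weakPartial_spec hc.1 i
  -- Three directions with this error each cost 2A · 3 · ε/(12A) = ε/2.
  have hη : 0 < ε / (12 * A) := by positivity
  have hφ' (i : Fin 3) := exists_testField isOpen_interior
    (by rw [← restrict_interior hcone]; exact (hw i).1 :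
      MemLp (weakPartial Ω i m) 2 (volume.restrict (interior Ω))) hη
  choose φ hφ hφg using hφ'
  simp_rw [← restrict_interior hcone] at hφg
  have hfinm : IsFiniteMeasure (volume.restrict Ω) := ⟨by simpa using hΩ.measure_lt_top⟩
  obtain ⟨C, hC⟩ := hc.exists_meshEnergy_le ha hΩ
  -- exchange
  have hexch : Tendsto (fun n : ℕ => 2 * A * ∑ i, (2 * ((a / n) ^ 3 * ∑ᶠ k ∈ nodes a Ω n,
      inner ℝ ((a / n)⁻¹ • (φ i (node a n k - (a / n) • basisVec i) - φ i (node a n k))) (μ n k)) -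
      (a / n) ^ 3 * ∑ᶠ k ∈ nodes a Ω n, ‖φ i (node a n k)‖ ^ 2)) atTop
      (𝓝 (2 * A * ∑ i, (2 * (∫ x in Ω, inner ℝ (weakPartial Ω i m x) (φ i x)) -
        ∫ x in Ω, ‖φ i x‖ ^ 2))) := by
    refine (tendsto_finsetSum _ fun i _ => ?_).const_mul _
    exact ((tendsto_sum_diffQuot ha hΩ hcone hB hc i (hφ i)).const_mul 2).sub
      (tendsto_riemann_sum ha hΩ hcone ((hφ i).contDiff.continuous.norm.pow 2))
  -- demagnetizing energy
  obtain ⟨v, hv, hv1, hv2⟩ := exists_subgradient_demagEnergy hμ₀ (memLp_indicator hcone hc.1.1)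
  rw [integral_inner_indicator hcone,
    ← demagEnergy_congr μ₀ (indicator_interior_ae_eq hcone m)] at hv1
  have hdem := (hc.2 v (hv.restrict Ω)).1
  rw [hv1] at hdem
  -- Zeeman energy
  have hzee := tendsto_sum_inner ha hΩ hcone hB (fun v hv => (hc.2 v hv).1) (C := 216 * C)
    (by
      filter_upwards [eventually_ge_atTop 1] with n hn
      exact (meshEnergy_le ha hΩ hn _).trans (by gcongr; exact hC n hn)) hhZ
    (Ψ := fun n k => hZ (node a n k))
    (fun ε hε => Eventually.of_forall fun n k hk => by simpa using hε.le)
  have htot := (hexch.add hdem).add hzee.neg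
  have hlim : energyInf A μ₀ hZ Ω m - ε < 2 * A * ∑ i, (2 * (∫ x in Ω,
      inner ℝ (weakPartial Ω i m x) (φ i x)) - ∫ x in Ω, ‖φ i x‖ ^ 2) +
      demagEnergy μ₀ (Ω.indicator m) + -∫ x in Ω, inner ℝ (hZ x) (m x) := by
    have hi (i : Fin 3) : 2 * (∫ x in Ω, inner ℝ (weakPartial Ω i m x) (φ i x)) -
        ∫ x in Ω, ‖φ i x‖ ^ 2 = (∫ x in Ω, ‖weakPartial Ω i m x‖ ^ 2) -
          ∫ x in Ω, ‖weakPartial Ω i m x - φ i x‖ ^ 2 := by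
      have hφL := (hφ i).memLp (volume.restrict Ω)
      have e : ∫ x in Ω, ‖weakPartial Ω i m x - φ i x‖ ^ 2 =
          (∫ x in Ω, ‖weakPartial Ω i m x‖ ^ 2) -
          2 * (∫ x in Ω, inner ℝ (weakPartial Ω i m x) (φ i x)) + ∫ x in Ω, ‖φ i x‖ ^ 2 :=
        integral_norm_sub_sq (hw i).1 hφL
      rw [e]; ring
    have h3 : 2 * A * (∑ i, ∫ x in Ω, ‖weakPartial Ω i m x‖ ^ 2) - ε < 2 * A *
        ∑ i, (2 * (∫ x in Ω, inner ℝ (weakPartial Ω i m x) (φ i x)) - ∫ x in Ω, ‖φ i x‖ ^ 2) := by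
      simp_rw [hi]
      rw [Finset.sum_sub_distrib, mul_sub]
      have : ∑ i, ∫ x in Ω, ‖weakPartial Ω i m x - φ i x‖ ^ 2 < ∑ i : Fin 3, ε / (12 * A) :=
        Finset.sum_lt_sum_of_nonempty Finset.univ_nonempty fun i _ => hφg i
      have h4 : 2 * A * ∑ i, ∫ x in Ω, ‖weakPartial Ω i m x - φ i x‖ ^ 2 <
          2 * A * ∑ i : Fin 3, ε / (12 * A) := by gcongr
      have h5 : 2 * A * ∑ i : Fin 3, ε / (12 * A) = ε / 2 := by
        rw [Finset.sum_const]; simp; field_simp; norm_num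
      linarith
    rw [energyInf, integral_finsetSum _ fun i _ => memLp_sq_integrable (hw i).1]
    linarith
  filter_upwards [htot.eventually_const_lt hlim, eventually_ge_atTop 1,
    eventually_all.2 fun i => (hφ i).eventually_closedBall_subset a] with n h1 hn h2
  refine h1.le.trans ?_
  rw [energyN, indicator_P]
  refine add_le_add (add_le_add ?_ ?_) le_rfl
  · rw [exchangeN_eq ha hΩ hn]
    refine mul_le_mul_of_nonneg_left ?_ (by positivity)
    rw [Finset.sum_comm, Finset.mul_sum]
    refine Finset.sum_le_sum fun i _ => ?_
    rw [finsum_mem_eq_finite_toFinset_sum _ (finite_nodes ha hΩ hn),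
      finsum_mem_eq_finite_toFinset_sum _ (finite_nodes ha hΩ hn)]
    exact sum_edges_ge ha hn _ (fun k => Set.Finite.mem_toFinset _) _ i (h2 i)
  · rw [← integral_inner_P]
    exact hv2 _ (memLp_P ha hΩ hn _)

theorem liminfIneq (ha : 0 < a) (hΩ : Bornology.IsBounded Ω)
    (hcone : UniformConeProperty Ω) {A μ₀ : ℝ} (hA : 0 < A) (hμ₀ : 0 < μ₀) {hZ : E3 → E3}
    (hhZ : Continuous hZ) {μ : ℕ → Idx → E3} {m : E3 → E3} (hB : BoundedSpins a Ω μ)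
    (hc : ConvergesTo a Ω μ m) : LiminfIneq a A μ₀ hZ Ω μ m := by
  refine le_of_forall_lt fun c hc' => ?_
  obtain ⟨r, hr1, hr2⟩ := EReal.lt_iff_exists_real_btwn.1 hc'
  have hε : 0 < energyInf A μ₀ hZ Ω m - r := sub_pos.2 (EReal.coe_lt_coe_iff.1 hr2)
  refine hr1.trans_le (le_liminf_of_le (by isBoundedDefault) ?_)
  filter_upwards [eventually_le_energyN ha hΩ hcone hA hμ₀ hhZ hB hc hε] with n hn
  rw [sub_sub_cancel] at hn
  exact EReal.coe_le_coe_iff.2 hn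

end

/-! ### The norm constraint passes to the limit -/

/-- The variance identity, obtained by expanding the square. It turns a bound on double differences
into a comparison of ∫|u|² with |∫u|². -/
lemma lintegral_lintegral_sub_sq {α : Type*} [MeasurableSpace α] {ν : Measure α}
    [IsFiniteMeasure ν] {u : α → E3} (hu : MemLp u 2 ν) :
    ∫⁻ y, ∫⁻ x, ‖u x - u y‖ₑ ^ 2 ∂ν ∂ν =
      ENNReal.ofReal (2 * (ν.real Set.univ * ∫ x, ‖u x‖ ^ 2 ∂ν) - 2 * ‖∫ x, u x ∂ν‖ ^ 2) := by
  have hui : Integrable u ν := hu.integrable (by norm_num)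
  have hin (y : α) : ∫⁻ x, ‖u x - u y‖ₑ ^ 2 ∂ν = ENNReal.ofReal
      ((∫ x, ‖u x‖ ^ 2 ∂ν) - 2 * inner ℝ (∫ x, u x ∂ν) (u y) + ν.real Set.univ * ‖u y‖ ^ 2) := by
    have hc : MemLp (fun _ : α => u y) 2 ν := memLp_const _
    have h1 := lintegral_enorm_sq (hu.sub hc)
    simp only [Pi.sub_apply] at h1
    rw [h1, integral_norm_sub_sq hu hc, integral_const, smul_eq_mul]
    congr 4
    simp_rw [real_inner_comm (u y)]
    exact integral_inner hui (u y)
  simp_rw [hin]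
  have i1 : Integrable (fun y => (∫ x, ‖u x‖ ^ 2 ∂ν) - 2 * inner ℝ (∫ x, u x ∂ν) (u y)) ν :=
    (integrable_const _).sub ((hui.const_inner _).const_mul 2)
  have i2 : Integrable (fun y => ν.real Set.univ * ‖u y‖ ^ 2) ν :=
    (memLp_sq_integrable hu).const_mul _
  have i3 : Integrable (fun y => (∫ x, ‖u x‖ ^ 2 ∂ν) - 2 * inner ℝ (∫ x, u x ∂ν) (u y) +
      ν.real Set.univ * ‖u y‖ ^ 2) ν := i1.add i2
  rw [← ofReal_integral_eq_lintegral_ofReal i3]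
  · congr 1
    rw [integral_add i1 i2, integral_sub (integrable_const _) ((hui.const_inner _).const_mul 2),
      integral_const, integral_const_mul, integral_const_mul, integral_inner hui,
      real_inner_self_eq_norm_sq, smul_eq_mul]
    ring
  · refine ae_of_all _ fun y => ?_
    have hc : MemLp (fun _ : α => u y) 2 ν := memLp_const _
    have h2 : 0 ≤ ∫ x, ‖u x - u y‖ ^ 2 ∂ν := integral_nonneg fun _ => by positivity
    rw [integral_norm_sub_sq hu hc, integral_const, smul_eq_mul] at h2
    have e : ∫ x, inner ℝ (u x) (u y) ∂ν = inner ℝ (∫ x, u x ∂ν) (u y) := by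
      simp_rw [real_inner_comm (u y)]
      exact integral_inner hui (u y)
    rw [e] at h2
    exact h2

section

variable {a : ℝ} {Ω : Set E3}

lemma norm_P_le_one (ha : 0 < a) {n : ℕ} (hn : 1 ≤ n) {μ : Idx → E3}
    (hμ : ∀ k ∈ nodes a Ω n, ‖μ k‖ = 1) (y : E3) : ‖P a Ω n μ y‖ ≤ 1 := by
  by_cases hy : y ∈ meshDomain a Ω n
  · obtain ⟨k, hk, hs⟩ := hy
    rw [P_apply hs hk]
    exact norm_interp_le μ ((mem_unitCell ha hn).2 hk)
      fun j hj => (hμ _ (mem_nodes_of_good ha hn hs hj)).le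
  · rw [P, Set.indicator_of_notMem hy]; simp

/-- The interpolations of unit spins are almost of norm one. -/
lemma tendsto_integral_one_sub (ha : 0 < a) (hΩ : Bornology.IsBounded Ω) {μ : ℕ → Idx → E3}
    (hμ : UnitSpins a Ω μ) {C : ℝ} (hC : ∀ n, 1 ≤ n → meshEnergy a Ω n (μ n) ≤ C) :
    Tendsto (fun n => ∫ y in meshDomain a Ω n, (1 - ‖P a Ω n (μ n) y‖ ^ 2)) atTop (𝓝 0) := by
  obtain ⟨V, hV0, hV⟩ := exists_card_nodes_le (Ω := Ω) ha hΩ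
  refine squeeze_zero' (g := fun n : ℕ => 24 * (V + C) * (a / n)) ?_ ?_ (tendsto_mesh a _)
  · filter_upwards [eventually_ge_atTop 1] with n hn
    exact integral_nonneg fun y => sub_nonneg.2
      (pow_le_one₀ (norm_nonneg _) (norm_P_le_one ha hn (hμ n hn) y))
  filter_upwards [eventually_ge_atTop 1] with n hn
  have hh : 0 < a / n := div_pos ha (by exact_mod_cast hn)
  have hK := isCompact_meshDomain (Ω := Ω) ha hΩ hn
  have hfin := finite_goodCells (Ω := Ω) ha hΩ hn
  set G := hfin.toFinset with hG
  have hGm {k : Idx} (hk : k ∈ G) : k ∈ goodCells a Ω n := by simpa [hG] using hk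
  have hIon : IntegrableOn (fun y => 1 - ‖P a Ω n (μ n) y‖ ^ 2) (meshDomain a Ω n) :=
    (integrableOn_const (C := (1 : ℝ)) hK.measure_lt_top.ne).sub
      (memLp_sq_integrable ((memLp_P ha hΩ hn (μ n)).restrict _))
  rw [← integral_indicator hK.measurableSet, integral_eq_sum_cellO hh
    (hIon.integrable_indicator hK.measurableSet) G (fun k hk y hy => Set.indicator_of_notMem
      (fun h => hk (hfin.mem_toFinset.2 ((mem_meshDomain_iff ha hn hy).1 h))) _)]
  have hcell {k : Idx} (hk : k ∈ G) : ∫ y in cellO (a / n) k, (meshDomain a Ω n).indicator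
      (fun y => 1 - ‖P a Ω n (μ n) y‖ ^ 2) y ≤
      24 * (a / n + edgeSum (μ n) k / (a / n)) * (a / n) ^ 3 := by
    have hvf : volume (cellO (a / n) k) < ⊤ := by
      rw [volume_cellO hh.le]; exact ENNReal.ofReal_lt_top
    have hvol : volume.real (cellO (a / n) k) = (a / n) ^ 3 := by
      rw [measureReal_def, volume_cellO hh.le, ENNReal.toReal_ofReal (by positivity)]
    rw [← hvol]
    refine (Real.le_norm_self _).trans (norm_setIntegral_le_of_norm_le_const hvf fun y hy => ?_)
    have hyc := cellO_subset_cell k hy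
    have hg := hGm hk
    rw [Set.indicator_of_mem (cell_subset_meshDomain hg hyc)]
    have h1 := norm_P_le_one ha hn (hμ n hn) y
    have h2 := norm_P_sub_le ha hn hg hyc (μ n)
    have h3 := hμ n hn k (goodCells_subset_nodes ha hn hg)
    -- The nodal value has norm one, whence 1 − |P|² ≤ 2(1 − |P|) ≤ 2 `cellOsc`; the constant 24 is
    -- 2 · 12.
    have h4 : 1 ≤ ‖P a Ω n (μ n) y‖ + cellOsc (μ n) k := by
      have := norm_sub_norm_le (μ n k) (P a Ω n (μ n) y)
      rw [norm_sub_rev] at this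
      linarith
    have b4 : cellOsc (μ n) k ≤ 12 * (a / n + edgeSum (μ n) k / (a / n)) := by
      refine (cellOsc_le (μ n) k).trans ?_
      have h1 := Real.sq_sqrt (edgeSum_nonneg (μ n) k)
      set q := √(edgeSum (μ n) k)
      rw [← h1]
      have : 0 ≤ (a / n - q) ^ 2 / (a / n) := by positivity
      have e : (a / n - q) ^ 2 / (a / n) = a / n + q ^ 2 / (a / n) - 2 * q := by field_simp; ring
      linarith
    have h0 := norm_nonneg (P a Ω n (μ n) y)
    rw [Real.norm_of_nonneg (by nlinarith)]
    nlinarith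
  refine (Finset.sum_le_sum fun k hk => hcell hk).trans ?_
  have e : ∑ k ∈ G, 24 * (a / n + edgeSum (μ n) k / (a / n)) * (a / n) ^ 3 =
      24 * ((a / n) ^ 3 * G.card + a / n * ∑ k ∈ G, edgeSum (μ n) k) * (a / n) := by
    have : ∀ k, 24 * (a / n + edgeSum (μ n) k / (a / n)) * (a / n) ^ 3 =
        24 * (a / n) ^ 4 + 24 * (a / n) * (a / n) * edgeSum (μ n) k := by
      intro k; field_simp
    simp_rw [this]
    rw [Finset.sum_add_distrib, Finset.sum_const, nsmul_eq_mul, ← Finset.mul_sum]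
    ring
  rw [e]
  have h1 := hV n hn G fun k hk => goodCells_subset_nodes ha hn (hGm hk)
  have h2 := hC n hn
  rw [meshEnergy, finsum_mem_eq_finite_toFinset_sum _ hfin] at h2
  gcongr

/-- Poincaré's inequality for the interpolation on a cube. -/
lemma poincare_P (ha : 0 < a) (hΩ : Bornology.IsBounded Ω) {n : ℕ} (hn : 1 ≤ n) (μ : Idx → E3)
    {ε : ℝ} (hε : 0 < ε) {k : Idx} (hk : cellO ε k ⊆ meshDomain a Ω n) :
    ∫ x in cellO ε k, ‖P a Ω n μ x‖ ^ 2 ≤ (ε ^ 3)⁻¹ * ‖∫ x in cellO ε k, P a Ω n μ x‖ ^ 2 +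
      16 * ε ^ 2 * ∑ i, ∫ x in cellO ε k, ‖fderiv ℝ (P a Ω n μ) x (basisVec i)‖ ^ 2 := by
  have hvf : volume (cellO ε k) < ⊤ := by
    rw [volume_cellO hε.le]; exact ENNReal.ofReal_lt_top
  have hvol : volume.real (cellO ε k) = ε ^ 3 := by
    rw [measureReal_def, volume_cellO hε.le, ENNReal.toReal_ofReal (by positivity)]
  have hfinm : IsFiniteMeasure (volume.restrict (cellO ε k)) := ⟨by simpa using hvf⟩
  have hP := (memLp_P ha hΩ hn μ).restrict (cellO ε k)
  have hg (i : Fin 3) := (memLp_fderiv_P ha hΩ hn μ i).restrict (cellO ε k)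
  have hint : cellO ε k ⊆ interior (meshDomain a Ω n) := interior_maximal hk (isOpen_cellO _ _)
  -- Differences of points of the cube lie in W = (−ε, ε)³, of volume 8ε³, and have length at most d
  -- = 2ε. Thus |W|d² = 32ε⁵, and half of it, divided by the volume ε³, is the constant 16ε².
  have key := lintegral_lintegral_sub_le hvf.ne hP hg
    (fun i => (isWeakPartial_P ha hΩ hn μ i).mono hint) (isOpen_cellO ε k) (convex_cellO ε k)
    (W := openBox (fun _ => -ε) (2 * ε)) (isOpen_openBox _ _).measurableSet
    (fun x hx y hy i => by
      have h1 := hx i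
      have h2 := hy i
      rw [PiLp.sub_apply]
      constructor <;> linarith)
    (d := 2 * ε) (fun w hw => norm_le_two_mul_of_abs_le hε.le fun i => by
      have h1 := hw i
      rw [abs_le]; constructor <;> linarith)
  rw [lintegral_lintegral_sub_sq hP, volume_openBox _ (by positivity),
    lintegral_finsetSum' _ (fun i _ => (hg i).1.enorm.pow_const 2)] at key
  simp_rw [fun i => lintegral_enorm_sq (hg i)] at key
  have h0 (i : Fin 3) : 0 ≤ ∫ y in cellO ε k, ‖fderiv ℝ (P a Ω n μ) y (basisVec i)‖ ^ 2 :=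
    integral_nonneg fun _ => by positivity
  rw [← ENNReal.ofReal_sum_of_nonneg (fun i _ => h0 i), ← ENNReal.ofReal_mul (by positivity),
    ← ENNReal.ofReal_mul (by positivity), ENNReal.ofReal_le_ofReal_iff (mul_nonneg (by positivity)
      (mul_nonneg (by positivity) (Finset.sum_nonneg fun i _ => h0 i))),
    measureReal_restrict_apply_univ, hvol] at key
  set X := ∫ x in cellO ε k, ‖P a Ω n μ x‖ ^ 2
  set Y := ‖∫ x in cellO ε k, P a Ω n μ x‖ ^ 2
  set Z := ∑ i, ∫ y in cellO ε k, ‖fderiv ℝ (P a Ω n μ) y (basisVec i)‖ ^ 2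
  have h3 : ε ^ 3 * X ≤ ε ^ 3 * ((ε ^ 3)⁻¹ * Y + 16 * ε ^ 2 * Z) := by
    rw [mul_add, mul_inv_cancel_left₀ (by positivity)]
    linarith
  exact le_of_mul_le_mul_left h3 (by positivity)

/-- Cauchy–Schwarz against the constant field equal to the integral itself. -/
lemma norm_sq_setIntegral_le {S : Set E3} (hS : volume S < ⊤) {m : E3 → E3}
    (hm : MemLp m 2 (volume.restrict S)) :
    ‖∫ x in S, m x‖ ^ 2 ≤ volume.real S * ∫ x in S, ‖m x‖ ^ 2 := by
  have hfinm : IsFiniteMeasure (volume.restrict S) := ⟨by simpa using hS⟩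
  set z := ∫ x in S, m x
  have h1 : ∫ x in S, inner ℝ (m x) z = ‖z‖ ^ 2 := by
    simp_rw [real_inner_comm z]
    rw [integral_inner (hm.integrable (by norm_num)), real_inner_self_eq_norm_sq]
  have h2 := integral_inner_le_sqrt hm (memLp_const z)
  rw [h1, integral_const, smul_eq_mul, measureReal_restrict_apply_univ,
    abs_of_nonneg (by positivity)] at h2
  have h3 := pow_le_pow_left₀ (by positivity) h2 2
  rw [mul_pow, Real.sq_sqrt (integral_nonneg fun _ => by positivity),
    Real.sq_sqrt (by positivity)] at h3
  by_cases hz : ‖z‖ = 0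
  · rw [hz]; simp; exact mul_nonneg (by positivity) (integral_nonneg fun _ => by positivity)
  · have : 0 < ‖z‖ ^ 2 := by positivity
    nlinarith

/-- Weak limits stay in the unit ball. Testing with m/|m| on S = {|m| > 1} gives ∫_S |m| ≤ |S|,
which forces S to be null. -/
lemma ae_norm_le_one (ha : 0 < a) (hΩ : Bornology.IsBounded Ω) {μ : ℕ → Idx → E3} {m : E3 → E3}
    (hμ : UnitSpins a Ω μ) (hc : ConvergesTo a Ω μ m) :
    ∀ᵐ x ∂(volume.restrict Ω), ‖m x‖ ≤ 1 := by
  have hfinm : IsFiniteMeasure (volume.restrict Ω) := ⟨by simpa using hΩ.measure_lt_top⟩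
  have hm := hc.1.1
  set m' := hm.1.mk m with hm'
  have hmm : m =ᵐ[volume.restrict Ω] m' := hm.1.ae_eq_mk
  have hmeas : Measurable m' := hm.1.stronglyMeasurable_mk.measurable
  set S := {x | 1 < ‖m' x‖} with hS
  have hSm : MeasurableSet S := measurableSet_lt measurable_const hmeas.norm
  set v := S.indicator fun x => ‖m' x‖⁻¹ • m' x with hv
  have hvm : Measurable v := (hmeas.norm.inv.smul hmeas).indicator hSm
  have hv1 (x : E3) : ‖v x‖ ≤ S.indicator (fun _ => (1 : ℝ)) x := by
    by_cases hx : x ∈ S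
    · rw [hv, Set.indicator_of_mem hx, Set.indicator_of_mem hx, norm_smul, norm_inv, norm_norm]
      exact inv_mul_le_one
    · rw [hv, Set.indicator_of_notMem hx, Set.indicator_of_notMem hx, norm_zero]
  have hS1 : Integrable (S.indicator fun _ => (1 : ℝ)) (volume.restrict Ω) :=
    (integrable_const 1).indicator hSm
  have hvL : MemLp v 2 (volume.restrict Ω) := MemLp.of_bound hvm.aestronglyMeasurable 1
    (ae_of_all _ fun x => (hv1 x).trans (Set.indicator_le_self' (fun _ _ => zero_le_one) x))
  have hle : ∫ x in Ω, inner ℝ (m x) (v x) ≤ ∫ x in Ω, S.indicator (fun _ => (1 : ℝ)) x := by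
    refine le_of_tendsto (hc.2 v hvL).1 ?_
    filter_upwards [eventually_ge_atTop 1] with n hn
    refine integral_mono (memLp_inner_integrable ((memLp_P ha hΩ hn _).restrict Ω) hvL) hS1
      fun x => ?_
    refine (real_inner_le_norm _ _).trans ?_
    have := norm_P_le_one ha hn (hμ n hn) x
    nlinarith [hv1 x, norm_nonneg (v x)]
  have heq : ∫ x in Ω, inner ℝ (m x) (v x) = ∫ x in Ω, S.indicator (fun x => ‖m' x‖) x := by
    refine integral_congr_ae ?_
    filter_upwards [hmm] with x hx
    rw [hx]
    by_cases hxS : x ∈ S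
    · rw [hv, Set.indicator_of_mem hxS, Set.indicator_of_mem hxS, inner_smul_right,
        real_inner_self_eq_norm_sq]
      have : ‖m' x‖ ≠ 0 := (zero_lt_one.trans hxS).ne'
      field_simp
    · rw [hv, Set.indicator_of_notMem hxS, Set.indicator_of_notMem hxS, inner_zero_right]
  have hS2 : Integrable (S.indicator fun x => ‖m' x‖) (volume.restrict Ω) :=
    (((hm.integrable (by norm_num)).congr hmm).norm).indicator hSm
  have h0 (x : E3) : 0 ≤ S.indicator (fun x => ‖m' x‖) x - S.indicator (fun _ => (1 : ℝ)) x := by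
    by_cases hxS : x ∈ S
    · rw [Set.indicator_of_mem hxS, Set.indicator_of_mem hxS]
      exact sub_nonneg.2 (le_of_lt hxS)
    · rw [Set.indicator_of_notMem hxS, Set.indicator_of_notMem hxS, sub_zero]
  have hz : ∫ x in Ω, (S.indicator (fun x => ‖m' x‖) x - S.indicator (fun _ => (1 : ℝ)) x) = 0 := by
    refine le_antisymm ?_ (integral_nonneg h0)
    rw [integral_sub hS2 hS1]
    linarith
  rw [integral_eq_zero_iff_of_nonneg h0 (hS2.sub hS1)] at hz
  filter_upwards [hz, hmm] with x hx hxm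
  rw [hxm]
  by_contra hcon
  have hxS : x ∈ S := not_le.1 hcon
  simp only [Set.indicator_of_mem hxS, Pi.zero_apply] at hx
  exact hcon (by linarith)

end

/-! ### The limit of unit spins has norm one -/

section

variable {a : ℝ} {Ω : Set E3}

lemma exists_mem_cell (ha : 0 < a) {n : ℕ} (hn : 1 ≤ n) (y : E3) : ∃ k, y ∈ cell a n k := by
  have hh : 0 < a / n := div_pos ha (by exact_mod_cast hn)
  refine ⟨fun i => ⌊y i / (a / n)⌋, fun i => ⟨?_, ?_⟩⟩
  · have := Int.floor_le (y i / (a / n))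
    rw [le_div_iff₀ hh] at this
    linarith
  · have := (Int.lt_floor_add_one (y i / (a / n))).le
    rw [div_le_iff₀ hh] at this
    linarith

/-- Compact subsets of the interior of `Ω` are eventually contained in the meshes. -/
lemma eventually_subset_interior_meshDomain (ha : 0 < a) {K : Set E3} (hK : IsCompact K)
    (hKΩ : K ⊆ interior Ω) : ∀ᶠ n : ℕ in atTop, K ⊆ interior (meshDomain a Ω n) := by
  obtain ⟨δ, hδ, hδ'⟩ := hK.exists_cthickening_subset_open isOpen_interior hKΩ
  filter_upwards [(tendsto_mesh a 4).eventually_le_const hδ, eventually_ge_atTop 1] with n h4 hn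
  refine (Metric.self_subset_thickening (half_pos hδ) K).trans
    (interior_maximal (fun y hy => ?_) Metric.isOpen_thickening)
  obtain ⟨k, hk⟩ := exists_mem_cell ha hn y
  refine ⟨k, hk, fun x hx => interior_subset (hδ' ?_)⟩
  obtain ⟨z, hz, hyz⟩ := Metric.mem_thickening_iff.1 hy
  refine Metric.mem_cthickening_of_dist_le x z δ K hz ?_
  have := dist_le_of_mem_cell ha hx hk
  linarith [dist_triangle x y z]

lemma sum_setIntegral_cellO_le {h : ℝ} (hh : 0 < h) {s : Finset Idx} {T : Set E3}
    (hT : ∀ k ∈ s, cellO h k ⊆ T) {f : E3 → ℝ} (hf : IntegrableOn f T) (h0 : ∀ x, 0 ≤ f x) :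
    ∑ k ∈ s, ∫ y in cellO h k, f y ≤ ∫ y in T, f y := by
  rw [← integral_biUnion_finset s (fun k _ => measurableSet_cellO h k)
    (fun k _ l _ hkl => disjoint_cellO hh hkl) (fun k hk => hf.mono_set (hT k hk))]
  exact setIntegral_mono_set hf (ae_of_all _ h0) (Set.iUnion₂_subset hT).eventuallyLE

/-- The components of the integral over S are pairings with the fields 1_S e_j, so weak convergence
suffices even for the square. -/
lemma tendsto_norm_sq_setIntegral_P (ha : 0 < a) (hΩ : Bornology.IsBounded Ω)
    {μ : ℕ → Idx → E3} {m : E3 → E3} (hc : ConvergesTo a Ω μ m)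
    {S : Set E3} (hS : MeasurableSet S) (hSΩ : S ⊆ Ω) :
    Tendsto (fun n => ‖∫ x in S, P a Ω n (μ n) x‖ ^ 2) atTop (𝓝 (‖∫ x in S, m x‖ ^ 2)) := by
  have hfinm : IsFiniteMeasure (volume.restrict Ω) := ⟨by simpa using hΩ.measure_lt_top⟩
  have hfinS : IsFiniteMeasure (volume.restrict S) :=
    ⟨by simpa using (measure_mono hSΩ).trans_lt hΩ.measure_lt_top⟩
  have comp {u : E3 → E3} (hu : MemLp u 2 (volume.restrict Ω)) :
      ‖∫ x in S, u x‖ ^ 2 =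
        ∑ j, (∫ x in Ω, inner ℝ (u x) (S.indicator (fun _ => basisVec j) x)) ^ 2 := by
    rw [EuclideanSpace.norm_sq_eq]
    refine Finset.sum_congr rfl fun j _ => ?_
    have huS : Integrable u (volume.restrict S) :=
      (hu.mono_measure (Measure.restrict_mono hSΩ le_rfl)).integrable (by norm_num)
    rw [Real.norm_eq_abs, sq_abs]
    have e1 : (∫ x in S, u x) j = ∫ x in S, inner ℝ (basisVec j) (u x) := by
      rw [integral_inner huS, basisVec, EuclideanSpace.inner_single_left]; simp
    have e2 (x : E3) : inner ℝ (u x) (S.indicator (fun _ => basisVec j) x) =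
        S.indicator (fun x => (inner ℝ (basisVec j) (u x) : ℝ)) x := by
      by_cases hx : x ∈ S
      · rw [Set.indicator_of_mem hx, Set.indicator_of_mem hx, real_inner_comm]
      · rw [Set.indicator_of_notMem hx, Set.indicator_of_notMem hx, inner_zero_right]
    simp_rw [e2]
    rw [e1, integral_indicator hS, Measure.restrict_restrict hS, Set.inter_eq_left.2 hSΩ]
  rw [comp hc.1.1]
  have hlim : Tendsto (fun n => ∑ j, (∫ x in Ω, inner ℝ (P a Ω n (μ n) x)
      (S.indicator (fun _ => basisVec j) x)) ^ 2) atTop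
      (𝓝 (∑ j, (∫ x in Ω, inner ℝ (m x) (S.indicator (fun _ => basisVec j) x)) ^ 2)) :=
    tendsto_finsetSum _ fun j _ => ((hc.2 _ ((memLp_const _).indicator hS)).1).pow 2
  refine hlim.congr' ?_
  filter_upwards [eventually_ge_atTop 1] with n hn
  exact (comp ((memLp_P ha hΩ hn _).restrict Ω)).symm

/-- The cubes are the cells of a fixed level N, while n → ∞. Poincaré's inequality holds for each
P_n. In the limit, ∫|P_n|² over a cube becomes its volume, the averages become those of m, and
Jensen's inequality bounds the latter by ∫|m|². The gradient term is bounded uniformly in n. -/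
lemma sum_cubes_le (ha : 0 < a) (hΩ : Bornology.IsBounded Ω)
    (hcone : UniformConeProperty Ω) {μ : ℕ → Idx → E3} {m : E3 → E3} (hμ : UnitSpins a Ω μ)
    (hc : ConvergesTo a Ω μ m) {C : ℝ} (hC : ∀ n, 1 ≤ n →
      ∑ i, ∫ y in Ω, ‖fderiv ℝ (P a Ω n (μ n)) y (basisVec i)‖ ^ 2 ≤ C)
    {N : ℕ} (hN : 1 ≤ N) (s : Finset Idx) (hs : ∀ k ∈ s, k ∈ goodCells a (interior Ω) N) :
    s.card * (a / N) ^ 3 ≤ (∫ x in Ω, ‖m x‖ ^ 2) + 16 * (a / N) ^ 2 * C := by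
  have hε : 0 < a / N := div_pos ha (by exact_mod_cast hN)
  set ε := a / N with hεdef
  have hQ (k : Idx) (hk : k ∈ s) : cellO ε k ⊆ interior Ω := (cellO_subset_cell k).trans (hs k hk)
  have hvf (k : Idx) : volume (cellO ε k) < ⊤ := by
    rw [volume_cellO hε.le]; exact ENNReal.ofReal_lt_top
  have hvol (k : Idx) : volume.real (cellO ε k) = ε ^ 3 := by
    rw [measureReal_def, volume_cellO hε.le, ENNReal.toReal_ofReal (by positivity)]
  have hD := tendsto_integral_one_sub ha hΩ hμ (C := 216 * C)
    fun n hn => (meshEnergy_le ha hΩ hn _).trans (by gcongr; exact hC n hn)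
  have hleft : Tendsto (fun n => ∑ k ∈ s, (ε ^ 3 -
      ∫ y in meshDomain a Ω n, (1 - ‖P a Ω n (μ n) y‖ ^ 2))) atTop (𝓝 (s.card * ε ^ 3)) := by
    have := tendsto_finsetSum s fun k _ => hD.const_sub (ε ^ 3)
    simpa using this
  have hright : Tendsto (fun n => ∑ k ∈ s, (ε ^ 3)⁻¹ * ‖∫ x in cellO ε k, P a Ω n (μ n) x‖ ^ 2 +
      16 * ε ^ 2 * C) atTop
      (𝓝 (∑ k ∈ s, (ε ^ 3)⁻¹ * ‖∫ x in cellO ε k, m x‖ ^ 2 + 16 * ε ^ 2 * C)) :=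
    (tendsto_finsetSum s fun k hk => (tendsto_norm_sq_setIntegral_P ha hΩ hc
      (measurableSet_cellO ε k) ((hQ k hk).trans interior_subset)).const_mul _).add_const _
  have hm' : MemLp m 2 (volume.restrict (interior Ω)) := by
    rw [← restrict_interior hcone]; exact hc.1.1
  have hlim : s.card * ε ^ 3 ≤ ∑ k ∈ s, (ε ^ 3)⁻¹ * ‖∫ x in cellO ε k, m x‖ ^ 2 +
      16 * ε ^ 2 * C := by
    refine le_of_tendsto_of_tendsto hleft hright ?_
    have hcover : ∀ᶠ n in atTop, ∀ k ∈ s, cellO ε k ⊆ meshDomain a Ω n := by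
      refine (Finset.eventually_all s).2 fun k hk => ?_
      have hcpt : IsCompact (cell a N k) := Metric.isCompact_of_isClosed_isBounded
        (isClosed_cell a N k) (hΩ.subset ((hs k hk).trans interior_subset))
      filter_upwards [eventually_subset_interior_meshDomain ha hcpt (hs k hk)] with n hn
      exact (cellO_subset_cell k).trans (hn.trans interior_subset)
    filter_upwards [hcover, eventually_ge_atTop 1] with n hcov hn
    have hPL := memLp_P ha hΩ hn (μ n)
    have hnn (y : E3) : 0 ≤ 1 - ‖P a Ω n (μ n) y‖ ^ 2 := sub_nonneg.2
      (pow_le_one₀ (norm_nonneg _) (norm_P_le_one ha hn (hμ n hn) y))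
    have hIon : IntegrableOn (fun y => 1 - ‖P a Ω n (μ n) y‖ ^ 2) (meshDomain a Ω n) :=
      (integrableOn_const (C := (1 : ℝ)) (isCompact_meshDomain ha hΩ hn).measure_lt_top.ne).sub
        (memLp_sq_integrable (hPL.restrict _))
    have hcell (k : Idx) (hk : k ∈ s) :
        ε ^ 3 - ∫ y in meshDomain a Ω n, (1 - ‖P a Ω n (μ n) y‖ ^ 2) ≤
        (ε ^ 3)⁻¹ * ‖∫ x in cellO ε k, P a Ω n (μ n) x‖ ^ 2 + 16 * ε ^ 2 *
          ∑ i, ∫ x in cellO ε k, ‖fderiv ℝ (P a Ω n (μ n)) x (basisVec i)‖ ^ 2 := by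
      refine le_trans ?_ (poincare_P ha hΩ hn (μ n) hε (hcov k hk))
      have h1 := setIntegral_mono_set hIon (ae_of_all _ hnn) (hcov k hk).eventuallyLE
      have h2 : ∫ y in cellO ε k, (1 - ‖P a Ω n (μ n) y‖ ^ 2) =
          ε ^ 3 - ∫ y in cellO ε k, ‖P a Ω n (μ n) y‖ ^ 2 := by
        rw [integral_sub (integrableOn_const (C := (1 : ℝ)) (hvf k).ne)
          (memLp_sq_integrable (hPL.restrict _)), setIntegral_const, hvol, smul_eq_mul, mul_one]
      linarith
    refine (Finset.sum_le_sum hcell).trans ?_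
    rw [Finset.sum_add_distrib, ← Finset.mul_sum s _ (16 * ε ^ 2), Finset.sum_comm]
    gcongr
    refine le_trans (Finset.sum_le_sum fun i _ => ?_) (hC n hn)
    rw [restrict_interior hcone]
    exact sum_setIntegral_cellO_le hε hQ
      (memLp_sq_integrable ((memLp_fderiv_P ha hΩ hn _ i).restrict _)) fun x => by positivity
  refine hlim.trans ?_
  gcongr
  rw [restrict_interior hcone]
  refine le_trans (Finset.sum_le_sum fun k hk => ?_)
    (sum_setIntegral_cellO_le hε hQ (memLp_sq_integrable hm') fun x => by positivity)
  have := norm_sq_setIntegral_le (hvf k)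
    (hm'.mono_measure (Measure.restrict_mono (hQ k hk) le_rfl))
  rw [hvol] at this
  rwa [inv_mul_le_iff₀ (by positivity)]

/-- Refining the cubes, N → ∞, exhausts the interior up to a vanishing layer and yields |Ω| ≤ ∫|m|².
As |m| ≤ 1, the nonnegative function 1 − |m|² has integral zero. -/
theorem ae_norm_eq_one (ha : 0 < a) (hΩ : Bornology.IsBounded Ω)
    (hcone : UniformConeProperty Ω) {μ : ℕ → Idx → E3} {m : E3 → E3} (hμ : UnitSpins a Ω μ)
    (hc : ConvergesTo a Ω μ m) : ∀ᵐ x ∂(volume.restrict Ω), ‖m x‖ = 1 := by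
  obtain ⟨C, hC⟩ := hc.exists_meshEnergy_le ha hΩ
  have hfinm : IsFiniteMeasure (volume.restrict Ω) := ⟨by simpa using hΩ.measure_lt_top⟩
  have h1 : ∀ N : ℕ, 1 ≤ N → volume (interior Ω) ≤
      ENNReal.ofReal ((∫ x in Ω, ‖m x‖ ^ 2) + 16 * (a / N) ^ 2 * C) +
      volume (Metric.cthickening (2 * (a / N)) (frontier Ω)) := by
    intro N hN
    have hε : 0 < a / N := div_pos ha (by exact_mod_cast hN)
    have hfin := finite_goodCells (Ω := interior Ω) ha (hΩ.subset interior_subset) hN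
    have h2 := sum_cubes_le ha hΩ hcone hμ hc hC hN hfin.toFinset
      fun k hk => hfin.mem_toFinset.1 hk
    have h3 : (interior Ω : Set E3) ≤ᵐ[volume] ((⋃ k ∈ hfin.toFinset, cellO (a / N) k) ∪
        Metric.cthickening (2 * (a / N)) (frontier Ω) : Set E3) := by
      filter_upwards [ae_mem_cellO hε] with y ⟨k, hk⟩ hy
      by_cases hg : k ∈ goodCells a (interior Ω) N
      · exact Or.inl (Set.mem_biUnion (hfin.mem_toFinset.2 hg) hk)
      · exact Or.inr (Metric.cthickening_subset_of_subset _ frontier_interior_subset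
          (mem_layer_of_mem_cell ha hy (cellO_subset_cell k hk) hg))
    refine (measure_mono_ae h3).trans ((measure_union_le _ _).trans ?_)
    gcongr
    refine (measure_biUnion_finset_le _ _).trans ?_
    simp_rw [volume_cellO hε.le]
    rw [Finset.sum_const, nsmul_eq_mul, ← ENNReal.ofReal_natCast,
      ← ENNReal.ofReal_mul (by positivity)]
    exact ENNReal.ofReal_le_ofReal h2
  have hlim : Tendsto (fun N : ℕ => ENNReal.ofReal ((∫ x in Ω, ‖m x‖ ^ 2) +
      16 * (a / N) ^ 2 * C) + volume (Metric.cthickening (2 * (a / N)) (frontier Ω))) atTop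
      (𝓝 (ENNReal.ofReal (∫ x in Ω, ‖m x‖ ^ 2))) := by
    have e1 : Tendsto (fun N : ℕ => (∫ x in Ω, ‖m x‖ ^ 2) + 16 * (a / N) ^ 2 * C) atTop
        (𝓝 ((∫ x in Ω, ‖m x‖ ^ 2) + 16 * 0 ^ 2 * C)) := by
      have := tendsto_mesh a 1
      simp only [one_mul] at this
      exact ((((this.pow 2).const_mul 16).mul_const C).const_add _)
    have e2 := tendsto_measure_layer hΩ hcone volume Measure.AbsolutelyContinuous.rfl
      (tendsto_mesh a 2)
    simpa using (ENNReal.tendsto_ofReal e1).add e2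
  have h4 : volume (interior Ω) ≤ ENNReal.ofReal (∫ x in Ω, ‖m x‖ ^ 2) :=
    ge_of_tendsto hlim ((eventually_ge_atTop 1).mono h1)
  have h5 : (volume.restrict Ω).real Set.univ ≤ ∫ x in Ω, ‖m x‖ ^ 2 := by
    rw [measureReal_def, restrict_interior hcone, Measure.restrict_apply_univ,
      ← restrict_interior hcone]
    exact ENNReal.toReal_le_of_le_ofReal (integral_nonneg fun _ => by positivity) h4
  have hle := ae_norm_le_one ha hΩ hμ hc
  have hnn : 0 ≤ᵐ[volume.restrict Ω] fun x => 1 - ‖m x‖ ^ 2 := by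
    filter_upwards [hle] with x hx
    exact sub_nonneg.2 (pow_le_one₀ (norm_nonneg _) hx)
  have hI : Integrable (fun x => 1 - ‖m x‖ ^ 2) (volume.restrict Ω) :=
    (integrable_const 1).sub (memLp_sq_integrable hc.1.1)
  have hz : ∫ x in Ω, (1 - ‖m x‖ ^ 2) = 0 := by
    refine le_antisymm ?_ (integral_nonneg_of_ae hnn)
    rw [integral_sub (integrable_const 1) (memLp_sq_integrable hc.1.1), integral_const, smul_eq_mul,
      mul_one]
    linarith
  rw [integral_eq_zero_iff_of_nonneg_ae hnn hI] at hz
  filter_upwards [hz] with x hx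
  have : ‖m x‖ ^ 2 = 1 := by simp only [Pi.zero_apply] at hx; linarith
  exact (pow_eq_one_iff_of_nonneg (norm_nonneg _) two_ne_zero).1 this

end

/-! ### Sufficient conditions for recovery sequences -/

section

variable {a : ℝ} {Ω : Set E3}

open Classical in
/-- The discrete Dirichlet energy. -/
def latticeEnergy (a : ℝ) (Ω : Set E3) (n : ℕ) (μ : Idx → E3) : ℝ :=
  a / n * ∑ᶠ k ∈ nodes a Ω n,
    ∑ i, if k + Pi.single i 1 ∈ nodes a Ω n then ‖μ (k + Pi.single i 1) - μ k‖ ^ 2 else 0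

lemma exchangeN_eq_latticeEnergy (ha : 0 < a) (hΩ : Bornology.IsBounded Ω) {n : ℕ} (hn : 1 ≤ n)
    (A : ℝ) (μ : Idx → E3) : exchangeN a A Ω n μ = 2 * A * latticeEnergy a Ω n μ := by
  rw [exchangeN_eq ha hΩ hn, latticeEnergy,
    finsum_mem_eq_finite_toFinset_sum _ (finite_nodes ha hΩ hn)]

/-- For each of the eight offsets j, the map k ↦ k + j is injective from good cells to nodes. -/
lemma meshEnergy_le_latticeEnergy (ha : 0 < a) (hΩ : Bornology.IsBounded Ω) {n : ℕ} (hn : 1 ≤ n)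
    (μ : Idx → E3) : meshEnergy a Ω n μ ≤ 8 * latticeEnergy a Ω n μ := by
  classical
  have hh : 0 < a / n := div_pos ha (by exact_mod_cast hn)
  have hN := finite_nodes (Ω := Ω) ha hΩ hn
  have hG := finite_goodCells (Ω := Ω) ha hΩ hn
  rw [meshEnergy, latticeEnergy, finsum_mem_eq_finite_toFinset_sum _ hN,
    finsum_mem_eq_finite_toFinset_sum _ hG]
  set e : Idx → ℝ := fun k => ∑ i, if k + Pi.single i 1 ∈ nodes a Ω n then
    ‖μ (k + Pi.single i 1) - μ k‖ ^ 2 else 0 with he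
  have he0 (k : Idx) : 0 ≤ e k := Finset.sum_nonneg fun i _ => by positivity
  have h1 : ∑ k ∈ hG.toFinset, edgeSum μ k ≤ 8 * ∑ k ∈ hN.toFinset, e k := by
    unfold edgeSum
    rw [Finset.sum_comm]
    have hj (j : Idx) (hj : j ∈ corners) : ∑ k ∈ hG.toFinset, ∑ i,
        (if j i = 0 then ‖μ (k + j + Pi.single i 1) - μ (k + j)‖ ^ 2 else 0) ≤
        ∑ k ∈ hN.toFinset, e k := by
      calc _ ≤ ∑ k ∈ hG.toFinset, e (k + j) := by
            refine Finset.sum_le_sum fun k hk => Finset.sum_le_sum fun i _ => ?_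
            by_cases hi : j i = 0
            · have hj' : j + Pi.single i 1 ∈ corners := by
                rw [mem_corners] at hj ⊢
                intro m
                by_cases hm : m = i
                · subst hm; simp [hi]
                · simp [hm, hj m]
              have hmem := mem_nodes_of_good ha hn (hG.mem_toFinset.1 hk) hj'
              rw [← add_assoc] at hmem
              rw [if_pos hi, if_pos hmem]
            · rw [if_neg hi]; positivity
        _ = ∑ k ∈ hG.toFinset.image (· + j), e k := by
            rw [Finset.sum_image fun x _ y _ h => add_right_cancel h]
        _ ≤ _ := by
            refine Finset.sum_le_sum_of_subset_of_nonneg (fun k hk => ?_) fun k _ _ => he0 k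
            obtain ⟨l, hl, rfl⟩ := Finset.mem_image.1 hk
            exact hN.mem_toFinset.2 (mem_nodes_of_good ha hn (hG.mem_toFinset.1 hl) hj)
    refine (Finset.sum_le_sum hj).trans_eq ?_
    rw [Finset.sum_const, card_corners, nsmul_eq_mul]
    norm_num
  have := mul_le_mul_of_nonneg_left h1 hh.le
  linarith

/-- On a cell, (3 `cellOsc`/h)² · h³ = 9h `cellOsc`² ≤ 9 · 576 h `edgeSum`, and 5184 = 9 · 576. -/
lemma integral_fderiv_P_sq_le (ha : 0 < a) (hΩ : Bornology.IsBounded Ω) {n : ℕ} (hn : 1 ≤ n)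
    (μ : Idx → E3) (i : Fin 3) :
    ∫ y in Ω, ‖fderiv ℝ (P a Ω n μ) y (basisVec i)‖ ^ 2 ≤ 5184 * meshEnergy a Ω n μ := by
  have hh : 0 < a / n := div_pos ha (by exact_mod_cast hn)
  have hG := finite_goodCells (Ω := Ω) ha hΩ hn
  rw [meshEnergy, finsum_mem_eq_finite_toFinset_sum _ hG]
  rw [setIntegral_eq_integral_of_forall_compl_eq_zero fun x hx => by
    rw [fderiv_P_eq_zero ha hΩ hn (fun h => hx (meshDomain_subset h))]; simp]
  rw [integral_eq_sum_cellO hh (memLp_sq_integrable (memLp_fderiv_P ha hΩ hn μ i)) hG.toFinset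
    (fun k hk y hy => by
      rw [fderiv_P_eq_zero ha hΩ hn (fun h => hk (hG.mem_toFinset.2
        ((mem_meshDomain_iff ha hn hy).1 h)))]
      simp)]
  rw [Finset.mul_sum, Finset.mul_sum]
  refine Finset.sum_le_sum fun k hk => ?_
  have hvf : volume (cellO (a / n) k) < ⊤ := by
    rw [volume_cellO hh.le]; exact ENNReal.ofReal_lt_top
  have hvol : volume.real (cellO (a / n) k) = (a / n) ^ 3 := by
    rw [measureReal_def, volume_cellO hh.le, ENNReal.toReal_ofReal (by positivity)]
  have hb : ‖∫ y in cellO (a / n) k, ‖fderiv ℝ (P a Ω n μ) y (basisVec i)‖ ^ 2‖ ≤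
      (3 * cellOsc μ k / (a / n)) ^ 2 * volume.real (cellO (a / n) k) := by
    refine norm_setIntegral_le_of_norm_le_const hvf fun y hy => ?_
    rw [norm_pow, norm_norm]
    exact pow_le_pow_left₀ (norm_nonneg _)
      (norm_fderiv_P_le ha hn (hG.mem_toFinset.1 hk) hy μ i) 2
  refine (Real.le_norm_self _).trans (hb.trans ?_)
  have e : (3 * cellOsc μ k / (a / n)) ^ 2 * (a / n) ^ 3 = 9 * (a / n) * cellOsc μ k ^ 2 := by
    field_simp; ring
  rw [hvol, e]
  have := mul_le_mul_of_nonneg_left (cellOsc_sq_le μ k) hh.le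
  linarith

/-- Weak convergence in `L²` can be tested with test fields. -/
lemma tendsto_inner_of_testFields (hcone : UniformConeProperty Ω) {f : ℕ → E3 → E3} {g : E3 → E3}
    (hf : ∀ n, 1 ≤ n → MemLp (f n) 2 (volume.restrict Ω)) (hg : MemLp g 2 (volume.restrict Ω))
    {C : ℝ} (hC : ∀ᶠ n in atTop, ∫ x in Ω, ‖f n x‖ ^ 2 ≤ C)
    (h : ∀ Φ, IsTestField (interior Ω) Φ → Tendsto (fun n => ∫ x in Ω, inner ℝ (f n x) (Φ x)) atTop
      (𝓝 (∫ x in Ω, inner ℝ (g x) (Φ x))))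
    {v : E3 → E3} (hv : MemLp v 2 (volume.restrict Ω)) :
    Tendsto (fun n => ∫ x in Ω, inner ℝ (f n x) (v x)) atTop
      (𝓝 (∫ x in Ω, inner ℝ (g x) (v x))) := by
  rw [Metric.tendsto_nhds]
  intro ε hε
  set K := √C + √(∫ x in Ω, ‖g x‖ ^ 2) + 1 with hK
  have hK0 : 0 < K := by positivity
  have hη : 0 < (ε / (2 * K)) ^ 2 := by positivity
  obtain ⟨Φ, hΦ, hΦv⟩ := exists_testField isOpen_interior
    (by rw [← restrict_interior hcone]; exact hv : MemLp v 2 (volume.restrict (interior Ω))) hη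
  rw [← restrict_interior hcone] at hΦv
  have hΦL : MemLp Φ 2 (volume.restrict Ω) := by
    rw [restrict_interior hcone]; exact hΦ.memLp _
  have hd : MemLp (fun x => v x - Φ x) 2 (volume.restrict Ω) := hv.sub hΦL
  have hs : √(∫ x in Ω, ‖v x - Φ x‖ ^ 2) ≤ ε / (2 * K) := by
    rw [← Real.sqrt_sq (by positivity : 0 ≤ ε / (2 * K))]
    exact Real.sqrt_le_sqrt hΦv.le
  filter_upwards [hC, (Metric.tendsto_nhds.1 (h Φ hΦ)) (ε / 2) (by positivity),
    eventually_ge_atTop 1] with n h1 h2 hn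
  have split {u : E3 → E3} (hu : MemLp u 2 (volume.restrict Ω)) : ∫ x in Ω, inner ℝ (u x) (v x) =
      (∫ x in Ω, inner ℝ (u x) (v x - Φ x)) + ∫ x in Ω, inner ℝ (u x) (Φ x) := by
    rw [← integral_add (memLp_inner_integrable hu hd) (memLp_inner_integrable hu hΦL)]
    congr 1
    ext x
    rw [← inner_add_right, sub_add_cancel]
  rw [split (hf n hn), split hg]
  rw [Real.dist_eq] at h2 ⊢
  have b1 := integral_inner_le_sqrt (hf n hn) hd
  have b2 := integral_inner_le_sqrt hg hd
  have b3 : √(∫ x in Ω, ‖f n x‖ ^ 2) ≤ √C := Real.sqrt_le_sqrt h1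
  have b4 : (√(∫ x in Ω, ‖f n x‖ ^ 2) + √(∫ x in Ω, ‖g x‖ ^ 2)) * √(∫ x in Ω, ‖v x - Φ x‖ ^ 2) ≤
      (K - 1) * (ε / (2 * K)) := by
    refine mul_le_mul ?_ hs (Real.sqrt_nonneg _) ?_
    · rw [hK]; linarith
    · rw [hK]; simp only [add_sub_cancel_right]; positivity
  have b5 : (K - 1) * (ε / (2 * K)) ≤ ε / 2 := by
    have : K * (ε / (2 * K)) = ε / 2 := by field_simp
    nlinarith [div_pos hε (by positivity : 0 < 2 * K)]
  set I1 := ∫ x in Ω, inner ℝ (f n x) (v x - Φ x)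
  set I2 := ∫ x in Ω, inner ℝ (f n x) (Φ x)
  set I3 := ∫ x in Ω, inner ℝ (g x) (v x - Φ x)
  set I4 := ∫ x in Ω, inner ℝ (g x) (Φ x)
  have e : I1 + I2 - (I3 + I4) = (I1 - I3) + (I2 - I4) := by ring
  rw [e]
  refine (abs_add_le _ _).trans_lt ?_
  have := abs_sub I1 I3
  linarith

/-- Strong convergence of the interpolations and bounded energy imply convergence. -/
lemma convergesTo_of_strong (ha : 0 < a) (hΩ : Bornology.IsBounded Ω)
    (hcone : UniformConeProperty Ω) {μ : ℕ → Idx → E3} {m : E3 → E3} (hm : MemH1 Ω m) {C : ℝ}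
    (hC : ∀ᶠ n in atTop, meshEnergy a Ω n (μ n) ≤ C)
    (hs : Tendsto (fun n => ∫⁻ y in Ω, ‖P a Ω n (μ n) y - m y‖ₑ ^ 2) atTop (𝓝 0)) :
    ConvergesTo a Ω μ m := by
  have hP (v : E3 → E3) (hv : MemLp v 2 (volume.restrict Ω)) :
      Tendsto (fun n => ∫ x in Ω, inner ℝ (P a Ω n (μ n) x) (v x)) atTop
        (𝓝 (∫ x in Ω, inner ℝ (m x) (v x))) :=
    tendsto_inner_of_strong (fun n hn => (memLp_P ha hΩ hn _).restrict Ω) hm.1 hv hs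
  refine ⟨hm, fun v hv => ⟨hP v hv, fun i => ?_⟩⟩
  have hw := weakPartial_spec hm i
  refine tendsto_inner_of_testFields hcone
    (fun n hn => (memLp_fderiv_P ha hΩ hn _ i).restrict Ω) hw.1 (C := 5184 * C) ?_ ?_ hv
  · filter_upwards [hC, eventually_ge_atTop 1] with n h1 hn
    exact (integral_fderiv_P_sq_le ha hΩ hn _ i).trans (by gcongr)
  intro Φ hΦ
  have hΦ' := hΦ.fderiv_apply (basisVec i)
  have hΦL : MemLp (fun x => fderiv ℝ Φ x (basisVec i)) 2 (volume.restrict Ω) := by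
    rw [restrict_interior hcone]; exact hΦ'.memLp _
  have h1 := (hP _ hΦL).neg
  have h2 := (hw.2.mono interior_subset).inner_eq isOpen_interior
    (by rw [← restrict_interior hcone]; exact hm.1)
    (by rw [← restrict_interior hcone]; exact hw.1) hΦ
  rw [← restrict_interior hcone] at h2
  rw [h2, neg_neg] at h1
  refine h1.congr' ?_
  -- Once the support of Φ is inside Ω_n, the derivative of P can be moved to Φ without meeting the
  -- jump of P at the boundary of Ω_n.
  filter_upwards [eventually_subset_interior_meshDomain ha hΦ.hasCompactSupport.isCompact
    hΦ.tsupport_subset, eventually_ge_atTop 1] with n hsub hn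
  have hΦn : IsTestField (interior (meshDomain a Ω n)) Φ :=
    ⟨hΦ.contDiff, hΦ.hasCompactSupport, hsub⟩
  have h3 := (isWeakPartial_P ha hΩ hn (μ n) i).inner_eq isOpen_interior
    ((memLp_P ha hΩ hn (μ n)).restrict _) ((memLp_fderiv_P ha hΩ hn (μ n) i).restrict _) hΦn
  have hM : interior (meshDomain a Ω n) ⊆ Ω := interior_subset.trans meshDomain_subset
  have glue {f : E3 → ℝ} (hf : ∀ x ∉ interior (meshDomain a Ω n), f x = 0) :
      ∫ x in interior (meshDomain a Ω n), f x = ∫ x in Ω, f x := by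
    rw [setIntegral_eq_integral_of_forall_compl_eq_zero hf,
      setIntegral_eq_integral_of_forall_compl_eq_zero fun x hx => hf x fun h => hx (hM h)]
  rw [glue (fun x hx => by rw [(hΦn.fderiv_apply (basisVec i)).eq_zero hx, inner_zero_right]),
    glue (fun x hx => by rw [hΦn.eq_zero hx, inner_zero_right])] at h3
  rw [h3, neg_neg]

/-- Two bounds suffice for a recovery sequence. Smallness of the L² distance on the good cells gives
strong convergence of the interpolations, along which the demagnetizing energy is continuous and the
Zeeman energy converges. The exchange energy is 2A times the lattice energy, bounded by x n. -/
theorem recovery_of_bounds (ha : 0 < a) (hΩ : Bornology.IsBounded Ω)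
    (hcone : UniformConeProperty Ω) {A μ₀ : ℝ} (hA : 0 < A) (hμ₀ : 0 < μ₀) {hZ : E3 → E3}
    (hhZ : Continuous hZ) {μ : ℕ → Idx → E3} {m : E3 → E3} (hm : MemH1 Ω m)
    (hB : BoundedSpins a Ω μ) {J : ℕ → ℝ≥0∞} (hJ : Tendsto J atTop (𝓝 0))
    (hμ : ∀ᶠ n : ℕ in atTop, ∀ s : Finset Idx, (∀ k ∈ s, k ∈ goodCells a Ω n) →
      ∑ k ∈ s, ∫⁻ y in cellO (a / n) k, ‖μ n k - m y‖ₑ ^ 2 ≤ J n)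
    {x : ℕ → ℝ} (hx : Tendsto x atTop (𝓝 (∫ x in Ω, ∑ i, ‖weakPartial Ω i m x‖ ^ 2)))
    (hE : ∀ᶠ n in atTop, latticeEnergy a Ω n (μ n) ≤ x n) :
    ConvergesTo a Ω μ m ∧ LimsupIneq a A μ₀ hZ Ω μ m := by
  have hC : ∀ᶠ n in atTop, meshEnergy a Ω n (μ n) ≤
      8 * ((∫ x in Ω, ∑ i, ‖weakPartial Ω i m x‖ ^ 2) + 1) := by
    filter_upwards [hE, hx.eventually_le_const (lt_add_one _), eventually_ge_atTop 1]
      with n h1 h2 hn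
    exact (meshEnergy_le_latticeEnergy ha hΩ hn _).trans (by gcongr; exact h1.trans h2)
  have hs := tendsto_P_strong ha hΩ hcone hm.1 hC hJ hμ
  have hc := convergesTo_of_strong ha hΩ hcone hm hC hs
  refine ⟨hc, ?_⟩
  have hzee := tendsto_sum_inner ha hΩ hcone hB (fun v hv => (hc.2 v hv).1) hC hhZ
    (Ψ := fun n k => hZ (node a n k))
    (fun ε hε => Eventually.of_forall fun n k hk => by simpa using hε.le)
  have hmI := memLp_indicator hcone hm.1
  have hdem : Tendsto (fun n => demagEnergy μ₀ (Ω.indicator m) +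
      μ₀ / 2 * √(∫⁻ y in Ω, ‖P a Ω n (μ n) y - m y‖ₑ ^ 2).toReal) atTop
      (𝓝 (demagEnergy μ₀ (Ω.indicator m))) := by
    have h1 := ((Real.continuous_sqrt.tendsto _).comp
      ((ENNReal.tendsto_toReal ENNReal.zero_ne_top).comp hs))
    simpa using (h1.const_mul (μ₀ / 2)).const_add (demagEnergy μ₀ (Ω.indicator m))
  have htot := ((hx.const_mul (2 * A)).add hdem).add hzee.neg
  refine le_of_forall_gt fun c hc' => ?_
  obtain ⟨r, hr1, hr2⟩ := EReal.lt_iff_exists_real_btwn.1 hc'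
  have hr : energyInf A μ₀ hZ Ω m < r := EReal.coe_lt_coe_iff.1 hr1
  refine (limsup_le_of_le (by isBoundedDefault) ?_).trans_lt hr2
  filter_upwards [htot.eventually_lt_const hr, hE, eventually_ge_atTop 1] with n h1 h2 hn
  refine EReal.coe_le_coe_iff.2 (le_trans ?_ h1.le)
  refine add_le_add (add_le_add ?_ ?_) le_rfl
  · rw [exchangeN_eq_latticeEnergy ha hΩ hn]
    gcongr
  · rw [indicator_P, demagEnergy_congr μ₀ (indicator_interior_ae_eq hcone m)]
    have hPL := memLp_P ha hΩ hn (μ n)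
    have h3 := abs_demagEnergy_sub_le hμ₀ hPL hmI
    have h4 : ∫ x, ‖P a Ω n (μ n) x - (interior Ω).indicator m x‖ ^ 2 =
        (∫⁻ y in Ω, ‖P a Ω n (μ n) y - m y‖ₑ ^ 2).toReal := by
      have e := lintegral_enorm_sq ((hPL.restrict Ω).sub hm.1)
      simp only [Pi.sub_apply] at e
      rw [e, ENNReal.toReal_ofReal (integral_nonneg fun _ => by positivity),
        restrict_interior hcone, ← integral_indicator isOpen_interior.measurableSet]
      -- The two extensions may differ on the frontier, as Ω may contain part of it, but the
      -- frontier is a null set.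
      have hz : ∀ᵐ x : E3, x ∉ frontier Ω :=
        measure_eq_zero_iff_ae_notMem.1 (volume_frontier_eq_zero hcone)
      refine integral_congr_ae ?_
      filter_upwards [hz] with x hxf
      by_cases hx : x ∈ interior Ω
      · rw [Set.indicator_of_mem hx, Set.indicator_of_mem hx]
      · rw [Set.indicator_of_notMem hx, Set.indicator_of_notMem hx, P, Set.indicator_of_notMem]
        · simp
        · exact fun h => hxf ⟨subset_closure (meshDomain_subset h), hx⟩
    rw [h4] at h3
    linarith [(abs_le.1 h3).2]

end

/-! ### Differences of Sobolev functions along displaced lattices -/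

/-- A measurable `H¹` function on `U` together with its weak partial derivatives. -/
structure IsSobolev (U : Set E3) (u : E3 → E3) (g : Fin 3 → E3 → E3) : Prop where
  isOpen : IsOpen U
  volume_ne_top : volume U ≠ ⊤
  measurable : Measurable u
  memLp : MemLp u 2 (volume.restrict U)
  memLp_partial : ∀ i, MemLp (g i) 2 (volume.restrict U)
  isWeakPartial : ∀ i, IsWeakPartial U i u (g i)

/-- The squared norm of the gradient. -/
def gradSq (g : Fin 3 → E3 → E3) (y : E3) : ℝ≥0∞ := ∑ i, ‖g i y‖ₑ ^ 2

namespace IsSobolev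

variable {U : Set E3} {u : E3 → E3} {g : Fin 3 → E3 → E3}

lemma isOpen_shift (h : ℝ) (p : E3) : IsOpen ((fun y => y - p) ⁻¹' cellO h 0) :=
  (isOpen_cellO h 0).preimage (by fun_prop)

lemma lintegral_segment_le (H : IsSobolev U u g) {h : ℝ} {p v : E3} {T : Set E3}
    (hT : MeasurableSet T) (hTU : T ⊆ U)
    (hseg : ∀ σ ∈ cellO h 0, ∀ t ∈ Set.Icc (0 : ℝ) 1, p + σ + t • v ∈ T) :
    ∫⁻ σ in cellO h 0, ‖u (p + v + σ) - u (p + σ)‖ₑ ^ 2 ≤ ‖v‖ₑ ^ 2 * ∫⁻ y in T, gradSq g y := by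
  have e : ∫⁻ σ in cellO h 0, ‖u (p + v + σ) - u (p + σ)‖ₑ ^ 2 =
      ∫⁻ y in (fun y => y - p) ⁻¹' cellO h 0, ‖u (y + v) - u y‖ₑ ^ 2 := by
    rw [← lintegral_cellO_translate h p fun y => ‖u (y + v) - u y‖ₑ ^ 2]
    simp_rw [add_right_comm p v]
  rw [e]
  refine lintegral_translate_sub_le_grad H.isOpen H.volume_ne_top H.memLp H.memLp_partial
    H.isWeakPartial (isOpen_shift h p) hT hTU fun t ht y hy => ?_
  have := hseg (y - p) hy t ht
  rwa [add_sub_cancel] at this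

/-- The integral estimate on every open subset of S bounds the integral of |u(· + v) − u|² by |v|²L
times the measure. Outer regularity extends this to measurable sets, and the bound then holds
pointwise almost everywhere. Only the segments in question have to stay in U, which need not be
convex. -/
lemma ae_translate_sub_le (H : IsSobolev U u g) {L : ℝ≥0∞} (hL : L ≠ ⊤)
    (hg : ∀ᵐ y, y ∈ U → gradSq g y ≤ L) {S : Set E3} (hS : IsOpen S) {v : E3}
    (hseg : ∀ t ∈ Set.Icc (0 : ℝ) 1, ∀ y ∈ S, y + t • v ∈ U) :
    ∀ᵐ y ∂(volume.restrict S), ‖u (y + v) - u y‖ₑ ^ 2 ≤ ‖v‖ₑ ^ 2 * L := by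
  have hmeas : Measurable fun y => ‖u (y + v) - u y‖ₑ ^ 2 :=
    ((H.measurable.comp (measurable_id.add_const v)).sub H.measurable).enorm.pow_const 2
  have hc : ‖v‖ₑ ^ 2 * L ≠ ⊤ := ENNReal.mul_ne_top (by simp) hL
  have hopen (S' : Set E3) (hS' : IsOpen S') (hsub : S' ⊆ S) :
      ∫⁻ y in S', ‖u (y + v) - u y‖ₑ ^ 2 ≤ ‖v‖ₑ ^ 2 * L * volume S' := by
    refine lintegral_translate_sub_le H.isOpen H.volume_ne_top H.memLp H.memLp_partial
      H.isWeakPartial hS' (fun t ht y hy => hseg t ht y (hsub hy)) fun t ht => ?_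
    rw [← setLIntegral_const]
    refine setLIntegral_mono_ae' hS'.measurableSet ?_
    have := (measurePreserving_add_right volume (t • v)).quasiMeasurePreserving.ae hg
    filter_upwards [this] with y hy hyS
    exact (enorm_sum_smul_sq_le v fun i => g i (y + t • v)).trans
      (mul_le_mul_right (hy (hseg t ht y (hsub hyS))) _)
  refine ae_le_of_forall_setLIntegral_le_of_sigmaFinite hmeas fun s hs hsfin => ?_
  rw [Measure.restrict_restrict hs, setLIntegral_const]
  refine ENNReal.le_of_forall_pos_le_add fun ε hε _ => ?_
  set c := ‖v‖ₑ ^ 2 * L with hcdef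
  have hε' : (ε : ℝ≥0∞) / (c + 1) ≠ 0 :=
    (ENNReal.div_pos (by exact_mod_cast hε.ne') (ENNReal.add_ne_top.2 ⟨hc, by simp⟩)).ne'
  obtain ⟨O, hsO, hO, hOle⟩ := (s ∩ S).exists_isOpen_le_add volume hε'
  calc ∫⁻ y in s ∩ S, ‖u (y + v) - u y‖ₑ ^ 2
      ≤ ∫⁻ y in O ∩ S, ‖u (y + v) - u y‖ₑ ^ 2 :=
        lintegral_mono_set (Set.subset_inter hsO Set.inter_subset_right)
    _ ≤ c * volume (O ∩ S) := hopen _ (hO.inter hS) Set.inter_subset_right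
    _ ≤ c * (volume (s ∩ S) + ε / (c + 1)) := by
        gcongr; exact (measure_mono Set.inter_subset_left).trans hOle
    _ ≤ c * volume (s ∩ S) + ε := by
        rw [mul_add]
        gcongr
        calc c * (ε / (c + 1)) ≤ (c + 1) * (ε / (c + 1)) := by gcongr; exact le_self_add
          _ ≤ ε := ENNReal.mul_div_le

lemma ae_segment_le (H : IsSobolev U u g) {L : ℝ≥0∞} (hL : L ≠ ⊤)
    (hg : ∀ᵐ y, y ∈ U → gradSq g y ≤ L) {h : ℝ} {p v : E3}
    (hseg : ∀ σ ∈ cellO h 0, ∀ t ∈ Set.Icc (0 : ℝ) 1, p + σ + t • v ∈ U) :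
    ∀ᵐ σ, σ ∈ cellO h 0 → ‖u (p + v + σ) - u (p + σ)‖ₑ ^ 2 ≤ ‖v‖ₑ ^ 2 * L := by
  have h1 := H.ae_translate_sub_le hL hg (isOpen_shift h p) (v := v) fun t ht y hy => by
    have := hseg (y - p) hy t ht
    rwa [add_sub_cancel] at this
  rw [ae_restrict_iff' (isOpen_shift h p).measurableSet] at h1
  have h2 := (measurePreserving_add_left volume p).quasiMeasurePreserving.ae h1
  filter_upwards [h2] with σ hσ hσc
  have := hσ (by simpa using hσc)
  rwa [add_right_comm]

lemma measurable_shift (H : IsSobolev U u g) (p : E3) : Measurable fun σ => u (p + σ) :=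
  H.measurable.comp (measurable_const.add measurable_id)

end IsSobolev

/-! ### Displacements and paths between displaced neighbours -/

lemma enorm_sub_sq_le_three (w x y z : E3) :
    ‖w - z‖ₑ ^ 2 ≤ 3 * (‖w - x‖ₑ ^ 2 + ‖x - y‖ₑ ^ 2 + ‖y - z‖ₑ ^ 2) := by
  simp_rw [← ofReal_norm, ← ENNReal.ofReal_pow (norm_nonneg _)]
  have h3 (t : ℝ) : 3 * ENNReal.ofReal t = ENNReal.ofReal (3 * t) := by
    rw [ENNReal.ofReal_mul (by norm_num)]; simp
  rw [← ENNReal.ofReal_add (by positivity) (by positivity),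
    ← ENNReal.ofReal_add (by positivity) (by positivity), h3]
  refine ENNReal.ofReal_le_ofReal ?_
  have h1 : ‖w - z‖ ≤ ‖w - x‖ + ‖x - y‖ + ‖y - z‖ := by
    have := norm_sub_le_norm_sub_add_norm_sub w x z
    have := norm_sub_le_norm_sub_add_norm_sub x y z
    linarith
  have h2 := pow_le_pow_left₀ (norm_nonneg _) h1 2
  nlinarith [sq_nonneg (‖w - x‖ - ‖x - y‖), sq_nonneg (‖w - x‖ - ‖y - z‖),
    sq_nonneg (‖x - y‖ - ‖y - z‖)]

/-- A displacement of the points of `Ω` away from the boundary, on the scale `h`. -/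
structure IsDisplacement (Ω : Set E3) (C h : ℝ) (τ : E3 → E3) : Prop where
  one_le : 1 ≤ C
  pos : 0 < h
  norm_le : ∀ y, ‖τ y‖ ≤ C * h
  eq_zero : ∀ y ∈ Ω, Metric.closedBall y (4 * h) ⊆ Ω → τ y = 0
  ball_subset : ∀ y ∈ Ω, ∀ y' ∈ Ω, dist y y' ≤ h → ∀ t ∈ Set.Icc (0 : ℝ) 1,
    Metric.ball (y + τ y + t • τ y') (4 * h) ⊆ interior Ω

namespace IsDisplacement

variable {Ω : Set E3} {C h : ℝ} {τ : E3 → E3} {u : E3 → E3} {g : Fin 3 → E3 → E3}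

lemma enorm_sq_le {v : E3} (hv : ‖v‖ ≤ C * h) :
    ‖v‖ₑ ^ 2 ≤ ENNReal.ofReal ((C * h) ^ 2) := by
  rw [← ofReal_norm, ← ENNReal.ofReal_pow (norm_nonneg _)]
  exact ENNReal.ofReal_le_ofReal (pow_le_pow_left₀ (norm_nonneg _) hv 2)

lemma segment_mem (D : IsDisplacement Ω C h τ) {x x' w : E3} (hx : x ∈ Ω) (hx' : x' ∈ Ω)
    (hd : dist x x' ≤ h) {t : ℝ} (ht : t ∈ Set.Icc (0 : ℝ) 1) (hw : ‖w‖ < 3 * h) {M : ℝ}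
    (hM : 2 * C + 3 ≤ M) :
    x + τ x + t • τ x' + w ∈ interior Ω ∩ Metric.ball x (M * h) := by
  have hp := D.pos
  refine ⟨D.ball_subset x hx x' hx' hd t ht ?_, ?_⟩
  · rw [Metric.mem_ball, dist_eq_norm, add_sub_cancel_left]; linarith
  · rw [Metric.mem_ball, dist_eq_norm]
    have e : x + τ x + t • τ x' + w - x = τ x + t • τ x' + w := by abel
    rw [e]
    have h1 : ‖t • τ x'‖ ≤ C * h := by
      rw [norm_smul, Real.norm_of_nonneg ht.1]
      have := D.norm_le x'
      nlinarith [ht.1, ht.2, norm_nonneg (τ x')]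
    have h2 := norm_add₃_le (a := τ x) (b := t • τ x') (c := w)
    have h3 := D.norm_le x
    nlinarith

lemma mem_of_shift (D : IsDisplacement Ω C h τ) {x σ : E3} (hx : x ∈ Ω) (hσ : σ ∈ cellO h 0) {M : ℝ}
    (hM : 2 * C + 3 ≤ M) : x + τ x + σ ∈ interior Ω ∩ Metric.ball x (M * h) := by
  have hp := D.pos
  have := D.segment_mem hx hx (by simpa using hp.le) (t := 0) (by simp) (w := σ)
    ((norm_lt_of_mem_cellO_zero hp hσ).trans (by linarith)) hM
  simpa using this

/-- The three segments of the path that joins two displaced neighbours. -/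
lemma path_mem (D : IsDisplacement Ω C h τ) {x e : E3} (hx : x ∈ Ω) (he : ‖e‖ ≤ h)
    (hx' : x + e ∈ Ω) {M : ℝ} (hM : 2 * C + 4 ≤ M) {σ : E3} (hσ : σ ∈ cellO h 0) {t : ℝ}
    (ht : t ∈ Set.Icc (0 : ℝ) 1) :
    x + τ x + σ + t • τ (x + e) ∈ interior Ω ∩ Metric.ball x (M * h) ∧
    x + τ x + τ (x + e) + σ + t • e ∈ interior Ω ∩ Metric.ball x (M * h) ∧
    x + e + τ (x + e) + σ + t • τ x ∈ interior Ω ∩ Metric.ball x (M * h) := by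
  have hp := D.pos
  have hσ' := norm_lt_of_mem_cellO_zero hp hσ
  have hd : dist x (x + e) ≤ h := by simpa using he
  refine ⟨?_, ?_, ?_⟩
  · have := D.segment_mem hx hx' hd ht (w := σ) (by linarith) (M := M) (by linarith)
    rwa [add_right_comm] at this
  · have h1 : ‖t • e‖ ≤ h := by
      rw [norm_smul, Real.norm_of_nonneg ht.1]
      nlinarith [ht.1, ht.2, norm_nonneg e]
    have := D.segment_mem hx hx' hd (t := 1) (by simp) (w := σ + t • e)
      (by linarith [norm_add_le σ (t • e)]) (M := M) (by linarith)
    rwa [one_smul, ← add_assoc] at this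
  · have := D.segment_mem hx' hx (by rwa [dist_comm]) ht (w := σ) (by linarith) (M := M - 1)
      (by linarith)
    rw [add_right_comm] at this
    refine ⟨this.1, ?_⟩
    have h2 := Metric.mem_ball.1 this.2
    rw [Metric.mem_ball]
    have h3 := dist_triangle (x + e + τ (x + e) + σ + t • τ x) (x + e) x
    rw [dist_comm (x + e) x] at h3
    nlinarith

/-- The straight segment between two displaced neighbours may leave Ω, since their cone directions
are unrelated. The path that adds τ(x + e), then e, and finally removes τ(x) stays in Ω, because two
successive pushes are admissible. The factor 9 is 3 segments times the 3 from squaring a sum of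
three terms. -/
lemma lintegral_edge_le (D : IsDisplacement Ω C h τ) (H : IsSobolev (interior Ω) u g) {x e : E3}
    (hx : x ∈ Ω) (he : ‖e‖ ≤ h) (hx' : x + e ∈ Ω) {M : ℝ} (hM : 2 * C + 4 ≤ M) :
    ∫⁻ σ in cellO h 0, ‖u (x + e + τ (x + e) + σ) - u (x + τ x + σ)‖ₑ ^ 2 ≤
      9 * ENNReal.ofReal ((C * h) ^ 2) * ∫⁻ y in interior Ω ∩ Metric.ball x (M * h), gradSq g y := by
  have hp := D.pos
  have hT : MeasurableSet (interior Ω ∩ Metric.ball x (M * h)) :=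
    isOpen_interior.measurableSet.inter Metric.isOpen_ball.measurableSet
  set I := ∫⁻ y in interior Ω ∩ Metric.ball x (M * h), gradSq g y
  have hCh : ‖e‖ ≤ C * h := he.trans (by nlinarith [D.one_le])
  have s1 : ∫⁻ σ in cellO h 0, ‖u (x + τ x + τ (x + e) + σ) - u (x + τ x + σ)‖ₑ ^ 2 ≤
      ENNReal.ofReal ((C * h) ^ 2) * I :=
    (H.lintegral_segment_le hT Set.inter_subset_left
      fun σ hσ t ht => (D.path_mem hx he hx' hM hσ ht).1).trans
      (mul_le_mul_left (enorm_sq_le (D.norm_le _)) _)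
  have s2 : ∫⁻ σ in cellO h 0, ‖u (x + τ x + τ (x + e) + e + σ) - u (x + τ x + τ (x + e) + σ)‖ₑ ^ 2 ≤
      ENNReal.ofReal ((C * h) ^ 2) * I :=
    (H.lintegral_segment_le hT Set.inter_subset_left
      fun σ hσ t ht => (D.path_mem hx he hx' hM hσ ht).2.1).trans
      (mul_le_mul_left (enorm_sq_le hCh) _)
  have s3 : ∫⁻ σ in cellO h 0, ‖u (x + e + τ (x + e) + τ x + σ) - u (x + e + τ (x + e) + σ)‖ₑ ^ 2 ≤
      ENNReal.ofReal ((C * h) ^ 2) * I :=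
    (H.lintegral_segment_le hT Set.inter_subset_left
      fun σ hσ t ht => (D.path_mem hx he hx' hM hσ ht).2.2).trans
      (mul_le_mul_left (enorm_sq_le (D.norm_le _)) _)
  have e1 : x + τ x + τ (x + e) + e = x + e + τ (x + e) + τ x := by abel
  rw [e1] at s2
  have m (p q : E3) : Measurable fun σ => ‖u (p + σ) - u (q + σ)‖ₑ ^ 2 :=
    ((H.measurable_shift p).sub (H.measurable_shift q)).enorm.pow_const 2
  calc _ ≤ ∫⁻ σ in cellO h 0, 3 * (‖u (x + e + τ (x + e) + τ x + σ) -
            u (x + e + τ (x + e) + σ)‖ₑ ^ 2 + ‖u (x + e + τ (x + e) + τ x + σ) -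
            u (x + τ x + τ (x + e) + σ)‖ₑ ^ 2 +
            ‖u (x + τ x + τ (x + e) + σ) - u (x + τ x + σ)‖ₑ ^ 2) := by
        refine lintegral_mono fun σ => ?_
        refine (enorm_sub_sq_le_three _ (u (x + e + τ (x + e) + τ x + σ))
          (u (x + τ x + τ (x + e) + σ)) _).trans_eq ?_
        rw [← enorm_neg (u (x + e + τ (x + e) + σ) - _), neg_sub]
    _ ≤ 3 * (ENNReal.ofReal ((C * h) ^ 2) * I + ENNReal.ofReal ((C * h) ^ 2) * I +
          ENNReal.ofReal ((C * h) ^ 2) * I) := by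
        rw [lintegral_const_mul' _ _ (by norm_num), lintegral_add_right _ (m _ _),
          lintegral_add_right _ (m _ _)]
        gcongr
    _ = _ := by ring

/-- The same path, with the pointwise estimate on each segment. -/
lemma ae_edge_le (D : IsDisplacement Ω C h τ) (H : IsSobolev (interior Ω) u g) {L : ℝ≥0∞}
    (hL : L ≠ ⊤) (hg : ∀ᵐ y, y ∈ interior Ω → gradSq g y ≤ L) {x e : E3}
    (hx : x ∈ Ω) (he : ‖e‖ ≤ h) (hx' : x + e ∈ Ω) :
    ∀ᵐ σ, σ ∈ cellO h 0 → ‖u (x + e + τ (x + e) + σ) - u (x + τ x + σ)‖ₑ ^ 2 ≤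
      9 * ENNReal.ofReal ((C * h) ^ 2) * L := by
  have hCh : ‖e‖ ≤ C * h := he.trans (by nlinarith [D.one_le, D.pos])
  have hp {σ : E3} (hσ : σ ∈ cellO h 0) {t : ℝ} (ht : t ∈ Set.Icc (0 : ℝ) 1) :=
    D.path_mem hx he hx' le_rfl hσ ht
  have s1 := H.ae_segment_le hL hg fun σ hσ t ht => (hp hσ ht).1.1
  have s2 := H.ae_segment_le hL hg fun σ hσ t ht => (hp hσ ht).2.1.1
  have s3 := H.ae_segment_le hL hg fun σ hσ t ht => (hp hσ ht).2.2.1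
  have e1 : x + τ x + τ (x + e) + e = x + e + τ (x + e) + τ x := by abel
  rw [e1] at s2
  filter_upwards [s1, s2, s3] with σ h1 h2 h3 hσ
  calc _ ≤ 3 * (‖u (x + e + τ (x + e) + τ x + σ) - u (x + e + τ (x + e) + σ)‖ₑ ^ 2 +
            ‖u (x + e + τ (x + e) + τ x + σ) - u (x + τ x + τ (x + e) + σ)‖ₑ ^ 2 +
            ‖u (x + τ x + τ (x + e) + σ) - u (x + τ x + σ)‖ₑ ^ 2) := by
        refine (enorm_sub_sq_le_three _ (u (x + e + τ (x + e) + τ x + σ))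
          (u (x + τ x + τ (x + e) + σ)) _).trans_eq ?_
        rw [← enorm_neg (u (x + e + τ (x + e) + σ) - _), neg_sub]
    _ ≤ 3 * (ENNReal.ofReal ((C * h) ^ 2) * L + ENNReal.ofReal ((C * h) ^ 2) * L +
          ENNReal.ofReal ((C * h) ^ 2) * L) := by
        gcongr
        · exact (h3 hσ).trans (mul_le_mul_left (enorm_sq_le (D.norm_le _)) _)
        · exact (h2 hσ).trans (mul_le_mul_left (enorm_sq_le hCh) _)
        · exact (h1 hσ).trans (mul_le_mul_left (enorm_sq_le (D.norm_le _)) _)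
    _ = _ := by ring

end IsDisplacement

/-! ### Choice of a shift of the lattice -/

/-- The closed ball of radius `4 h` around the node `k` is contained in `Ω`. -/
def IsDeep (Ω : Set E3) (h : ℝ) (k : Idx) : Prop := Metric.closedBall (latt h k) (4 * h) ⊆ Ω

/-- The part of the interior of `Ω` that is `δ`-close to the boundary. -/
def layer (Ω : Set E3) (δ : ℝ) : Set E3 := interior Ω ∩ Metric.cthickening δ (frontier Ω)

section

variable {Ω : Set E3} {h : ℝ} {u : E3 → E3} {g : Fin 3 → E3 → E3}

lemma exists_frontier_of_not_isDeep (hh : 0 < h) {k : Idx} (hk : latt h k ∈ Ω)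
    (hd : ¬ IsDeep Ω h k) : ∃ z ∈ frontier Ω, dist z (latt h k) ≤ 4 * h :=
  exists_frontier_of_not_subset (convex_closedBall _ _).isPreconnected hk
    (Metric.mem_closedBall_self (by positivity)) hd

lemma IsDeep.ball_subset {k : Idx} (hk : IsDeep Ω h k) :
    Metric.ball (latt h k) (4 * h) ⊆ interior Ω :=
  Metric.isOpen_ball.subset_interior_iff.2 (Metric.ball_subset_closedBall.trans hk)

/-- The distance 5h covers 4h from a node that is not deep to the frontier, plus h for an edge
leading to such a node. -/
lemma ball_subset_layer {x z : E3} {M : ℝ} (hz : z ∈ frontier Ω) (hd : dist z x ≤ 5 * h) :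
    interior Ω ∩ Metric.ball x (M * h) ⊆ layer Ω ((M + 5) * h) := fun y hy =>
  ⟨hy.1, mem_cthickening_of_dist hz (by
    have := Metric.mem_ball.1 hy.2
    rw [dist_comm] at hd
    linarith [dist_triangle y x z])⟩

lemma IsSobolev.measurable_lintegral_sub (H : IsSobolev (interior Ω) u g) (p : E3) (S : Set E3) :
    Measurable fun σ => ∫⁻ y in S, ‖u (p + σ) - u y‖ₑ ^ 2 := by
  refine Measurable.lintegral_prod_right' (f := fun z : E3 × E3 => ‖u (p + z.1) - u z.2‖ₑ ^ 2) ?_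
  exact (((H.measurable_shift p).comp measurable_fst).sub
    (H.measurable.comp measurable_snd)).enorm.pow_const 2

/-- Edges between deep nodes. -/
lemma IsSobolev.sum_deep_edges_le (H : IsSobolev (interior Ω) u g) (hh : 0 < h) {s : Finset Idx}
    (hs : ∀ k ∈ s, IsDeep Ω h k) (i : Fin 3) :
    ∑ k ∈ s, ∫⁻ σ in cellO h 0, ‖u (latt h k + h • basisVec i + σ) - u (latt h k + σ)‖ₑ ^ 2 ≤
      ENNReal.ofReal (h ^ 2) * ∫⁻ y in interior Ω, ‖g i y‖ₑ ^ 2 := by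
  set v : E3 := h • basisVec i with hv
  set S : Set E3 := ⋃ k ∈ s, cellO h k
  have hS : IsOpen S := isOpen_biUnion fun k _ => isOpen_cellO h k
  have hnv : ‖v‖ = h := by rw [hv, norm_smul, norm_basisVec, mul_one, Real.norm_of_nonneg hh.le]
  have hSv : ∀ t ∈ Set.Icc (0 : ℝ) 1, ∀ y ∈ S, y + t • v ∈ interior Ω := by
    intro t ht y hy
    obtain ⟨k, hk, hyk⟩ := Set.mem_iUnion₂.1 hy
    refine (hs k hk).ball_subset ?_
    have h1 := dist_latt_lt hh hyk
    have h2 : ‖t • v‖ ≤ h := by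
      rw [norm_smul, Real.norm_of_nonneg ht.1, hnv]
      nlinarith [ht.1, ht.2]
    rw [Metric.mem_ball]
    have h3 := dist_triangle (y + t • v) y (latt h k)
    have h4 : dist (y + t • v) y = ‖t • v‖ := by simp
    linarith
  -- The disjoint cells combine into one translation integral. As nothing overlaps and only the
  -- derivative along e_i enters, the constant is exactly h²; the upper bound needs this sharpness.
  have e : ∑ k ∈ s, ∫⁻ σ in cellO h 0, ‖u (latt h k + v + σ) - u (latt h k + σ)‖ₑ ^ 2 =
      ∫⁻ y in S, ‖u (y + v) - u y‖ₑ ^ 2 := by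
    rw [lintegral_biUnion_finset (fun k _ l _ hkl => disjoint_cellO hh hkl)
      (fun k _ => measurableSet_cellO h k)]
    refine Finset.sum_congr rfl fun k _ => ?_
    rw [lintegral_cellO_eq h k]
    simp_rw [add_right_comm _ v]
  rw [e]
  refine lintegral_translate_sub_le H.isOpen H.volume_ne_top H.memLp H.memLp_partial
    H.isWeakPartial hS hSv fun t ht => ?_
  have hsum (y : E3) : ‖∑ j, v j • g j (y + t • v)‖ₑ ^ 2 =
      ENNReal.ofReal (h ^ 2) * ‖g i (y + t • v)‖ₑ ^ 2 := by
    have : ∑ j, v j • g j (y + t • v) = h • g i (y + t • v) := by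
      rw [Finset.sum_eq_single i]
      · simp [hv, basisVec]
      · intro j _ hj; simp [hv, basisVec, hj]
      · simp
    rw [this, enorm_smul, mul_pow, Real.enorm_of_nonneg hh.le, ENNReal.ofReal_pow hh.le]
  simp_rw [hsum]
  rw [lintegral_const_mul' _ _ ENNReal.ofReal_ne_top]
  exact mul_le_mul_right (setLIntegral_translate_le (hSv t ht) (fun y => ‖g i y‖ₑ ^ 2)
    isOpen_interior.measurableSet) _

/-- Poincaré inequality on the cells of deep nodes. -/
lemma IsSobolev.sum_deep_cells_le (H : IsSobolev (interior Ω) u g) (hh : 0 < h) {s : Finset Idx}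
    (hs : ∀ k ∈ s, IsDeep Ω h k) :
    ∑ k ∈ s, ∫⁻ σ in cellO h 0, ∫⁻ y in cellO h k, ‖u (latt h k + σ) - u y‖ₑ ^ 2 ≤
      ENNReal.ofReal (32 * h ^ 5) * ∫⁻ y in interior Ω, gradSq g y := by
  have hsub (k : Idx) (hk : k ∈ s) : cellO h k ⊆ interior Ω := fun y hy =>
    (hs k hk).ball_subset (by
      rw [Metric.mem_ball]; linarith [dist_latt_lt hh hy])
  have hone (k : Idx) (hk : k ∈ s) :
      ∫⁻ σ in cellO h 0, ∫⁻ y in cellO h k, ‖u (latt h k + σ) - u y‖ₑ ^ 2 ≤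
        ENNReal.ofReal (32 * h ^ 5) * ∫⁻ y in cellO h k, gradSq g y := by
    rw [← lintegral_cellO_eq h k fun x => ∫⁻ y in cellO h k, ‖u x - u y‖ₑ ^ 2]
    have hr := Measure.restrict_mono (μ := (volume : Measure E3)) (hsub k hk) le_rfl
    have hp := lintegral_lintegral_sub_le (S := cellO h k)
      (by rw [volume_cellO hh.le]; exact ENNReal.ofReal_ne_top)
      (H.memLp.mono_measure hr) (fun i => (H.memLp_partial i).mono_measure hr)
      (fun i => (H.isWeakPartial i).mono (hsub k hk)) (isOpen_cellO h k) (convex_cellO h k)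
      (W := openBox (fun _ => -h) (2 * h)) (isOpen_openBox _ _).measurableSet
      (fun x hx y hy i => by
        have h1 := hx i
        have h2 := hy i
        simp only [PiLp.sub_apply]
        constructor <;> linarith)
      (d := 2 * h) (fun w hw => norm_le_two_mul_of_abs_le hh.le fun i => by
        have := hw i
        rw [abs_le]; constructor <;> linarith)
    rw [volume_openBox _ (by positivity), ← mul_assoc, ← ENNReal.ofReal_mul (by positivity)] at hp
    have e : ∫⁻ x in cellO h k, ∫⁻ y in cellO h k, ‖u x - u y‖ₑ ^ 2 =
        ∫⁻ y in cellO h k, ∫⁻ x in cellO h k, ‖u x - u y‖ₑ ^ 2 :=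
      lintegral_congr fun x => lintegral_congr fun y => by rw [← enorm_neg, neg_sub]
    rw [e]
    rw [show 32 * h ^ 5 = (2 * h) ^ 3 * (2 * h) ^ 2 by ring]
    exact hp
  refine (Finset.sum_le_sum hone).trans ?_
  rw [← Finset.mul_sum]
  gcongr
  exact sum_lintegral_cellO_le hh hsub _


variable {C : ℝ} {τ : E3 → E3}

/-- Edges that are not between deep nodes. -/
lemma IsDisplacement.sum_shallow_edges_le (D : IsDisplacement Ω C h τ)
    (H : IsSobolev (interior Ω) u g) {M : ℕ} (hM : 2 * C + 4 ≤ M) {s : Finset Idx} (i : Fin 3)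
    (hs : ∀ k ∈ s, latt h k ∈ Ω ∧ latt h k + h • basisVec i ∈ Ω ∧
      ¬ (IsDeep Ω h k ∧ IsDeep Ω h (k + Pi.single i 1))) :
    ∑ k ∈ s, ∫⁻ σ in cellO h 0, ‖u (latt h k + h • basisVec i +
        τ (latt h k + h • basisVec i) + σ) - u (latt h k + τ (latt h k) + σ)‖ₑ ^ 2 ≤
      9 * ENNReal.ofReal ((C * h) ^ 2) *
        (((2 * M + 2) ^ 3 : ℕ) * ∫⁻ y in layer Ω ((M + 5) * h), gradSq g y) := by
  have hh := D.pos
  have hnv : ‖h • basisVec i‖ = h := by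
    rw [norm_smul, norm_basisVec, mul_one, Real.norm_of_nonneg hh.le]
  refine (Finset.sum_le_sum fun k hk => D.lintegral_edge_le H (hs k hk).1 hnv.le
    (hs k hk).2.1 hM).trans ?_
  rw [← Finset.mul_sum]
  refine mul_le_mul_right (sum_lintegral_ball_le hh (fun k _ => isOpen_interior.measurableSet.inter
    Metric.isOpen_ball.measurableSet) (fun k hk => ?_) M (fun k _ => Set.inter_subset_right) _ ?_) _
  · obtain ⟨h1, h2, h3⟩ := hs k hk
    by_cases hd : IsDeep Ω h k
    · have e : latt h (k + Pi.single i 1) = latt h k + h • basisVec i := by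
        rw [latt_add, latt_single]
      obtain ⟨z, hz, hzd⟩ := exists_frontier_of_not_isDeep hh (e ▸ h2) fun hd' => h3 ⟨hd, hd'⟩
      refine ball_subset_layer hz ?_
      rw [e] at hzd
      have := dist_triangle z (latt h k + h • basisVec i) (latt h k)
      have h4 : dist (latt h k + h • basisVec i) (latt h k) = h := by simpa using hnv
      linarith
    · obtain ⟨z, hz, hzd⟩ := exists_frontier_of_not_isDeep hh h1 hd
      exact ball_subset_layer hz (by linarith)
  · exact (Finset.aemeasurable_fun_sum _ fun i _ => ((H.memLp_partial i).1.enorm.pow_const 2)).mono_measure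
      (Measure.restrict_mono Set.inter_subset_left le_rfl)

/-- Values at the displaced nodes that are not deep. -/
lemma IsDisplacement.sum_shallow_nodes_le (D : IsDisplacement Ω C h τ)
    (H : IsSobolev (interior Ω) u g) {M : ℕ} (hM : 2 * C + 4 ≤ M) {s : Finset Idx}
    (hs : ∀ k ∈ s, latt h k ∈ Ω ∧ ¬ IsDeep Ω h k) :
    ∑ k ∈ s, ∫⁻ σ in cellO h 0, ‖u (latt h k + τ (latt h k) + σ)‖ₑ ^ 2 ≤
      ((2 * M + 2) ^ 3 : ℕ) * ∫⁻ y in layer Ω ((M + 5) * h), ‖u y‖ₑ ^ 2 := by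
  have hh := D.pos
  simp_rw [fun k => lintegral_cellO_translate h (latt h k + τ (latt h k)) fun y => ‖u y‖ₑ ^ 2]
  have hmem : ∀ k ∈ s, (fun y => y - (latt h k + τ (latt h k))) ⁻¹' cellO h 0 ⊆
      interior Ω ∩ Metric.ball (latt h k) (M * h) := by
    intro k hk y hy
    have := D.mem_of_shift (hs k hk).1 hy (M := M) (by linarith)
    rwa [add_sub_cancel] at this
  refine sum_lintegral_ball_le hh (fun k _ => (IsSobolev.isOpen_shift h _).measurableSet)
    (fun k hk => ?_) M (fun k hk => (hmem k hk).trans Set.inter_subset_right) _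
    (H.measurable.enorm.pow_const 2).aemeasurable
  obtain ⟨z, hz, hzd⟩ := exists_frontier_of_not_isDeep hh (hs k hk).1 (hs k hk).2
  exact (hmem k hk).trans (ball_subset_layer hz (by linarith))

end

/-- The sum of the squared differences along the edges of a set of lattice indices. -/
def edgeSq (N : Finset Idx) (w : Idx → E3) : ℝ≥0∞ :=
  ∑ i, ∑ k ∈ N.filter (fun k => k + Pi.single i 1 ∈ N), ‖w (k + Pi.single i 1) - w k‖ₑ ^ 2

open Classical in
/-- The squared `L²` distance of nodal values to `u` on the cells of the deep nodes, plus the squared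
discrete `L²` norm at the other nodes. -/
def cellSq (Ω : Set E3) (h : ℝ) (N : Finset Idx) (u : E3 → E3) (w : Idx → E3) : ℝ≥0∞ :=
  (∑ k ∈ N.filter (fun k => IsDeep Ω h k), ∫⁻ y in cellO h k, ‖w k - u y‖ₑ ^ 2) +
    ENNReal.ofReal (h ^ 3) * ∑ k ∈ N.filter (fun k => ¬ IsDeep Ω h k), ‖w k‖ₑ ^ 2

namespace IsDisplacement

variable {Ω : Set E3} {h C : ℝ} {u : E3 → E3} {g : Fin 3 → E3 → E3} {τ : E3 → E3}

/-- The values of `u` at the displaced and shifted lattice nodes. -/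
def _root_.shiftedValues (h : ℝ) (τ u : E3 → E3) (σ : E3) (k : Idx) : E3 :=
  u (latt h k + τ (latt h k) + σ)

lemma _root_.IsSobolev.measurable_shiftedValues (H : IsSobolev (interior Ω) u g) (h : ℝ)
    (τ : E3 → E3) (k : Idx) : Measurable fun σ => shiftedValues h τ u σ k :=
  H.measurable_shift _

lemma measurable_edgeSq (H : IsSobolev (interior Ω) u g) (h : ℝ) (τ : E3 → E3) (N : Finset Idx) :
    Measurable fun σ => edgeSq N (shiftedValues h τ u σ) :=
  Finset.measurable_fun_sum _ fun _ _ => Finset.measurable_fun_sum _ fun _ _ =>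
    ((H.measurable_shiftedValues h τ _).sub (H.measurable_shiftedValues h τ _)).enorm.pow_const 2

lemma measurable_cellSq (H : IsSobolev (interior Ω) u g) (h : ℝ) (τ : E3 → E3) (N : Finset Idx) :
    Measurable fun σ => cellSq Ω h N u (shiftedValues h τ u σ) :=
  (Finset.measurable_fun_sum _ fun _ _ => H.measurable_lintegral_sub _ _).add
    ((Finset.measurable_fun_sum _ fun _ _ =>
      (H.measurable_shiftedValues h τ _).enorm.pow_const 2).const_mul _)

lemma tau_eq_zero (D : IsDisplacement Ω C h τ) {k : Idx} (hd : IsDeep Ω h k) :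
    τ (latt h k) = 0 :=
  D.eq_zero _ (hd (Metric.mem_closedBall_self (by linarith [D.pos]))) hd

/-- Edges between deep nodes are not displaced and carry the sharp constant. All others have lossy
constants but see only a boundary layer; 27 collects the factor 9 in three directions. -/
lemma lintegral_edgeSq_le (D : IsDisplacement Ω C h τ) (H : IsSobolev (interior Ω) u g) {M : ℕ}
    (hM : 2 * C + 4 ≤ M) {N : Finset Idx} (hN : ∀ k ∈ N, latt h k ∈ Ω) :
    ∫⁻ σ in cellO h 0, edgeSq N (shiftedValues h τ u σ) ≤ ENNReal.ofReal (h ^ 2) *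
      ((∫⁻ y in interior Ω, gradSq g y) + 27 * ENNReal.ofReal (C ^ 2) *
        (((2 * M + 2) ^ 3 : ℕ) * ∫⁻ y in layer Ω ((M + 5) * h), gradSq g y)) := by
  classical
  have hh := D.pos
  have m (k l : Idx) : Measurable fun σ =>
      ‖shiftedValues h τ u σ k - shiftedValues h τ u σ l‖ₑ ^ 2 :=
    ((H.measurable_shiftedValues h τ _).sub (H.measurable_shiftedValues h τ _)).enorm.pow_const 2
  have e (k : Idx) (i : Fin 3) : latt h (k + Pi.single i 1) = latt h k + h • basisVec i := by
    rw [latt_add, latt_single]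
  set X := ENNReal.ofReal (h ^ 2) * (9 * ENNReal.ofReal (C ^ 2) *
        (((2 * M + 2) ^ 3 : ℕ) * ∫⁻ y in layer Ω ((M + 5) * h), gradSq g y)) with hX
  have key (i : Fin 3) : ∑ k ∈ N.filter (fun k => k + Pi.single i 1 ∈ N), ∫⁻ σ in cellO h 0,
      ‖shiftedValues h τ u σ (k + Pi.single i 1) - shiftedValues h τ u σ k‖ₑ ^ 2 ≤
      ENNReal.ofReal (h ^ 2) * (∫⁻ y in interior Ω, ‖g i y‖ₑ ^ 2) + X := by
    rw [← Finset.sum_filter_add_sum_filter_not _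
      (fun k => IsDeep Ω h k ∧ IsDeep Ω h (k + Pi.single i 1))]
    refine add_le_add ?_ ?_
    · refine le_trans (le_of_eq (Finset.sum_congr rfl fun k hk => ?_)) (H.sum_deep_edges_le hh
        (s := (N.filter (fun k => k + Pi.single i 1 ∈ N)).filter
          (fun k => IsDeep Ω h k ∧ IsDeep Ω h (k + Pi.single i 1)))
        (fun k hk => (Finset.mem_filter.1 hk).2.1) i)
      have hd := (Finset.mem_filter.1 hk).2
      have h0 := D.tau_eq_zero hd.2
      rw [e] at h0
      simp only [shiftedValues, D.tau_eq_zero hd.1, h0, add_zero, e]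
    · have h1 := D.sum_shallow_edges_le H hM
        (s := (N.filter (fun k => k + Pi.single i 1 ∈ N)).filter
          (fun k => ¬ (IsDeep Ω h k ∧ IsDeep Ω h (k + Pi.single i 1)))) i fun k hk => by
          obtain ⟨h1, h2⟩ := Finset.mem_filter.1 hk
          obtain ⟨h3, h4⟩ := Finset.mem_filter.1 h1
          exact ⟨hN k h3, e k i ▸ hN _ h4, h2⟩
      refine le_trans (le_of_eq (Finset.sum_congr rfl fun k hk => ?_)) (h1.trans_eq ?_)
      · simp only [shiftedValues, e]
      · rw [hX, mul_pow, ENNReal.ofReal_mul (by positivity)]; ring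
  have e2 : ∫⁻ σ in cellO h 0, edgeSq N (shiftedValues h τ u σ) =
      ∑ i, ∑ k ∈ N.filter (fun k => k + Pi.single i 1 ∈ N), ∫⁻ σ in cellO h 0,
        ‖shiftedValues h τ u σ (k + Pi.single i 1) - shiftedValues h τ u σ k‖ₑ ^ 2 := by
    simp only [edgeSq]
    rw [lintegral_finsetSum _ fun i _ => Finset.measurable_fun_sum _ fun _ _ => m _ _]
    exact Finset.sum_congr rfl fun i _ => lintegral_finsetSum _ fun _ _ => m _ _
  rw [e2]
  refine (Finset.sum_le_sum fun i _ => key i).trans (le_of_eq ?_)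
  rw [Finset.sum_add_distrib, ← Finset.mul_sum,
    ← lintegral_finsetSum' _ fun i _ => ((H.memLp_partial i).1.enorm.pow_const 2), hX]
  simp only [Finset.sum_const, Finset.card_univ, Fintype.card_fin, nsmul_eq_mul, gradSq]
  push_cast
  ring

lemma lintegral_cellSq_le (D : IsDisplacement Ω C h τ) (H : IsSobolev (interior Ω) u g) {M : ℕ}
    (hM : 2 * C + 4 ≤ M) {N : Finset Idx} (hN : ∀ k ∈ N, latt h k ∈ Ω) :
    ∫⁻ σ in cellO h 0, cellSq Ω h N u (shiftedValues h τ u σ) ≤ ENNReal.ofReal (h ^ 3) *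
      (ENNReal.ofReal (32 * h ^ 2) * (∫⁻ y in interior Ω, gradSq g y) +
        ((2 * M + 2) ^ 3 : ℕ) * ∫⁻ y in layer Ω ((M + 5) * h), ‖u y‖ₑ ^ 2) := by
  classical
  have hh := D.pos
  have m1 (k : Idx) : Measurable fun σ => ∫⁻ y in cellO h k, ‖shiftedValues h τ u σ k - u y‖ₑ ^ 2 :=
    H.measurable_lintegral_sub _ _
  have m2 (k : Idx) : Measurable fun σ => ‖shiftedValues h τ u σ k‖ₑ ^ 2 :=
    (H.measurable_shiftedValues h τ _).enorm.pow_const 2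
  simp only [cellSq]
  rw [lintegral_add_left (Finset.measurable_fun_sum _ fun _ _ => m1 _),
    lintegral_const_mul _ (Finset.measurable_fun_sum _ fun _ _ => m2 _),
    lintegral_finsetSum _ (fun _ _ => m1 _), lintegral_finsetSum _ (fun _ _ => m2 _), mul_add]
  refine add_le_add ?_ (mul_le_mul_right (D.sum_shallow_nodes_le H hM fun k hk =>
    ⟨hN k (Finset.mem_filter.1 hk).1, (Finset.mem_filter.1 hk).2⟩) _)
  refine le_trans (le_of_eq (Finset.sum_congr rfl fun k hk => ?_)) ((H.sum_deep_cells_le hh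
    (s := N.filter (fun k => IsDeep Ω h k)) fun k hk => (Finset.mem_filter.1 hk).2).trans_eq ?_)
  · simp only [shiftedValues, D.tau_eq_zero (Finset.mem_filter.1 hk).2, add_zero]
  · rw [← mul_assoc, ← ENNReal.ofReal_mul (by positivity)]
    congr 2
    ring

/-- There is a shift for which both the energy and the distance are controlled by their mean. -/
theorem exists_shift (D : IsDisplacement Ω C h τ) (H : IsSobolev (interior Ω) u g) {M : ℕ}
    (hM : 2 * C + 4 ≤ M) {N : Finset Idx} (hN : ∀ k ∈ N, latt h k ∈ Ω) {p : E3 → Prop}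
    (hp : ∀ᵐ σ, σ ∈ cellO h 0 → p σ) (q : ℝ≥0∞) :
    ∃ σ, p σ ∧ ENNReal.ofReal h * edgeSq N (shiftedValues h τ u σ) +
        cellSq Ω h N u (shiftedValues h τ u σ) / q ≤
      ((∫⁻ y in interior Ω, gradSq g y) + 27 * ENNReal.ofReal (C ^ 2) *
        (((2 * M + 2) ^ 3 : ℕ) * ∫⁻ y in layer Ω ((M + 5) * h), gradSq g y)) +
      (ENNReal.ofReal (32 * h ^ 2) * (∫⁻ y in interior Ω, gradSq g y) +
        ((2 * M + 2) ^ 3 : ℕ) * ∫⁻ y in layer Ω ((M + 5) * h), ‖u y‖ₑ ^ 2) / q := by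
  have hh := D.pos
  have hvol : volume (cellO h 0) = ENNReal.ofReal (h ^ 3) := volume_cellO hh.le 0
  have hpos : 0 < h ^ 3 := by positivity
  have hne : volume.restrict (cellO h 0) ≠ 0 := by
    rw [Ne, Measure.restrict_eq_zero, hvol]; simpa using hpos
  have : IsFiniteMeasure (volume.restrict (cellO h 0)) := ⟨by simp [hvol]⟩
  have m1 := (measurable_edgeSq H h τ N).const_mul (ENNReal.ofReal h)
  have m2 := (measurable_cellSq H h τ N).div_const q
  have hp' : ∀ᵐ σ ∂(volume.restrict (cellO h 0)), p σ :=
    (ae_restrict_iff' (measurableSet_cellO h 0)).2 hp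
  -- A function is at most its mean somewhere off any given null set. Averaging the sum of the two
  -- quantities makes one shift serve both.
  obtain ⟨σ, hσ, hle⟩ := exists_notMem_null_le_laverage hne (m1.add m2).aemeasurable hp'
  refine ⟨σ, by simpa using hσ, hle.trans ?_⟩
  rw [laverage_eq, Measure.restrict_apply_univ, hvol]
  have hne0 : ENNReal.ofReal (h ^ 3) ≠ 0 := by simpa using hpos
  refine ENNReal.div_le_of_le_mul' ?_
  have e1 : ∫⁻ σ in cellO h 0, ((fun σ => ENNReal.ofReal h * edgeSq N (shiftedValues h τ u σ)) +
      fun σ => cellSq Ω h N u (shiftedValues h τ u σ) / q) σ =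
      ENNReal.ofReal h * (∫⁻ σ in cellO h 0, edgeSq N (shiftedValues h τ u σ)) +
        (∫⁻ σ in cellO h 0, cellSq Ω h N u (shiftedValues h τ u σ)) / q := by
    simp only [Pi.add_apply]
    rw [lintegral_add_left m1, lintegral_const_mul _ (measurable_edgeSq H h τ N)]
    simp only [div_eq_mul_inv]
    rw [lintegral_mul_const _ (measurable_cellSq H h τ N)]
  rw [e1, mul_add]
  refine add_le_add ?_ ?_
  · refine (mul_le_mul_right (D.lintegral_edgeSq_le H hM hN) _).trans_eq ?_
    rw [← mul_assoc, ← ENNReal.ofReal_mul hh.le]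
    congr 2
    ring
  · rw [← mul_div_assoc]
    exact ENNReal.div_le_div_right (D.lintegral_cellSq_le H hM hN) _

end IsDisplacement

/-! ### Recovery sequences -/

lemma UniformConeProperty.exists_isDisplacement {Ω : Set E3} (hcone : UniformConeProperty Ω) :
    ∃ C h₀ : ℝ, 1 ≤ C ∧ 0 < h₀ ∧ ∀ h, 0 < h → h < h₀ → ∃ τ, IsDisplacement Ω C h τ := by
  obtain ⟨C, h₀, hC, hh₀, H⟩ := hcone.exists_displacement
  refine ⟨C, h₀, hC, hh₀, fun h hh hlt => ?_⟩
  obtain ⟨τ, h1, h2, h3⟩ := H h hh hlt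
  exact ⟨τ, hC, hh, h1, h2, h3⟩

/-- A bound for large `n` suffices. -/
lemma boundedSpins_of_eventually {a : ℝ} {Ω : Set E3} {μ : ℕ → Idx → E3} {B : ℝ}
    (h : ∀ᶠ n : ℕ in atTop, (a / n) ^ 3 * ∑ᶠ k ∈ nodes a Ω n, ‖μ n k‖ ^ 2 ≤ B) :
    BoundedSpins a Ω μ := by
  obtain ⟨n₀, hn₀⟩ := eventually_atTop.1 h
  set f : ℕ → ℝ := fun n => (a / n) ^ 3 * ∑ᶠ k ∈ nodes a Ω n, ‖μ n k‖ ^ 2 with hf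
  set B' : ℝ := |B| + ∑ n ∈ Finset.range n₀, |f n| with hB'
  have h0 : 0 ≤ B' := by positivity
  refine ⟨B' + 1, fun n _ => ?_⟩
  have h1 : f n ≤ B' := by
    rcases lt_or_ge n n₀ with hn | hn
    · have := Finset.single_le_sum (f := fun n => |f n|) (fun _ _ => abs_nonneg _)
        (Finset.mem_range.2 hn)
      have h3 := le_abs_self (f n)
      have h4 := abs_nonneg B
      linarith
    · have h2 : f n ≤ B := hn₀ n hn
      have h3 : 0 ≤ ∑ n ∈ Finset.range n₀, |f n| := Finset.sum_nonneg fun _ _ => abs_nonneg _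
      linarith [le_abs_self B]
  change f n ≤ _
  nlinarith

lemma two_mul_enorm_sq_lintegral_le {S : Set E3} (hS : MeasurableSet S) (u : E3 → E3)
    (hu : Measurable u) (w : E3) :
    ∫⁻ y in S, ‖w - u y‖ₑ ^ 2 ≤ 2 * (‖w‖ₑ ^ 2 * volume S) + 2 * ∫⁻ y in S, ‖u y‖ₑ ^ 2 := by
  rw [← setLIntegral_const, ← lintegral_const_mul _ measurable_const,
    ← lintegral_const_mul _ (hu.enorm.pow_const 2), ← lintegral_add_left
    (measurable_const.const_mul _)]
  refine setLIntegral_mono' hS fun y _ => ?_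
  have := enorm_sub_sq_le w 0 (u y)
  simpa using this

section

variable {Ω : Set E3} {h : ℝ} {u : E3 → E3} {N : Finset Idx} {w : Idx → E3}

/-- On cells of deep nodes this is part of `cellSq`. On the others, |w − u|² ≤ 2|w|² + 2|u|², where
the first term is again controlled by `cellSq` and the second lives in the layer; hence 3 = 1 + 2.
-/
lemma sum_cells_le (hh : 0 < h) (hu : Measurable u) (hN : ∀ k ∈ N, latt h k ∈ Ω) {M : ℕ}
    (hM : 1 ≤ M) {s : Finset Idx} (hs : s ⊆ N) (hsub : ∀ k ∈ s, cellO h k ⊆ interior Ω) :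
    ∑ k ∈ s, ∫⁻ y in cellO h k, ‖w k - u y‖ₑ ^ 2 ≤
      3 * cellSq Ω h N u w + 2 * ∫⁻ y in layer Ω ((M + 5) * h), ‖u y‖ₑ ^ 2 := by
  classical
  rw [← Finset.sum_filter_add_sum_filter_not s (fun k => IsDeep Ω h k)]
  have h1 : ∑ k ∈ s.filter (fun k => IsDeep Ω h k), ∫⁻ y in cellO h k, ‖w k - u y‖ₑ ^ 2 ≤
      cellSq Ω h N u w := by
    rw [cellSq]
    refine le_add_right (le_trans (Finset.sum_le_sum_of_subset (Finset.filter_subset_filter _ hs))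
      (le_of_eq (Finset.sum_congr ?_ fun _ _ => rfl)))
    ext; simp
  have h2 : ENNReal.ofReal (h ^ 3) * ∑ k ∈ s.filter (fun k => ¬ IsDeep Ω h k), ‖w k‖ₑ ^ 2 ≤
      cellSq Ω h N u w := by
    rw [cellSq]
    refine le_add_left (mul_le_mul_right (le_trans
      (Finset.sum_le_sum_of_subset (Finset.filter_subset_filter _ hs))
      (le_of_eq (Finset.sum_congr ?_ fun _ _ => rfl))) _)
    ext; simp
  have h3 : ∑ k ∈ s.filter (fun k => ¬ IsDeep Ω h k), ∫⁻ y in cellO h k, ‖u y‖ₑ ^ 2 ≤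
      ∫⁻ y in layer Ω ((M + 5) * h), ‖u y‖ₑ ^ 2 := by
    refine sum_lintegral_cellO_le hh (fun k hk y hy => ?_) _
    obtain ⟨hk, hd⟩ := Finset.mem_filter.1 hk
    obtain ⟨z, hz, hzd⟩ := exists_frontier_of_not_isDeep hh (hN k (hs hk)) hd
    refine ⟨hsub k hk hy, mem_cthickening_of_dist hz ?_⟩
    have h4 := dist_latt_lt hh hy
    have h5 := dist_triangle_right y z (latt h k)
    have h6 : (1 : ℝ) ≤ M := by exact_mod_cast hM
    nlinarith
  calc _ ≤ cellSq Ω h N u w + ∑ k ∈ s.filter (fun k => ¬ IsDeep Ω h k),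
        (2 * (‖w k‖ₑ ^ 2 * ENNReal.ofReal (h ^ 3)) + 2 * ∫⁻ y in cellO h k, ‖u y‖ₑ ^ 2) := by
        refine add_le_add h1 (Finset.sum_le_sum fun k _ => ?_)
        rw [← volume_cellO hh.le k]
        exact two_mul_enorm_sq_lintegral_le (measurableSet_cellO h k) u hu (w k)
    _ = cellSq Ω h N u w + (2 * (ENNReal.ofReal (h ^ 3) *
          ∑ k ∈ s.filter (fun k => ¬ IsDeep Ω h k), ‖w k‖ₑ ^ 2) +
          2 * ∑ k ∈ s.filter (fun k => ¬ IsDeep Ω h k), ∫⁻ y in cellO h k, ‖u y‖ₑ ^ 2) := by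
        rw [Finset.sum_add_distrib, ← Finset.mul_sum, ← Finset.mul_sum, ← Finset.sum_mul,
          mul_comm (ENNReal.ofReal _)]
    _ ≤ cellSq Ω h N u w + (2 * cellSq Ω h N u w +
          2 * ∫⁻ y in layer Ω ((M + 5) * h), ‖u y‖ₑ ^ 2) := by gcongr
    _ = _ := by ring

/-- This yields the discrete L² bound. At deep nodes |w|² is compared with u on the undisplaced
cell, and at the others it is already a summand of `cellSq`. -/
lemma sum_nodes_le (hh : 0 < h) (hu : Measurable u) :
    ENNReal.ofReal (h ^ 3) * ∑ k ∈ N, ‖w k‖ₑ ^ 2 ≤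
      2 * cellSq Ω h N u w + 2 * ∫⁻ y in interior Ω, ‖u y‖ₑ ^ 2 := by
  classical
  rw [← Finset.sum_filter_add_sum_filter_not N (fun k => IsDeep Ω h k), mul_add]
  have hone (k : Idx) : ENNReal.ofReal (h ^ 3) * ‖w k‖ₑ ^ 2 ≤
      2 * (∫⁻ y in cellO h k, ‖w k - u y‖ₑ ^ 2) + 2 * ∫⁻ y in cellO h k, ‖u y‖ₑ ^ 2 := by
    have hm : Measurable fun y => ‖w k - u y‖ₑ ^ 2 := (measurable_const.sub hu).enorm.pow_const 2
    rw [mul_comm, ← volume_cellO hh.le k, ← setLIntegral_const, ← lintegral_const_mul _ hm,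
      ← lintegral_const_mul _ (hu.enorm.pow_const 2),
      ← lintegral_add_right _ ((hu.enorm.pow_const 2).const_mul _)]
    refine setLIntegral_mono' (measurableSet_cellO h k) fun y _ => ?_
    simpa using enorm_sub_sq_le (w k) (u y) 0
  have h3 : ∑ k ∈ N.filter (fun k => IsDeep Ω h k), ∫⁻ y in cellO h k, ‖u y‖ₑ ^ 2 ≤
      ∫⁻ y in interior Ω, ‖u y‖ₑ ^ 2 := by
    refine sum_lintegral_cellO_le hh (fun k hk y hy => ?_) _
    exact (Finset.mem_filter.1 hk).2.ball_subset (by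
      rw [Metric.mem_ball]; linarith [dist_latt_lt hh hy])
  rw [cellSq]
  set X := ∑ k ∈ N.filter (fun k => IsDeep Ω h k), ∫⁻ y in cellO h k, ‖w k - u y‖ₑ ^ 2
  set Y := ENNReal.ofReal (h ^ 3) * ∑ k ∈ N.filter (fun k => ¬ IsDeep Ω h k), ‖w k‖ₑ ^ 2
  have h1 : ENNReal.ofReal (h ^ 3) * ∑ k ∈ N.filter (fun k => IsDeep Ω h k), ‖w k‖ₑ ^ 2 ≤
      2 * X + 2 * ∫⁻ y in interior Ω, ‖u y‖ₑ ^ 2 := by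
    rw [Finset.mul_sum]
    refine (Finset.sum_le_sum fun k _ => hone k).trans ?_
    rw [Finset.sum_add_distrib, ← Finset.mul_sum, ← Finset.mul_sum]
    gcongr
  have e (Z : ℝ≥0∞) : Z ≤ 2 * Z := by rw [two_mul]; exact le_self_add
  calc _ ≤ 2 * X + 2 * (∫⁻ y in interior Ω, ‖u y‖ₑ ^ 2) + 2 * Y := add_le_add h1 (e Y)
    _ = 2 * (X + Y) + 2 * ∫⁻ y in interior Ω, ‖u y‖ₑ ^ 2 := by ring
    _ ≤ _ := by
        refine le_of_eq ?_
        congr!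

end

lemma ofReal_latticeEnergy {a : ℝ} (ha : 0 < a) {Ω : Set E3} {n : ℕ} {N : Finset Idx}
    (hN : (N : Set Idx) = nodes a Ω n) (w : Idx → E3) :
    ENNReal.ofReal (latticeEnergy a Ω n w) = ENNReal.ofReal (a / n) * edgeSq N w := by
  classical
  have hmem (k : Idx) : k ∈ nodes a Ω n ↔ k ∈ N := by rw [← hN]; simp
  rw [latticeEnergy, ENNReal.ofReal_mul (by positivity), edgeSq, ← hN, finsum_mem_coe_finset,
    Finset.sum_comm]
  congr 1
  simp_rw [Finset.sum_filter]
  rw [ENNReal.ofReal_sum_of_nonneg fun i _ => Finset.sum_nonneg fun k _ => by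
    split_ifs <;> positivity]
  refine Finset.sum_congr rfl fun i _ => ?_
  rw [ENNReal.ofReal_sum_of_nonneg fun k _ => by split_ifs <;> positivity]
  refine Finset.sum_congr rfl fun k _ => ?_
  by_cases hk : k + Pi.single i 1 ∈ N
  · simp [hk, ← ofReal_norm, ENNReal.ofReal_pow (norm_nonneg _)]
  · simp [hk]

/-- A recovery sequence all of whose levels satisfy a condition `p` that holds for the values of the
limit at almost every shift of the displaced lattice. -/
theorem exists_recovery {a : ℝ} (ha : 0 < a) {Ω : Set E3} (hΩ : Bornology.IsBounded Ω)
    (hcone : UniformConeProperty Ω) {A μ₀ : ℝ} (hA : 0 < A) (hμ₀ : 0 < μ₀) {hZ : E3 → E3}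
    (hhZ : Continuous hZ) {m : E3 → E3} (hm : MemH1 Ω m) {u : E3 → E3}
    (H : IsSobolev (interior Ω) u (fun i => weakPartial Ω i m))
    (hum : m =ᵐ[volume.restrict (interior Ω)] u) {C h₀ : ℝ} (hC : 1 ≤ C) (hh₀ : 0 < h₀)
    (hτ : ∀ h, 0 < h → h < h₀ → ∃ τ, IsDisplacement Ω C h τ) {p : ℕ → (Idx → E3) → Prop}
    (hp : ∀ n : ℕ, 1 ≤ n → ∀ τ, IsDisplacement Ω C (a / n) τ →
      ∀ᵐ σ, σ ∈ cellO (a / n) 0 → p n (shiftedValues (a / n) τ u σ))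
    (hp' : ∀ n, ∃ w, p n w) :
    ∃ μ, (∀ n, p n (μ n)) ∧ BoundedSpins a Ω μ ∧ ConvergesTo a Ω μ m ∧
      LimsupIneq a A μ₀ hZ Ω μ m := by
  obtain ⟨M, hM⟩ := exists_nat_ge (2 * C + 4)
  set E := ∫⁻ y in interior Ω, gradSq (fun i => weakPartial Ω i m) y with hE
  set ℓ : ℕ → ℝ≥0∞ := fun n =>
    ∫⁻ y in layer Ω ((M + 5) * (a / n)), gradSq (fun i => weakPartial Ω i m) y with hℓ
  set ℓ' : ℕ → ℝ≥0∞ := fun n => ∫⁻ y in layer Ω ((M + 5) * (a / n)), ‖u y‖ₑ ^ 2 with hℓ'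
  set j : ℕ → ℝ≥0∞ := fun n => ENNReal.ofReal (32 * (a / n) ^ 2) * E + ((2 * M + 2) ^ 3 : ℕ) * ℓ' n
    with hj
  -- The weight q tends to 0, but so slowly that j/q ≤ √j → 0. Thus the energy bound T tends to E
  -- while the distance is at most T q → 0. The summand a/n keeps q nonzero if j vanishes.
  set q : ℕ → ℝ≥0∞ := fun n => j n ^ (1 / 2 : ℝ) + ENNReal.ofReal (a / n) with hq
  set T : ℕ → ℝ≥0∞ := fun n =>
    (E + 27 * ENNReal.ofReal (C ^ 2) * (((2 * M + 2) ^ 3 : ℕ) * ℓ n)) + j n / q n with hT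
  -- the limits of the bounds
  have hEsum : E = ENNReal.ofReal (∫ x in Ω, ∑ i, ‖weakPartial Ω i m x‖ ^ 2) := by
    have h1 (i : Fin 3) := H.memLp_partial i
    rw [hE, restrict_interior hcone, integral_finsetSum _ fun i _ => memLp_sq_integrable (h1 i),
      ENNReal.ofReal_sum_of_nonneg fun i _ => integral_nonneg fun _ => by positivity]
    simp only [gradSq]
    rw [lintegral_finsetSum' _ fun i _ => (h1 i).1.enorm.pow_const 2]
    exact Finset.sum_congr rfl fun i _ => lintegral_enorm_sq (h1 i)
  have hEfin : E ≠ ⊤ := hEsum ▸ ENNReal.ofReal_ne_top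
  have hUfin : ∫⁻ y in interior Ω, ‖u y‖ₑ ^ 2 ≠ ⊤ := by
    rw [lintegral_enorm_sq H.memLp]; exact ENNReal.ofReal_ne_top
  have hℓ0 : Tendsto ℓ atTop (𝓝 0) := tendsto_lintegral_layer hΩ hcone hEfin (tendsto_mesh a _)
  have hℓ'0 : Tendsto ℓ' atTop (𝓝 0) := tendsto_lintegral_layer hΩ hcone hUfin (tendsto_mesh a _)
  have hmesh : Tendsto (fun n : ℕ => a / n) atTop (𝓝 0) := by simpa using tendsto_mesh a 1
  have hj0 : Tendsto j atTop (𝓝 0) := by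
    have h1 : Tendsto (fun n : ℕ => ENNReal.ofReal (32 * (a / n) ^ 2) * E) atTop (𝓝 0) := by
      have := ENNReal.tendsto_ofReal ((hmesh.pow 2).const_mul 32)
      simpa using ENNReal.Tendsto.mul_const this (Or.inr hEfin)
    have h2 := ENNReal.Tendsto.const_mul hℓ'0 (a := (((2 * M + 2) ^ 3 : ℕ) : ℝ≥0∞))
      (Or.inr (ENNReal.natCast_ne_top _))
    have h3 := h1.add h2
    rwa [mul_zero, add_zero] at h3
  have hjr : Tendsto (fun n => j n ^ (1 / 2 : ℝ)) atTop (𝓝 0) := by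
    have := hj0.ennrpow_const (1 / 2)
    rwa [ENNReal.zero_rpow_of_pos (by norm_num)] at this
  have hq0 : Tendsto q atTop (𝓝 0) := by
    have := hjr.add (ENNReal.tendsto_ofReal hmesh)
    rwa [ENNReal.ofReal_zero, add_zero] at this
  have hjq : Tendsto (fun n => j n / q n) atTop (𝓝 0) := by
    refine tendsto_of_tendsto_of_tendsto_of_le_of_le tendsto_const_nhds hjr (fun _ => zero_le)
      fun n => ENNReal.div_le_of_le_mul ?_
    calc j n = j n ^ (1 / 2 : ℝ) * j n ^ (1 / 2 : ℝ) := by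
          rw [← ENNReal.rpow_add_of_nonneg _ _ (by norm_num) (by norm_num)]; norm_num
      _ ≤ _ := by gcongr; exact le_self_add
  have hTE : Tendsto T atTop (𝓝 E) := by
    have h2 := ENNReal.Tendsto.const_mul (ENNReal.Tendsto.const_mul hℓ0
      (a := (((2 * M + 2) ^ 3 : ℕ) : ℝ≥0∞)) (Or.inr (ENNReal.natCast_ne_top _)))
      (a := 27 * ENNReal.ofReal (C ^ 2)) (Or.inr (ENNReal.mul_ne_top (by norm_num)
        ENNReal.ofReal_ne_top))
    have := (tendsto_const_nhds (x := E)).add h2 |>.add hjq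
    rwa [mul_zero, mul_zero, add_zero, add_zero] at this
  have hTq : Tendsto (fun n => T n * q n) atTop (𝓝 0) := by
    have := ENNReal.Tendsto.mul hTE (Or.inr (by simp)) hq0 (Or.inr hEfin)
    simpa using this
  -- the sequence
  have hex : ∀ n : ℕ, ∃ w, p n w ∧ ∀ N : Finset Idx, 1 ≤ n → a / n < h₀ →
      (N : Set Idx) = nodes a Ω n →
      ENNReal.ofReal (a / n) * edgeSq N w + cellSq Ω (a / n) N u w / q n ≤ T n := by
    intro n
    by_cases hn : 1 ≤ n ∧ a / n < h₀
    · obtain ⟨hn, hlt⟩ := hn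
      have hh : 0 < a / n := div_pos ha (by exact_mod_cast hn)
      obtain ⟨τ, D⟩ := hτ _ hh hlt
      obtain ⟨σ, hσ, hle⟩ := D.exists_shift H hM (N := (finite_nodes ha hΩ hn).toFinset)
        (fun k hk => ((finite_nodes ha hΩ hn).mem_toFinset.1 hk : k ∈ nodes a Ω n))
        (hp n hn τ D) (q n)
      refine ⟨_, hσ, fun N _ _ hN => ?_⟩
      have : N = (finite_nodes ha hΩ hn).toFinset := by ext; simp [← hN]
      rw [this]
      exact hle
    -- On the levels with n = 0 or a/n ≥ h₀ there is no displacement to use; any field that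
    -- satisfies p will do, as these levels do not affect the limit.
    · obtain ⟨w, hw⟩ := hp' n
      exact ⟨w, hw, fun N h1 h2 => absurd ⟨h1, h2⟩ hn⟩
  choose μ hμp hμ using hex
  have hsmall : ∀ᶠ n : ℕ in atTop, a / n < h₀ := hmesh.eventually_lt_const hh₀
  have hcell : ∀ᶠ n : ℕ in atTop, ∀ N : Finset Idx, (N : Set Idx) = nodes a Ω n →
      cellSq Ω (a / n) N u (μ n) ≤ T n * q n := by
    filter_upwards [hsmall, eventually_ge_atTop 1,
      hq0.eventually_lt_const (by simp : (0 : ℝ≥0∞) < 1)] with n h1 hn hq1 N hN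
    have hqn : q n ≠ 0 := by
      have hh : 0 < a / n := div_pos ha (by exact_mod_cast hn)
      simp [hq, hh]
    exact (ENNReal.div_le_iff hqn (hq1.trans ENNReal.one_lt_top).ne).1
      (le_add_self.trans (hμ n N hn h1 hN))
  have hN (n : ℕ) (hn : 1 ≤ n) :
      ((finite_nodes ha hΩ hn).toFinset : Set Idx) = nodes a Ω n := by simp
  have hB : BoundedSpins a Ω μ := by
    set V := 2 + 2 * ∫⁻ y in interior Ω, ‖u y‖ₑ ^ 2 with hV
    have hVfin : V ≠ ⊤ := ENNReal.add_ne_top.2 ⟨by simp, ENNReal.mul_ne_top (by simp) hUfin⟩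
    refine boundedSpins_of_eventually (B := V.toReal) ?_
    filter_upwards [hcell, eventually_ge_atTop 1,
      hTq.eventually_lt_const (by simp : (0 : ℝ≥0∞) < 1)] with n h1 hn h2
    have hh : 0 < a / n := div_pos ha (by exact_mod_cast hn)
    rw [← ENNReal.ofReal_le_iff_le_toReal hVfin,
      finsum_mem_eq_finite_toFinset_sum _ (finite_nodes ha hΩ hn),
      ENNReal.ofReal_mul (by positivity),
      ENNReal.ofReal_sum_of_nonneg fun k _ => by positivity]
    simp_rw [ENNReal.ofReal_pow (norm_nonneg _), ofReal_norm]
    refine (sum_nodes_le (Ω := Ω) hh H.measurable).trans ?_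
    rw [hV]
    refine add_le_add ?_ le_rfl
    calc 2 * cellSq Ω (a / n) _ u (μ n) ≤ 2 * 1 := by
          gcongr; exact (h1 _ (hN n hn)).trans h2.le
      _ = 2 := mul_one 2
  obtain ⟨hconv, hlim⟩ := recovery_of_bounds ha hΩ hcone hA hμ₀ hhZ hm hB
    (J := fun n => 3 * (T n * q n) + 2 * ℓ' n)
    (by
      have h1 := ENNReal.Tendsto.const_mul hTq (a := 3) (Or.inr (by norm_num))
      have h2 := ENNReal.Tendsto.const_mul hℓ'0 (a := 2) (Or.inr (by norm_num))
      simpa using h1.add h2)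
    (by
      filter_upwards [hcell, eventually_ge_atTop 1] with n h1 hn s hs
      have hh : 0 < a / n := div_pos ha (by exact_mod_cast hn)
      have hsub : ∀ k ∈ s, cellO (a / n) k ⊆ interior Ω := fun k hk =>
        interior_maximal ((cellO_subset_cell k).trans (hs k hk)) (isOpen_cellO _ _)
      calc ∑ k ∈ s, ∫⁻ y in cellO (a / n) k, ‖μ n k - m y‖ₑ ^ 2 =
            ∑ k ∈ s, ∫⁻ y in cellO (a / n) k, ‖μ n k - u y‖ₑ ^ 2 := by
            refine Finset.sum_congr rfl fun k hk => lintegral_congr_ae ?_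
            filter_upwards [ae_mono (Measure.restrict_mono (hsub k hk) le_rfl) hum] with y hy
            rw [hy]
        _ ≤ 3 * cellSq Ω (a / n) (finite_nodes ha hΩ hn).toFinset u (μ n) + 2 * ℓ' n :=
            sum_cells_le hh H.measurable
              (fun k hk => ((finite_nodes ha hΩ hn).mem_toFinset.1 hk : k ∈ nodes a Ω n))
              (by
                have : (1 : ℝ) ≤ M := by linarith
                exact_mod_cast this)
              (fun k hk => (finite_nodes ha hΩ hn).mem_toFinset.2
                (goodCells_subset_nodes ha hn (hs k hk))) hsub
        _ ≤ _ := by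
            gcongr
            exact h1 _ (hN n hn))
    (x := fun n => (T n).toReal)
    (by
      have := (ENNReal.tendsto_toReal hEfin).comp hTE
      rwa [hEsum, ENNReal.toReal_ofReal (integral_nonneg fun _ => by positivity)] at this)
    (by
      filter_upwards [hsmall, eventually_ge_atTop 1,
        hTE.eventually_lt_const (lt_top_iff_ne_top.2 hEfin)] with n h1 hn h2
      rw [← ENNReal.ofReal_le_iff_le_toReal h2.ne, ofReal_latticeEnergy ha (hN n hn)]
      exact le_self_add.trans (hμ n _ hn h1 (hN n hn)))
  exact ⟨μ, hμp, hB, hconv, hlim⟩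

/-- The representative of an `H¹` function used for the recovery sequence. -/
lemma MemH1.exists_isSobolev {Ω : Set E3} (hΩ : Bornology.IsBounded Ω)
    (hcone : UniformConeProperty Ω) {m : E3 → E3} (hm : MemH1 Ω m) :
    ∃ u, IsSobolev (interior Ω) u (fun i => weakPartial Ω i m) ∧
      m =ᵐ[volume.restrict (interior Ω)] u := by
  have hr := restrict_interior hcone
  have hu := hm.1.1.ae_eq_mk
  refine ⟨hm.1.1.mk m, ⟨isOpen_interior, (hΩ.subset interior_subset).measure_lt_top.ne,
    hm.1.1.stronglyMeasurable_mk.measurable, ?_, fun i => ?_, fun i => ?_⟩, by rwa [← hr]⟩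
  · rw [← hr]; exact hm.1.ae_eq hu
  · rw [← hr]; exact (weakPartial_spec hm i).1
  · exact ((weakPartial_spec hm i).2.congr hu).mono interior_subset

/-- Almost every shift of the displaced lattice takes values of norm one. -/
lemma IsDisplacement.ae_norm_shiftedValues {Ω : Set E3} {C h : ℝ} {τ u : E3 → E3}
    (D : IsDisplacement Ω C h τ) (hu : ∀ᵐ y, y ∈ interior Ω → ‖u y‖ = 1) :
    ∀ᵐ σ, σ ∈ cellO h 0 → ∀ k, latt h k ∈ Ω → ‖shiftedValues h τ u σ k‖ = 1 := by
  have h1 (k : Idx) : ∀ᵐ σ, latt h k + τ (latt h k) + σ ∈ interior Ω →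
      ‖u (latt h k + τ (latt h k) + σ)‖ = 1 :=
    (measurePreserving_add_left volume (latt h k + τ (latt h k))).quasiMeasurePreserving.ae hu
  -- There are countably many nodes, so almost every shift is admissible for all of them at once.
  filter_upwards [ae_all_iff.2 h1] with σ hσ hσc k hk
  exact hσ k (D.mem_of_shift hk hσc le_rfl).1

/-- For bounded gradients, almost every shift of the displaced lattice leads to values whose
differences along edges are of the order of the lattice parameter. -/
lemma IsDisplacement.ae_sub_shiftedValues {Ω : Set E3} {C h : ℝ} {τ u : E3 → E3}
    {g : Fin 3 → E3 → E3} (D : IsDisplacement Ω C h τ) (H : IsSobolev (interior Ω) u g) {L : ℝ}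
    (hL : 0 ≤ L) (hg : ∀ᵐ y, y ∈ interior Ω → gradSq g y ≤ ENNReal.ofReal L) :
    ∀ᵐ σ, σ ∈ cellO h 0 → ∀ k i, latt h k ∈ Ω → latt h (k + Pi.single i 1) ∈ Ω →
      ‖shiftedValues h τ u σ (k + Pi.single i 1) - shiftedValues h τ u σ k‖ ^ 2 ≤
        9 * (C * h) ^ 2 * L := by
  have hh := D.pos
  have e (k : Idx) (i : Fin 3) : latt h (k + Pi.single i 1) = latt h k + h • basisVec i := by
    rw [latt_add, latt_single]
  have hnv (i : Fin 3) : ‖h • basisVec i‖ = h := by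
    rw [norm_smul, norm_basisVec, mul_one, Real.norm_of_nonneg hh.le]
  have h1 (k : Idx) (i : Fin 3) : ∀ᵐ σ, σ ∈ cellO h 0 → latt h k ∈ Ω →
      latt h (k + Pi.single i 1) ∈ Ω →
      ‖shiftedValues h τ u σ (k + Pi.single i 1) - shiftedValues h τ u σ k‖ ^ 2 ≤
        9 * (C * h) ^ 2 * L := by
    by_cases hk : latt h k ∈ Ω
    · by_cases hk' : latt h (k + Pi.single i 1) ∈ Ω
      · rw [e] at hk'
        filter_upwards [D.ae_edge_le H ENNReal.ofReal_ne_top hg hk (hnv i).le hk'] with σ hσ hσc _ _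
        have h2 := hσ hσc
        have e9 : (9 : ℝ≥0∞) * ENNReal.ofReal ((C * h) ^ 2) * ENNReal.ofReal L =
            ENNReal.ofReal (9 * (C * h) ^ 2 * L) := by
          rw [ENNReal.ofReal_mul (by positivity), ENNReal.ofReal_mul (by positivity)]
          simp
        rw [e9, ← ofReal_norm, ← ENNReal.ofReal_pow (norm_nonneg _),
          ENNReal.ofReal_le_ofReal_iff (by positivity)] at h2
        simpa only [shiftedValues, e] using h2
      · exact ae_of_all _ fun σ _ _ h => absurd h hk'
    · exact ae_of_all _ fun σ _ h => absurd h hk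
  filter_upwards [ae_all_iff.2 fun k => ae_all_iff.2 (h1 k)] with σ hσ hσc k i
  exact hσ k i hσc

/-- A function with bounded weak partial derivatives. -/
lemma exists_gradSq_le {Ω : Set E3} (hcone : UniformConeProperty Ω) {g : Fin 3 → E3 → E3}
    (hg : ∀ i, MemLp (g i) ⊤ (volume.restrict Ω)) :
    ∃ L : ℝ, 0 ≤ L ∧ ∀ᵐ y, y ∈ interior Ω → gradSq g y ≤ ENNReal.ofReal L := by
  have h1 (i : Fin 3) : ∀ᵐ y ∂(volume.restrict Ω), ‖g i y‖ₑ ≤ eLpNorm (g i) ⊤ (volume.restrict Ω) := by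
    rw [eLpNorm_exponent_top]
    exact ae_le_eLpNormEssSup
  set L := ∑ i, eLpNorm (g i) ⊤ (volume.restrict Ω) ^ 2 with hL
  have hfin : L ≠ ⊤ := (ENNReal.sum_lt_top.2 fun i _ => ENNReal.pow_lt_top (hg i).2).ne
  refine ⟨L.toReal, ENNReal.toReal_nonneg, ?_⟩
  rw [ENNReal.ofReal_toReal hfin]
  rw [← ae_restrict_iff' isOpen_interior.measurableSet, ← restrict_interior hcone]
  filter_upwards [ae_all_iff.2 h1] with y hy
  exact Finset.sum_le_sum fun i _ => pow_le_pow_left₀ (zero_le) (hy i) 2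

/-- Edge differences of order `1 / n` everywhere. -/
lemma locallyAligned_of_edges {a : ℝ} {Ω : Set E3} {μ : ℕ → Idx → E3} {c : ℝ} (hc : 0 ≤ c)
    (h : ∀ n, ∀ k i, k ∈ nodes a Ω n → k + Pi.single i 1 ∈ nodes a Ω n →
      ‖μ n (k + Pi.single i 1) - μ n k‖ ^ 2 ≤ c / (n : ℝ) ^ 2) : LocallyAligned a Ω μ := by
  -- No defects are needed, so the exceptional sets are empty; c + 1 replaces c because the constant
  -- must be positive.
  refine ⟨c + 1, by linarith, 0, fun _ => 0, tendsto_const_nhds, fun n _ => ⟨∅, by simp, by simp,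
    fun k hk _ l hl => ?_, by simp⟩⟩
  have hle : c / (n : ℝ) ^ 2 ≤ (c + 1) / (n : ℝ) ^ 2 := by gcongr; linarith
  obtain ⟨hl, i, rfl | rfl⟩ := hl
  · rw [← norm_neg, neg_sub]
    exact (h n k i hk hl).trans hle
  · have := h n (k - Pi.single i 1) i hl (by simpa using hk)
    rw [sub_add_cancel] at this
    exact this.trans hle

end

/-! ### Assembly of the theorem -/

theorem mainTheorem2 (Ω : Set E3) (hΩ : Bornology.IsBounded Ω) (hcone : UniformConeProperty Ω)
    (a A μ₀ : ℝ) (ha : 0 < a) (hA : 0 < A) (hμ₀ : 0 < μ₀)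
    (hZ : E3 → E3) (hhZ : Continuous hZ) :
    -- the demagnetizing field is well defined on `L²(ℝ³; ℝ³)`
    (∀ u : E3 → E3, MemLp u 2 volume →
      (∃ h, IsDemagField u h) ∧
        ∀ h₁ h₂, IsDemagField u h₁ → IsDemagField u h₂ → h₁ =ᵐ[volume] h₂) ∧
    -- `Γ`-convergence: lower bound and recovery sequences
    (∀ μ m, BoundedSpins a Ω μ → ConvergesTo a Ω μ m → LiminfIneq a A μ₀ hZ Ω μ m) ∧
    (∀ m, MemH1 Ω m → ∃ μ, BoundedSpins a Ω μ ∧ ConvergesTo a Ω μ m ∧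
      LimsupIneq a A μ₀ hZ Ω μ m) ∧
    -- compatibility with the unit norm constraint
    (∀ μ m, UnitSpins a Ω μ → ConvergesTo a Ω μ m → LiminfIneq a A μ₀ hZ Ω μ m ∧
      ∀ᵐ x ∂(volume.restrict Ω), ‖m x‖ = 1) ∧
    (∀ m, MemH1 Ω m → (∀ᵐ x ∂(volume.restrict Ω), ‖m x‖ = 1) →
      ∃ μ, UnitSpins a Ω μ ∧ ConvergesTo a Ω μ m ∧ LimsupIneq a A μ₀ hZ Ω μ m) ∧
    -- for limits with bounded gradient the recovery sequences can be chosen in `W^𝔥`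
    (∀ m, MemH1 Ω m → (∀ i, MemLp (weakPartial Ω i m) ⊤ (volume.restrict Ω)) →
      (∃ μ, LocallyAligned a Ω μ ∧ BoundedSpins a Ω μ ∧ ConvergesTo a Ω μ m ∧
        LimsupIneq a A μ₀ hZ Ω μ m) ∧
      ((∀ᵐ x ∂(volume.restrict Ω), ‖m x‖ = 1) →
        ∃ μ, LocallyAligned a Ω μ ∧ UnitSpins a Ω μ ∧ ConvergesTo a Ω μ m ∧
          LimsupIneq a A μ₀ hZ Ω μ m)) := by
  obtain ⟨C, h₀, hC, hh₀, hτ⟩ := hcone.exists_isDisplacement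
  -- A constant unit field satisfies all the conditions imposed below and serves the levels that are
  -- too coarse for the displaced lattice.
  have hconst (n : ℕ) : ∃ w : Idx → E3, (∀ k ∈ nodes a Ω n, ‖w k‖ = 1) ∧
      ∀ c : ℝ, 0 ≤ c → ∀ k i, k ∈ nodes a Ω n → k + Pi.single i 1 ∈ nodes a Ω n →
        ‖w (k + Pi.single i 1) - w k‖ ^ 2 ≤ c :=
    ⟨fun _ => basisVec 0, fun _ _ => norm_basisVec 0, fun c hc _ _ _ _ => by simpa using hc⟩
  have hunit {m u : E3 → E3} (hum : m =ᵐ[volume.restrict (interior Ω)] u)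
      (h1 : ∀ᵐ x ∂(volume.restrict Ω), ‖m x‖ = 1) : ∀ᵐ y, y ∈ interior Ω → ‖u y‖ = 1 := by
    rw [restrict_interior hcone] at h1
    rw [← ae_restrict_iff' isOpen_interior.measurableSet]
    filter_upwards [hum, h1] with y hy h1
    rwa [← hy]
  -- The edge bound is proportional to h² = a²/n², which is the decay required by W^𝔥.
  have halign {L : ℝ} {μ : ℕ → Idx → E3} (hL : 0 ≤ L)
      (h : ∀ n, ∀ k i, k ∈ nodes a Ω n → k + Pi.single i 1 ∈ nodes a Ω n →
        ‖μ n (k + Pi.single i 1) - μ n k‖ ^ 2 ≤ 9 * (C * (a / n)) ^ 2 * L) :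
      LocallyAligned a Ω μ := by
    refine locallyAligned_of_edges (c := 9 * (C * a) ^ 2 * L) (by positivity)
      fun n k i hk hk' => (h n k i hk hk').trans_eq ?_
    ring
  refine ⟨fun u hu => ⟨⟨_, isDemagField_gradProj hu⟩, fun h₁ h₂ => isDemagField_unique⟩,
    fun μ m hB hc => liminfIneq ha hΩ hcone hA hμ₀ hhZ hB hc, fun m hm => ?_,
    fun μ m hμ hc => ⟨liminfIneq ha hΩ hcone hA hμ₀ hhZ (hμ.boundedSpins ha hΩ) hc,
      ae_norm_eq_one ha hΩ hcone hμ hc⟩, fun m hm h1 => ?_, fun m hm hg => ?_⟩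
  · obtain ⟨u, H, hum⟩ := hm.exists_isSobolev hΩ hcone
    obtain ⟨μ, -, h⟩ := exists_recovery (p := fun _ _ => True) ha hΩ hcone hA hμ₀ hhZ hm H hum hC
      hh₀ hτ (fun _ _ _ _ => by simp) (fun _ => ⟨0, trivial⟩)
    exact ⟨μ, h⟩
  · obtain ⟨u, H, hum⟩ := hm.exists_isSobolev hΩ hcone
    obtain ⟨μ, hμ, -, h⟩ := exists_recovery (p := fun n w => ∀ k ∈ nodes a Ω n, ‖w k‖ = 1) ha hΩ
      hcone hA hμ₀ hhZ hm H hum hC hh₀ hτ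
      (fun n _ τ D => D.ae_norm_shiftedValues (hunit hum h1))
      (fun n => let ⟨w, hw, _⟩ := hconst n; ⟨w, hw⟩)
    exact ⟨μ, fun n _ => hμ n, h⟩
  · obtain ⟨u, H, hum⟩ := hm.exists_isSobolev hΩ hcone
    obtain ⟨L, hL, hgL⟩ := exists_gradSq_le hcone hg
    refine ⟨?_, fun h1 => ?_⟩
    · obtain ⟨μ, hμ, h⟩ := exists_recovery (p := fun n w => ∀ k i, k ∈ nodes a Ω n →
        k + Pi.single i 1 ∈ nodes a Ω n →
        ‖w (k + Pi.single i 1) - w k‖ ^ 2 ≤ 9 * (C * (a / n)) ^ 2 * L) ha hΩ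
        hcone hA hμ₀ hhZ hm H hum hC hh₀ hτ
        (fun n _ τ D => by
          filter_upwards [D.ae_sub_shiftedValues H hL hgL] with σ h2 hσ
          exact h2 hσ)
        (fun n => let ⟨w, _, hw⟩ := hconst n; ⟨w, hw _ (by positivity)⟩)
      exact ⟨μ, halign hL hμ, h⟩
    · obtain ⟨μ, hμ, -, h⟩ := exists_recovery (p := fun n w => (∀ k ∈ nodes a Ω n, ‖w k‖ = 1) ∧
        ∀ k i, k ∈ nodes a Ω n → k + Pi.single i 1 ∈ nodes a Ω n →
        ‖w (k + Pi.single i 1) - w k‖ ^ 2 ≤ 9 * (C * (a / n)) ^ 2 * L) ha hΩ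
        hcone hA hμ₀ hhZ hm H hum hC hh₀ hτ
        (fun n _ τ D => by
          filter_upwards [D.ae_norm_shiftedValues (hunit hum h1),
            D.ae_sub_shiftedValues H hL hgL] with σ h1 h2 hσ
          exact ⟨h1 hσ, h2 hσ⟩)
        (fun n => let ⟨w, hw, hw'⟩ := hconst n; ⟨w, hw, hw' _ (by positivity)⟩)
      exact ⟨μ, halign hL fun n => (hμ n).2, fun n _ => (hμ n).1, h⟩
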